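/- Let $K$ be a field and let $\mathcal A$, $\mathcal B$ be superadditive categories over $K$, that is, $K$-linear categories in which every morphism space is $\mathbb Z/2$-graded, $\mathcal A(X,Y)=\mathcal A(X,Y)_0\oplus\mathcal A(X,Y)_1$, compatibly with composition: for $\alpha\in\mathcal A(X,Y)_i$ and $\beta\in\mathcal A(Y,Z)_j$ the composite, written $\alpha\beta$, lies in $\mathcal A(X,Z)_{i+j}$. Write $|\alpha|$ for the parity of a homogeneous morphism. The tensor product $\mathcal A\otimes\mathcal B$ has as objects the pairs $(X,Y)$, as morphism spaces the graded tensor products $\mathcal A(X,X')\otimes_K\mathcal B(Y,Y')$, and the composition $(\varphi_1\otimes\varphi_2)(\psi_1\otimes\psi_2)=(-1)^{|\varphi_2||\psi_1|}\varphi_1\psi_1\otimes\varphi_2\psi_2$. **Normalized Hochschild--Mitchell complex.** For a superadditive category $\mathcal C$ let $$C_n(\mathcal C)=\bigoplus_{X_0,\dots,X_n}\mathcal C(X_0,X_1)\otimes\mathcal C(X_1,X_2)\otimes\cdots\otimes\mathcal C(X_n,X_0)$$ and write $(a_0,\dots,a_n)$ for $a_0\otimes\cdots\otimes a_n$. On homogeneous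 chains put $$\partial(a_0,\dots,a_n)=\sum_{i=0}^{n-1}(-1)^i(a_0,\dots,a_ia_{i+1},\dots,a_n)+(-1)^{n+|a_n|(|a_0|+\cdots+|a_{n-1}|)}(a_na_0,a_1,\dots,a_{n-1}),$$ $$t(a_0,\dots,a_n)=(-1)^{n+|a_n|(|a_0|+\cdots+|a_{n-1}|)}(a_n,a_0,\dots,a_{n-1}),\qquad s(a_0,\dots,a_n)=(1,a_0,\dots,a_n),$$ and $B=(1-t)\,s\,(1+t+\cdots+t^n)$. Let $N_n(\mathcal C)$ be the quotient of $C_n(\mathcal C)$ by the span of the chains $(a_0,\dots,a_n)$ in which some $a_i$ with $i\ge1$ is an identity morphism. Then $\partial$ and $B$ descend, and $(N(\mathcal C),\partial,B)$ is a mixed complex. **Mixed complexes.** The tensor product of mixed complexes $M,M'$ is $(M\otimes M')_n=\bigoplus_{p+q=n}M_p\otimes M'_q$ with $b(x\otimes y)=bx\otimes y+(-1)^{p}x\otimes by$ and $B(x\otimes y)=Bx\otimes y+(-1)^{p}x\otimes By$ for $x\in M_p$. The total cyclic complex of $M$ is $\mathrm{Tot}(M)_n=\bigoplus_{k\ge0}M_{n-2k}$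 with differential $b+B$; put $HH_n(M)=H_n(M,b)$ and $HC_n(M)=H_n(\mathrm{Tot}\,M)$. The short exact sequence $0\to(M,b)\to\mathrm{Tot}(M)\to\mathrm{Tot}(M)[2]\to0$, in which the first map is the inclusion of the summand $k=0$ and the second one forgets this summand, induces the maps $$I:HH_n(M)\to HC_n(M),\qquad S:HC_{n+2}(M)\to HC_n(M),\qquad B:HC_n(M)\to HH_{n+1}(M)$$ of Connes' exact sequence ($B$ is the connecting homomorphism). **Shuffle map.** For homogeneous $a=(a_0,\dots,a_p)$ in $\mathcal A$ and $b=(b_0,\dots,b_q)$ in $\mathcal B$, $$\mathrm{sh}(a\otimes b)=\sum_\sigma\pm\,\sigma\bigl(a_0\otimes b_0,\;a_1\otimes1,\dots,a_p\otimes1;\;1\otimes b_1,\dots,1\otimes b_q\bigr)\in N_{p+q}(\mathcal A\otimes\mathcal B),$$ where $\sigma$ runs over the $(p,q)$-shuffles; $\sigma$ fixes the first entry $a_0\otimes b_0$ and permutes the other $p+q$ entries, keeping the order of the $a_i\otimes 1$ and that of the $1\otimes b_j$. The symbols $1$ are the identities of those objects that make the entries composable. The sign $\pm$ is $\mathrm{sgn}(\sigma)$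 times the Koszul sign, i.e. times $(-1)^{|a_i||b_j|}$ for every pair $(i,j)$ with $i\ge1$ such that $b_j$ precedes $a_i$ in the result ($b_0$ precedes all of them). **Cyclic shuffle map.** With $a,b$ as before, $$\mathrm{csh}(a\otimes b)=(-1)^p\sum_{i=0}^{p}\sum_{j=0}^{q}\sum_{\sigma}\ \bigl[\sigma\text{-term of }\mathrm{sh}\bigl(s\,t^i a\otimes s\,t^j b\bigr)\bigr]\in N_{p+q+2}(\mathcal A\otimes\mathcal B),$$ where $\sigma$ runs over the $(p+1,q+1)$-shuffles that place $a_0$ before $b_0$. Both maps are well defined on the normalized complexes, and extend to $N(\mathcal A)\otimes N(\mathcal B)$ by linearity. Let $$\mathrm{Sh}=\begin{pmatrix}\mathrm{sh}&\mathrm{csh}&&\\&\mathrm{sh}&\mathrm{csh}&\\&&\ddots&\ddots\end{pmatrix}:\ \mathrm{Tot}\bigl(N(\mathcal A)\otimes N(\mathcal B)\bigr)\longrightarrow\mathrm{Tot}\bigl(N(\mathcal A\otimes\mathcal B)\bigr).$$ **Theorem.** The map $\mathrm{sh}:(N(\mathcal A)\otimes N(\mathcal B),\partial)\to(N(\mathcal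 A\otimes\mathcal B),\partial)$ and the map $\mathrm{Sh}$ are morphisms of complexes, and $\mathrm{Sh}$ induces for every $n$ an isomorphism $$\mathrm{Sh}_*:HC_n\bigl(N(\mathcal A)\otimes N(\mathcal B)\bigr)\xrightarrow{\ \sim\ }HC_n\bigl(N(\mathcal A\otimes\mathcal B)\bigr).$$ Moreover $\mathrm{Sh}_*$ commutes with the maps of Connes' exact sequences of the two mixed complexes: $I\circ\mathrm{sh}_*=\mathrm{Sh}_*\circ I$, $S\circ\mathrm{Sh}_*=\mathrm{Sh}_*\circ S$ and $B\circ\mathrm{Sh}_*=\mathrm{sh}_*\circ B$ in all degrees. -/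

import Mathlib

open CategoryTheory
open scoped TensorProduct DirectSum

universe w u v u' v'

noncomputable section

namespace SuperCyclic

/-- The sign `(-1)^e` for a parity `e`, as a scalar of `K`. -/
def ksgn (K : Type w) [Field K] (e : ZMod 2) : K := (-1) ^ e.val

/-- A superadditive category over `K`: a `K`-linear category (a category whose morphism sets are
`K`-vector spaces, with bilinear composition) with a `ZMod 2`-grading on every morphism space that
is compatible with composition. -/
class SuperCategory (K : Type w) [Field K] (C : Type u) [Category.{v} C] [Preadditive C]
    [Linear K C] where
  /-- the homogeneous morphisms of a given parity -/
  gr : ∀ X Y : C, ZMod 2 → Submodule K (X ⟶ Y)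
  isCompl : ∀ X Y : C, IsCompl (gr X Y 0) (gr X Y 1)
  comp_mem : ∀ {X Y Z : C} {i j : ZMod 2} {f : X ⟶ Y} {g : Y ⟶ Z},
    f ∈ gr X Y i → g ∈ gr Y Z j → f ≫ g ∈ gr X Z (i + j)

section Signs

variable (K : Type w) [Field K]

@[simp] lemma ksgn_zero : ksgn K 0 = 1 := by simp [ksgn]

@[simp] lemma ksgn_one : ksgn K 1 = -1 := by simp [ksgn, ZMod.val_one]

lemma zmod2_cases (e : ZMod 2) : e = 0 ∨ e = 1 := by
  revert e; decide

lemma ksgn_add (a b : ZMod 2) : ksgn K (a + b) = ksgn K a * ksgn K b := by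
  have h : (1 : ZMod 2) + 1 = 0 := by decide
  rcases zmod2_cases a with rfl | rfl <;> rcases zmod2_cases b with rfl | rfl <;> simp [h]

end Signs

section Graded

variable {K : Type w} [Field K] {C : Type u} [Category.{v} C] [Preadditive C]
    [Linear K C] [SuperCategory K C]

open SuperCategory

lemma gr_isCompl (X Y : C) (e : ZMod 2) : IsCompl (gr (K := K) X Y e) (gr X Y (e + 1)) := by
  have h : (1 : ZMod 2) + 1 = 0 := by decide
  rcases zmod2_cases e with rfl | rfl
  · simpa using isCompl X Y
  · simpa [h] using (isCompl X Y).symm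

/-- The homogeneous component of parity `e` of a morphism. -/
def proj (K : Type w) [Field K] {C : Type u} [Category.{v} C] [Preadditive C]
    [Linear K C] [SuperCategory K C] {X Y : C} (e : ZMod 2) : (X ⟶ Y) →ₗ[K] gr (K := K) X Y e :=
  Submodule.projectionOnto _ _ (gr_isCompl X Y e)

lemma proj_of_mem {X Y : C} {e : ZMod 2} {f : X ⟶ Y} (h : f ∈ gr (K := K) X Y e) :
    (proj K e f : X ⟶ Y) = f := by
  rw [proj, Submodule.projectionOnto_apply_of_mem_left _ h]

lemma zmod2_eq_add_one {e e' : ZMod 2} (h : e ≠ e') : e = e' + 1 := by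
  revert e e'; decide

lemma proj_of_mem_ne {X Y : C} {e e' : ZMod 2} {f : X ⟶ Y} (h : f ∈ gr (K := K) X Y e)
    (hne : e ≠ e') : proj K e' f = 0 := by
  rw [proj, Submodule.projectionOnto_apply_eq_zero_iff]
  rwa [← zmod2_eq_add_one hne]

lemma sum_zmod2 {M : Type*} [AddCommMonoid M] (f : ZMod 2 → M) : ∑ e, f e = f 0 + f 1 :=
  Fin.sum_univ_two f

lemma sum_proj {X Y : C} (f : X ⟶ Y) : ∑ e, (proj K e f : X ⟶ Y) = f := by
  have hf : f ∈ gr (K := K) X Y 0 ⊔ gr (K := K) X Y 1 := by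
    rw [(isCompl X Y).sup_eq_top]; trivial
  obtain ⟨a, ha, b, hb, rfl⟩ := Submodule.mem_sup.1 hf
  rw [sum_zmod2, map_add, map_add, Submodule.coe_add, Submodule.coe_add, proj_of_mem ha,
    proj_of_mem hb, proj_of_mem_ne ha zero_ne_one, proj_of_mem_ne hb one_ne_zero]
  simp

lemma comp_mem' {X Y Z : C} {i j k : ZMod 2} {f : X ⟶ Y} {g : Y ⟶ Z}
    (hf : f ∈ gr (K := K) X Y i) (hg : g ∈ gr (K := K) Y Z j) (h : i + j = k) :
    f ≫ g ∈ gr (K := K) X Z k := h ▸ comp_mem hf hg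

/-- The identities of a superadditive category are even. -/
lemma id_mem (X : C) : 𝟙 X ∈ gr (K := K) X X 0 := by
  have h2 : (1 : ZMod 2) + 1 = 0 := by decide
  have hs := sum_proj (K := K) (𝟙 X)
  rw [sum_zmod2] at hs
  set a : X ⟶ X := (proj K 0 (𝟙 X) : X ⟶ X) with ha
  set b : X ⟶ X := (proj K 1 (𝟙 X) : X ⟶ X) with hb
  have ham : a ∈ gr (K := K) X X 0 := (proj K 0 (𝟙 X)).2
  have hbm : b ∈ gr (K := K) X X 1 := (proj K 1 (𝟙 X)).2
  -- a and b are composed with the identity written as a + b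
  have key : ∀ (e : ZMod 2) (f : X ⟶ X), f ∈ gr (K := K) X X e → f ≫ b = 0 := by
    intro e f hf
    have h1 : f ≫ a + f ≫ b = f := by rw [← Preadditive.comp_add, hs, Category.comp_id]
    have h3 : f ≫ b ∈ gr (K := K) X X e := by
      have : f ≫ b = f - f ≫ a := by rw [← h1]; abel_nf; simp [h1]
      rw [this]
      exact Submodule.sub_mem _ hf (comp_mem' hf ham (by simp))
    have h4 : f ≫ b ∈ gr (K := K) X X (e + 1) := comp_mem' hf hbm rfl
    exact (Submodule.disjoint_def.1 (gr_isCompl (K := K) X X e).disjoint) _ h3 h4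
  have hb0 : b = 0 := by
    have : (a + b) ≫ b = 0 := by rw [Preadditive.add_comp, key 0 a ham, key 1 b hbm, add_zero]
    rwa [hs, Category.id_comp] at this
  rw [hb0, add_zero] at hs
  rwa [← hs]

/-- The homogeneous component of parity `e`, as an endomorphism of the morphism space. -/
def pr (K : Type w) [Field K] {C : Type u} [Category.{v} C] [Preadditive C]
    [Linear K C] [SuperCategory K C] {X Y : C} (e : ZMod 2) : (X ⟶ Y) →ₗ[K] (X ⟶ Y) :=
  (gr (K := K) X Y e).subtype ∘ₗ proj K e

lemma pr_of_mem {X Y : C} {e : ZMod 2} {f : X ⟶ Y} (h : f ∈ gr (K := K) X Y e) (i : ZMod 2) :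
    pr K i f = if e = i then f else 0 := by
  split_ifs with hi
  · subst hi; exact proj_of_mem h
  · simp [pr, proj_of_mem_ne h hi]

lemma pr_mem {X Y : C} (e : ZMod 2) (f : X ⟶ Y) : pr K e f ∈ gr (K := K) X Y e := (proj K e f).2

lemma sum_pr {X Y : C} (f : X ⟶ Y) : ∑ e, pr K e f = f := sum_proj f

end Graded

section Tensor

open SuperCategory

/-- Objects of the tensor product of two superadditive categories: pairs of objects. -/
structure SuperTensor (K : Type w) (A : Type u) (B : Type u') where
  fst : A
  snd : B

variable {K : Type w} [Field K]
  {A : Type u} [Category.{v} A] [Preadditive A] [Linear K A] [SuperCategory K A]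
  {B : Type u'} [Category.{v'} B] [Preadditive B] [Linear K B] [SuperCategory K B]

/-- Composition in the tensor product category, bilinear with
`(φ₁ ⊗ φ₂) ≫ (ψ₁ ⊗ ψ₂) = (-1)^(|φ₂||ψ₁|) (φ₁ ≫ ψ₁) ⊗ (φ₂ ≫ ψ₂)` on homogeneous morphisms. -/
def tensorComp (X Y Z : SuperTensor K A B) :
    ((X.fst ⟶ Y.fst) ⊗[K] (X.snd ⟶ Y.snd)) →ₗ[K]
    ((Y.fst ⟶ Z.fst) ⊗[K] (Y.snd ⟶ Z.snd)) →ₗ[K] ((X.fst ⟶ Z.fst) ⊗[K] (X.snd ⟶ Z.snd)) :=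
  ∑ i : ZMod 2, ∑ j : ZMod 2, ksgn K (i * j) •
    TensorProduct.map₂ ((Linear.comp X.fst Y.fst Z.fst).compl₂ (pr K j))
      ((Linear.comp X.snd Y.snd Z.snd) ∘ₗ pr K i)

lemma tensorComp_tmul {X Y Z : SuperTensor K A B} {i j : ZMod 2}
    (f₁ : X.fst ⟶ Y.fst) {f₂ : X.snd ⟶ Y.snd} {g₁ : Y.fst ⟶ Z.fst} (g₂ : Y.snd ⟶ Z.snd)
    (hf : f₂ ∈ gr (K := K) X.snd Y.snd i) (hg : g₁ ∈ gr (K := K) Y.fst Z.fst j) :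
    tensorComp X Y Z (f₁ ⊗ₜ f₂) (g₁ ⊗ₜ g₂) = ksgn K (i * j) • ((f₁ ≫ g₁) ⊗ₜ (f₂ ≫ g₂)) := by
  simp only [tensorComp, LinearMap.sum_apply, LinearMap.smul_apply, TensorProduct.map₂_apply_tmul,
    TensorProduct.map_tmul, LinearMap.compl₂_apply, LinearMap.comp_apply, pr_of_mem hf,
    pr_of_mem hg, Linear.comp_apply, Linear.leftComp_apply]
  rw [Finset.sum_eq_single i, Finset.sum_eq_single j]
  · simp
  · intro b _ hb; simp [hb.symm]
  · simp
  · intro b _ hb; simp [hb.symm]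
  · simp

/-- Every element of a tensor product of morphism spaces is a sum of homogeneous tensors. -/
lemma tensor_induction {X X' : A} {Y Y' : B} {p : ((X ⟶ X') ⊗[K] (Y ⟶ Y')) → Prop}
    (x : (X ⟶ X') ⊗[K] (Y ⟶ Y')) (h0 : p 0) (hadd : ∀ x y, p x → p y → p (x + y))
    (ht : ∀ (i j : ZMod 2) (f : X ⟶ X') (g : Y ⟶ Y'), f ∈ gr (K := K) X X' i →
      g ∈ gr (K := K) Y Y' j → p (f ⊗ₜ g)) : p x := by
  induction x using TensorProduct.induction_on with
  | zero => exact h0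
  | add x y hx hy => exact hadd x y hx hy
  | tmul f g =>
    rw [← sum_pr (K := K) f, ← sum_pr (K := K) g]
    simp only [sum_zmod2, TensorProduct.add_tmul, TensorProduct.tmul_add]
    refine hadd _ _ (hadd _ _ ?_ ?_) (hadd _ _ ?_ ?_) <;>
    exact ht _ _ _ _ (pr_mem _ _) (pr_mem _ _)

lemma tensorComp_id_left {X Y : SuperTensor K A B}
    (x : (X.fst ⟶ Y.fst) ⊗[K] (X.snd ⟶ Y.snd)) :
    tensorComp X X Y (𝟙 X.fst ⊗ₜ 𝟙 X.snd) x = x := by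
  induction x using tensor_induction with
  | h0 => simp
  | hadd x y hx hy => rw [map_add, hx, hy]
  | ht i j f g hf hg => rw [tensorComp_tmul _ _ (id_mem _) hf]; simp

lemma tensorComp_id_right {X Y : SuperTensor K A B}
    (x : (X.fst ⟶ Y.fst) ⊗[K] (X.snd ⟶ Y.snd)) :
    tensorComp X Y Y x (𝟙 Y.fst ⊗ₜ 𝟙 Y.snd) = x := by
  induction x using tensor_induction with
  | h0 => simp
  | hadd x y hx hy => rw [map_add, LinearMap.add_apply, hx, hy]
  | ht i j f g hf hg => rw [tensorComp_tmul _ _ hg (id_mem _)]; simp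

lemma tensorComp_assoc {W X Y Z : SuperTensor K A B}
    (x : (W.fst ⟶ X.fst) ⊗[K] (W.snd ⟶ X.snd)) (y : (X.fst ⟶ Y.fst) ⊗[K] (X.snd ⟶ Y.snd))
    (z : (Y.fst ⟶ Z.fst) ⊗[K] (Y.snd ⟶ Z.snd)) :
    tensorComp W Y Z (tensorComp W X Y x y) z = tensorComp W X Z x (tensorComp X Y Z y z) := by
  induction x using tensor_induction with
  | h0 => simp
  | hadd x x' hx hy => simp only [map_add, LinearMap.add_apply, hx, hy]
  | ht i j f g hf hg =>
  induction y using tensor_induction with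
  | h0 => simp
  | hadd x x' hx hy => simp only [map_add, LinearMap.add_apply, hx, hy]
  | ht i' j' f' g' hf' hg' =>
  induction z using tensor_induction with
  | h0 => simp
  | hadd x x' hx hy => simp only [map_add, hx, hy]
  | ht i'' j'' f'' g'' hf'' hg'' =>
  rw [tensorComp_tmul _ _ hg hf', tensorComp_tmul _ _ hg' hf'', map_smul, map_smul,
    LinearMap.smul_apply, tensorComp_tmul _ _ (comp_mem hg hg') hf'',
    tensorComp_tmul _ _ hg (comp_mem hf' hf''), smul_smul, smul_smul, ← ksgn_add, ← ksgn_add,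
    Category.assoc, Category.assoc]
  congr 2
  ring

instance : Category.{max v v'} (SuperTensor K A B) where
  Hom X Y := (X.fst ⟶ Y.fst) ⊗[K] (X.snd ⟶ Y.snd)
  id X := 𝟙 X.fst ⊗ₜ 𝟙 X.snd
  comp {X Y Z} f g := tensorComp X Y Z f g
  id_comp f := tensorComp_id_left f
  comp_id f := tensorComp_id_right f
  assoc f g h := tensorComp_assoc f g h

instance : Preadditive (SuperTensor K A B) where
  homGroup X Y := inferInstanceAs (AddCommGroup ((X.fst ⟶ Y.fst) ⊗[K] (X.snd ⟶ Y.snd)))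
  add_comp X Y Z f f' g := LinearMap.map_add₂ (tensorComp X Y Z) f f' g
  comp_add X Y Z f g g' := LinearMap.map_add (tensorComp X Y Z f) g g'

instance : Linear K (SuperTensor K A B) where
  homModule X Y := inferInstanceAs (Module K ((X.fst ⟶ Y.fst) ⊗[K] (X.snd ⟶ Y.snd)))
  smul_comp X Y Z r f g := LinearMap.map_smul₂ (tensorComp X Y Z) r f g
  comp_smul X Y Z f r g := LinearMap.map_smul (tensorComp X Y Z f) r g

/-- The part of parity `e` of a tensor product of morphism spaces. -/
def tensorGr (X Y : SuperTensor K A B) (e : ZMod 2) :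
    Submodule K ((X.fst ⟶ Y.fst) ⊗[K] (X.snd ⟶ Y.snd)) :=
  Submodule.span K {x | ∃ (i j : ZMod 2) (f : X.fst ⟶ Y.fst) (g : X.snd ⟶ Y.snd),
    f ∈ gr (K := K) X.fst Y.fst i ∧ g ∈ gr (K := K) X.snd Y.snd j ∧ i + j = e ∧ x = f ⊗ₜ g}

/-- The projection of a tensor product of morphism spaces to its part of parity `e`. -/
def tensorPr (X Y : SuperTensor K A B) (e : ZMod 2) :
    ((X.fst ⟶ Y.fst) ⊗[K] (X.snd ⟶ Y.snd)) →ₗ[K] ((X.fst ⟶ Y.fst) ⊗[K] (X.snd ⟶ Y.snd)) :=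
  ∑ i : ZMod 2, TensorProduct.map (pr K i) (pr K (e - i))

lemma tensorPr_of_mem {X Y : SuperTensor K A B} {e e' : ZMod 2}
    {x : (X.fst ⟶ Y.fst) ⊗[K] (X.snd ⟶ Y.snd)} (hx : x ∈ tensorGr X Y e) :
    tensorPr X Y e' x = if e = e' then x else 0 := by
  induction hx using Submodule.span_induction with
  | zero => simp
  | add x y _ _ hx hy => rw [map_add, hx, hy]; split_ifs <;> simp
  | smul c x _ hx => rw [map_smul, hx]; split_ifs <;> simp
  | mem x hx =>
    obtain ⟨i, j, f, g, hf, hg, rfl, rfl⟩ := hx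
    simp only [tensorPr, LinearMap.sum_apply, TensorProduct.map_tmul, pr_of_mem hf, pr_of_mem hg]
    rw [Finset.sum_eq_single i]
    · have : j = e' - i ↔ i + j = e' := by rw [eq_sub_iff_add_eq, add_comm]
      simp only [this, if_true]
      split_ifs <;> simp
    · intro b _ hb; simp [hb.symm]
    · simp

lemma tensorGr_isCompl (X Y : SuperTensor K A B) : IsCompl (tensorGr X Y 0) (tensorGr X Y 1) := by
  constructor
  · rw [Submodule.disjoint_def]
    intro x h0 h1
    have e0 := tensorPr_of_mem (e' := 0) h0
    have e1 := tensorPr_of_mem (e' := 0) h1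
    simp only [if_true] at e0
    rw [e0] at e1
    simpa using e1
  · rw [codisjoint_iff, eq_top_iff]
    intro x _
    induction x using tensor_induction with
    | h0 => exact Submodule.zero_mem _
    | hadd x y hx hy => exact Submodule.add_mem _ (hx trivial) (hy trivial)
    | ht i j f g hf hg =>
      have hm : f ⊗ₜ[K] g ∈ tensorGr X Y (i + j) :=
        Submodule.subset_span ⟨i, j, f, g, hf, hg, rfl, rfl⟩
      rcases zmod2_cases (i + j) with h | h
      · exact Submodule.mem_sup_left (h ▸ hm)
      · exact Submodule.mem_sup_right (h ▸ hm)

lemma tensorGr_comp_mem {X Y Z : SuperTensor K A B} {e e' : ZMod 2}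
    {x : (X.fst ⟶ Y.fst) ⊗[K] (X.snd ⟶ Y.snd)} {y : (Y.fst ⟶ Z.fst) ⊗[K] (Y.snd ⟶ Z.snd)}
    (hx : x ∈ tensorGr X Y e) (hy : y ∈ tensorGr Y Z e') :
    tensorComp X Y Z x y ∈ tensorGr X Z (e + e') := by
  induction hx using Submodule.span_induction with
  | zero => simp
  | add x y _ _ hx hy => rw [map_add]; exact Submodule.add_mem _ hx hy
  | smul c x _ hx => rw [map_smul]; exact Submodule.smul_mem _ _ hx
  | mem x hx =>
    obtain ⟨i, j, f, g, hf, hg, rfl, rfl⟩ := hx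
    induction hy using Submodule.span_induction with
    | zero => simp
    | add x y _ _ hx hy => rw [map_add]; exact Submodule.add_mem _ hx hy
    | smul c x _ hx => rw [map_smul]; exact Submodule.smul_mem _ _ hx
    | mem y hy =>
      obtain ⟨i', j', f', g', hf', hg', rfl, rfl⟩ := hy
      rw [tensorComp_tmul _ _ hg hf']
      exact Submodule.smul_mem _ _ (Submodule.subset_span
        ⟨i + i', j + j', _, _, comp_mem hf hf', comp_mem hg hg', by ring, rfl⟩)

/-- The (graded) tensor product of two superadditive categories. -/
instance : SuperCategory K (SuperTensor K A B) where
  gr X Y e := tensorGr X Y e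
  isCompl X Y := tensorGr_isCompl X Y
  comp_mem hf hg := tensorGr_comp_mem hf hg

end Tensor

section Chains

open SuperCategory

/-- A homogeneous morphism of a superadditive category, with its source, target and parity. -/
structure HArr (K : Type w) [Field K] (C : Type u) [Category.{v} C] [Preadditive C]
    [Linear K C] [SuperCategory K C] where
  src : C
  tgt : C
  par : ZMod 2
  hom : src ⟶ tgt
  mem : hom ∈ gr (K := K) src tgt par

variable {K : Type w} [Field K] {C : Type u} [Category.{v} C] [Preadditive C]
    [Linear K C] [SuperCategory K C]

lemma HArr.ext_hom {a b : HArr K C} (hs : a.src = b.src) (ht : a.tgt = b.tgt) (hp : a.par = b.par)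
    (h : a.hom = eqToHom hs ≫ b.hom ≫ eqToHom ht.symm) : a = b := by
  obtain ⟨s, t, p, f, hf⟩ := a
  obtain ⟨s', t', p', f', hf'⟩ := b
  dsimp only at hs ht hp
  subst hs ht hp
  simp at h
  subst h
  rfl

/-- The identity of an object, as an even morphism. -/
def HArr.id (X : C) : HArr K C := ⟨X, X, 0, 𝟙 X, id_mem X⟩

lemma eqToHom_mem {X Y : C} (h : X = Y) : eqToHom h ∈ gr (K := K) X Y 0 := by
  subst h; exact id_mem X

open Classical in
/-- The composite of two homogeneous morphisms (a junk value if they are not composable). -/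
def HArr.comp (a b : HArr K C) : HArr K C :=
  if h : a.tgt = b.src then
    ⟨a.src, b.tgt, a.par + b.par, a.hom ≫ eqToHom h ≫ b.hom,
      comp_mem a.mem (comp_mem' (eqToHom_mem h) b.mem (zero_add _))⟩
  else a

lemma HArr.comp_mk {X Y Z : C} {p q : ZMod 2} {f : X ⟶ Y} {g : Y ⟶ Z}
    (hf : f ∈ gr (K := K) X Y p) (hg : g ∈ gr (K := K) Y Z q) :
    HArr.comp ⟨X, Y, p, f, hf⟩ ⟨Y, Z, q, g, hg⟩ = ⟨X, Z, p + q, f ≫ g, comp_mem hf hg⟩ := by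
  unfold HArr.comp
  rw [dif_pos rfl]
  apply HArr.ext_hom <;> simp

@[simp] lemma HArr.comp_src (a b : HArr K C) : (a.comp b).src = a.src := by
  unfold HArr.comp; split_ifs <;> rfl

lemma HArr.comp_tgt {a b : HArr K C} (h : a.tgt = b.src) : (a.comp b).tgt = b.tgt := by
  unfold HArr.comp; rw [dif_pos h]

lemma HArr.comp_par {a b : HArr K C} (h : a.tgt = b.src) : (a.comp b).par = a.par + b.par := by
  unfold HArr.comp; rw [dif_pos h]

lemma HArr.comp_assoc {a b c : HArr K C} (h : a.tgt = b.src) (h' : b.tgt = c.src) :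
    (a.comp b).comp c = a.comp (b.comp c) := by
  have h1 : (a.comp b).tgt = c.src := (HArr.comp_tgt h).trans h'
  have h2 : a.tgt = (b.comp c).src := by simpa using h
  obtain ⟨s, t, p, f, hf⟩ := a
  obtain ⟨s', t', p', f', hf'⟩ := b
  obtain ⟨s'', t'', p'', f'', hf''⟩ := c
  dsimp only at h h'
  subst h h'
  simp only [HArr.comp_mk, Category.assoc, add_assoc]

lemma HArr.id_comp {a : HArr K C} {X : C} (h : X = a.src) : (HArr.id X).comp a = a := by
  obtain ⟨s, t, p, f, hf⟩ := a
  dsimp only at h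
  subst h
  rw [HArr.id, HArr.comp_mk]
  simp

lemma HArr.comp_id {a : HArr K C} {X : C} (h : a.tgt = X) : a.comp (HArr.id X) = a := by
  obtain ⟨s, t, p, f, hf⟩ := a
  dsimp only at h
  subst h
  rw [HArr.id, HArr.comp_mk]
  simp

/-- `LinRel c a a' a''`: the three homogeneous morphisms are parallel of the same parity, and
`a'' = c • a + a'`. -/
inductive LinRel (c : K) : HArr K C → HArr K C → HArr K C → Prop
  | mk (X Y : C) (e : ZMod 2) (f f' : X ⟶ Y) (hf : f ∈ gr (K := K) X Y e)
      (hf' : f' ∈ gr (K := K) X Y e) :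
      LinRel c ⟨X, Y, e, f, hf⟩ ⟨X, Y, e, f', hf'⟩
        ⟨X, Y, e, c • f + f', Submodule.add_mem _ (Submodule.smul_mem _ c hf) hf'⟩

lemma LinRel.props {c : K} {a a' a'' : HArr K C} (h : LinRel c a a' a'') :
    (a'.src = a.src ∧ a'.tgt = a.tgt ∧ a'.par = a.par) ∧
    (a''.src = a.src ∧ a''.tgt = a.tgt ∧ a''.par = a.par) := by
  cases h; simp

lemma LinRel.refl_zero (a : HArr K C) : LinRel (0 : K) a a a := by
  obtain ⟨s, t, p, f, hf⟩ := a
  have := LinRel.mk (c := (0 : K)) s t p f f hf hf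
  simpa using this

lemma LinRel.comp_right {c : K} {a a' a'' : HArr K C} (h : LinRel c a a' a'') (b : HArr K C)
    (hb : a.tgt = b.src) : LinRel c (a.comp b) (a'.comp b) (a''.comp b) := by
  obtain ⟨s, t, p, g, hg⟩ := b
  cases h with
  | mk X Y e f f' hf hf' =>
  dsimp only at hb
  subst hb
  have := LinRel.mk (c := c) X t (e + p) (f ≫ g) (f' ≫ g) (comp_mem hf hg) (comp_mem hf' hg)
  simpa [HArr.comp_mk] using this

lemma LinRel.comp_left {c : K} {a a' a'' : HArr K C} (h : LinRel c a a' a'') (b : HArr K C)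
    (hb : b.tgt = a.src) : LinRel c (b.comp a) (b.comp a') (b.comp a'') := by
  obtain ⟨s, t, p, g, hg⟩ := b
  cases h with
  | mk X Y e f f' hf hf' =>
  dsimp only at hb
  subst hb
  have := LinRel.mk (c := c) s Y (p + e) (g ≫ f) (g ≫ f') (comp_mem hg hf) (comp_mem hg hf')
  simpa [HArr.comp_mk] using this

/-- The `K`-module of (unnormalized) Hochschild-Mitchell `n`-chains: the direct sum, over all
`(n+1)`-tuples of objects, of the tensor products
`C(X₀, X₁) ⊗ C(X₁, X₂) ⊗ ⋯ ⊗ C(Xₙ, X₀)`. The index `i + 1` is taken modulo `n + 1`. -/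
def NChain (K : Type w) [Field K] (C : Type u) [Category.{v} C] [Preadditive C]
    [Linear K C] (n : ℕ) : Type (max u v w) :=
  ⨁ X : Fin (n + 1) → C, ⨂[K] i : Fin (n + 1), (X i ⟶ X (i + 1))

instance (n : ℕ) : AddCommGroup (NChain K C n) :=
  inferInstanceAs (AddCommGroup (⨁ X : Fin (n + 1) → C, ⨂[K] i : Fin (n + 1), (X i ⟶ X (i + 1))))

instance (n : ℕ) : Module K (NChain K C n) :=
  inferInstanceAs (Module K (⨁ X : Fin (n + 1) → C, ⨂[K] i : Fin (n + 1), (X i ⟶ X (i + 1))))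

open Classical in
/-- The inclusion of the summand indexed by a tuple of objects. -/
def NChain.of {n : ℕ} (X : Fin (n + 1) → C) :
    (⨂[K] i : Fin (n + 1), (X i ⟶ X (i + 1))) →ₗ[K] NChain K C n :=
  DirectSum.lof K (Fin (n + 1) → C) (fun X => ⨂[K] i : Fin (n + 1), (X i ⟶ X (i + 1))) X

open Classical in
/-- The linear map on chains with prescribed restrictions to all summands. -/
def NChain.desc {n : ℕ} {M : Type*} [AddCommGroup M] [Module K M]
    (φ : ∀ X : Fin (n + 1) → C, (⨂[K] i : Fin (n + 1), (X i ⟶ X (i + 1))) →ₗ[K] M) :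
    NChain K C n →ₗ[K] M :=
  DirectSum.toModule K _ _ φ

open Classical in
lemma NChain.desc_of {n : ℕ} {M : Type*} [AddCommGroup M] [Module K M]
    (φ : ∀ X : Fin (n + 1) → C, (⨂[K] i : Fin (n + 1), (X i ⟶ X (i + 1))) →ₗ[K] M)
    (X : Fin (n + 1) → C) (x : ⨂[K] i : Fin (n + 1), (X i ⟶ X (i + 1))) :
    NChain.desc φ (NChain.of X x) = φ X x := by
  exact DirectSum.toModule_lof K (φ := φ) X x

lemma NChain.hom_ext {n : ℕ} {M : Type*} [AddCommGroup M] [Module K M]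
    {f f' : NChain K C n →ₗ[K] M}
    (h : ∀ X : Fin (n + 1) → C, f ∘ₗ NChain.of X = f' ∘ₗ NChain.of X) : f = f' := by
  classical exact DirectSum.linearMap_ext K h

/-- The sequence of homogeneous morphisms `g 0, …, g n` is composable to a cycle. -/
def IsCycle (n : ℕ) (g : ℕ → HArr K C) : Prop :=
  (∀ j, j < n → (g j).tgt = (g (j + 1)).src) ∧ (g n).tgt = (g 0).src

lemma IsCycle.fin {n : ℕ} {g : ℕ → HArr K C} (h : IsCycle n g) (i : Fin (n + 1)) :
    (g i).tgt = (g ((i + 1 : Fin (n + 1)) : ℕ)).src := by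
  rcases Fin.eq_castSucc_or_eq_last i with ⟨j, rfl⟩ | rfl
  · have : ((j.castSucc + 1 : Fin (n + 1)) : ℕ) = j + 1 := by simp
    rw [this]
    exact h.1 j j.2
  · simpa using h.2

open Classical in
/-- The chain `(g 0, g 1, …, g n)` (zero if the morphisms do not form a cycle). Only the first
`n + 1` terms of the sequence `g` matter. -/
def cls (n : ℕ) (g : ℕ → HArr K C) : NChain K C n :=
  if h : IsCycle n g then
    NChain.of (fun i => (g i).src) (PiTensorProduct.tprod K fun i => (g i).hom ≫ eqToHom (h.fin i))
  else 0

lemma fin_val_succ {n j : ℕ} (hj : j < n) :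
    ((⟨j, Nat.lt_succ_of_lt hj⟩ + 1 : Fin (n + 1)) : ℕ) = j + 1 := by
  rw [Fin.val_add_one_of_lt]
  simp [Fin.lt_def, hj]

open Classical in
lemma cls_eq {n : ℕ} {g : ℕ → HArr K C} (X : Fin (n + 1) → C)
    (hs : ∀ i : Fin (n + 1), X i = (g i).src) (ht : ∀ i : Fin (n + 1), (g i).tgt = X (i + 1)) :
    cls n g = NChain.of X
      (PiTensorProduct.tprod K fun i => eqToHom (hs i) ≫ (g i).hom ≫ eqToHom (ht i)) := by
  have hX : X = fun i : Fin (n + 1) => (g i).src := funext hs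
  subst hX
  have h : IsCycle n g := by
    constructor
    · intro j hj
      have := ht ⟨j, Nat.lt_succ_of_lt hj⟩
      dsimp only at this
      rwa [fin_val_succ hj] at this
    · have := ht (Fin.last n)
      simpa using this
  rw [cls, dif_pos h]
  congr 2
  funext i
  simp

lemma IsCycle.congr {n : ℕ} {g g' : ℕ → HArr K C} (hg : ∀ j, j ≤ n → (g' j).src = (g j).src)
    (hg' : ∀ j, j ≤ n → (g' j).tgt = (g j).tgt) (h : IsCycle n g) : IsCycle n g' := by
  constructor
  · intro j hj
    rw [hg' j hj.le, hg (j + 1) hj]; exact h.1 j hj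
  · rw [hg' n le_rfl, hg 0 (Nat.zero_le _)]; exact h.2

lemma cls_not {n : ℕ} {g : ℕ → HArr K C} (h : ¬ IsCycle n g) : cls n g = 0 := by
  rw [cls, dif_neg h]

open Classical in
lemma cls_lin {n : ℕ} {c : K} {F F' F'' : ℕ → HArr K C} {k : ℕ} (hk : k ≤ n)
    (hj : ∀ j, j ≤ n → j ≠ k → F'' j = F j ∧ F' j = F j) (hr : LinRel c (F k) (F' k) (F'' k)) :
    cls n F'' = c • cls n F + cls n F' := by
  have s1 : ∀ j, j ≤ n → (F' j).src = (F j).src := by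
    intro j h; by_cases e : j = k
    · subst e; exact hr.props.1.1
    · rw [(hj j h e).2]
  have s2 : ∀ j, j ≤ n → (F' j).tgt = (F j).tgt := by
    intro j h; by_cases e : j = k
    · subst e; exact hr.props.1.2.1
    · rw [(hj j h e).2]
  have s3 : ∀ j, j ≤ n → (F'' j).src = (F j).src := by
    intro j h; by_cases e : j = k
    · subst e; exact hr.props.2.1
    · rw [(hj j h e).1]
  have s4 : ∀ j, j ≤ n → (F'' j).tgt = (F j).tgt := by
    intro j h; by_cases e : j = k
    · subst e; exact hr.props.2.2.1
    · rw [(hj j h e).1]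
  by_cases hc : IsCycle n F
  · have le : ∀ i : Fin (n + 1), (i : ℕ) ≤ n := fun i => Nat.lt_succ_iff.1 i.2
    rw [cls_eq (g := F) (fun i => (F i).src) (fun i => rfl) hc.fin,
      cls_eq (g := F') (fun i => (F i).src) (fun i => (s1 i (le i)).symm)
        (fun i => (s2 i (le i)).trans (hc.fin i)),
      cls_eq (g := F'') (fun i => (F i).src) (fun i => (s3 i (le i)).symm)
        (fun i => (s4 i (le i)).trans (hc.fin i)), ← map_smul, ← map_add]
    congr 1
    set m : ∀ i : Fin (n + 1), ((F i).src ⟶ (F ((i + 1 : Fin (n + 1)) : ℕ)).src) :=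
      fun i => eqToHom rfl ≫ (F i).hom ≫ eqToHom (hc.fin i) with hm
    let k' : Fin (n + 1) := ⟨k, Nat.lt_succ_iff.2 hk⟩
    set x' : (F k').src ⟶ (F ((k' + 1 : Fin (n + 1)) : ℕ)).src :=
      eqToHom (s1 k' (le k')).symm ≫ (F' k').hom ≫
        eqToHom ((s2 k' (le k')).trans (hc.fin k')) with hx'
    have key : ∀ (G : ℕ → HArr K C) (hs : ∀ i : Fin (n + 1), (F i).src = (G i).src)
        (ht : ∀ i : Fin (n + 1), (G i).tgt = (F ((i + 1 : Fin (n + 1)) : ℕ)).src)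
        (_ : ∀ j, j ≤ n → j ≠ k → G j = F j),
        (fun i : Fin (n + 1) => eqToHom (hs i) ≫ (G i).hom ≫ eqToHom (ht i)) =
        Function.update m k' (eqToHom (hs k') ≫ (G k').hom ≫ eqToHom (ht k')) := by
      intro G hs ht hG
      funext i
      by_cases e : i = k'
      · subst e; simp
      · rw [Function.update_of_ne e, hm]
        have hne : (i : ℕ) ≠ k := fun h => e (Fin.ext h)
        have hGi := hG i (le i) hne
        dsimp only
        have gen : ∀ (a b : HArr K C) (Z : C) (_ : a = b) (h1 : b.src = a.src) (h2 : a.tgt = Z)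
            (h3 : b.src = b.src) (h4 : b.tgt = Z), eqToHom h1 ≫ a.hom ≫ eqToHom h2 =
            eqToHom h3 ≫ b.hom ≫ eqToHom h4 := by
          intro a b Z hab; subst hab; intros; rfl
        exact gen _ _ _ hGi _ _ _ _
    rw [key F' _ _ (fun j h e => (hj j h e).2), key F'' _ _ (fun j h e => (hj j h e).1),
      show (PiTensorProduct.tprod K m) = PiTensorProduct.tprod K (Function.update m k' (m k')) by
        rw [Function.update_eq_self]]
    rw [← MultilinearMap.map_update_smul, ← MultilinearMap.map_update_add]
    congr 2
    have gen : ∀ (a a' a'' : HArr K C) (_ : LinRel c a a' a'') (Z W : C) (h1 : Z = a.src)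
        (h2 : Z = a'.src) (h3 : Z = a''.src) (h4 : a.tgt = W) (h5 : a'.tgt = W)
        (h6 : a''.tgt = W), eqToHom h3 ≫ a''.hom ≫ eqToHom h6 =
          c • (eqToHom h1 ≫ a.hom ≫ eqToHom h4) + eqToHom h2 ≫ a'.hom ≫ eqToHom h5 := by
      intro a a' a'' h
      cases h
      intro Z W h1 _ _ h4 _ _
      dsimp only at h1 h4
      subst h1 h4
      simp
    exact gen _ _ _ hr _ _ _ _ _ _ _ _
  · have h1 : ¬ IsCycle n F' := fun h => hc (h.congr (fun j e => (s1 j e).symm)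
      (fun j e => (s2 j e).symm))
    have h2 : ¬ IsCycle n F'' := fun h => hc (h.congr (fun j e => (s3 j e).symm)
      (fun j e => (s4 j e).symm))
    rw [cls_not hc, cls_not h1, cls_not h2]; simp

lemma cls_congr {n : ℕ} {F F' : ℕ → HArr K C} (h : ∀ j, j ≤ n → F j = F' j) :
    cls n F = cls n F' := by
  have := cls_lin (c := (0 : K)) (n := n) (F := F') (F' := F') (F'' := F) (k := 0) (Nat.zero_le _)
    (fun j hj _ => ⟨h j hj, rfl⟩) (by rw [h 0 (Nat.zero_le _)]; exact LinRel.refl_zero _)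
  simpa using this

/-- A function of `n + 1` cyclically composable homogeneous morphisms is multilinear. -/
def IsMulti {M : Type*} [AddCommGroup M] [Module K M] (n : ℕ) (φ : (ℕ → HArr K C) → M) : Prop :=
  ∀ (c : K) (F F' F'' : ℕ → HArr K C) (k : ℕ), k ≤ n →
    (∀ j, j ≤ n → j ≠ k → F'' j = F j ∧ F' j = F j) → LinRel c (F k) (F' k) (F'' k) →
    IsCycle n F → φ F'' = c • φ F + φ F'

section Lift

variable {M : Type*} [AddCommGroup M] [Module K M] {n : ℕ} {φ : (ℕ → HArr K C) → M}

lemma IsMulti.congr (h : IsMulti n φ) {F F' : ℕ → HArr K C} (hc : IsCycle n F)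
    (he : ∀ j, j ≤ n → F' j = F j) : φ F' = φ F := by
  have := h 0 F F F' 0 (Nat.zero_le _) (fun j hj _ => ⟨he j hj, rfl⟩)
    (by rw [he 0 (Nat.zero_le _)]; exact LinRel.refl_zero _) hc
  simpa using this

lemma IsMulti.zero (h : IsMulti n φ) {F : ℕ → HArr K C} (hc : IsCycle n F) {k : ℕ} (hk : k ≤ n)
    (h0 : (F k).hom = 0) : φ F = 0 := by
  have := h (-1) F F F k hk (fun j hj _ => ⟨rfl, rfl⟩) (by
    generalize F k = a at h0
    obtain ⟨s, t, p, f, hf⟩ := a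
    dsimp only at h0
    have := LinRel.mk (c := (-1 : K)) s t p f f hf hf
    simpa [h0] using this) hc
  simpa using this

/-- The sequence of homogeneous components, of prescribed parities, of a cycle of morphisms. -/
def seqOf (X : Fin (n + 1) → C) (a : ∀ i : Fin (n + 1), (X i ⟶ X (i + 1)))
    (e : Fin (n + 1) → ZMod 2) (j : ℕ) : HArr K C :=
  ⟨X (Fin.ofNat (n + 1) j), X (Fin.ofNat (n + 1) j + 1), e (Fin.ofNat (n + 1) j),
    pr K (e (Fin.ofNat (n + 1) j)) (a (Fin.ofNat (n + 1) j)), pr_mem _ _⟩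

lemma seqOf_fin (X : Fin (n + 1) → C) (a : ∀ i : Fin (n + 1), (X i ⟶ X (i + 1)))
    (e : Fin (n + 1) → ZMod 2) (i : Fin (n + 1)) :
    seqOf (K := K) X a e i = ⟨X i, X (i + 1), e i, pr K (e i) (a i), pr_mem _ _⟩ := by
  unfold seqOf
  have : Fin.ofNat (n + 1) (i : ℕ) = i := by ext; simp
  have gen : ∀ i' : Fin (n + 1), i' = i →
      (⟨X i', X (i' + 1), e i', pr K (e i') (a i'), pr_mem _ _⟩ : HArr K C) =
        ⟨X i, X (i + 1), e i, pr K (e i) (a i), pr_mem _ _⟩ := by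
    rintro _ rfl; rfl
  exact gen _ this

lemma seqOf_cycle (X : Fin (n + 1) → C) (a : ∀ i : Fin (n + 1), (X i ⟶ X (i + 1)))
    (e : Fin (n + 1) → ZMod 2) : IsCycle n (seqOf (K := K) X a e) := by
  constructor
  · intro j hj
    have h1 := seqOf_fin (K := K) X a e ⟨j, Nat.lt_succ_of_lt hj⟩
    have h2 := seqOf_fin (K := K) X a e (⟨j, Nat.lt_succ_of_lt hj⟩ + 1)
    rw [fin_val_succ hj] at h2
    simp only at h1
    rw [h1, h2]
  · have h1 := seqOf_fin (K := K) X a e (Fin.last n)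
    have h2 := seqOf_fin (K := K) X a e 0
    simp only [Fin.val_last, Fin.val_zero] at h1 h2
    rw [h1, h2]
    simp

lemma seqOf_update (h : IsMulti n φ) [DecidableEq (Fin (n + 1))] (X : Fin (n + 1) → C)
    (a : ∀ i : Fin (n + 1), (X i ⟶ X (i + 1))) (e : Fin (n + 1) → ZMod 2) (i : Fin (n + 1))
    (c : K) (x y : X i ⟶ X (i + 1)) :
    φ (seqOf X (Function.update a i (c • x + y)) e) =
      c • φ (seqOf X (Function.update a i x) e) + φ (seqOf X (Function.update a i y) e) := by
  refine h c _ _ _ i (Nat.lt_succ_iff.1 i.2) ?_ ?_ (seqOf_cycle _ _ _)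
  · intro j hj hne
    have hj' : j = ((⟨j, Nat.lt_succ_iff.2 hj⟩ : Fin (n + 1)) : ℕ) := rfl
    have hne' : (⟨j, Nat.lt_succ_iff.2 hj⟩ : Fin (n + 1)) ≠ i := fun h => hne (by rw [← h])
    have gen : ∀ a' : ∀ i : Fin (n + 1), (X i ⟶ X (i + 1)), (∀ i', i' ≠ i → a' i' = a i') →
        seqOf (K := K) X a' e j = seqOf X a e j := by
      intro a' h
      rw [hj', seqOf_fin, seqOf_fin]
      simp only [h _ hne']
    constructor
    · rw [gen (Function.update a i _) fun i' h => Function.update_of_ne h _ _,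
        gen (Function.update a i x) fun i' h => Function.update_of_ne h _ _]
    · rw [gen (Function.update a i y) fun i' h => Function.update_of_ne h _ _,
        gen (Function.update a i x) fun i' h => Function.update_of_ne h _ _]
  · rw [seqOf_fin, seqOf_fin, seqOf_fin]
    simp only [Function.update_self]
    have := LinRel.mk (c := c) (X i) (X (i + 1)) (e i) (pr K (e i) x) (pr K (e i) y) (pr_mem _ _)
      (pr_mem _ _)
    simpa using this

/-- The linear map on chains with prescribed values on homogeneous chains. -/
def lift (n : ℕ) (φ : (ℕ → HArr K C) → M) (h : IsMulti n φ) : NChain K C n →ₗ[K] M :=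
  NChain.desc fun X => PiTensorProduct.lift
    { toFun := fun a => ∑ e : Fin (n + 1) → ZMod 2, φ (seqOf X a e)
      map_update_add' := by
        intro _ a i x y
        rw [← Finset.sum_add_distrib]
        refine Finset.sum_congr rfl fun e _ => ?_
        have := seqOf_update h X a e i 1 x y
        simpa using this
      map_update_smul' := by
        intro _ a i c x
        rw [Finset.smul_sum]
        refine Finset.sum_congr rfl fun e _ => ?_
        have h1 := seqOf_update h X a e i c x 0
        have h2 : φ (seqOf X (Function.update a i 0) e) = 0 := by
          refine h.zero (seqOf_cycle _ _ _) (Nat.lt_succ_iff.1 i.2) ?_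
          rw [seqOf_fin]
          simp only [Function.update_self, map_zero]
        simpa [h2] using h1 }

lemma lift_cls (h : IsMulti n φ) {g : ℕ → HArr K C} (hg : IsCycle n g) :
    lift n φ h (cls n g) = φ g := by
  have ev : lift n φ h (cls n g) = ∑ e : Fin (n + 1) → ZMod 2, φ (seqOf (fun i => (g i).src)
      (fun i => (g i).hom ≫ eqToHom (hg.fin i)) e) := by
    rw [cls, dif_pos hg, lift, NChain.desc_of, PiTensorProduct.lift.tprod]
    rfl
  have hmem : ∀ i : Fin (n + 1), (g i).hom ≫ eqToHom (hg.fin i) ∈ gr (K := K) _ _ (g i).par :=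
    fun i => comp_mem' (g i).mem (eqToHom_mem _) (add_zero _)
  rw [ev, Finset.sum_eq_single (fun i : Fin (n + 1) => (g i).par)]
  · refine h.congr hg fun j hj => ?_
    have := seqOf_fin (K := K) (fun i : Fin (n + 1) => (g i).src)
      (fun i => (g i).hom ≫ eqToHom (hg.fin i)) (fun i => (g i).par) ⟨j, Nat.lt_succ_iff.2 hj⟩
    simp only at this
    rw [this]
    refine HArr.ext_hom rfl (hg.fin ⟨j, Nat.lt_succ_iff.2 hj⟩).symm rfl ?_
    have h2 := pr_of_mem (hmem ⟨j, Nat.lt_succ_iff.2 hj⟩) (g j).par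
    rw [if_pos rfl] at h2
    dsimp only at h2 ⊢
    refine h2.trans ?_
    simp
  · intro e _ hne
    obtain ⟨i, hi⟩ := Function.ne_iff.1 hne
    refine h.zero (seqOf_cycle _ _ _) (Nat.lt_succ_iff.1 i.2) ?_
    rw [seqOf_fin]
    exact (pr_of_mem (hmem i) (e i)).trans (if_neg (Ne.symm hi))
  · simp

lemma chain_ext {f f' : NChain K C n →ₗ[K] M}
    (h : ∀ g : ℕ → HArr K C, IsCycle n g → f (cls n g) = f' (cls n g)) : f = f' := by
  refine NChain.hom_ext fun X => PiTensorProduct.ext (MultilinearMap.ext fun a => ?_)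
  simp only [LinearMap.compMultilinearMap_apply, LinearMap.comp_apply]
  have ha : a = fun i => ∑ e : ZMod 2, pr K e (a i) := funext fun i => (sum_pr (a i)).symm
  rw [ha, MultilinearMap.map_sum]
  simp only [map_sum]
  refine Finset.sum_congr rfl fun r _ => ?_
  have hc : cls n (seqOf (K := K) X a r) = NChain.of X
      (PiTensorProduct.tprod K fun i => pr K (r i) (a i)) := by
    rw [cls_eq X (fun i => by rw [seqOf_fin]) (fun i => by rw [seqOf_fin])]
    congr 2
    funext i
    have gen : ∀ (b b' : HArr K C) (_ : b = b') (h1 : b'.src = b.src) (h2 : b.tgt = b'.tgt),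
        eqToHom h1 ≫ b.hom ≫ eqToHom h2 = b'.hom := by
      intro b b' hb; subst hb; simp
    exact gen _ _ (seqOf_fin X a r i) _ _
  have := h _ (seqOf_cycle X a r)
  rw [hc] at this
  exact this

end Lift

section Operators

/-- The sum of the parities of `g 0, …, g (m - 1)`. -/
def parSum (m : ℕ) (g : ℕ → HArr K C) : ZMod 2 := ∑ j ∈ Finset.range m, (g j).par

lemma parSum_congr {m : ℕ} {g g' : ℕ → HArr K C} (h : ∀ j, j < m → (g' j).par = (g j).par) :
    parSum m g' = parSum m g :=
  Finset.sum_congr rfl fun j hj => h j (Finset.mem_range.1 hj)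

lemma isMulti_cls {D : Type u'} [Category.{v'} D] [Preadditive D] [Linear K D]
    [SuperCategory K D] {n m : ℕ} (s : (ℕ → HArr K C) → ZMod 2)
    (op : (ℕ → HArr K C) → (ℕ → HArr K D))
    (hs : ∀ F F' : ℕ → HArr K C, (∀ j, j ≤ n → (F' j).par = (F j).par) → s F' = s F)
    (hop : ∀ (c : K) (F F' F'' : ℕ → HArr K C) (k : ℕ), k ≤ n →
      (∀ j, j ≤ n → j ≠ k → F'' j = F j ∧ F' j = F j) → LinRel c (F k) (F' k) (F'' k) →
      IsCycle n F → ∃ k', k' ≤ m ∧ (∀ j, j ≤ m → j ≠ k' → op F'' j = op F j ∧ op F' j = op F j) ∧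
        LinRel c (op F k') (op F' k') (op F'' k')) :
    IsMulti n (fun g => ksgn K (s g) • cls m (op g)) := by
  intro c F F' F'' k hk h1 h2 hc
  obtain ⟨k', hk', h3, h4⟩ := hop c F F' F'' k hk h1 h2 hc
  have e1 : s F' = s F := hs _ _ fun j hj => by
    by_cases e : j = k
    · subst e; exact h2.props.1.2.2
    · rw [(h1 j hj e).2]
  have e2 : s F'' = s F := hs _ _ fun j hj => by
    by_cases e : j = k
    · subst e; exact h2.props.2.2.2
    · rw [(h1 j hj e).1]
  dsimp only
  rw [cls_lin hk' h3 h4, e1, e2, smul_add, smul_comm]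

/-- The sequence underlying the `i`-th face, `0 ≤ i ≤ n + 1`, of `(g 0, …, g (n + 1))`:
`(g 0, …, g i ≫ g (i + 1), …, g (n + 1))` for `i ≤ n`, and
`(g (n + 1) ≫ g 0, g 1, …, g n)` for `i = n + 1`. -/
def faceSeq (n i : ℕ) (g : ℕ → HArr K C) : ℕ → HArr K C := fun j =>
  if i ≤ n then
    if j < i then g j else if j = i then (g i).comp (g (i + 1)) else g (j + 1)
  else
    if j = 0 then (g (n + 1)).comp (g 0) else g j

/-- The Koszul sign exponent of the `i`-th face: zero for `i ≤ n`, and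
`|g (n + 1)| (|g 0| + ⋯ + |g n|)` for the last face. -/
def faceSign (n i : ℕ) (g : ℕ → HArr K C) : ZMod 2 :=
  if i ≤ n then 0 else (g (n + 1)).par * parSum (n + 1) g

lemma faceSeq_multi (n i : ℕ) :
    IsMulti (n + 1) (fun g : ℕ → HArr K C => ksgn K (faceSign n i g) • cls n (faceSeq n i g)) := by
  refine isMulti_cls _ _ ?_ ?_
  · intro F F' h
    unfold faceSign
    rw [h (n + 1) le_rfl, parSum_congr fun j hj => h j hj.le]
  · intro c F F' F'' k hk h1 h2 hc
    by_cases hi : i ≤ n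
    · refine ⟨if k ≤ i then k else k - 1, by split_ifs <;> omega, ?_, ?_⟩
      · intro j hj hne
        unfold faceSeq
        simp only [if_pos hi]
        split_ifs at hne ⊢ with a1 a2 a3 a2 a3
        all_goals first
          | exact h1 _ (by omega) (by omega)
          | (constructor
             · rw [(h1 i (by omega) (by omega)).1, (h1 (i + 1) (by omega) (by omega)).1]
             · rw [(h1 i (by omega) (by omega)).2, (h1 (i + 1) (by omega) (by omega)).2])
      · unfold faceSeq
        simp only [if_pos hi]
        rcases lt_trichotomy k i with h | h | h
        · simp only [if_pos h.le, if_pos h]; exact h2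
        · subst h
          simp only [le_refl, if_true, lt_irrefl, if_false]
          rw [(h1 (k + 1) (by omega) (by omega)).1, (h1 (k + 1) (by omega) (by omega)).2]
          exact h2.comp_right _ (hc.1 _ (by omega))
        · simp only [if_neg (not_le.2 h), if_neg (show ¬ k - 1 < i by omega)]
          by_cases e : k = i + 1
          · subst e
            simp only [Nat.add_sub_cancel, if_true]
            rw [(h1 i (by omega) (by omega)).1, (h1 i (by omega) (by omega)).2]
            exact h2.comp_left _ (hc.1 _ (by omega))
          · simp only [if_neg (show ¬ k - 1 = i by omega), show k - 1 + 1 = k by omega]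
            exact h2
    · refine ⟨if k = n + 1 then 0 else k, by split_ifs <;> omega, ?_, ?_⟩
      · intro j hj hne
        unfold faceSeq
        simp only [if_neg hi]
        split_ifs at hne ⊢ with a1 a2 a3
        all_goals first
          | exact h1 _ (by omega) (by omega)
          | (constructor
             · rw [(h1 (n + 1) (by omega) (by omega)).1, (h1 0 (by omega) (by omega)).1]
             · rw [(h1 (n + 1) (by omega) (by omega)).2, (h1 0 (by omega) (by omega)).2])
      · unfold faceSeq
        simp only [if_neg hi]
        by_cases e : k = n + 1
        · subst e
          simp only [if_true]
          rw [(h1 0 (by omega) (by omega)).1, (h1 0 (by omega) (by omega)).2]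
          exact h2.comp_right _ hc.2
        · simp only [if_neg e]
          by_cases e0 : k = 0
          · subst e0
            simp only [if_true]
            rw [(h1 (n + 1) (by omega) (by omega)).1, (h1 (n + 1) (by omega) (by omega)).2]
            exact h2.comp_left _ hc.2
          · simp only [if_neg e0]; exact h2

/-- The face map `d^i` from `(n + 1)`-chains to `n`-chains, `0 ≤ i ≤ n + 1`. -/
def face (n i : ℕ) : NChain K C (n + 1) →ₗ[K] NChain K C n :=
  lift (n + 1) (fun g => ksgn K (faceSign n i g) • cls n (faceSeq n i g)) (faceSeq_multi n i)

lemma face_cls {n : ℕ} (i : ℕ) {g : ℕ → HArr K C} (hg : IsCycle (n + 1) g) :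
    face n i (cls (n + 1) g) = ksgn K (faceSign n i g) • cls n (faceSeq n i g) := lift_cls _ hg

/-- The sequence `(g n, g 0, …, g (n - 1))`. -/
def rotSeq (n : ℕ) (g : ℕ → HArr K C) : ℕ → HArr K C := fun j => if j = 0 then g n else g (j - 1)

lemma rotSeq_multi (n : ℕ) : IsMulti n (fun g : ℕ → HArr K C =>
    ksgn K (n + (g n).par * parSum n g) • cls n (rotSeq n g)) := by
  refine isMulti_cls _ _ ?_ ?_
  · intro F F' h
    rw [h n le_rfl, parSum_congr fun j hj => h j hj.le]
  · intro c F F' F'' k hk h1 h2 hc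
    refine ⟨if k = n then 0 else k + 1, by split_ifs <;> omega, ?_, ?_⟩
    · intro j hj hne
      unfold rotSeq
      split_ifs at hne ⊢ with a1 a2 <;> exact h1 _ (by omega) (by omega)
    · unfold rotSeq
      by_cases e : k = n
      · subst e; simpa using h2
      · simpa [e] using h2

/-- The cyclic operator
`t (a₀, …, aₙ) = (-1)^(n + |aₙ|(|a₀| + ⋯ + |aₙ₋₁|)) (aₙ, a₀, …, aₙ₋₁)`. -/
def rot (n : ℕ) : NChain K C n →ₗ[K] NChain K C n :=
  lift n (fun g => ksgn K (n + (g n).par * parSum n g) • cls n (rotSeq n g)) (rotSeq_multi n)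

lemma rot_cls {n : ℕ} {g : ℕ → HArr K C} (hg : IsCycle n g) :
    rot n (cls n g) = ksgn K (n + (g n).par * parSum n g) • cls n (rotSeq n g) := lift_cls _ hg

/-- The sequence `(1, g 0, g 1, …)`. -/
def idSeq (g : ℕ → HArr K C) : ℕ → HArr K C := fun j =>
  if j = 0 then HArr.id (g 0).src else g (j - 1)

lemma idSeq_multi (n : ℕ) : IsMulti n (fun g : ℕ → HArr K C => cls (n + 1) (idSeq g)) := by
  have := isMulti_cls (K := K) (C := C) (D := C) (n := n) (m := n + 1) (fun _ => 0) idSeq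
    (fun _ _ _ => rfl) ?_
  · simpa using this
  · intro c F F' F'' k hk h1 h2 hc
    have hs : (F' 0).src = (F 0).src ∧ (F'' 0).src = (F 0).src := by
      by_cases e : 0 = k
      · subst e; exact ⟨h2.props.1.1, h2.props.2.1⟩
      · rw [(h1 0 (by omega) e).1, (h1 0 (by omega) e).2]; simp
    refine ⟨k + 1, by omega, ?_, ?_⟩
    · intro j hj hne
      unfold idSeq
      rw [hs.1, hs.2]
      split_ifs
      · simp
      · exact h1 _ (by omega) (by omega)
    · simpa [idSeq] using h2

/-- The extra degeneracy `s (a₀, …, aₙ) = (1, a₀, …, aₙ)`. -/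
def extra (n : ℕ) : NChain K C n →ₗ[K] NChain K C (n + 1) :=
  lift n (fun g => cls (n + 1) (idSeq g)) (idSeq_multi n)

lemma extra_cls {n : ℕ} {g : ℕ → HArr K C} (hg : IsCycle n g) :
    extra n (cls n g) = cls (n + 1) (idSeq g) := lift_cls _ hg

/-- The Hochschild boundary `∂ = ∑ (-1)^i d^i` from `(n + 1)`-chains to `n`-chains. -/
def bdry (n : ℕ) : NChain K C (n + 1) →ₗ[K] NChain K C n :=
  ∑ i ∈ Finset.range (n + 2), ksgn K i • face n i

/-- The norm operator `N = 1 + t + ⋯ + tⁿ`. -/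
def normOp (n : ℕ) : NChain K C n →ₗ[K] NChain K C n :=
  ∑ j ∈ Finset.range (n + 1), rot n ^ j

/-- Connes' operator `B = (1 - t) s N`. -/
def connes (n : ℕ) : NChain K C n →ₗ[K] NChain K C (n + 1) :=
  (LinearMap.id - rot (n + 1)) ∘ₗ extra n ∘ₗ normOp n

section Cycles

variable {n : ℕ} {g : ℕ → HArr K C}

lemma IsCycle.face (i : ℕ) (hg : IsCycle (n + 1) g) : IsCycle n (faceSeq n i g) := by
  unfold faceSeq
  by_cases hi : i ≤ n
  · simp only [if_pos hi]
    have ht := HArr.comp_tgt (hg.1 i (by omega))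
    constructor
    · intro j hj
      have h1 := hg.1 j (by omega)
      have h2 := hg.1 (j + 1) (by omega)
      dsimp only
      split_ifs <;> first | omega | exact h1 | exact h2 | grind [HArr.comp_src]
    · have h1 := hg.2
      dsimp only
      split_ifs <;> first | omega | exact h1 | grind [HArr.comp_src]
  · simp only [if_neg hi]
    have ht := HArr.comp_tgt hg.2
    constructor
    · intro j hj
      have h1 := hg.1 j (by omega)
      dsimp only
      split_ifs <;> first | omega | exact h1 | grind [HArr.comp_src]
    · have h1 := hg.1 n (by omega)
      dsimp only
      split_ifs <;> first | omega | exact h1 | grind [HArr.comp_src]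

lemma IsCycle.rot (hg : IsCycle n g) : IsCycle n (rotSeq n g) := by
  unfold rotSeq
  constructor
  · intro j hj
    rcases Nat.eq_zero_or_pos j with rfl | h
    · simpa using hg.2
    · have := hg.1 (j - 1) (by omega)
      rw [show j - 1 + 1 = j by omega] at this
      simpa [h.ne'] using this
  · rcases Nat.eq_zero_or_pos n with rfl | h
    · simpa using hg.2
    · have := hg.1 (n - 1) (by omega)
      rw [show n - 1 + 1 = n by omega] at this
      simpa [h.ne'] using this

lemma IsCycle.extra (hg : IsCycle n g) : IsCycle (n + 1) (idSeq g) := by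
  unfold idSeq
  constructor
  · intro j hj
    rcases Nat.eq_zero_or_pos j with rfl | h
    · simp [HArr.id]
    · have := hg.1 (j - 1) (by omega)
      rw [show j - 1 + 1 = j by omega] at this
      simpa [h.ne'] using this
  · simpa [HArr.id] using hg.2

lemma sum_inner (f : ℕ → ZMod 2) (i : ℕ) (n : ℕ) (h : i ≤ n) :
    (∑ k ∈ Finset.range (n + 1), if k < i then f k else if k = i then f i + f (i + 1)
      else f (k + 1)) = ∑ k ∈ Finset.range (n + 2), f k := by
  induction n, h using Nat.le_induction with
  | base =>
    rw [Finset.sum_range_succ, Finset.sum_range_succ _ (i + 1), Finset.sum_range_succ _ i]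
    simp only [lt_irrefl, if_false, if_true]
    rw [Finset.sum_congr rfl fun k hk => if_pos (Finset.mem_range.1 hk), add_assoc]
  | succ n hn ih =>
    rw [Finset.sum_range_succ, ih, Finset.sum_range_succ _ (n + 2),
      if_neg (by omega), if_neg (by omega)]

lemma parSum_face (i : ℕ) (hg : IsCycle (n + 1) g) :
    parSum (n + 1) (faceSeq n i g) = parSum (n + 2) g := by
  unfold parSum
  by_cases hi : i ≤ n
  · rw [← sum_inner (fun k => (g k).par) i n hi]
    refine Finset.sum_congr rfl fun k _ => ?_
    unfold faceSeq
    rw [if_pos hi]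
    split_ifs
    · rfl
    · exact HArr.comp_par (hg.1 i (by omega))
    · rfl
  · rw [Finset.sum_range_succ', Finset.sum_range_succ _ (n + 1), Finset.sum_range_succ' _ n]
    unfold faceSeq
    simp only [if_neg hi, if_true, Nat.succ_ne_zero, if_false]
    rw [HArr.comp_par hg.2]
    ring

lemma parSum_rot : parSum (n + 1) (rotSeq n g) = parSum (n + 1) g := by
  unfold parSum
  rw [Finset.sum_range_succ', Finset.sum_range_succ]
  simp [rotSeq]

lemma zmod2_sq (a : ZMod 2) : a * a = a := by revert a; decide

lemma zmod2_add_self (a : ZMod 2) : a + a = 0 := by revert a; decide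

lemma last_sign (n : ℕ) (g : ℕ → HArr K C) :
    (g n).par * parSum n g = (g n).par * (parSum (n + 1) g + 1) := by
  have h : parSum (n + 1) g = parSum n g + (g n).par := Finset.sum_range_succ _ _
  rw [h, mul_add, mul_add, zmod2_sq, mul_one, add_assoc, zmod2_add_self, add_zero]

lemma faceSign_eq (i : ℕ) : faceSign n i g =
    if i ≤ n then 0 else (g (n + 1)).par * (parSum (n + 2) g + 1) := by
  unfold faceSign; rw [last_sign]

lemma faceSeq_faceSeq {i j : ℕ} (hij : i ≤ j) (hj : j ≤ n + 1) (hg : IsCycle (n + 2) g) (k : ℕ)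
    (hk : k ≤ n) :
    faceSeq n i (faceSeq (n + 1) (j + 1) g) k = faceSeq n j (faceSeq (n + 1) i g) k := by
  unfold faceSeq
  by_cases h1 : j ≤ n
  · simp only [if_pos (show j + 1 ≤ n + 1 by omega), if_pos (show i ≤ n by omega), if_pos h1,
      if_pos (show i ≤ n + 1 by omega)]
    rcases hij.lt_or_eq with h2 | rfl
    · rcases lt_trichotomy k i with h | rfl | h
      · rw [if_pos h, if_pos (by omega), if_pos (by omega), if_pos (by omega)]
      · rw [if_neg (by omega), if_pos rfl, if_pos (by omega), if_pos (by omega), if_pos (by omega),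
          if_neg (by omega), if_pos rfl]
      · rw [if_neg (show ¬ k < i by omega), if_neg (show ¬ k = i by omega)]
        rcases lt_trichotomy k j with h' | rfl | h'
        · rw [if_pos (by omega), if_pos h', if_neg (by omega), if_neg (by omega)]
        · rw [if_neg (by omega), if_pos rfl, if_neg (by omega), if_pos rfl, if_neg (by omega),
            if_neg (by omega), if_neg (by omega), if_neg (by omega)]
        · rw [if_neg (by omega), if_neg (by omega), if_neg (by omega), if_neg (by omega),
            if_neg (by omega), if_neg (by omega)]
    · rcases lt_trichotomy k i with h | rfl | h
      · rw [if_pos h, if_pos (by omega), if_pos (by omega), if_pos (by omega)]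
      · rw [if_neg (by omega), if_pos rfl, if_pos (by omega), if_neg (by omega), if_pos rfl,
          if_neg (by omega), if_pos rfl, if_neg (by omega), if_pos rfl, if_neg (by omega),
          if_neg (by omega)]
        exact (HArr.comp_assoc (hg.1 k (by omega)) (hg.1 (k + 1) (by omega))).symm
      · rw [if_neg (by omega), if_neg (by omega), if_neg (by omega), if_neg (by omega),
          if_neg (by omega), if_neg (by omega), if_neg (by omega), if_neg (by omega)]
  · obtain rfl : j = n + 1 := by omega
    simp only [if_neg (show ¬ n + 1 + 1 ≤ n + 1 by omega), if_neg (show ¬ n + 1 ≤ n by omega),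
      if_pos (show i ≤ n + 1 by omega)]
    by_cases h2 : i ≤ n
    · simp only [if_pos h2]
      rw [if_neg (show ¬ n + 1 < i by omega), if_neg (show ¬ n + 1 = i by omega)]
      by_cases h0 : k = 0
      · subst h0
        rw [if_pos rfl]
        rcases Nat.eq_zero_or_pos i with rfl | hi
        · simpa using HArr.comp_assoc hg.2 (hg.1 0 (by omega))
        · rw [if_pos hi, if_pos rfl, if_pos hi]
      · rw [if_neg h0]
        rcases lt_trichotomy k i with h | rfl | h
        · rw [if_pos h, if_neg h0, if_pos h]
        · simp [h0]
        · rw [if_neg (by omega), if_neg (by omega), if_neg (by omega), if_neg (by omega),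
            if_neg (by omega), if_neg (by omega)]
    · obtain rfl : i = n + 1 := by omega
      simp only [if_neg h2, lt_irrefl, if_false, if_true, if_neg (show ¬ n + 1 = 0 by omega),
        if_pos (show 0 < n + 1 by omega), if_pos (show k < n + 1 by omega)]
      by_cases h0 : k = 0
      · subst h0
        rw [if_pos rfl, if_pos rfl]
        exact (HArr.comp_assoc (hg.1 (n + 1) (by omega)) hg.2).symm
      · rw [if_neg h0, if_neg h0, if_neg h0]

/-- The simplicial identities. -/
lemma face_face {i j : ℕ} (hij : i < j) (hj : j ≤ n + 2) :
    (face n i ∘ₗ face (n + 1) j : NChain K C (n + 2) →ₗ[K] _) =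
      face n (j - 1) ∘ₗ face (n + 1) i := by
  refine chain_ext fun g hg => ?_
  simp only [LinearMap.comp_apply]
  rw [face_cls j hg, face_cls i hg, map_smul, map_smul, face_cls _ (hg.face j),
    face_cls _ (hg.face i), smul_smul, smul_smul, ← ksgn_add, ← ksgn_add]
  refine congrArg₂ (· • ·) (congrArg (ksgn K) ?_) ?_
  · simp only [faceSign_eq, parSum_face i hg, parSum_face j hg]
    rw [if_pos (show i ≤ n + 1 by omega)]
    by_cases h1 : j ≤ n + 1
    · rw [if_pos h1, if_pos (show i ≤ n by omega), if_pos (show j - 1 ≤ n by omega)]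
    · rw [if_neg h1, if_neg (show ¬ j - 1 ≤ n by omega)]
      unfold faceSeq
      rw [if_neg h1, if_pos (show i ≤ n + 1 by omega)]
      by_cases h2 : i ≤ n
      · rw [if_pos h2, if_neg (by omega), if_neg (by omega)]; ring
      · have h3 : i = n + 1 := by omega
        subst h3
        simp only [lt_irrefl, if_false, if_true, if_neg h2, Nat.succ_ne_zero]
        rw [HArr.comp_par (hg.1 (n + 1) (by omega))]
        ring
  · refine cls_congr fun k hk => ?_
    obtain ⟨j, rfl⟩ : ∃ j', j = j' + 1 := ⟨j - 1, by omega⟩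
    exact faceSeq_faceSeq (by omega) (by omega) hg k hk

lemma lin_sum_comp {ι M N P : Type*} [AddCommGroup M] [Module K M] [AddCommGroup N] [Module K N]
    [AddCommGroup P] [Module K P] (s : Finset ι) (f : ι → N →ₗ[K] P) (h : M →ₗ[K] N) :
    (∑ i ∈ s, f i) ∘ₗ h = ∑ i ∈ s, f i ∘ₗ h := by
  ext x; simp

lemma lin_comp_sum {ι M N P : Type*} [AddCommGroup M] [Module K M] [AddCommGroup N] [Module K N]
    [AddCommGroup P] [Module K P] (s : Finset ι) (f : ι → M →ₗ[K] N) (h : N →ₗ[K] P) :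
    h ∘ₗ (∑ i ∈ s, f i) = ∑ i ∈ s, h ∘ₗ f i := by
  ext x; simp

lemma face_rot_zero : (face n 0 ∘ₗ rot (n + 1) : NChain K C (n + 1) →ₗ[K] _) =
    ksgn K (n + 1 : ℕ) • face n (n + 1) := by
  refine chain_ext fun g hg => ?_
  simp only [LinearMap.comp_apply, LinearMap.smul_apply]
  rw [rot_cls hg, map_smul, face_cls _ hg.rot, face_cls _ hg, smul_smul, smul_smul, ← ksgn_add,
    ← ksgn_add]
  refine congrArg₂ (· • ·) (congrArg (ksgn K) ?_) (cls_congr fun k hk => ?_)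
  · rw [faceSign_eq, faceSign_eq, last_sign, if_pos (Nat.zero_le _), if_neg (by omega), add_zero]
  · unfold faceSeq rotSeq
    simp only [if_pos (Nat.zero_le n), if_neg (show ¬ n + 1 ≤ n by omega)]
    by_cases h : k = 0
    · subst h; simp
    · simp [h]

lemma face_rot_succ {i : ℕ} (hi : i ≤ n) :
    (face n (i + 1) ∘ₗ rot (n + 1) : NChain K C (n + 1) →ₗ[K] _) = - (rot n ∘ₗ face n i) := by
  refine chain_ext fun g hg => ?_
  simp only [LinearMap.comp_apply, LinearMap.neg_apply]
  rw [rot_cls hg, map_smul, face_cls _ hg.rot, face_cls _ hg, map_smul, rot_cls (hg.face i),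
    smul_smul, smul_smul, ← ksgn_add, ← ksgn_add, ← neg_one_smul K, smul_smul, ← ksgn_one,
    ← ksgn_add]
  refine congrArg₂ (· • ·) (congrArg (ksgn K) ?_) (cls_congr fun k hk => ?_)
  · simp only [faceSign_eq, last_sign, if_pos hi, parSum_rot, parSum_face i hg]
    push_cast
    by_cases h : i = n
    · subst h
      simp only [if_neg (show ¬ i + 1 ≤ i by omega)]
      unfold rotSeq faceSeq
      simp only [if_pos le_rfl, lt_irrefl, if_false, if_true, Nat.succ_ne_zero,
        Nat.add_sub_cancel]
      rw [HArr.comp_par (hg.1 i (by omega))]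
      ring
    · rw [if_pos (show i + 1 ≤ n by omega)]
      unfold faceSeq
      rw [if_pos hi, if_neg (by omega), if_neg (by omega)]
      ring
  · unfold rotSeq faceSeq
    by_cases h : i = n
    · subst h
      simp only [if_neg (show ¬ i + 1 ≤ i by omega), if_pos le_rfl, lt_irrefl, if_false, if_true,
        Nat.succ_ne_zero, Nat.add_sub_cancel]
      by_cases h0 : k = 0
      · simp [h0]
      · rw [if_neg h0, if_neg h0, if_neg h0, if_pos (by omega)]
    · simp only [if_pos hi, if_pos (show i + 1 ≤ n by omega)]
      by_cases h0 : k = 0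
      · subst h0
        rw [if_pos (by omega), if_pos rfl, if_pos rfl, if_neg (by omega), if_neg (by omega)]
      · obtain ⟨k, rfl⟩ : ∃ k', k = k' + 1 := ⟨k - 1, by omega⟩
        simp only [Nat.succ_ne_zero, if_false, Nat.add_sub_cancel, Nat.add_lt_add_iff_right,
          Nat.add_right_cancel_iff]

lemma rot_pow_cls (hg : IsCycle n g) (k : ℕ) (hk : k ≤ n + 1) :
    IsCycle n (fun j => if j < k then g (n + 1 - k + j) else g (j - k)) ∧
    parSum (n + 1) (fun j => if j < k then g (n + 1 - k + j) else g (j - k)) =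
      parSum (n + 1) g ∧
    (rot n ^ k) (cls n g) =
      ksgn K (k * n + (∑ m ∈ Finset.range k, (g (n - m)).par) * (parSum (n + 1) g + 1)) •
        cls n (fun j => if j < k then g (n + 1 - k + j) else g (j - k)) := by
  induction k with
  | zero => simpa using hg
  | succ k ih =>
    obtain ⟨h1, h2, h3⟩ := ih (by omega)
    have e : ∀ j, j ≤ n → rotSeq n (fun j => if j < k then g (n + 1 - k + j) else g (j - k)) j =
        (fun j => if j < k + 1 then g (n + 1 - (k + 1) + j) else g (j - (k + 1))) j := by
      intro j hj
      unfold rotSeq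
      dsimp only
      by_cases h0 : j = 0
      · subst h0
        rw [if_pos rfl, if_neg (by omega), if_pos (by omega)]
        congr 1; omega
      · rw [if_neg h0]
        by_cases hjk : j - 1 < k
        · rw [if_pos hjk, if_pos (by omega)]; congr 1; omega
        · rw [if_neg hjk, if_neg (by omega)]; congr 1; omega
    refine ⟨?_, ?_, ?_⟩
    · exact h1.rot.congr (fun j hj => by rw [e j hj]) (fun j hj => by rw [e j hj])
    · exact (parSum_congr fun j hj => by rw [e j (by omega)]).trans (parSum_rot.trans h2)
    · have hl := last_sign n (fun j => if j < k then g (n + 1 - k + j) else g (j - k))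
      rw [h2] at hl
      rw [pow_succ', Module.End.mul_apply, h3, map_smul, rot_cls h1, smul_smul, ← ksgn_add,
        cls_congr e, hl]
      congr 2
      rw [Finset.sum_range_succ, if_neg (by omega)]
      push_cast
      ring

lemma rot_pow (n : ℕ) : (rot n : NChain K C n →ₗ[K] NChain K C n) ^ (n + 1) = 1 := by
  refine chain_ext fun g hg => ?_
  rw [(rot_pow_cls hg (n + 1) le_rfl).2.2, Module.End.one_apply]
  have e : ∑ m ∈ Finset.range (n + 1), (g (n - m)).par = parSum (n + 1) g :=
    Finset.sum_range_reflect (fun j => (g j).par) (n + 1)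
  rw [e, cls_congr (F' := g) (fun j hj => by rw [if_pos (by omega)]; congr 1; omega)]
  have h : ((n + 1 : ℕ) * n + parSum (n + 1) g * (parSum (n + 1) g + 1) : ZMod 2) = 0 := by
    push_cast
    rw [add_mul, mul_add, zmod2_sq, zmod2_sq]
    simp [zmod2_add_self]
  rw [h]
  simp

/-- The truncated boundary `b' = ∑_{i ≤ n} (-1)^i d^i`. -/
def bdry' (n : ℕ) : NChain K C (n + 1) →ₗ[K] NChain K C n :=
  ∑ i ∈ Finset.range (n + 1), ksgn K i • face n i

lemma bdry_eq (n : ℕ) : (bdry n : NChain K C (n + 1) →ₗ[K] NChain K C n) =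
    bdry' n + ksgn K (n + 1 : ℕ) • face n (n + 1) := Finset.sum_range_succ _ _

lemma ksgn_sq (a : ZMod 2) : ksgn K a * ksgn K a = 1 := by
  rw [← ksgn_add, zmod2_add_self, ksgn_zero]

lemma ksgn_succ (i : ℕ) : ksgn K (i + 1 : ℕ) = - ksgn K i := by
  push_cast
  rw [ksgn_add, ksgn_one]; ring

lemma bdry_rot (n : ℕ) : (bdry n ∘ₗ (LinearMap.id - rot (n + 1)) :
    NChain K C (n + 1) →ₗ[K] NChain K C n) = (LinearMap.id - rot n) ∘ₗ bdry' n := by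
  have h : (bdry n ∘ₗ rot (n + 1) : NChain K C (n + 1) →ₗ[K] NChain K C n) =
      face n (n + 1) + 0 • face n 0 - face n (n + 1) + ksgn K (n + 1 : ℕ) • face n (n + 1) +
        rot n ∘ₗ bdry' n := by
    rw [bdry, Finset.sum_range_succ', bdry', LinearMap.add_comp, LinearMap.smul_comp,
      face_rot_zero, lin_sum_comp, lin_comp_sum]
    simp only [LinearMap.smul_comp, LinearMap.comp_smul]
    rw [Finset.sum_congr rfl (g := fun i : ℕ => ksgn K i • (rot n ∘ₗ face n i : NChain K C (n + 1) →ₗ[K] _))]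
    · simp; abel
    · intro i hi
      rw [face_rot_succ (by have := Finset.mem_range.1 hi; omega), ksgn_succ]
      simp
  rw [LinearMap.comp_sub, h, bdry_eq, LinearMap.sub_comp, LinearMap.comp_id, LinearMap.id_comp,
    zero_smul]
  abel

lemma face_rot_pow {i j : ℕ} (hi : i ≤ n) (hj : j ≤ i) :
    (face n i ∘ₗ (rot (n + 1) ^ j) : NChain K C (n + 1) →ₗ[K] _) =
      ksgn K j • ((rot n ^ j) ∘ₗ face n (i - j)) := by
  induction j with
  | zero => ext x; simp
  | succ j ih =>
    obtain ⟨m, hm⟩ : ∃ m, i - j = m + 1 := ⟨i - j - 1, by omega⟩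
    rw [pow_succ, Module.End.mul_eq_comp, ← LinearMap.comp_assoc, ih (by omega), hm,
      LinearMap.smul_comp, LinearMap.comp_assoc, face_rot_succ (by omega), ksgn_succ,
      show i - (j + 1) = m by omega, pow_succ, Module.End.mul_eq_comp]
    simp [LinearMap.comp_assoc, LinearMap.comp_neg]

lemma face_rot_pow' {i j : ℕ} (hi : i ≤ n) (hij : i < j) (hj : j ≤ n + 1) :
    (face n i ∘ₗ (rot (n + 1) ^ j) : NChain K C (n + 1) →ₗ[K] _) =
      ksgn K (n + j : ℕ) • ((rot n ^ (j - 1)) ∘ₗ face n (n + 2 + i - j)) := by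
  have e0 : ∀ k, k ≤ n + 1 → (face n (n + 1) ∘ₗ (rot (n + 1) ^ k) : NChain K C (n + 1) →ₗ[K] _) =
      ksgn K k • ((rot n ^ k) ∘ₗ face n (n + 1 - k)) := by
    intro k hk
    induction k with
    | zero => ext x; simp
    | succ k ih =>
      rw [pow_succ, Module.End.mul_eq_comp, ← LinearMap.comp_assoc, ih (by omega),
        show n + 1 - k = n - k + 1 by omega, LinearMap.smul_comp, LinearMap.comp_assoc,
        face_rot_succ (by omega), ksgn_succ, show n + 1 - (k + 1) = n - k by omega, pow_succ,
        Module.End.mul_eq_comp]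
      simp [LinearMap.comp_assoc, LinearMap.comp_neg]
  obtain ⟨k, rfl⟩ : ∃ k, j = i + (k + 1) := ⟨j - i - 1, by omega⟩
  have e1 : (face n 0 ∘ₗ (rot (n + 1) ^ (k + 1)) : NChain K C (n + 1) →ₗ[K] _) =
      ksgn K (n + 1 + k : ℕ) • ((rot n ^ k) ∘ₗ face n (n + 1 - k)) := by
    rw [pow_succ', Module.End.mul_eq_comp, ← LinearMap.comp_assoc, face_rot_zero,
      LinearMap.smul_comp, e0 k (by omega), smul_smul, ← ksgn_add]
    push_cast
    rfl
  rw [pow_add, Module.End.mul_eq_comp, ← LinearMap.comp_assoc, face_rot_pow hi le_rfl,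
    LinearMap.smul_comp, LinearMap.comp_assoc, Nat.sub_self, e1, LinearMap.comp_smul, smul_smul,
    ← ksgn_add, ← LinearMap.comp_assoc, ← Module.End.mul_eq_comp, ← pow_add,
    show i + (k + 1) - 1 = i + k by omega, show n + 2 + i - (i + (k + 1)) = n + 1 - k by omega]
  congr 2
  push_cast
  ring

lemma bdry'_norm (n : ℕ) : (bdry' n ∘ₗ normOp (n + 1) : NChain K C (n + 1) →ₗ[K] NChain K C n) =
    normOp n ∘ₗ bdry n := by
  have h1 : (bdry' n ∘ₗ normOp (n + 1) : NChain K C (n + 1) →ₗ[K] NChain K C n) =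
      ∑ p ∈ Finset.range (n + 1) ×ˢ Finset.range (n + 2),
        ksgn K p.1 • (face n p.1 ∘ₗ (rot (n + 1) ^ p.2)) := by
    rw [bdry', normOp, lin_sum_comp, Finset.sum_product]
    refine Finset.sum_congr rfl fun i _ => ?_
    rw [lin_comp_sum]
    exact Finset.sum_congr rfl fun j _ => LinearMap.smul_comp _ _ _
  have h2 : (normOp n ∘ₗ bdry n : NChain K C (n + 1) →ₗ[K] NChain K C n) =
      ∑ p ∈ Finset.range (n + 1) ×ˢ Finset.range (n + 2),
        ksgn K p.2 • ((rot n ^ p.1) ∘ₗ face n p.2) := by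
    rw [bdry, normOp, lin_sum_comp, Finset.sum_product]
    refine Finset.sum_congr rfl fun i _ => ?_
    rw [lin_comp_sum]
    exact Finset.sum_congr rfl fun j _ => LinearMap.comp_smul _ _ _
  rw [h1, h2]
  refine Finset.sum_bij' (fun p _ => if p.2 ≤ p.1 then (p.2, p.1 - p.2)
      else (p.2 - 1, n + 2 + p.1 - p.2))
    (fun p _ => if p.1 + p.2 ≤ n then (p.1 + p.2, p.1) else (p.1 + p.2 - (n + 1), p.1 + 1))
    ?_ ?_ ?_ ?_ ?_
  · rintro ⟨i, j⟩ h
    simp only [Finset.mem_product, Finset.mem_range] at h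
    dsimp only
    split_ifs <;> simp only [Finset.mem_product, Finset.mem_range] <;> omega
  · rintro ⟨i, j⟩ h
    simp only [Finset.mem_product, Finset.mem_range] at h
    dsimp only
    split_ifs <;> simp only [Finset.mem_product, Finset.mem_range] <;> omega
  · rintro ⟨i, j⟩ h
    simp only [Finset.mem_product, Finset.mem_range] at h
    dsimp only
    by_cases hij : j ≤ i
    · simp only [if_pos hij, if_pos (show j + (i - j) ≤ n by omega)]
      exact Prod.ext (by dsimp only; omega) (by dsimp only)
    · simp only [if_neg hij, if_neg (show ¬ j - 1 + (n + 2 + i - j) ≤ n by omega)]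
      exact Prod.ext (by dsimp only; omega) (by dsimp only; omega)
  · rintro ⟨i, j⟩ h
    simp only [Finset.mem_product, Finset.mem_range] at h
    dsimp only
    by_cases hij : i + j ≤ n
    · simp only [if_pos hij, if_pos (show i ≤ i + j by omega)]
      exact Prod.ext (by dsimp only) (by dsimp only; omega)
    · simp only [if_neg hij, if_neg (show ¬ i + 1 ≤ i + j - (n + 1) by omega)]
      exact Prod.ext (by dsimp only; omega) (by dsimp only; omega)
  · rintro ⟨i, j⟩ h
    simp only [Finset.mem_product, Finset.mem_range] at h
    dsimp only
    split_ifs with hij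
    · rw [face_rot_pow (by omega) hij, smul_smul, ← ksgn_add]
      congr 2
      obtain ⟨m, rfl⟩ := Nat.exists_eq_add_of_le hij
      rw [Nat.add_sub_cancel_left]
      have := zmod2_add_self (j : ZMod 2)
      push_cast
      linear_combination this
    · rw [face_rot_pow' (by omega) (by omega) (by omega), smul_smul, ← ksgn_add]
      congr 2
      obtain ⟨m, hm⟩ : ∃ m, n + 2 + i = m + j := ⟨n + 2 + i - j, by omega⟩
      rw [show n + 2 + i - j = m by omega]
      have h3 : ((n + 2 + i : ℕ) : ZMod 2) = (m + j : ℕ) := by rw [hm]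
      have := zmod2_add_self (j : ZMod 2)
      have h5 : (2 : ZMod 2) = 0 := by decide
      push_cast at h3 ⊢
      linear_combination h3 + this - h5

lemma face_extra_zero (n : ℕ) :
    (face n 0 ∘ₗ extra n : NChain K C n →ₗ[K] NChain K C n) = LinearMap.id := by
  refine chain_ext fun g hg => ?_
  simp only [LinearMap.comp_apply, LinearMap.id_apply]
  rw [extra_cls hg, face_cls _ hg.extra, faceSign_eq, if_pos (Nat.zero_le _), ksgn_zero, one_smul]
  refine cls_congr fun k hk => ?_
  unfold faceSeq idSeq
  simp only [if_pos (Nat.zero_le n)]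
  by_cases h : k = 0
  · subst h
    simpa using HArr.id_comp rfl
  · simp [h]

lemma face_extra_succ {i : ℕ} (hi : i ≤ n) :
    (face (n + 1) (i + 1) ∘ₗ extra (n + 1) : NChain K C (n + 1) →ₗ[K] NChain K C (n + 1)) =
      extra n ∘ₗ face n i := by
  refine chain_ext fun g hg => ?_
  simp only [LinearMap.comp_apply]
  rw [extra_cls hg, face_cls _ hg.extra, face_cls _ hg, map_smul, extra_cls (hg.face i),
    faceSign_eq, faceSign_eq, if_pos (by omega), if_pos hi]
  congr 1
  refine cls_congr fun k hk => ?_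
  unfold faceSeq idSeq
  simp only [if_pos hi, if_pos (show i + 1 ≤ n + 1 by omega)]
  by_cases h0 : k = 0
  · subst h0
    rcases Nat.eq_zero_or_pos i with rfl | h
    · simp
    · simp [h]
  · obtain ⟨k, rfl⟩ : ∃ k', k = k' + 1 := ⟨k - 1, by omega⟩
    simp only [Nat.succ_ne_zero, if_false, Nat.add_sub_cancel, Nat.add_lt_add_iff_right,
      Nat.add_right_cancel_iff]

lemma bdry'_extra_zero :
    (bdry' 0 ∘ₗ extra 0 : NChain K C 0 →ₗ[K] NChain K C 0) = LinearMap.id := by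
  simp [bdry', face_extra_zero]

lemma bdry'_extra_succ (n : ℕ) :
    (bdry' (n + 1) ∘ₗ extra (n + 1) : NChain K C (n + 1) →ₗ[K] NChain K C (n + 1)) =
      LinearMap.id - extra n ∘ₗ bdry' n := by
  rw [bdry', Finset.sum_range_succ', LinearMap.add_comp, LinearMap.smul_comp, face_extra_zero,
    lin_sum_comp, bdry', lin_comp_sum]
  rw [Finset.sum_congr rfl (g := fun i : ℕ => - (extra n ∘ₗ (ksgn K i • face n i) :
    NChain K C (n + 1) →ₗ[K] _))]
  · simp; abel
  · intro i hi
    rw [LinearMap.smul_comp, face_extra_succ (by have := Finset.mem_range.1 hi; omega), ksgn_succ]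
    simp [LinearMap.comp_smul]

lemma rot_norm (n : ℕ) : ((LinearMap.id - rot n) ∘ₗ normOp n : NChain K C n →ₗ[K] NChain K C n) =
    0 := by
  have h := mul_neg_geom_sum (rot n : Module.End K (NChain K C n)) (n + 1)
  rw [rot_pow, sub_self] at h
  exact h

lemma bdry_bdry (n : ℕ) : (bdry n ∘ₗ bdry (n + 1) : NChain K C (n + 2) →ₗ[K] NChain K C n) = 0 := by
  have h1 : (bdry n ∘ₗ bdry (n + 1) : NChain K C (n + 2) →ₗ[K] NChain K C n) =
      ∑ p ∈ Finset.range (n + 2) ×ˢ Finset.range (n + 3),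
        ksgn K (p.1 + p.2 : ℕ) • (face n p.1 ∘ₗ face (n + 1) p.2) := by
    rw [bdry, bdry, lin_sum_comp, Finset.sum_product]
    refine Finset.sum_congr rfl fun i _ => ?_
    rw [lin_comp_sum]
    refine Finset.sum_congr rfl fun j _ => ?_
    rw [LinearMap.smul_comp, LinearMap.comp_smul, smul_smul, ← ksgn_add]
    push_cast
    rfl
  rw [h1, ← Finset.sum_filter_add_sum_filter_not _ (fun p : ℕ × ℕ => p.1 < p.2),
    add_eq_zero_iff_eq_neg, ← Finset.sum_neg_distrib]
  refine Finset.sum_bij' (fun p _ => (p.2 - 1, p.1)) (fun p _ => (p.2, p.1 + 1)) ?_ ?_ ?_ ?_ ?_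
  · rintro ⟨i, j⟩ h
    simp only [Finset.mem_filter, Finset.mem_product, Finset.mem_range] at h ⊢
    omega
  · rintro ⟨i, j⟩ h
    simp only [Finset.mem_filter, Finset.mem_product, Finset.mem_range] at h ⊢
    omega
  · rintro ⟨i, j⟩ h
    simp only [Finset.mem_filter, Finset.mem_product, Finset.mem_range] at h
    simp only [Prod.mk.injEq, true_and]
    omega
  · rintro ⟨i, j⟩ h
    simp
  · rintro ⟨i, j⟩ h
    simp only [Finset.mem_filter, Finset.mem_product, Finset.mem_range] at h
    dsimp only
    obtain ⟨j, rfl⟩ : ∃ j', j = j' + 1 := ⟨j - 1, by omega⟩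
    rw [face_face h.2 (by omega), ← add_assoc, ksgn_succ, Nat.add_sub_cancel, add_comm j i,
      neg_smul]

lemma bdry_connes_zero : (bdry 0 ∘ₗ connes 0 : NChain K C 0 →ₗ[K] NChain K C 0) = 0 := by
  rw [connes, ← LinearMap.comp_assoc, bdry_rot, LinearMap.comp_assoc,
    ← LinearMap.comp_assoc (normOp 0), bdry'_extra_zero, LinearMap.id_comp, rot_norm]

lemma lin_comp_sub {M N P : Type*} [AddCommGroup M] [Module K M] [AddCommGroup N] [Module K N]
    [AddCommGroup P] [Module K P] (h : N →ₗ[K] P) (f f' : M →ₗ[K] N) :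
    h ∘ₗ (f - f') = h ∘ₗ f - h ∘ₗ f' := by
  ext x; simp

lemma bdry_connes (n : ℕ) : (bdry (n + 1) ∘ₗ connes (n + 1) + connes n ∘ₗ bdry n :
    NChain K C (n + 1) →ₗ[K] NChain K C (n + 1)) = 0 := by
  have h1 : (bdry' (n + 1) ∘ₗ extra (n + 1)) ∘ₗ normOp (n + 1) =
      (normOp (n + 1) - extra n ∘ₗ normOp n ∘ₗ bdry n : NChain K C (n + 1) →ₗ[K] _) := by
    rw [bdry'_extra_succ, LinearMap.sub_comp, LinearMap.id_comp, LinearMap.comp_assoc, bdry'_norm]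
  rw [connes, ← LinearMap.comp_assoc, bdry_rot, LinearMap.comp_assoc,
    ← LinearMap.comp_assoc (normOp (n + 1)), h1, lin_comp_sub, rot_norm, connes,
    LinearMap.comp_assoc, LinearMap.comp_assoc]
  simp

end Cycles

/-- The chains with an identity among `g 0, …, g n`. -/
def weakDegen (K : Type w) [Field K] (C : Type u) [Category.{v} C] [Preadditive C]
    [Linear K C] [SuperCategory K C] (n : ℕ) : Submodule K (NChain K C n) :=
  Submodule.span K {x | ∃ g : ℕ → HArr K C, IsCycle n g ∧
    (∃ j, j ≤ n ∧ ∃ X, g j = HArr.id X) ∧ x = cls n g}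

/-- The degenerate chains: the span of the chains `(g 0, …, g n)` with an identity
among `g 1, …, g n`. -/
def degen (K : Type w) [Field K] (C : Type u) [Category.{v} C] [Preadditive C]
    [Linear K C] [SuperCategory K C] (n : ℕ) : Submodule K (NChain K C n) :=
  Submodule.span K {x | ∃ g : ℕ → HArr K C, IsCycle n g ∧
    (∃ j, 1 ≤ j ∧ j ≤ n ∧ ∃ X, g j = HArr.id X) ∧ x = cls n g}

lemma cls_mem_degen {n : ℕ} {g : ℕ → HArr K C} (hg : IsCycle n g) (j : ℕ) (h1 : 1 ≤ j)
    (h2 : j ≤ n) {X : C} (hX : g j = HArr.id X) : cls n g ∈ degen K C n :=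
  Submodule.subset_span ⟨g, hg, ⟨j, h1, h2, X, hX⟩, rfl⟩

lemma cls_mem_weakDegen {n : ℕ} {g : ℕ → HArr K C} (hg : IsCycle n g) (j : ℕ)
    (h2 : j ≤ n) {X : C} (hX : g j = HArr.id X) : cls n g ∈ weakDegen K C n :=
  Submodule.subset_span ⟨g, hg, ⟨j, h2, X, hX⟩, rfl⟩

lemma degen_le (n : ℕ) : degen K C n ≤ weakDegen K C n := by
  refine Submodule.span_le.2 ?_
  rintro _ ⟨g, hg, ⟨j, h1, h2, X, hX⟩, rfl⟩
  exact cls_mem_weakDegen hg j h2 hX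

lemma bdry_degen (n : ℕ) : degen K C (n + 1) ≤ (degen K C n).comap (bdry n) := by
  refine Submodule.span_le.2 ?_
  rintro _ ⟨g, hg, ⟨j, h1, h2, X, hX⟩, rfl⟩
  obtain ⟨j, rfl⟩ : ∃ j', j = j' + 1 := ⟨j - 1, by omega⟩
  simp only [Submodule.comap_coe, Set.mem_preimage, SetLike.mem_coe, bdry, LinearMap.sum_apply,
    LinearMap.smul_apply]
  have hs : (g j).tgt = X := by
    have := hg.1 j (by omega)
    rwa [hX] at this
  have hpar : (g (j + 1)).par = 0 := by rw [hX]; rfl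
  have e : face n j (cls (n + 1) g) = face n (j + 1) (cls (n + 1) g) := by
    rw [face_cls j hg, face_cls (j + 1) hg]
    have s1 : faceSign n j g = 0 := by rw [faceSign, if_pos (by omega)]
    have s2 : faceSign n (j + 1) g = 0 := by
      unfold faceSign
      split_ifs with h
      · rfl
      · obtain rfl : j = n := by omega
        rw [hpar, zero_mul]
    rw [s1, s2]
    congr 1
    refine cls_congr fun k hk => ?_
    unfold faceSeq
    rw [if_pos (show j ≤ n by omega)]
    by_cases hj : j + 1 ≤ n
    · rw [if_pos hj]
      rcases lt_trichotomy k j with h | rfl | h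
      · rw [if_pos h, if_pos (by omega)]
      · rw [if_neg (by omega), if_pos rfl, if_pos (by omega), hX, HArr.comp_id hs]
      · rw [if_neg (by omega), if_neg (by omega), if_neg (by omega)]
        split_ifs with h'
        · subst h'
          have := hg.1 (j + 1) (by omega)
          rw [hX] at this ⊢
          exact (HArr.id_comp this).symm
        · rfl
    · obtain rfl : j = n := by omega
      rw [if_neg hj]
      by_cases h0 : k = 0
      · subst h0
        have := hg.2
        rw [hX] at this
        have this' : (HArr.id X).comp (g 0) = g 0 := HArr.id_comp this
        rw [if_pos rfl, hX, this']
        split_ifs with h h'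
        · rfl
        · subst h'; exact HArr.comp_id hs
        · omega
      · rw [if_neg h0]
        split_ifs with h h'
        · rfl
        · subst h'; rw [hX, HArr.comp_id hs]
        · omega
  rw [← Finset.add_sum_erase _ _ (Finset.mem_range.2 (show j < n + 2 by omega)),
    ← Finset.add_sum_erase _ _ (Finset.mem_erase.2 ⟨show j + 1 ≠ j by omega,
      Finset.mem_range.2 (show j + 1 < n + 2 by omega)⟩), ← add_assoc, e, ← add_smul, ksgn_succ,
    add_neg_cancel, zero_smul, zero_add]
  refine Submodule.sum_mem _ fun i hi => Submodule.smul_mem _ _ ?_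
  simp only [Finset.mem_erase, Finset.mem_range] at hi
  rw [face_cls i hg]
  refine Submodule.smul_mem _ _ ?_
  by_cases hin : i ≤ n
  · rcases lt_or_gt_of_ne hi.2.1 with h | h
    · refine cls_mem_degen (hg.face i) j (by omega) (by omega) (X := X) ?_
      unfold faceSeq
      rw [if_pos hin, if_neg (by omega), if_neg (by omega), hX]
    · refine cls_mem_degen (hg.face i) (j + 1) (by omega) (by omega) (X := X) ?_
      unfold faceSeq
      rw [if_pos hin, if_pos (by omega), hX]
  · refine cls_mem_degen (hg.face i) (j + 1) (by omega) (by omega) (X := X) ?_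
    unfold faceSeq
    rw [if_neg hin, if_neg (by omega), hX]

lemma rot_weakDegen (n : ℕ) : weakDegen K C n ≤ (weakDegen K C n).comap (rot n) := by
  refine Submodule.span_le.2 ?_
  rintro _ ⟨g, hg, ⟨j, h2, X, hX⟩, rfl⟩
  simp only [Submodule.comap_coe, Set.mem_preimage, SetLike.mem_coe]
  rw [rot_cls hg]
  refine Submodule.smul_mem _ _ ?_
  by_cases h : j = n
  · subst h
    exact cls_mem_weakDegen hg.rot 0 (by omega) (X := X) (by simp [rotSeq, hX])
  · exact cls_mem_weakDegen hg.rot (j + 1) (by omega) (X := X) (by simp [rotSeq, hX])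

lemma rot_pow_weakDegen (n k : ℕ) {x : NChain K C n} (hx : x ∈ weakDegen K C n) :
    (rot n ^ k) x ∈ weakDegen K C n := by
  induction k with
  | zero => simpa using hx
  | succ k ih => rw [pow_succ', Module.End.mul_apply]; exact rot_weakDegen n ih

lemma extra_weakDegen (n : ℕ) : weakDegen K C n ≤ (degen K C (n + 1)).comap (extra n) := by
  refine Submodule.span_le.2 ?_
  rintro _ ⟨g, hg, ⟨j, h2, X, hX⟩, rfl⟩
  simp only [Submodule.comap_coe, Set.mem_preimage, SetLike.mem_coe]
  rw [extra_cls hg]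
  exact cls_mem_degen hg.extra (j + 1) (by omega) (by omega) (X := X) (by simp [idSeq, hX])

lemma rot_extra_mem (n : ℕ) (x : NChain K C n) : rot (n + 1) (extra n x) ∈ degen K C (n + 1) := by
  suffices h : (degen K C (n + 1)).mkQ ∘ₗ rot (n + 1) ∘ₗ extra n = 0 by
    have := LinearMap.congr_fun h x
    simpa using this
  refine chain_ext fun g hg => ?_
  simp only [LinearMap.comp_apply, LinearMap.zero_apply, Submodule.mkQ_apply,
    Submodule.Quotient.mk_eq_zero]
  rw [extra_cls hg, rot_cls hg.extra]
  exact Submodule.smul_mem _ _ (cls_mem_degen hg.extra.rot 1 le_rfl (by omega)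
    (X := (g 0).src) (by simp [rotSeq, idSeq]))

lemma connes_degen (n : ℕ) : degen K C n ≤ (degen K C (n + 1)).comap (connes n) := by
  intro x hx
  rw [Submodule.mem_comap, connes, LinearMap.comp_apply, LinearMap.comp_apply,
    LinearMap.sub_apply, LinearMap.id_apply]
  refine Submodule.sub_mem _ ?_ (rot_extra_mem n _)
  refine extra_weakDegen n ?_
  rw [normOp, LinearMap.sum_apply]
  exact Submodule.sum_mem _ fun j _ => rot_pow_weakDegen n j (degen_le n hx)

lemma connes_connes (n : ℕ) : (connes (n + 1) ∘ₗ connes n : NChain K C n →ₗ[K] _) = 0 := by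
  have h : (normOp (n + 1) ∘ₗ (LinearMap.id - rot (n + 1)) : NChain K C (n + 1) →ₗ[K] _) = 0 := by
    have h := geom_sum_mul_neg (rot (n + 1) : Module.End K (NChain K C (n + 1))) (n + 2)
    rw [rot_pow, sub_self] at h
    exact h
  have e : (connes (n + 1) ∘ₗ connes n : NChain K C n →ₗ[K] _) =
      (LinearMap.id - rot (n + 2)) ∘ₗ extra (n + 1) ∘ₗ
        (normOp (n + 1) ∘ₗ (LinearMap.id - rot (n + 1))) ∘ₗ extra n ∘ₗ normOp n := rfl
  rw [e, h]
  simp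

end Operators

end Chains

section Mixed

universe z z'

/-- A mixed complex: a graded vector space with operators `b` of degree `-1` and `B` of degree `1`
such that `b² = B² = bB + Bb = 0`. -/
structure MixedComplex (K : Type w) [Field K] where
  X : ℕ → Type z
  [grp : ∀ n, AddCommGroup (X n)]
  [mod : ∀ n, Module K (X n)]
  b : ∀ n, X (n + 1) →ₗ[K] X n
  B : ∀ n, X n →ₗ[K] X (n + 1)
  bb : ∀ n x, b n (b (n + 1) x) = 0
  BB : ∀ n x, B (n + 1) (B n x) = 0
  bB_zero : ∀ x, b 0 (B 0 x) = 0
  bB : ∀ n x, b (n + 1) (B (n + 1) x) + B n (b n x) = 0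

attribute [instance] MixedComplex.grp MixedComplex.mod

/-- The mixed complex of normalized Hochschild-Mitchell chains of a superadditive category, with
the operators induced by `∂` and Connes' `B`. -/
def normMixed (K : Type w) [Field K] (C : Type u) [Category.{v} C] [Preadditive C]
    [Linear K C] [SuperCategory K C] : MixedComplex.{w, max u v w} K where
  X n := NChain K C n ⧸ degen K C n
  b n := (degen K C (n + 1)).mapQ (degen K C n) (bdry n) (bdry_degen n)
  B n := (degen K C n).mapQ (degen K C (n + 1)) (connes n) (connes_degen n)
  bb n x := by
    obtain ⟨x, rfl⟩ := Submodule.Quotient.mk_surjective _ x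
    have := LinearMap.congr_fun (bdry_bdry (K := K) (C := C) n) x
    simp only [LinearMap.comp_apply, LinearMap.zero_apply] at this
    simp [Submodule.mapQ_apply, this]
  BB n x := by
    obtain ⟨x, rfl⟩ := Submodule.Quotient.mk_surjective _ x
    have := LinearMap.congr_fun (connes_connes (K := K) (C := C) n) x
    simp only [LinearMap.comp_apply, LinearMap.zero_apply] at this
    simp [Submodule.mapQ_apply, this]
  bB_zero x := by
    obtain ⟨x, rfl⟩ := Submodule.Quotient.mk_surjective _ x
    have := LinearMap.congr_fun (bdry_connes_zero (K := K) (C := C)) x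
    simp only [LinearMap.comp_apply, LinearMap.zero_apply] at this
    simp [Submodule.mapQ_apply, this]
  bB n x := by
    obtain ⟨x, rfl⟩ := Submodule.Quotient.mk_surjective _ x
    have := LinearMap.congr_fun (bdry_connes (K := K) (C := C) n) x
    simp only [LinearMap.comp_apply, LinearMap.add_apply, LinearMap.zero_apply] at this
    rw [Submodule.mapQ_apply, Submodule.mapQ_apply, Submodule.mapQ_apply, Submodule.mapQ_apply,
      ← Submodule.Quotient.mk_add, this, Submodule.Quotient.mk_zero]

/-- The underlying chain complex `(M, b)` of a mixed complex. -/
def MixedComplex.chain {K : Type w} [Field K] (M : MixedComplex.{w, z} K) :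
    ChainComplex (ModuleCat.{z} K) ℕ :=
  ChainComplex.of (fun n => ModuleCat.of K (M.X n)) (fun n => ModuleCat.ofHom (M.b n)) fun n => by
    ext x
    exact M.bb n x

section TensorMixed

variable {K : Type w} [Field K] (M : MixedComplex.{w, z} K) (M' : MixedComplex.{w, z'} K)

/-- The degree `n` part `⨁_{p + q = n} M_p ⊗ M'_q` of the tensor product. -/
abbrev tensorX (n : ℕ) : Type (max z z') :=
  ∀ x : {x : ℕ × ℕ // x.1 + x.2 = n}, M.X x.1.1 ⊗[K] M'.X x.1.2

/-- The component in `M_p ⊗ M'_q` of an element of the tensor product. -/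
def tensorCoord {n : ℕ} (p q : ℕ) (h : p + q = n) : tensorX M M' n →ₗ[K] M.X p ⊗[K] M'.X q :=
  LinearMap.proj (φ := fun x : {x : ℕ × ℕ // x.1 + x.2 = n} => M.X x.1.1 ⊗[K] M'.X x.1.2)
    ⟨(p, q), h⟩

/-- `b (x ⊗ y) = b x ⊗ y + (-1)^p x ⊗ b y` for `x` of degree `p`. -/
def tensorb (n : ℕ) : tensorX M M' (n + 1) →ₗ[K] tensorX M M' n :=
  LinearMap.pi fun x =>
    (M.b x.1.1).rTensor (M'.X x.1.2) ∘ₗ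
      tensorCoord M M' (x.1.1 + 1) x.1.2 (by have := x.2; omega) +
    (-1 : K) ^ x.1.1 • (M'.b x.1.2).lTensor (M.X x.1.1) ∘ₗ
      tensorCoord M M' x.1.1 (x.1.2 + 1) (by have := x.2; omega)

/-- The component in `M_p ⊗ M'_q` of `B ⊗ 1`. -/
def tensorBleft (n : ℕ) :
    ∀ p q : ℕ, p + q = n + 1 → (tensorX M M' n →ₗ[K] M.X p ⊗[K] M'.X q)
  | 0, _, _ => 0
  | p + 1, q, h => (M.B p).rTensor (M'.X q) ∘ₗ tensorCoord M M' p q (by omega)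

/-- The component in `M_p ⊗ M'_q` of `1 ⊗ B`, with its sign. -/
def tensorBright (n : ℕ) :
    ∀ p q : ℕ, p + q = n + 1 → (tensorX M M' n →ₗ[K] M.X p ⊗[K] M'.X q)
  | _, 0, _ => 0
  | p, q + 1, h => (-1 : K) ^ p • (M'.B q).lTensor (M.X p) ∘ₗ tensorCoord M M' p q (by omega)

/-- `B (x ⊗ y) = B x ⊗ y + (-1)^p x ⊗ B y` for `x` of degree `p`. -/
def tensorB (n : ℕ) : tensorX M M' n →ₗ[K] tensorX M M' (n + 1) :=
  LinearMap.pi fun x =>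
    tensorBleft M M' n x.1.1 x.1.2 x.2 + tensorBright M M' n x.1.1 x.1.2 x.2

lemma tensorX_ext {n : ℕ} {x y : tensorX M M' n}
    (h : ∀ p q (e : p + q = n), tensorCoord M M' p q e x = tensorCoord M M' p q e y) : x = y :=
  funext fun z => h z.1.1 z.1.2 z.2

lemma coord_b {n p q : ℕ} (h : p + q = n) (x : tensorX M M' (n + 1)) :
    tensorCoord M M' p q h (tensorb M M' n x) =
      (M.b p).rTensor (M'.X q) (tensorCoord M M' (p + 1) q (by omega) x) +
      (-1 : K) ^ p • (M'.b q).lTensor (M.X p) (tensorCoord M M' p (q + 1) (by omega) x) := rfl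

lemma coord_B_succ_zero {n p : ℕ} (h : (p + 1) + 0 = n + 1) (x : tensorX M M' n) :
    tensorCoord M M' (p + 1) 0 h (tensorB M M' n x) =
      (M.B p).rTensor (M'.X 0) (tensorCoord M M' p 0 (by omega) x) := add_zero _

lemma coord_B_zero_succ {n q : ℕ} (h : 0 + (q + 1) = n + 1) (x : tensorX M M' n) :
    tensorCoord M M' 0 (q + 1) h (tensorB M M' n x) =
      (M'.B q).lTensor (M.X 0) (tensorCoord M M' 0 q (by omega) x) := by
  have e : tensorCoord M M' 0 (q + 1) h (tensorB M M' n x) = 0 + (-1 : K) ^ 0 •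
      (M'.B q).lTensor (M.X 0) (tensorCoord M M' 0 q (by omega) x) := rfl
  rw [e, zero_add, pow_zero, one_smul]

lemma coord_B_succ_succ {n p q : ℕ} (h : (p + 1) + (q + 1) = n + 1) (x : tensorX M M' n) :
    tensorCoord M M' (p + 1) (q + 1) h (tensorB M M' n x) =
      (M.B p).rTensor (M'.X (q + 1)) (tensorCoord M M' p (q + 1) (by omega) x) +
      (-1 : K) ^ (p + 1) • (M'.B q).lTensor (M.X (p + 1))
        (tensorCoord M M' (p + 1) q (by omega) x) := rfl

lemma rTensor_lTensor_comm {P Q P' Q' : Type*} [AddCommGroup P] [Module K P] [AddCommGroup Q]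
    [Module K Q] [AddCommGroup P'] [Module K P'] [AddCommGroup Q'] [Module K Q']
    (f : P →ₗ[K] P') (g : Q →ₗ[K] Q') (x : P ⊗[K] Q) :
    f.rTensor Q' (g.lTensor P x) = g.lTensor P' (f.rTensor Q x) := by
  rw [← LinearMap.comp_apply, ← LinearMap.comp_apply, LinearMap.rTensor_comp_lTensor,
    LinearMap.lTensor_comp_rTensor]

lemma rTensor_zero' {P Q P' P'' : Type*} [AddCommGroup P] [Module K P] [AddCommGroup Q]
    [Module K Q] [AddCommGroup P'] [Module K P'] [AddCommGroup P''] [Module K P'']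
    (f : P →ₗ[K] P') (g : P' →ₗ[K] P'') (h : ∀ x, g (f x) = 0) (x : P ⊗[K] Q) :
    g.rTensor Q (f.rTensor Q x) = 0 := by
  rw [← LinearMap.comp_apply, ← LinearMap.rTensor_comp, show g ∘ₗ f = 0 from LinearMap.ext h]
  simp

lemma lTensor_zero' {P Q P' P'' : Type*} [AddCommGroup P] [Module K P] [AddCommGroup Q]
    [Module K Q] [AddCommGroup P'] [Module K P'] [AddCommGroup P''] [Module K P'']
    (f : P →ₗ[K] P') (g : P' →ₗ[K] P'') (h : ∀ x, g (f x) = 0) (x : Q ⊗[K] P) :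
    g.lTensor Q (f.lTensor Q x) = 0 := by
  rw [← LinearMap.comp_apply, ← LinearMap.lTensor_comp, show g ∘ₗ f = 0 from LinearMap.ext h]
  simp

lemma rTensor_anti {P Q P' P'' : Type*} [AddCommGroup P] [Module K P] [AddCommGroup Q]
    [Module K Q] [AddCommGroup P'] [Module K P'] [AddCommGroup P''] [Module K P'']
    (f : P →ₗ[K] P') (g : P' →ₗ[K] P) (f' : P →ₗ[K] P'') (g' : P'' →ₗ[K] P)
    (h : ∀ x, g (f x) + g' (f' x) = 0) (x : P ⊗[K] Q) :
    g.rTensor Q (f.rTensor Q x) = - g'.rTensor Q (f'.rTensor Q x) := by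
  rw [← LinearMap.comp_apply, ← LinearMap.comp_apply, ← LinearMap.rTensor_comp,
    ← LinearMap.rTensor_comp, eq_neg_iff_add_eq_zero, ← LinearMap.add_apply,
    ← LinearMap.rTensor_add, show g ∘ₗ f + g' ∘ₗ f' = 0 from LinearMap.ext h]
  simp

lemma lTensor_anti {P Q P' P'' : Type*} [AddCommGroup P] [Module K P] [AddCommGroup Q]
    [Module K Q] [AddCommGroup P'] [Module K P'] [AddCommGroup P''] [Module K P'']
    (f : P →ₗ[K] P') (g : P' →ₗ[K] P) (f' : P →ₗ[K] P'') (g' : P'' →ₗ[K] P)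
    (h : ∀ x, g (f x) + g' (f' x) = 0) (x : Q ⊗[K] P) :
    g.lTensor Q (f.lTensor Q x) = - g'.lTensor Q (f'.lTensor Q x) := by
  rw [← LinearMap.comp_apply, ← LinearMap.comp_apply, ← LinearMap.lTensor_comp,
    ← LinearMap.lTensor_comp, eq_neg_iff_add_eq_zero, ← LinearMap.add_apply,
    ← LinearMap.lTensor_add, show g ∘ₗ f + g' ∘ₗ f' = 0 from LinearMap.ext h]
  simp

lemma neg_pow_sq (p : ℕ) : (-1 : K) ^ p * (-1 : K) ^ p = 1 := by
  rw [← mul_pow]; simp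

/-- The tensor product of two mixed complexes. -/
def MixedComplex.tensor : MixedComplex.{w, max z z'} K where
  X n := tensorX M M' n
  b n := tensorb M M' n
  B n := tensorB M M' n
  bb n x := by
    refine tensorX_ext M M' fun p q e => ?_
    rw [coord_b, coord_b, coord_b, map_add, map_add, map_smul, map_smul,
      rTensor_zero' _ _ (M.bb p), lTensor_zero' _ _ (M'.bb q), rTensor_lTensor_comm, map_zero,
      pow_succ]
    simp
  BB n x := by
    refine tensorX_ext M M' fun p q e => ?_
    have hB := M.BB
    have hB' := M'.BB
    rcases p with _ | _ | p <;> rcases q with _ | _ | q <;>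
    first
    | omega
    | simp only [coord_B_succ_zero, coord_B_zero_succ, coord_B_succ_succ, map_add, map_smul,
        map_zero, rTensor_zero' _ _ (hB _), lTensor_zero' _ _ (hB' _), rTensor_lTensor_comm,
        pow_succ]
      try simp
  bB_zero x := by
    refine tensorX_ext M M' fun p q e => ?_
    obtain rfl : p = 0 := by omega
    obtain rfl : q = 0 := by omega
    rw [coord_b, coord_B_succ_zero, coord_B_zero_succ, rTensor_zero' _ _ M.bB_zero,
      lTensor_zero' _ _ M'.bB_zero]
    simp
  bB n x := by
    refine tensorX_ext M M' fun p q e => ?_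
    have hb := M.bB
    have hb' := M'.bB
    rcases p with _ | p <;> rcases q with _ | q
    · omega
    · simp only [map_add, coord_b, coord_B_succ_zero, coord_B_zero_succ, coord_B_succ_succ,
        map_smul, lTensor_anti _ _ _ _ (hb' _), rTensor_zero' _ _ M.bB_zero,
        rTensor_lTensor_comm, map_zero, pow_succ]
      simp
      abel
    · simp only [map_add, coord_b, coord_B_succ_zero, coord_B_zero_succ, coord_B_succ_succ,
        map_smul, rTensor_anti _ _ _ _ (hb _), lTensor_zero' _ _ M'.bB_zero,
        rTensor_lTensor_comm, map_zero, pow_succ]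
      simp
      abel
    · simp only [map_add, coord_b, coord_B_succ_zero, coord_B_zero_succ, coord_B_succ_succ,
        map_smul, rTensor_anti _ _ _ _ (hb _), lTensor_anti _ _ _ _ (hb' _),
        rTensor_lTensor_comm, map_zero, pow_succ, smul_add, smul_smul, smul_neg]
      simp [neg_pow_sq]
      abel

end TensorMixed

section Total

open HomologicalComplex

variable {K : Type w} [Field K] (M : MixedComplex.{w, z} K)

/-- The degree `n` part `⨁_{m + 2 k = n} M_m` of the total cyclic complex. -/
abbrev totX (n : ℕ) : Type z := ∀ x : {x : ℕ × ℕ // x.1 + 2 * x.2 = n}, M.X x.1.1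

/-- The component in the `k`-th copy of `M_m` of an element of the total complex. -/
def totCoord {n : ℕ} (m k : ℕ) (h : m + 2 * k = n) : totX M n →ₗ[K] M.X m :=
  LinearMap.proj (φ := fun x : {x : ℕ × ℕ // x.1 + 2 * x.2 = n} => M.X x.1.1) ⟨(m, k), h⟩

lemma totX_ext {n : ℕ} {x y : totX M n}
    (h : ∀ m k (e : m + 2 * k = n), totCoord M m k e x = totCoord M m k e y) : x = y :=
  funext fun z => h z.1.1 z.1.2 z.2

/-- The part of the differential of the total complex that comes from `B`; it maps the
`(k + 1)`-st copy of `M_m` to the `k`-th copy of `M_{m + 1}`. -/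
def totBPart (n : ℕ) : ∀ m k : ℕ, m + 2 * k = n → (totX M (n + 1) →ₗ[K] M.X m)
  | 0, _, _ => 0
  | m + 1, k, h => M.B m ∘ₗ totCoord M m (k + 1) (by omega)

/-- The differential `b + B` of the total complex. -/
def totD (n : ℕ) : totX M (n + 1) →ₗ[K] totX M n :=
  LinearMap.pi fun x =>
    M.b x.1.1 ∘ₗ totCoord M (x.1.1 + 1) x.1.2 (by have := x.2; omega) +
      totBPart M n x.1.1 x.1.2 x.2

lemma coord_totD_zero {n k : ℕ} (h : 0 + 2 * k = n) (x : totX M (n + 1)) :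
    totCoord M 0 k h (totD M n x) = M.b 0 (totCoord M 1 k (by omega) x) := add_zero _

lemma coord_totD_succ {n m k : ℕ} (h : m + 1 + 2 * k = n) (x : totX M (n + 1)) :
    totCoord M (m + 1) k h (totD M n x) = M.b (m + 1) (totCoord M (m + 2) k (by omega) x) +
      M.B m (totCoord M m (k + 1) (by omega) x) := rfl

lemma totD_totD (n : ℕ) (x : totX M (n + 2)) : totD M n (totD M (n + 1) x) = 0 := by
  refine totX_ext M fun m k e => ?_
  rcases m with _ | _ | m
  · rw [coord_totD_zero, coord_totD_succ, map_add, M.bb, M.bB_zero, map_zero, add_zero]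
  · rw [coord_totD_succ, coord_totD_succ, coord_totD_zero, map_add, M.bb]
    exact (add_assoc _ _ _).trans ((zero_add _).trans ((M.bB 0 _).trans (map_zero _).symm))
  · rw [coord_totD_succ, coord_totD_succ, coord_totD_succ, map_add, map_add, M.bb, zero_add,
      M.BB, add_zero]
    exact (M.bB (m + 1) _).trans (map_zero _).symm

/-- The total cyclic complex of a mixed complex. -/
def MixedComplex.tot : ChainComplex (ModuleCat.{z} K) ℕ :=
  ChainComplex.of (fun n => ModuleCat.of K (totX M n)) (fun n => ModuleCat.ofHom (totD M n))
    fun n => by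
      ext1
      exact LinearMap.ext (totD_totD M n)

lemma chain_d (n : ℕ) : M.chain.d (n + 1) n = ModuleCat.ofHom (M.b n) := by
  exact ChainComplex.of_d (fun n => ModuleCat.of K (M.X n))
    (fun n => ModuleCat.ofHom (M.b n)) n

lemma tot_d (n : ℕ) : M.tot.d (n + 1) n = ModuleCat.ofHom (totD M n) := by
  exact ChainComplex.of_d (fun n => ModuleCat.of K (totX M n))
    (fun n => ModuleCat.ofHom (totD M n)) n

/-- The identification of `M_n` with `M_m` for `n = m`. -/
def MixedComplex.cast {n m : ℕ} (h : n = m) : M.X n →ₗ[K] M.X m := h ▸ LinearMap.id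

/-- The component in the `k`-th copy of `M_m` of the inclusion of the copy of `M_n` with `k = 0`. -/
def totInclCoord (n : ℕ) : ∀ m k : ℕ, m + 2 * k = n → (M.X n →ₗ[K] M.X m)
  | _, 0, h => M.cast (by omega)
  | _, _ + 1, _ => 0

/-- The inclusion of `M_n` in the total complex, as the copy with `k = 0`. -/
def totIncl (n : ℕ) : M.X n →ₗ[K] totX M n :=
  LinearMap.pi fun x => totInclCoord M n x.1.1 x.1.2 x.2

lemma coord_incl_zero {n : ℕ} (h : n + 2 * 0 = n) (x : M.X n) :
    totCoord M n 0 h (totIncl M n x) = x := rfl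

lemma coord_incl_succ {n m k : ℕ} (h : m + 2 * (k + 1) = n) (x : M.X n) :
    totCoord M m (k + 1) h (totIncl M n x) = 0 := rfl

lemma totD_totIncl (n : ℕ) (x : M.X (n + 1)) :
    totD M n (totIncl M (n + 1) x) = totIncl M n (M.b n x) := by
  refine totX_ext M fun m k e => ?_
  rcases k with _ | k
  · obtain rfl : m = n := by omega
    rcases m with _ | m
    · rw [coord_totD_zero, coord_incl_zero, coord_incl_zero]
    · rw [coord_totD_succ, coord_incl_zero, coord_incl_zero, coord_incl_succ, map_zero,
        add_zero]
  · rcases m with _ | m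
    · rw [coord_totD_zero, coord_incl_succ, coord_incl_succ, map_zero]
    · rw [coord_totD_succ, coord_incl_succ, coord_incl_succ, coord_incl_succ, map_zero,
        map_zero, add_zero]

/-- The map `I : (M, b) ⟶ Tot M`. -/
def MixedComplex.I : M.chain ⟶ M.tot :=
  ChainComplex.ofHom (X := M.chain) (Y := M.tot) (fun n => ModuleCat.ofHom (totIncl M n)) fun n => by
    rw [chain_d, tot_d]
    ext1
    exact LinearMap.ext (totD_totIncl M n)

/-- The embedding `n ↦ n + 2` of degrees. -/
def shiftTwo : (ComplexShape.down ℕ).Embedding (ComplexShape.down ℕ) where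
  f n := n + 2
  injective_f := add_left_injective 2
  rel {i j} h := by
    change j + 1 = i at h
    change j + 2 + 1 = i + 2
    omega

lemma shiftTwo_f (n : ℕ) : shiftTwo.f n = n + 2 := rfl

instance : shiftTwo.IsRelIff where
  rel' i j h := by
    change j + 2 + 1 = i + 2 at h
    change j + 1 = i
    omega

/-- The shift `C[2]` of a chain complex: `C[2]_{n + 2} = C_n`, and `C[2]_0 = C[2]_1 = 0`. -/
abbrev shift (C : ChainComplex (ModuleCat.{z} K) ℕ) : ChainComplex (ModuleCat.{z} K) ℕ :=
  C.extend shiftTwo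

/-- The shift of a chain map. -/
abbrev shiftMap {C D : ChainComplex (ModuleCat.{z} K) ℕ} (f : C ⟶ D) : shift C ⟶ shift D :=
  extendMap f shiftTwo

/-- The map on total complexes that forgets the copy with `k = 0`. -/
def totShift (n : ℕ) : totX M (n + 2) →ₗ[K] totX M n :=
  LinearMap.pi fun x => totCoord M x.1.1 (x.1.2 + 1) (by have := x.2; omega)

lemma coord_totShift {n m k : ℕ} (h : m + 2 * k = n) (x : totX M (n + 2)) :
    totCoord M m k h (totShift M n x) = totCoord M m (k + 1) (by omega) x := rfl

lemma totShift_totD (n : ℕ) (x : totX M (n + 3)) :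
    totD M n (totShift M (n + 1) x) = totShift M n (totD M (n + 2) x) := by
  refine totX_ext M fun m k e => ?_
  rw [coord_totShift]
  rcases m with _ | m
  · rw [coord_totD_zero, coord_totD_zero]; rfl
  · rw [coord_totD_succ, coord_totD_succ]; rfl

/-- `totShift` as a morphism from the restriction of the total complex to degrees `≥ 2`. -/
def totShiftHom : M.tot.restriction shiftTwo ⟶ M.tot :=
  ChainComplex.ofHom (X := M.tot.restriction shiftTwo) (Y := M.tot)
    (fun n => ModuleCat.ofHom (totShift M n)) fun n => by
      rw [tot_d]
      change ModuleCat.ofHom (totShift M (n + 1)) ≫ ModuleCat.ofHom (totD M n) =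
        M.tot.d (n + 3) (n + 2) ≫ ModuleCat.ofHom (totShift M n)
      rw [tot_d]
      ext1
      exact LinearMap.ext fun x => totShift_totD M n x

lemma totShiftHom_hasLift : shiftTwo.HasLift (totShiftHom M) := by
  intro j hj i h
  exact (hj.2 (j + 1) (by change j + 2 + 1 = j + 1 + 2; omega)).elim

/-- The map `S : Tot M ⟶ (Tot M)[2]`. -/
def MixedComplex.S : M.tot ⟶ shift M.tot :=
  shiftTwo.liftExtend (totShiftHom M) (totShiftHom_hasLift M)

lemma S_f (n : ℕ) : (M.S).f (n + 2) = ModuleCat.ofHom (totShift M n) ≫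
    (M.tot.extendXIso shiftTwo (shiftTwo_f n)).inv := by
  have := shiftTwo.liftExtend_f (totShiftHom M) (totShiftHom_hasLift M) (shiftTwo_f n)
  rw [MixedComplex.S, this]
  exact Category.id_comp _

lemma shiftTwo_ne {n : ℕ} (h : n < 2) : ∀ i, shiftTwo.f i ≠ n := by
  intro i
  change i + 2 ≠ n
  omega

lemma totShift_totIncl (n : ℕ) (x : M.X (n + 2)) : totShift M n (totIncl M (n + 2) x) = 0 :=
  totX_ext M fun m k e => by rw [coord_totShift, coord_incl_succ, map_zero]

lemma I_S : M.I ≫ M.S = 0 := by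
  ext1 n
  by_cases h : n < 2
  · exact (M.tot.isZero_extend_X shiftTwo n (shiftTwo_ne h)).eq_of_tgt _ _
  · obtain ⟨n, rfl⟩ : ∃ m, n = m + 2 := ⟨n - 2, by omega⟩
    have : (M.I).f (n + 2) ≫ ModuleCat.ofHom (totShift M n) = 0 := by
      ext1
      exact LinearMap.ext (totShift_totIncl M n)
    have e : (M.I ≫ M.S).f (n + 2) = ((M.I).f (n + 2) ≫ ModuleCat.ofHom (totShift M n)) ≫
        (M.tot.extendXIso shiftTwo (shiftTwo_f n)).inv := by
      rw [HomologicalComplex.comp_f, S_f]; rfl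
    rw [e]
    exact (congrArg (· ≫ (M.tot.extendXIso shiftTwo (shiftTwo_f n)).inv) this).trans
      Limits.zero_comp

/-- The sequence `0 ⟶ (M, b) ⟶ Tot M ⟶ (Tot M)[2] ⟶ 0`. -/
def MixedComplex.connesSeq : ShortComplex (ChainComplex (ModuleCat.{z} K) ℕ) :=
  ShortComplex.mk M.I M.S (I_S M)

lemma totIncl_injective (n : ℕ) : Function.Injective (totIncl M n) := by
  intro x y h
  rw [← coord_incl_zero M (n := n) rfl x, h, coord_incl_zero]

lemma totIncl_range (n : ℕ) (x : totX M n)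
    (h : ∀ m k (e : m + 2 * (k + 1) = n), totCoord M m (k + 1) e x = 0) :
    ∃ y, totIncl M n y = x := by
  refine ⟨totCoord M n 0 rfl x, totX_ext M fun m k e => ?_⟩
  rcases k with _ | k
  · obtain rfl : m = n := by omega
    rw [coord_incl_zero]
  · rw [coord_incl_succ, h]

lemma totShift_surjective (n : ℕ) : Function.Surjective (totShift M n) := by
  intro y
  let c : ∀ m k : ℕ, m + 2 * k = n + 2 → M.X m := fun m k => match k with
    | 0 => fun _ => 0
    | k + 1 => fun e => totCoord M m k (by omega) y
  exact ⟨fun x => c x.1.1 x.1.2 x.2, totX_ext M fun m k e => rfl⟩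

/-- The sequence `0 ⟶ (M, b) ⟶ Tot M ⟶ (Tot M)[2] ⟶ 0` is exact. -/
lemma connesSeq_exact : M.connesSeq.ShortExact := by
  refine HomologicalComplex.shortExact_of_degreewise_shortExact _ fun n => ?_
  have hmono : Mono ((M.I).f n) :=
    (ModuleCat.mono_iff_injective _).2 (totIncl_injective M n)
  by_cases h : n < 2
  · have hz := M.tot.isZero_extend_X shiftTwo n (shiftTwo_ne h)
    refine
      { exact := ?_
        mono_f := hmono
        epi_g := ⟨fun f g _ => hz.eq_of_src f g⟩ }
    rw [ShortComplex.moduleCat_exact_iff]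
    intro x _
    exact totIncl_range M n x fun m k e => by omega
  · obtain ⟨n, rfl⟩ : ∃ m, n = m + 2 := ⟨n - 2, by omega⟩
    have hS := S_f M n
    have hepi : Epi (ModuleCat.ofHom (totShift M n)) :=
      (ModuleCat.epi_iff_surjective _).2 (totShift_surjective M n)
    refine
      { exact := ?_
        mono_f := hmono
        epi_g := ?_ }
    · rw [ShortComplex.moduleCat_exact_iff]
      intro x hx
      have hx' : (M.S).f (n + 2) x = 0 := hx
      rw [hS] at hx'
      have h0 : totShift M n x = 0 := by
        refine (ModuleCat.mono_iff_injective
          (M.tot.extendXIso shiftTwo (shiftTwo_f n)).inv).1 inferInstance ?_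
        exact hx'.trans (map_zero _).symm
      refine totIncl_range M (n + 2) x fun m k e => ?_
      have := congrArg (totCoord M m k (by omega)) h0
      rw [map_zero] at this
      exact this
    · have : Epi ((M.S).f (n + 2)) := by
        have h2 : Epi (M.tot.extendXIso shiftTwo (shiftTwo_f n)).inv := inferInstance
        rw [hS]
        exact @epi_comp _ _ _ _ _ _ hepi _ h2
      exact this

/-- Hochschild homology of a mixed complex. -/
abbrev MixedComplex.HH (n : ℕ) : ModuleCat.{z} K := M.chain.homology n

/-- Cyclic homology of a mixed complex. -/
abbrev MixedComplex.HC (n : ℕ) : ModuleCat.{z} K := M.tot.homology n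

/-- The homology of the shifted complex: `H_{n + 2}(C[2]) = H_n(C)`. -/
abbrev shiftHomologyIso (C : ChainComplex (ModuleCat.{z} K) ℕ) (n : ℕ) :
    (shift C).homology (n + 2) ≅ C.homology n :=
  C.extendHomologyIso shiftTwo (shiftTwo_f n)

/-- The map `I : HH_n ⟶ HC_n` of Connes' exact sequence. -/
def MixedComplex.connesI (n : ℕ) : M.HH n ⟶ M.HC n := homologyMap M.I n

/-- The map `S : HC_{n + 2} ⟶ HC_n` of Connes' exact sequence. -/
def MixedComplex.connesS (n : ℕ) : M.HC (n + 2) ⟶ M.HC n :=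
  homologyMap M.S (n + 2) ≫ (shiftHomologyIso M.tot n).hom

/-- The map `B : HC_n ⟶ HH_{n + 1}` of Connes' exact sequence: the connecting homomorphism of
`0 ⟶ (M, b) ⟶ Tot M ⟶ (Tot M)[2] ⟶ 0`. -/
def MixedComplex.connesB (n : ℕ) : M.HC n ⟶ M.HH (n + 1) :=
  (shiftHomologyIso M.tot n).inv ≫ (connesSeq_exact M).δ (n + 2) (n + 1) rfl

end Total

section Matrix

variable {K : Type w} [Field K] {M : MixedComplex.{w, z} K} {M' : MixedComplex.{w, z'} K}

/-- The off-diagonal part of a map of total complexes. -/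
def totMatrixPart (g : ∀ n, M.X n →ₗ[K] M'.X (n + 2)) (n : ℕ) :
    ∀ m k : ℕ, m + 2 * k = n → (totX M n →ₗ[K] M'.X m)
  | 0, _, _ => 0
  | 1, _, _ => 0
  | m + 2, k, h => g m ∘ₗ totCoord M m (k + 1) (by omega)

/-- The map of total complexes given by the matrix with a family `f` of degree `0` on the diagonal
and a family `g` of degree `2` next to the diagonal: `g` maps the `(k + 1)`-st copy of `M_m` to the
`k`-th copy of `M'_{m + 2}`. -/
def totMatrix (f : ∀ n, M.X n →ₗ[K] M'.X n) (g : ∀ n, M.X n →ₗ[K] M'.X (n + 2)) (n : ℕ) :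
    totX M n →ₗ[K] totX M' n :=
  LinearMap.pi fun x =>
    f x.1.1 ∘ₗ totCoord M x.1.1 x.1.2 x.2 + totMatrixPart g n x.1.1 x.1.2 x.2

end Matrix

end Mixed

section Shuffle

open SuperCategory

variable {K : Type w} [Field K]
  {A : Type u} [Category.{v} A] [Preadditive A] [Linear K A] [SuperCategory K A]
  {B : Type u'} [Category.{v'} B] [Preadditive B] [Linear K B] [SuperCategory K B]

lemma HArr.mk_congr {C : Type u} [Category.{v} C] [Preadditive C] [Linear K C]
    [SuperCategory K C] {X Y : C} {e e' : ZMod 2} {f f' : X ⟶ Y} {h : f ∈ gr (K := K) X Y e}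
    {h' : f' ∈ gr (K := K) X Y e'} (he : e = e') (hf : f = f') :
    (⟨X, Y, e, f, h⟩ : HArr K C) = ⟨X, Y, e', f', h'⟩ := by
  subst he hf; rfl

/-- The tensor product of two homogeneous morphisms. -/
def HArr.tensor (a : HArr K A) (b : HArr K B) : HArr K (SuperTensor K A B) where
  src := ⟨a.src, b.src⟩
  tgt := ⟨a.tgt, b.tgt⟩
  par := a.par + b.par
  hom := a.hom ⊗ₜ[K] b.hom
  mem := Submodule.subset_span ⟨a.par, b.par, a.hom, b.hom, a.mem, b.mem, rfl, rfl⟩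

lemma HArr.tensor_id (X : A) (Y : B) :
    HArr.tensor (HArr.id (K := K) X) (HArr.id (K := K) Y) = HArr.id ⟨X, Y⟩ :=
  HArr.mk_congr (zero_add _) rfl

lemma LinRel.tensor_left {c : K} {a a' a'' : HArr K A} (h : LinRel c a a' a'') (b : HArr K B) :
    LinRel c (a.tensor b) (a'.tensor b) (a''.tensor b) := by
  obtain ⟨s, t, p, g, hg⟩ := b
  cases h with
  | mk X Y e f f' hf hf' =>
  have := LinRel.mk (K := K) (C := SuperTensor K A B) (c := c) ⟨X, s⟩ ⟨Y, t⟩ (e + p)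
    (f ⊗ₜ[K] g) (f' ⊗ₜ[K] g)
    (Submodule.subset_span ⟨e, p, f, g, hf, hg, rfl, rfl⟩)
    (Submodule.subset_span ⟨e, p, f', g, hf', hg, rfl, rfl⟩)
  convert this using 1
  · rfl
  · rfl
  · exact HArr.mk_congr rfl (TensorProduct.add_tmul (c • f) f' g)

lemma LinRel.tensor_right {c : K} {b b' b'' : HArr K B} (h : LinRel c b b' b'') (a : HArr K A) :
    LinRel c (a.tensor b) (a.tensor b') (a.tensor b'') := by
  obtain ⟨s, t, p, g, hg⟩ := a
  cases h with
  | mk X Y e f f' hf hf' =>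
  have := LinRel.mk (K := K) (C := SuperTensor K A B) (c := c) ⟨s, X⟩ ⟨t, Y⟩ (p + e)
    (g ⊗ₜ[K] f) (g ⊗ₜ[K] f')
    (Submodule.subset_span ⟨p, e, g, f, hg, hf, rfl, rfl⟩)
    (Submodule.subset_span ⟨p, e, g, f', hg, hf', rfl, rfl⟩)
  convert this using 1
  · rfl
  · rfl
  · refine HArr.mk_congr rfl ?_
    have e : g ⊗ₜ[K] (c • f + f') = c • (g ⊗ₜ[K] f) + g ⊗ₜ[K] f' := by
      rw [TensorProduct.tmul_add, TensorProduct.tmul_smul]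
    exact e

/-- The permutation `σ` (which maps the letter `m` to its position) is a `(p, q)`-shuffle: it is
increasing on the first `p` letters and on the last `q` letters. -/
def IsShuffle (p q : ℕ) (σ : Equiv.Perm (Fin (p + q))) : Prop :=
  (∀ i i' : Fin p, i < i' → σ (Fin.castAdd q i) < σ (Fin.castAdd q i')) ∧
  (∀ j j' : Fin q, j < j' → σ (Fin.natAdd p j) < σ (Fin.natAdd p j'))

/-- The entry of the shuffle of `(a 0, …, a p)` and `(b 0, …, b q)` that comes from the letter `m`
when this letter has position `k`. The first `p` letters stand for `a 1 ⊗ 1, …, a p ⊗ 1` and the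
last `q` letters for `1 ⊗ b 1, …, 1 ⊗ b q`. If the letter `m` of a shuffle stands for an entry of
`a` then `k - m` letters standing for entries of `b` precede it, and conversely, which determines
the objects whose identities have to be inserted. -/
def shEntry (p q : ℕ) (a : ℕ → HArr K A) (b : ℕ → HArr K B) (k : ℕ) (m : Fin (p + q)) :
    HArr K (SuperTensor K A B) :=
  Fin.addCases (motive := fun _ => HArr K (SuperTensor K A B))
    (fun i : Fin p => (a (i + 1)).tensor (HArr.id (b (k - i)).tgt))
    (fun j : Fin q => (HArr.id (a (k - j)).tgt).tensor (b (j + 1))) m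

/-- The shuffle of the sequences `(a 0, …, a p)` and `(b 0, …, b q)` by `σ`: it starts with
`a 0 ⊗ b 0`, followed by the entries of the letters in the order given by `σ`. -/
def shSeq (p q : ℕ) (σ : Equiv.Perm (Fin (p + q))) (a : ℕ → HArr K A) (b : ℕ → HArr K B) :
    ℕ → HArr K (SuperTensor K A B) := fun l =>
  if h : 1 ≤ l ∧ l ≤ p + q then shEntry p q a b (l - 1) (σ.symm ⟨l - 1, by omega⟩)
  else (a 0).tensor (b 0)

/-- The Koszul sign exponent of a shuffle: the sum of `|a i| |b j|` over all pairs such that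
`b j` is moved past `a i`, `1 ≤ i`. -/
def shSign (p q : ℕ) (σ : Equiv.Perm (Fin (p + q))) (a : ℕ → HArr K A) (b : ℕ → HArr K B) :
    ZMod 2 :=
  ∑ i : Fin p, ((a (i + 1)).par * (b 0).par +
    ∑ j : Fin q, if σ (Fin.natAdd p j) < σ (Fin.castAdd q i)
      then (a (i + 1)).par * (b (j + 1)).par else 0)

lemma shSeq_castAdd (p q : ℕ) (σ : Equiv.Perm (Fin (p + q))) (a : ℕ → HArr K A) (b : ℕ → HArr K B)
    (i : Fin p) : shSeq p q σ a b (σ (Fin.castAdd q i) + 1) =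
      (a (i + 1)).tensor (HArr.id (b (σ (Fin.castAdd q i) - i)).tgt) := by
  have hlt := (σ (Fin.castAdd q i)).2
  rw [shSeq, dif_pos ⟨by omega, by omega⟩]
  simp [shEntry]

lemma shSeq_natAdd (p q : ℕ) (σ : Equiv.Perm (Fin (p + q))) (a : ℕ → HArr K A) (b : ℕ → HArr K B)
    (j : Fin q) : shSeq p q σ a b (σ (Fin.natAdd p j) + 1) =
      (HArr.id (a (σ (Fin.natAdd p j) - j)).tgt).tensor (b (j + 1)) := by
  have hlt := (σ (Fin.natAdd p j)).2
  rw [shSeq, dif_pos ⟨by omega, by omega⟩]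
  simp [shEntry]

lemma shSeq_zero (p q : ℕ) (σ : Equiv.Perm (Fin (p + q))) (a : ℕ → HArr K A) (b : ℕ → HArr K B) :
    shSeq p q σ a b 0 = (a 0).tensor (b 0) := by
  rw [shSeq, dif_neg (by omega)]

/-- A position in the shuffled sequence is zero or the position of a letter. -/
lemma position_cases {p q : ℕ} (σ : Equiv.Perm (Fin (p + q))) (l : ℕ) (hl : l ≤ p + q) :
    l = 0 ∨ (∃ i : Fin p, l = σ (Fin.castAdd q i) + 1) ∨
      ∃ j : Fin q, l = σ (Fin.natAdd p j) + 1 := by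
  rcases Nat.eq_zero_or_pos l with h | h
  · exact Or.inl h
  · right
    obtain ⟨m, hm⟩ := σ.surjective ⟨l - 1, by omega⟩
    have hm' : l = (σ m : ℕ) + 1 := by rw [hm]; simp only; omega
    induction m using Fin.addCases with
    | left i => exact Or.inl ⟨i, hm'⟩
    | right j => exact Or.inr ⟨j, hm'⟩

lemma tgt_of_linRel {c : K} {F F' F'' : ℕ → HArr K A} {k n : ℕ}
    (h1 : ∀ j, j ≤ n → j ≠ k → F'' j = F j ∧ F' j = F j) (h2 : LinRel c (F k) (F' k) (F'' k))
    (j : ℕ) (hj : j ≤ n) : (F'' j).tgt = (F j).tgt ∧ (F' j).tgt = (F j).tgt := by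
  by_cases e : j = k
  · subst e; exact ⟨h2.props.2.2.1, h2.props.1.2.1⟩
  · rw [(h1 j hj e).1, (h1 j hj e).2]; exact ⟨rfl, rfl⟩

lemma shSign_congr {p q : ℕ} {σ : Equiv.Perm (Fin (p + q))} {a a' : ℕ → HArr K A}
    {b b' : ℕ → HArr K B} (ha : ∀ j, j ≤ p → (a' j).par = (a j).par)
    (hb : ∀ j, j ≤ q → (b' j).par = (b j).par) : shSign p q σ a' b' = shSign p q σ a b := by
  unfold shSign
  refine Finset.sum_congr rfl fun i _ => ?_
  rw [ha (i + 1) (by omega), hb 0 (by omega)]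
  congr 1
  refine Finset.sum_congr rfl fun j _ => ?_
  rw [hb (j + 1) (by omega)]

lemma mono_bound {p N : ℕ} (f : Fin p → ℕ) (hf : ∀ i i', i < i' → f i < f i')
    (hN : ∀ i, f i < N) (i : Fin p) : f i + p ≤ N + i := by
  have h : ∀ (d : ℕ) (i i' : Fin p), (i' : ℕ) = i + d → f i + d ≤ f i' := by
    intro d
    induction d with
    | zero =>
      intro i i' h
      rw [show i' = i from Fin.ext h]; omega
    | succ d ih =>
      intro i i' h
      have h1 := ih i ⟨i + d, by have := i'.2; omega⟩ rfl
      have h2 := hf ⟨i + d, by have := i'.2; omega⟩ i' (Fin.lt_def.2 (by dsimp only; omega))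
      omega
  have hp := i.2
  have e : p - 1 < p := by omega
  have h1 := h (p - 1 - i) i ⟨p - 1, e⟩ (by dsimp only; omega)
  have h2 := hN ⟨p - 1, e⟩
  omega

lemma IsShuffle.bound_left {p q : ℕ} {σ : Equiv.Perm (Fin (p + q))} (h : IsShuffle p q σ)
    (i : Fin p) : (σ (Fin.castAdd q i) : ℕ) - i ≤ q := by
  have : (σ (Fin.castAdd q i) : ℕ) + p ≤ p + q + i :=
    mono_bound (fun i : Fin p => (σ (Fin.castAdd q i) : ℕ)) (fun i i' e => h.1 i i' e)
    (N := p + q) (fun i => (σ (Fin.castAdd q i)).2) i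
  omega

lemma IsShuffle.bound_right {p q : ℕ} {σ : Equiv.Perm (Fin (p + q))} (h : IsShuffle p q σ)
    (j : Fin q) : (σ (Fin.natAdd p j) : ℕ) - j ≤ p := by
  have : (σ (Fin.natAdd p j) : ℕ) + q ≤ p + q + j :=
    mono_bound (fun j : Fin q => (σ (Fin.natAdd p j) : ℕ)) (fun i i' e => h.2 i i' e)
    (N := p + q) (fun i => (σ (Fin.natAdd p i)).2) j
  omega

lemma shuffle_multi_right (n p q : ℕ) (hn : p + q = n) (σ : Equiv.Perm (Fin (p + q)))
    (hσ : IsShuffle p q σ) (a : ℕ → HArr K A) : IsMulti q (fun b : ℕ → HArr K B =>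
      ksgn K (shSign p q σ a b) • cls n (shSeq p q σ a b)) := by
  subst hn
  refine isMulti_cls _ _ ?_ ?_
  · intro F F' h
    exact shSign_congr (fun _ _ => rfl) h
  · intro c F F' F'' k hk h1 h2 hc
    have ht := tgt_of_linRel h1 h2
    have other : ∀ l, l ≤ p + q → (k = 0 → l ≠ 0) →
        (∀ j : Fin q, k = j + 1 → l ≠ σ (Fin.natAdd p j) + 1) →
        shSeq p q σ a F'' l = shSeq p q σ a F l ∧ shSeq p q σ a F' l = shSeq p q σ a F l := by
      intro l hl h0 hj
      rcases position_cases σ l hl with rfl | ⟨i, rfl⟩ | ⟨j, rfl⟩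
      · simp only [shSeq_zero]
        rw [(h1 0 (by omega) (fun e => h0 e.symm rfl)).1,
          (h1 0 (by omega) (fun e => h0 e.symm rfl)).2]
        exact ⟨rfl, rfl⟩
      · simp only [shSeq_castAdd]
        rw [(ht _ (hσ.bound_left i)).1, (ht _ (hσ.bound_left i)).2]
        exact ⟨rfl, rfl⟩
      · simp only [shSeq_natAdd]
        rw [(h1 (j + 1) (by omega) (fun e => hj j e.symm rfl)).1,
          (h1 (j + 1) (by omega) (fun e => hj j e.symm rfl)).2]
        exact ⟨rfl, rfl⟩
    rcases Nat.eq_zero_or_pos k with rfl | hpos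
    · refine ⟨0, by omega, fun l hl hne => other l hl (fun _ => hne) (fun j e => by omega), ?_⟩
      simp only [shSeq_zero]
      exact h2.tensor_right _
    · obtain ⟨j, rfl⟩ : ∃ j : Fin q, k = j + 1 := ⟨⟨k - 1, by omega⟩, by simp only; omega⟩
      have hlt := (σ (Fin.natAdd p j)).2
      refine ⟨σ (Fin.natAdd p j) + 1, by omega, fun l hl hne => other l hl (fun e => by omega)
        (fun j' e => ?_), ?_⟩
      · rwa [show j' = j from Fin.ext (by omega)]
      · simp only [shSeq_natAdd]
        exact h2.tensor_right _

lemma shuffle_multi_left (n p q : ℕ) (hn : p + q = n) (σ : Equiv.Perm (Fin (p + q)))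
    (hσ : IsShuffle p q σ) (b : ℕ → HArr K B) : IsMulti p (fun a : ℕ → HArr K A =>
      ksgn K (shSign p q σ a b) • cls n (shSeq p q σ a b)) := by
  subst hn
  refine isMulti_cls _ _ ?_ ?_
  · intro F F' h
    exact shSign_congr h (fun _ _ => rfl)
  · intro c F F' F'' k hk h1 h2 hc
    have ht := tgt_of_linRel h1 h2
    have other : ∀ l, l ≤ p + q → (k = 0 → l ≠ 0) →
        (∀ i : Fin p, k = i + 1 → l ≠ σ (Fin.castAdd q i) + 1) →
        shSeq p q σ F'' b l = shSeq p q σ F b l ∧ shSeq p q σ F' b l = shSeq p q σ F b l := by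
      intro l hl h0 hj
      rcases position_cases σ l hl with rfl | ⟨i, rfl⟩ | ⟨j, rfl⟩
      · simp only [shSeq_zero]
        rw [(h1 0 (by omega) (fun e => h0 e.symm rfl)).1,
          (h1 0 (by omega) (fun e => h0 e.symm rfl)).2]
        exact ⟨rfl, rfl⟩
      · simp only [shSeq_castAdd]
        rw [(h1 (i + 1) (by omega) (fun e => hj i e.symm rfl)).1,
          (h1 (i + 1) (by omega) (fun e => hj i e.symm rfl)).2]
        exact ⟨rfl, rfl⟩
      · simp only [shSeq_natAdd]
        rw [(ht _ (hσ.bound_right j)).1, (ht _ (hσ.bound_right j)).2]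
        exact ⟨rfl, rfl⟩
    rcases Nat.eq_zero_or_pos k with rfl | hpos
    · refine ⟨0, by omega, fun l hl hne => other l hl (fun _ => hne) (fun j e => by omega), ?_⟩
      simp only [shSeq_zero]
      exact h2.tensor_left _
    · obtain ⟨i, rfl⟩ : ∃ i : Fin p, k = i + 1 := ⟨⟨k - 1, by omega⟩, by simp only; omega⟩
      have hlt := (σ (Fin.castAdd q i)).2
      refine ⟨σ (Fin.castAdd q i) + 1, by omega, fun l hl hne => other l hl (fun e => by omega)
        (fun j' e => ?_), ?_⟩
      · rwa [show j' = i from Fin.ext (by omega)]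
      · simp only [shSeq_castAdd]
        exact h2.tensor_left _

lemma shuffle_multi (n p q : ℕ) (hn : p + q = n) (σ : Equiv.Perm (Fin (p + q)))
    (hσ : IsShuffle p q σ) :
    IsMulti p (fun a : ℕ → HArr K A => (lift q (fun b : ℕ → HArr K B =>
      ksgn K (shSign p q σ a b) • cls n (shSeq p q σ a b))
      (shuffle_multi_right n p q hn σ hσ a) : NChain K B q →ₗ[K] _)) := by
  intro c F F' F'' k hk h1 h2 hc
  refine chain_ext fun b hb => ?_
  rw [LinearMap.add_apply, LinearMap.smul_apply, lift_cls _ hb, lift_cls _ hb, lift_cls _ hb]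
  exact shuffle_multi_left n p q hn σ hσ b c F F' F'' k hk h1 h2 hc

/-- The `σ`-term of the shuffle product, without the sign of the permutation. -/
def shTerm (n p q : ℕ) (hn : p + q = n) (σ : Equiv.Perm (Fin (p + q))) (hσ : IsShuffle p q σ) :
    NChain K A p →ₗ[K] NChain K B q →ₗ[K] NChain K (SuperTensor K A B) n :=
  lift p (fun a => lift q (fun b => ksgn K (shSign p q σ a b) • cls n (shSeq p q σ a b))
    (shuffle_multi_right n p q hn σ hσ a)) (shuffle_multi n p q hn σ hσ)

lemma shTerm_cls {n p q : ℕ} (hn : p + q = n) (σ : Equiv.Perm (Fin (p + q)))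
    (hσ : IsShuffle p q σ) {a : ℕ → HArr K A} {b : ℕ → HArr K B} (ha : IsCycle p a)
    (hb : IsCycle q b) : shTerm n p q hn σ hσ (cls p a) (cls q b) =
      ksgn K (shSign p q σ a b) • cls n (shSeq p q σ a b) := by
  rw [shTerm, lift_cls _ ha, lift_cls _ hb]

open Classical in
/-- The shuffle product `sh (x ⊗ y)` of unnormalized chains, with `x` of degree `p` and `y` of
degree `q`, as a chain of degree `n = p + q`. -/
def sh (n p q : ℕ) (hn : p + q = n) :
    NChain K A p →ₗ[K] NChain K B q →ₗ[K] NChain K (SuperTensor K A B) n :=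
  ∑ σ : {σ : Equiv.Perm (Fin (p + q)) // IsShuffle p q σ},
    ((Equiv.Perm.sign σ.1 : ℤ) : K) • shTerm n p q hn σ.1 σ.2

open Classical in
/-- The cyclic shuffle product
`csh (x ⊗ y) = (-1)^p ∑ ± (1, σ (a₀, …, aₚ, b₀, …, b_q))` of unnormalized chains, with `x` of degree
`p` and `y` of degree `q`, as a chain of degree `n = p + q + 2`. The sum is over all ways of first
permuting `(a₀, …, aₚ)` and `(b₀, …, b_q)` cyclically and then shuffling the results such that `a₀`
precedes `b₀`. -/
def csh (n p q : ℕ) (hn : p + q + 2 = n) :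
    NChain K A p →ₗ[K] NChain K B q →ₗ[K] NChain K (SuperTensor K A B) n :=
  (-1 : K) ^ p • ∑ i : Fin (p + 1), ∑ j : Fin (q + 1),
    ∑ σ : {σ : Equiv.Perm (Fin ((p + 1) + (q + 1))) // IsShuffle (p + 1) (q + 1) σ ∧
        σ (Fin.castAdd (q + 1) i) < σ (Fin.natAdd (p + 1) j)},
      ((Equiv.Perm.sign σ.1 : ℤ) : K) •
        (shTerm n (p + 1) (q + 1) (by omega) σ.1 σ.2.1).compl₁₂
          (extra p ∘ₗ rot p ^ (i : ℕ)) (extra q ∘ₗ rot q ^ (j : ℕ))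

lemma shTerm_degen {n p q : ℕ} (hn : p + q = n) (σ : Equiv.Perm (Fin (p + q)))
    (hσ : IsShuffle p q σ) (x : NChain K A p) (y : NChain K B q)
    (h : x ∈ degen K A p ∨ y ∈ degen K B q) :
    shTerm n p q hn σ hσ x y ∈ degen K (SuperTensor K A B) n := by
  have key : ∀ (a : ℕ → HArr K A) (b : ℕ → HArr K B), IsCycle p a → IsCycle q b →
      ((∃ j, 1 ≤ j ∧ j ≤ p ∧ ∃ X, a j = HArr.id X) ∨ ∃ j, 1 ≤ j ∧ j ≤ q ∧ ∃ X, b j = HArr.id X) →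
      shTerm n p q hn σ hσ (cls p a) (cls q b) ∈ degen K (SuperTensor K A B) n := by
    intro a b ha hb h
    rw [shTerm_cls hn σ hσ ha hb]
    refine Submodule.smul_mem _ _ ?_
    by_cases hc : IsCycle n (shSeq p q σ a b)
    · rcases h with ⟨j, h1, h2, X, hX⟩ | ⟨j, h1, h2, X, hX⟩
      · obtain ⟨i, rfl⟩ : ∃ i : Fin p, j = i + 1 := ⟨⟨j - 1, by omega⟩, by simp only; omega⟩
        have hlt := (σ (Fin.castAdd q i)).2
        refine cls_mem_degen hc (σ (Fin.castAdd q i) + 1) (by omega) (by omega)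
          (X := ⟨X, (b (σ (Fin.castAdd q i) - i)).tgt⟩) ?_
        rw [shSeq_castAdd, hX, HArr.tensor_id]
      · obtain ⟨i, rfl⟩ : ∃ i : Fin q, j = i + 1 := ⟨⟨j - 1, by omega⟩, by simp only; omega⟩
        have hlt := (σ (Fin.natAdd p i)).2
        refine cls_mem_degen hc (σ (Fin.natAdd p i) + 1) (by omega) (by omega)
          (X := ⟨(a (σ (Fin.natAdd p i) - i)).tgt, X⟩) ?_
        rw [shSeq_natAdd, hX, HArr.tensor_id]
    · rw [cls_not hc]; exact Submodule.zero_mem _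
  rcases h with h | h
  · suffices e : (degen K (SuperTensor K A B) n).mkQ ∘ₗ shTerm n p q hn σ hσ x = 0 by
      have := LinearMap.congr_fun e y
      simpa using this
    refine chain_ext fun b hb => ?_
    simp only [LinearMap.comp_apply, LinearMap.zero_apply, Submodule.mkQ_apply,
      Submodule.Quotient.mk_eq_zero]
    induction h using Submodule.span_induction with
    | zero => simp
    | add x y _ _ hx hy => rw [map_add, LinearMap.add_apply]; exact Submodule.add_mem _ hx hy
    | smul c x _ hx => rw [map_smul, LinearMap.smul_apply]; exact Submodule.smul_mem _ _ hx
    | mem x hx =>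
      obtain ⟨a, ha, hj, rfl⟩ := hx
      exact key a b ha hb (Or.inl hj)
  · suffices e : (degen K (SuperTensor K A B) n).mkQ ∘ₗ (shTerm n p q hn σ hσ).flip y = 0 by
      have := LinearMap.congr_fun e x
      simpa using this
    refine chain_ext fun a ha => ?_
    simp only [LinearMap.comp_apply, LinearMap.zero_apply, Submodule.mkQ_apply,
      Submodule.Quotient.mk_eq_zero, LinearMap.flip_apply]
    induction h using Submodule.span_induction with
    | zero => simp
    | add x y _ _ hx hy => rw [map_add]; exact Submodule.add_mem _ hx hy
    | smul c x _ hx => rw [map_smul]; exact Submodule.smul_mem _ _ hx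
    | mem x hx =>
      obtain ⟨b, hb, hj, rfl⟩ := hx
      exact key a b ha hb (Or.inr hj)

lemma sh_degen {n p q : ℕ} (hn : p + q = n) (x : NChain K A p) (y : NChain K B q)
    (h : x ∈ degen K A p ∨ y ∈ degen K B q) :
    sh n p q hn x y ∈ degen K (SuperTensor K A B) n := by
  rw [sh, LinearMap.sum_apply, LinearMap.sum_apply]
  refine Submodule.sum_mem _ fun σ _ => ?_
  rw [LinearMap.smul_apply, LinearMap.smul_apply]
  exact Submodule.smul_mem _ _ (shTerm_degen hn σ.1 σ.2 x y h)

lemma csh_degen {n p q : ℕ} (hn : p + q + 2 = n) (x : NChain K A p) (y : NChain K B q)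
    (h : x ∈ degen K A p ∨ y ∈ degen K B q) :
    csh n p q hn x y ∈ degen K (SuperTensor K A B) n := by
  rw [csh, LinearMap.smul_apply, LinearMap.smul_apply]
  refine Submodule.smul_mem _ _ ?_
  rw [LinearMap.sum_apply, LinearMap.sum_apply]
  refine Submodule.sum_mem _ fun i _ => ?_
  rw [LinearMap.sum_apply, LinearMap.sum_apply]
  refine Submodule.sum_mem _ fun j _ => ?_
  rw [LinearMap.sum_apply, LinearMap.sum_apply]
  refine Submodule.sum_mem _ fun σ _ => ?_
  rw [LinearMap.smul_apply, LinearMap.smul_apply]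
  refine Submodule.smul_mem _ _ (shTerm_degen (by omega) σ.1 σ.2.1 _ _ ?_)
  exact h.imp (fun h => extra_weakDegen p (rot_pow_weakDegen p i (degen_le p h)))
    (fun h => extra_weakDegen q (rot_pow_weakDegen q j (degen_le q h)))

/-- The map on the tensor product of two quotients that is induced by a bilinear map. -/
def descend {M N P : Type*} [AddCommGroup M] [Module K M] [AddCommGroup N] [Module K N]
    [AddCommGroup P] [Module K P] (f : M →ₗ[K] N →ₗ[K] P) (M₀ : Submodule K M)
    (N₀ : Submodule K N) (P₀ : Submodule K P)
    (h : ∀ x y, x ∈ M₀ ∨ y ∈ N₀ → f x y ∈ P₀) : (M ⧸ M₀) ⊗[K] (N ⧸ N₀) →ₗ[K] P ⧸ P₀ :=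
  TensorProduct.lift <| M₀.liftQ
    { toFun := fun x => N₀.mapQ P₀ (f x) fun y hy => h x y (Or.inr hy)
      map_add' := fun x x' => by ext y; simp
      map_smul' := fun c x => by ext y; simp }
    fun x hx => by
      rw [LinearMap.mem_ker]
      ext y
      simpa using h x y (Or.inl hx)

lemma descend_tmul {M N P : Type*} [AddCommGroup M] [Module K M] [AddCommGroup N] [Module K N]
    [AddCommGroup P] [Module K P] (f : M →ₗ[K] N →ₗ[K] P) (M₀ : Submodule K M)
    (N₀ : Submodule K N) (P₀ : Submodule K P)
    (h : ∀ x y, x ∈ M₀ ∨ y ∈ N₀ → f x y ∈ P₀) (x : M) (y : N) :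
    descend f M₀ N₀ P₀ h (Submodule.Quotient.mk x ⊗ₜ Submodule.Quotient.mk y) =
      Submodule.Quotient.mk (f x y) := rfl

/-- The degree `n` part of the shuffle map `sh : N(A) ⊗ N(B) ⟶ N(A ⊗ B)` on normalized chains. -/
def shuffleMap (K : Type w) [Field K]
    (A : Type u) [Category.{v} A] [Preadditive A] [Linear K A] [SuperCategory K A]
    (B : Type u') [Category.{v'} B] [Preadditive B] [Linear K B] [SuperCategory K B] (n : ℕ) :
    ((normMixed K A).tensor (normMixed K B)).X n →ₗ[K] (normMixed K (SuperTensor K A B)).X n :=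
  ∑ p : Fin (n + 1), descend (sh n p (n - p) (by omega)) (degen K A p) (degen K B (n - p))
      (degen K (SuperTensor K A B) n) (sh_degen _) ∘ₗ
    tensorCoord (normMixed K A) (normMixed K B) p (n - p) (by omega)

/-- The degree `n` part of the cyclic shuffle map `csh : N(A) ⊗ N(B) ⟶ N(A ⊗ B)[2]` on normalized
chains. -/
def cyclicShuffleMap (K : Type w) [Field K]
    (A : Type u) [Category.{v} A] [Preadditive A] [Linear K A] [SuperCategory K A]
    (B : Type u') [Category.{v'} B] [Preadditive B] [Linear K B] [SuperCategory K B] (n : ℕ) :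
    ((normMixed K A).tensor (normMixed K B)).X n →ₗ[K]
      (normMixed K (SuperTensor K A B)).X (n + 2) :=
  ∑ p : Fin (n + 1), descend (csh (n + 2) p (n - p) (by omega)) (degen K A p) (degen K B (n - p))
      (degen K (SuperTensor K A B) (n + 2)) (csh_degen _) ∘ₗ
    tensorCoord (normMixed K A) (normMixed K B) p (n - p) (by omega)

/-- The degree `n` part of the map `Sh` of total complexes. -/
def totalShuffleMap (K : Type w) [Field K]
    (A : Type u) [Category.{v} A] [Preadditive A] [Linear K A] [SuperCategory K A]
    (B : Type u') [Category.{v'} B] [Preadditive B] [Linear K B] [SuperCategory K B] (n : ℕ) :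
    totX ((normMixed K A).tensor (normMixed K B)) n →ₗ[K]
      totX (normMixed K (SuperTensor K A B)) n :=
  totMatrix (shuffleMap K A B) (cyclicShuffleMap K A B) n

end Shuffle

end SuperCyclic

end

/-!
The proof reduces the identities between the shuffle maps and the operators `∂` and `B` to the
combinatorics of lattice paths, and the isomorphism to the Eilenberg-Zilber theorem together with
the five lemma.

*From chains to words.* An increasing map `φ : ℤ → ℤ` that is compatible with the translations by
`m + 1` and `n + 1` induces an operator `op n m φ : C_n ⟶ C_m`, which composes the morphisms of a
cyclic chain in blocks, with a Koszul sign. These operators are functorial (`op_op`), and the faces,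
`t` and `s` are among them, `t` up to the sign `(-1)^n`. Such a map is determined by its values on
`0, …, m`, that is, by a word of `m + 1` integers. Deleting a letter is taking a face (`face_opL`),
and a repeated letter gives a degenerate chain (`opL_mem_degen`). Moreover
`(a₀, …, aₙ) ⊗ (b₀, …, bₙ) ↦ ± (a₀ ⊗ b₀, …, aₙ ⊗ bₙ)` is an isomorphism
`C_n(A) ⊗ C_n(B) ≅ C_n(A ⊗ B)` (`zip`) that commutes with all operators. So a word of pairs of
integers assigns to `x` and `y` a chain of `A ⊗ B` (`grid`), and all signs that come from the
gradings have disappeared into `op` and `zip`.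

*The shuffle maps.* In these terms `sh (x ⊗ y)` is the signed sum of the lattice paths in a
rectangle (`sh_eq`), i.e. the triangulation of a product of two simplices, and `csh (x ⊗ y)` is a sum
over pairs of windows `-1 - i, …, p - i` and `-1 - j, …, q - j` of the lattice paths that reach the
column `0` before the row `0` (`csh_eq`). The boundary of the sum of all paths consists of the paths
in the faces of the rectangle (`wbd_paths`), so `sh` commutes with `∂` (`b_shuffleMap`). If the paths
avoid a quadrant, there are in addition the pairs of paths that meet at its corner
(`wbd_cpaths`). In the sum over all windows most of the faces telescope (`altSum_rotations`). There
remain the terms of `sh (B x ⊗ y)` and `sh (x ⊗ B y)`, those of `csh (∂x ⊗ y)` and `csh (x ⊗ ∂y)`,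
and the corner terms, which are the terms of `B (sh (x ⊗ y))` because cutting all paths of a
rectangle at all their vertices is the same as choosing a vertex and two paths (`cutSum_paths`).
This is `bdry_csh`, an identity of chains before normalization. On normalized chains also
`B csh = 0` and `csh B = 0`, since all the chains in question start with an identity. Together these
identities say that `Sh` commutes with `∂ + B` (`totD_totMatrix`).

*The isomorphism.* The Alexander-Whitney map is the sum over all cuts of a word of the front part in
the first and the back part in the second factor. It is a left inverse of `sh` on normalized chains
(`awNorm_shuffleMap`), and a homotopy between the other composite and the identity is constructed
on words by acyclic models, with the contraction that puts the first letter in front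
(`ezHomotopy`, `shuffleMap_awNorm`). Hence `sh` is an isomorphism on Hochschild homology. As `Sh` is
part of a morphism of the short exact sequences that define Connes' exact sequences, the maps `I`,
`S` and `B` are natural, and the five lemma shows by induction on the degree that `Sh` is an
isomorphism on cyclic homology (`isIso_homologyMap_tot`).
-/

noncomputable section

namespace SuperCyclic

/-! ### Words, alternating sums and lattice paths -/

section AlternatingSum

variable {V W M M' : Type*} [AddCommGroup M] [AddCommGroup M']

/-- The alternating sum `∑ (-1)^k f (l without its k-th entry)`. -/
def altSum : (List V → M) → List V → M
  | _, [] => 0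
  | f, x :: l => f l - altSum (fun w => f (x :: w)) l

@[simp] lemma altSum_nil (f : List V → M) : altSum f [] = 0 := rfl

lemma altSum_cons (f : List V → M) (x : V) (l : List V) :
    altSum f (x :: l) = f l - altSum (fun w => f (x :: w)) l := rfl

lemma altSum_eq_sum (f : List V → M) (l : List V) :
    altSum f l = ∑ k ∈ Finset.range l.length, (-1 : ℤ) ^ k • f (l.eraseIdx k) := by
  induction l generalizing f with
  | nil => simp
  | cons x l ih =>
    rw [altSum_cons, ih, List.length_cons, Finset.sum_range_succ']
    simp only [List.eraseIdx_cons_succ, List.eraseIdx_zero, List.tail_cons, pow_zero, one_smul,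
      pow_succ, mul_neg, mul_one, neg_smul, Finset.sum_neg_distrib]
    abel

lemma altSum_congr {f f' : List V → M} {l : List V}
    (h : ∀ k, k < l.length → f (l.eraseIdx k) = f' (l.eraseIdx k)) : altSum f l = altSum f' l := by
  rw [altSum_eq_sum, altSum_eq_sum]
  exact Finset.sum_congr rfl fun k hk => by rw [h k (Finset.mem_range.1 hk)]

lemma altSum_congr_length {f f' : List V → M} {l : List V}
    (h : ∀ w : List V, w.length + 1 = l.length → f w = f' w) : altSum f l = altSum f' l :=
  altSum_congr fun k hk => h _ (by rw [List.length_eraseIdx_of_lt hk]; omega)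

lemma altSum_map_hom (g : M →+ M') (f : List V → M) (l : List V) :
    g (altSum f l) = altSum (fun w => g (f w)) l := by
  rw [altSum_eq_sum, altSum_eq_sum, map_sum]
  exact Finset.sum_congr rfl fun k _ => map_zsmul _ _ _

lemma altSum_add (f f' : List V → M) (l : List V) :
    altSum (fun w => f w + f' w) l = altSum f l + altSum f' l := by
  simp only [altSum_eq_sum, smul_add, Finset.sum_add_distrib]

lemma altSum_sub (f f' : List V → M) (l : List V) :
    altSum (fun w => f w - f' w) l = altSum f l - altSum f' l := by
  simp only [altSum_eq_sum, smul_sub, Finset.sum_sub_distrib]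

lemma altSum_neg (f : List V → M) (l : List V) :
    altSum (fun w => -f w) l = -altSum f l := by
  simp only [altSum_eq_sum, smul_neg, Finset.sum_neg_distrib]

lemma altSum_smul {R : Type*} [Ring R] [Module R M] (c : R) (f : List V → M) (l : List V) :
    altSum (fun w => c • f w) l = c • altSum f l :=
  (altSum_map_hom (DistribSMul.toAddMonoidHom M c) f l).symm

@[simp] lemma altSum_zero (l : List V) : altSum (fun _ => (0 : M)) l = 0 := by
  simp [altSum_eq_sum]

/-- A boundary of a boundary vanishes, for the functions `altSum f` of words. -/
lemma altSum_altSum (f : List V → M) (l : List V) : altSum (fun w => altSum f w) l = 0 := by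
  induction l generalizing f with
  | nil => rfl
  | cons x l ih =>
    rw [altSum_cons]
    simp only [altSum_cons f]
    rw [altSum_sub, ih]
    simp

/-- The faces of a word that is cut in two are the faces of its two parts. -/
lemma altSum_append (f : List V → M) (u v : List V) :
    altSum f (u ++ v) = altSum (fun w => f (w ++ v)) u +
      (-1 : ℤ) ^ u.length • altSum (fun w => f (u ++ w)) v := by
  induction u generalizing f with
  | nil => simp
  | cons x u ih =>
    rw [List.cons_append, altSum_cons, altSum_cons, ih, List.length_cons, pow_succ]
    simp only [List.cons_append, mul_neg, mul_one, neg_smul]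
    abel

lemma altSum_map (f : List W → M) (g : V → W) (l : List V) :
    altSum f (l.map g) = altSum (fun w => f (w.map g)) l := by
  induction l generalizing f with
  | nil => rfl
  | cons x l ih => rw [List.map_cons, altSum_cons, altSum_cons, ih]; rfl

end AlternatingSum

section Words

variable {K : Type*} [CommRing K] {V W : Type*}

variable (K V) in
/-- Formal linear combinations of words in the alphabet `V`. -/
abbrev Words := List V →₀ K

variable (K) in
/-- A word, as a formal linear combination of words. -/
def wd (l : List V) : Words K V := Finsupp.single l 1

/-- The linear map on `Words K V` with prescribed values on words. -/
def wlift {M : Type*} [AddCommGroup M] [Module K M] (f : List V → M) : Words K V →ₗ[K] M :=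
  Finsupp.linearCombination K f

@[simp] lemma wlift_wd {M : Type*} [AddCommGroup M] [Module K M] (f : List V → M) (l : List V) :
    wlift f (wd K l) = f l := by simp [wlift, wd]

lemma words_ext {M : Type*} [AddCommGroup M] [Module K M] {f f' : Words K V →ₗ[K] M}
    (h : ∀ l, f (wd K l) = f' (wd K l)) : f = f' :=
  Finsupp.lhom_ext' fun l => LinearMap.ext_ring (h l)

/-- Adding a letter in front of a word. -/
def pre (x : V) : Words K V →ₗ[K] Words K V := wlift fun l => wd K (x :: l)

@[simp] lemma pre_wd (x : V) (l : List V) : pre x (wd K l) = wd K (x :: l) := wlift_wd _ _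

/-- Concatenation of words. -/
def cat : Words K V →ₗ[K] Words K V →ₗ[K] Words K V := wlift fun l => wlift fun l' => wd K (l ++ l')

@[simp] lemma cat_wd (l l' : List V) : cat (wd K l) (wd K l') = wd K (l ++ l') := by simp [cat]

lemma cat_pre (x : V) (z z' : Words K V) : cat (pre x z) z' = pre x (cat z z') := by
  suffices h : (cat ∘ₗ pre x : Words K V →ₗ[K] _) = (cat (K := K) (V := V)).compr₂ (pre x) from
    LinearMap.congr_fun (LinearMap.congr_fun h z) z'
  exact words_ext fun l => words_ext fun l' => by simp

@[simp] lemma cat_nil (z : Words K V) : cat (wd K []) z = z := by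
  suffices h : (cat (wd K []) : Words K V →ₗ[K] _) = LinearMap.id from LinearMap.congr_fun h z
  exact words_ext fun l => by simp

/-- The boundary of a word: the alternating sum of the words obtained by deleting a letter. -/
def wbd : Words K V →ₗ[K] Words K V := wlift fun l => altSum (wd K) l

@[simp] lemma wbd_wd (l : List V) : wbd (wd K l) = altSum (wd K) l := wlift_wd _ _

lemma wlift_altSum {M : Type*} [AddCommGroup M] [Module K M] (f : List V → M) (l : List V) :
    wlift f (altSum (wd K) l) = altSum f l := by
  have := altSum_map_hom (wlift (K := K) f).toAddMonoidHom (wd K) l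
  simpa using this

lemma altSum_lin {M M' : Type*} [AddCommGroup M] [Module K M] [AddCommGroup M'] [Module K M']
    (g : M →ₗ[K] M') (f : List V → M) (l : List V) :
    altSum (fun w => g (f w)) l = g (altSum f l) :=
  (altSum_map_hom g.toAddMonoidHom f l).symm

/-- Adding a letter in front is a contraction of the complex of words. -/
lemma wbd_pre (x : V) (z : Words K V) : wbd (pre x z) = z - pre x (wbd z) := by
  suffices h : (wbd ∘ₗ pre x : Words K V →ₗ[K] _) = LinearMap.id - pre x ∘ₗ wbd from
    LinearMap.congr_fun h z
  refine words_ext fun l => ?_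
  simp only [LinearMap.comp_apply, pre_wd, wbd_wd, LinearMap.sub_apply, LinearMap.id_apply,
    altSum_cons, ← altSum_lin]

/-- Applying a map to all letters. -/
def wmap (f : V → W) : Words K V →ₗ[K] Words K W := wlift fun l => wd K (l.map f)

@[simp] lemma wmap_wd (f : V → W) (l : List V) : wmap f (wd K l) = wd K (l.map f) := wlift_wd _ _

lemma wmap_pre (f : V → W) (x : V) (z : Words K V) : wmap f (pre x z) = pre (f x) (wmap f z) := by
  suffices h : (wmap f ∘ₗ pre x : Words K V →ₗ[K] _) = pre (f x) ∘ₗ wmap f from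
    LinearMap.congr_fun h z
  exact words_ext fun l => by simp

end Words

section Paths

variable (K : Type*) [CommRing K] {V W : Type*}

/-- The signed sum of the lattice paths in the grid with columns `u` and rows `v`, from the first
to the last vertex, as words of vertices. This is the triangulation of the product of the simplices
with vertices `u` and `v`. -/
def paths : List V → List W → Words K (V × W)
  | [], _ => 0
  | _, [] => 0
  | [a], [b] => wd K [(a, b)]
  | a :: a' :: u, [b] => pre (a, b) (paths (a' :: u) [b])
  | [a], b :: b' :: v => pre (a, b) (paths [a] (b' :: v))
  | a :: a' :: u, b :: b' :: v => pre (a, b) (paths (a' :: u) (b :: b' :: v)) +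
      (-1 : K) ^ (u.length + 1) • pre (a, b) (paths (a :: a' :: u) (b' :: v))
termination_by u v => u.length + v.length

@[simp] lemma paths_nil_left (v : List W) : paths K ([] : List V) v = 0 := by
  rw [paths]

@[simp] lemma paths_nil_right (u : List V) : paths K u ([] : List W) = 0 := by
  cases u <;> simp [paths]

open Classical in
/-- The empty word if both lists are empty, otherwise zero. -/
def unitIf (u : List V) (v : List W) : Words K (V × W) := if u = [] ∧ v = [] then wd K [] else 0

/-- The first step of a path goes to the next column or to the next row; `unitIf` stands for the
path that consists of a single vertex. -/
lemma paths_cons (a : V) (u : List V) (b : W) (v : List W) :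
    paths K (a :: u) (b :: v) = pre (a, b) (unitIf K u v + paths K u (b :: v) +
      (-1 : K) ^ u.length • paths K (a :: u) v) := by
  cases u <;> cases v <;> simp [paths, unitIf]

lemma unitIf_altSum_left (u : List V) (v : List W) :
    altSum (fun w => unitIf K w v) u = if u.length = 1 ∧ v = [] then wd K [] else 0 := by
  classical
  rcases u with _ | ⟨a, _ | ⟨a', u⟩⟩
  · simp
  · simp [altSum_cons, unitIf]
  · simp only [altSum_cons, unitIf]
    simp

lemma unitIf_altSum_right (u : List V) (v : List W) :
    altSum (fun w => unitIf K u w) v = if v.length = 1 ∧ u = [] then wd K [] else 0 := by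
  classical
  rcases v with _ | ⟨a, _ | ⟨a', v⟩⟩
  · simp
  · simp [altSum_cons, unitIf]
  · simp only [altSum_cons, unitIf]
    simp

/-- The boundary of the triangulated product is the triangulation of the boundary: deleting a corner
of a path gives a term that also arises from the path with the opposite corner, with the other sign.
What is left are the paths in the faces of the two factors, and for two points the empty word. -/
lemma wbd_paths (u : List V) (v : List W) :
    wbd (paths K u v) = altSum (fun w => paths K w v) u +
      (-1 : K) ^ (u.length + 1) • altSum (fun w => paths K u w) v +
      (if u.length = 1 ∧ v.length = 1 then wd K [] else 0) := by
  induction h : u.length + v.length using Nat.strong_induction_on generalizing u v with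
  | _ n ih =>
  subst h
  rcases u with _ | ⟨a, u⟩
  · simp
  rcases v with _ | ⟨b, v⟩
  · simp
  have h1 := ih _ (by simp) u (b :: v) rfl
  have h2 := ih _ (by simp) (a :: u) v rfl
  -- the faces of the two factors, with the first vertex of the path split off
  have e1 : altSum (fun w => paths K w (b :: v)) (a :: u) = paths K u (b :: v) -
      pre (a, b) (altSum (fun w => unitIf K w v) u + altSum (fun w => paths K w (b :: v)) u -
        (-1 : K) ^ u.length • altSum (fun w => paths K (a :: w) v) u) := by
    rw [altSum_cons]
    simp only [paths_cons, altSum_lin]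
    congr 2
    rw [altSum_add, altSum_add, sub_eq_add_neg]
    congr 1
    rw [← altSum_smul, ← altSum_neg]
    refine altSum_congr_length fun w hw => ?_
    rw [← hw, pow_succ, mul_neg_one, neg_smul, neg_neg]
  have e2 : altSum (fun w => paths K (a :: u) w) (b :: v) = paths K (a :: u) v -
      pre (a, b) (altSum (fun w => unitIf K u w) v + altSum (fun w => paths K u (b :: w)) v +
        (-1 : K) ^ u.length • altSum (fun w => paths K (a :: u) w) v) := by
    rw [altSum_cons]
    simp only [paths_cons, altSum_lin]
    congr 2
    rw [altSum_add, altSum_add, altSum_smul]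
  rw [altSum_cons (fun w => paths K u w)] at h1
  rw [altSum_cons (fun w => paths K w v)] at h2
  have h3 : wbd (unitIf K u v) = 0 := by unfold unitIf; split_ifs <;> simp
  rw [paths_cons, wbd_pre, map_add wbd, map_add wbd, map_smul, h1, h2, h3, e1, e2,
    unitIf_altSum_left, unitIf_altSum_right, unitIf]
  simp only [List.length_cons, Nat.add_eq_right, List.length_eq_zero_iff, and_comm (a := u = []),
    pow_succ, mul_neg, mul_one, neg_neg]
  rcases neg_one_pow_eq_or K u.length with h | h <;>
  simp only [h, one_smul, neg_smul, neg_neg, map_add, map_sub, map_neg, map_zero] <;> abel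

variable {K}

lemma unitIf_of_ne {u : List V} {v : List W} (h : u ≠ [] ∨ v ≠ []) : unitIf K u v = 0 := by
  unfold unitIf
  rw [if_neg (by tauto)]

/-- `IsPath u v l`: the word `l` is a lattice path from the first to the last vertex of the grid
with columns `u` and rows `v`. -/
inductive IsPath : List V → List W → List (V × W) → Prop
  | single (a : V) (b : W) : IsPath [a] [b] [(a, b)]
  | left {u : List V} {v : List W} {l : List (V × W)} (a : V) (b : W) (h : IsPath u (b :: v) l) :
      IsPath (a :: u) (b :: v) ((a, b) :: l)
  | right {u : List V} {v : List W} {l : List (V × W)} (a : V) (b : W) (h : IsPath (a :: u) v l) :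
      IsPath (a :: u) (b :: v) ((a, b) :: l)

lemma IsPath.length {u : List V} {v : List W} {l : List (V × W)} (h : IsPath u v l) :
    l.length + 1 = u.length + v.length := by
  induction h with
  | single a b => rfl
  | left a b h ih => simp only [List.length_cons] at *; omega
  | right a b h ih => simp only [List.length_cons] at *; omega

lemma wlift_unitIf {M : Type*} [AddCommGroup M] [Module K M] (f : List (V × W) → M)
    (u : List V) (v : List W) : wlift f (unitIf K u v) = if u = [] ∧ v = [] then f [] else 0 := by
  unfold unitIf
  split_ifs <;> simp

lemma wlift_pre {M : Type*} [AddCommGroup M] [Module K M] (f : List V → M) (x : V)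
    (z : Words K V) : wlift f (pre x z) = wlift (fun l => f (x :: l)) z := by
  suffices h : wlift f ∘ₗ pre x = wlift (K := K) (fun l => f (x :: l)) from LinearMap.congr_fun h z
  exact words_ext fun l => by simp

/-- Linear maps that agree on all paths agree on the sum of all paths. -/
lemma wlift_paths_congr {M : Type*} [AddCommGroup M] [Module K M] {f f' : List (V × W) → M}
    (u : List V) (v : List W) (h : ∀ l, IsPath u v l → f l = f' l) :
    wlift f (paths K u v) = wlift f' (paths K u v) := by
  induction hn : u.length + v.length using Nat.strong_induction_on generalizing u v f f' with
  | _ n ih =>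
  subst hn
  rcases u with _ | ⟨a, u⟩
  · simp
  rcases v with _ | ⟨b, v⟩
  · simp
  rw [paths_cons, wlift_pre, wlift_pre]
  simp only [map_add, map_smul, wlift_unitIf]
  rw [ih _ (by simp) u (b :: v) (fun l hl => h _ (hl.left a b)) rfl,
    ih _ (by simp) (a :: u) v (fun l hl => h _ (hl.right a b)) rfl]
  congr 2
  split_ifs with e
  · obtain ⟨rfl, rfl⟩ := e
    exact h _ (IsPath.single a b)
  · rfl

variable (K) in
/-- The signed sum of the lattice paths in the grid with columns `u ++ u'` and rows `v ++ v'` that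
avoid the vertices in `u × v'`, i.e. that reach the columns `u'` before the rows `v'`. -/
def cpaths : List V → List V → List W → List W → Words K (V × W)
  | [], u', v, v' => paths K u' (v ++ v')
  | _ :: _, _, [], _ => 0
  | a :: u, u', b :: v, v' => pre (a, b) (cpaths u u' (b :: v) v' +
      (-1 : K) ^ (u.length + u'.length) • cpaths (a :: u) u' v v')
termination_by u _ v _ => u.length + v.length

lemma cpaths_nil (u' : List V) (v v' : List W) : cpaths K [] u' v v' = paths K u' (v ++ v') := by
  rw [cpaths]

lemma cpaths_nil_right (u u' : List V) (v' : List W) :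
    cpaths K u u' [] v' = if u = [] then paths K u' v' else 0 := by
  cases u <;> simp [cpaths]

lemma cpaths_cons (a : V) (u u' : List V) (b : W) (v v' : List W) :
    cpaths K (a :: u) u' (b :: v) v' = pre (a, b) (cpaths K u u' (b :: v) v' +
      (-1 : K) ^ (u.length + u'.length) • cpaths K (a :: u) u' v v') := by
  rw [cpaths]

/-- There is no path that reaches the columns `u'` if `u'` is empty. -/
lemma cpaths_nil_left' (u : List V) (v v' : List W) : cpaths K u [] v v' = 0 := by
  induction hn : u.length + v.length using Nat.strong_induction_on generalizing u v with
  | _ n ih =>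
  subst hn
  rcases u with _ | ⟨a, u⟩
  · simp [cpaths_nil]
  rcases v with _ | ⟨b, v⟩
  · simp [cpaths_nil_right]
  rw [cpaths_cons, ih _ (by simp) u (b :: v) rfl, ih _ (by simp) (a :: u) v rfl]
  simp

/-- If there are no rows `v'`, there is nothing to avoid. -/
lemma cpaths_nil_right' (u u' : List V) (v : List W) (hu' : u' ≠ []) (hv : v ≠ []) :
    cpaths K u u' v [] = paths K (u ++ u') v := by
  induction hn : u.length + v.length using Nat.strong_induction_on generalizing u v with
  | _ n ih =>
  subst hn
  rcases u with _ | ⟨a, u⟩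
  · simp [cpaths_nil]
  rcases v with _ | ⟨b, v⟩
  · simp at hv
  rw [cpaths_cons, ih _ (by simp) u (b :: v) (by simp) rfl, List.cons_append, paths_cons,
    unitIf_of_ne (by simp [hu']), List.length_append, zero_add]
  rcases v with _ | ⟨b', v⟩
  · simp [cpaths_nil_right]
  · rw [ih _ (by simp) (a :: u) (b' :: v) (by simp) rfl, List.cons_append]

/-- The boundary of the sum of the lattice paths that avoid a corner: besides the paths in the faces
of the two simplices there is a sum over the paths that touch the corner diagonally. -/
lemma wbd_cpaths (u u' : List V) (v v' : List W) (hv : v ≠ []) (hv' : v' ≠ []) :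
    wbd (cpaths K u u' v v') = altSum (fun w => cpaths K w u' v v') u +
      (-1 : K) ^ u.length • altSum (fun w => cpaths K u w v v') u' +
      (-1 : K) ^ (u.length + u'.length + 1) • (altSum (fun w => cpaths K u u' w v') v +
        (-1 : K) ^ v.length • altSum (fun w => cpaths K u u' v w) v') +
      (-1 : K) ^ (u.length + v.length + u'.length * v.length) •
        cat (paths K u v) (paths K u' v') := by
  induction hn : u.length + v.length using Nat.strong_induction_on generalizing u v with
  | _ n ih =>
  subst hn
  rcases u with _ | ⟨a, u⟩
  -- without columns `u` this is the boundary of a sum of all paths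
  · simp only [cpaths_nil, altSum_nil, List.length_nil, pow_zero, one_smul, zero_add,
      paths_nil_left, map_zero, LinearMap.zero_apply, smul_zero, add_zero]
    rw [wbd_paths, altSum_append, if_neg, add_zero]
    · rw [← Int.cast_smul_eq_zsmul K]
      push_cast
      rfl
    · have := List.length_pos_iff.2 hv
      have := List.length_pos_iff.2 hv'
      rw [List.length_append]
      omega
  rcases v with _ | ⟨b, v⟩
  · simp at hv
  -- the second step of the recursion needs a nonempty `v`; the case `v = []` is treated at the end
  have h1 := ih _ (by simp) u (b :: v) (by simp) rfl
  have h2 : v ≠ [] → _ := fun h => ih _ (by simp) (a :: u) v h rfl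
  have e1 : altSum (fun w => cpaths K w u' (b :: v) v') (a :: u) = cpaths K u u' (b :: v) v' -
      pre (a, b) (altSum (fun w => cpaths K w u' (b :: v) v') u -
        (-1 : K) ^ (u.length + u'.length) • altSum (fun w => cpaths K (a :: w) u' v v') u) := by
    rw [altSum_cons]
    simp only [cpaths_cons, altSum_lin]
    congr 2
    rw [altSum_add, sub_eq_add_neg]
    congr 1
    rw [← altSum_smul, ← altSum_neg]
    refine altSum_congr_length fun w hw => ?_
    rw [← hw, Nat.add_right_comm, pow_succ, mul_neg_one, neg_smul, neg_neg]
  have e2 : altSum (fun w => cpaths K (a :: u) w (b :: v) v') u' =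
      pre (a, b) (altSum (fun w => cpaths K u w (b :: v) v') u' -
        (-1 : K) ^ (u.length + u'.length) • altSum (fun w => cpaths K (a :: u) w v v') u') := by
    simp only [cpaths_cons, altSum_lin]
    congr 1
    rw [altSum_add, sub_eq_add_neg]
    congr 1
    rw [← altSum_smul, ← altSum_neg]
    refine altSum_congr_length fun w hw => ?_
    rw [← hw, ← add_assoc, pow_succ, mul_neg_one, neg_smul, neg_neg]
  have e3 : altSum (fun w => cpaths K (a :: u) u' w v') (b :: v) = cpaths K (a :: u) u' v v' -
      pre (a, b) (altSum (fun w => cpaths K u u' (b :: w) v') v +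
        (-1 : K) ^ (u.length + u'.length) • altSum (fun w => cpaths K (a :: u) u' w v') v) := by
    rw [altSum_cons]
    simp only [cpaths_cons, altSum_lin]
    congr 2
    rw [altSum_add, altSum_smul]
  have e4 : altSum (fun w => cpaths K (a :: u) u' (b :: v) w) v' =
      pre (a, b) (altSum (fun w => cpaths K u u' (b :: v) w) v' +
        (-1 : K) ^ (u.length + u'.length) • altSum (fun w => cpaths K (a :: u) u' v w) v') := by
    simp only [cpaths_cons, altSum_lin]
    congr 1
    rw [altSum_add, altSum_smul]
  rw [altSum_cons (fun w => cpaths K u u' w v')] at h1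
  rw [altSum_cons (fun w => cpaths K w u' v v')] at h2
  rw [e1, e2, e3, e4, cpaths_cons, wbd_pre, paths_cons, cat_pre, map_add wbd, map_smul, h1]
  simp only [List.length_cons, pow_succ, pow_add, mul_add, mul_one, mul_neg,
    pow_mul] at h2 ⊢
  rcases v with _ | ⟨b', v⟩
  · simp only [cpaths_nil_right, List.length_nil, pow_zero, altSum_nil, reduceCtorEq, if_false,
      altSum_zero, unitIf, and_true, paths_nil_right]
    rcases u with _ | ⟨a', u⟩
    · rcases neg_one_pow_eq_or K u'.length with h | h <;>
      simp [h] <;> abel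
    · rcases neg_one_pow_eq_or K u'.length with h | h <;>
      rcases neg_one_pow_eq_or K u.length with h' | h' <;>
      simp [h, h', pow_succ] <;> abel
  · rw [h2 (by simp), unitIf_of_ne (by simp)]
    rcases neg_one_pow_eq_or K u'.length with h | h <;>
    rcases neg_one_pow_eq_or K u.length with h' | h' <;>
    rcases neg_one_pow_eq_or K (b' :: v).length with h'' | h'' <;>
    simp only [h, h', h'', one_pow, mul_one, mul_neg, neg_neg, map_add, map_sub, map_neg,
      one_smul, neg_smul, smul_add, smul_sub, smul_neg, LinearMap.add_apply,
      LinearMap.neg_apply, zero_add] <;>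
    abel

end Paths

/-! ### Cuts of words and the Eilenberg-Zilber homotopy on words -/

section PathTools

variable {K : Type*} [CommRing K] {V W : Type*}

lemma wmap_unitIf {V' W' : Type*} (f : V → V') (g : W → W') (u : List V) (v : List W) :
    wmap (Prod.map f g) (unitIf K u v) = unitIf K (u.map f) (v.map g) := by
  unfold unitIf
  simp only [List.map_eq_nil_iff]
  split_ifs <;> simp

lemma wmap_paths {V' W' : Type*} (f : V → V') (g : W → W') (u : List V) (v : List W) :
    wmap (Prod.map f g) (paths K u v) = paths K (u.map f) (v.map g) := by
  induction hn : u.length + v.length using Nat.strong_induction_on generalizing u v with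
  | _ n ih =>
  subst hn
  rcases u with _ | ⟨a, u⟩
  · simp
  rcases v with _ | ⟨b, v⟩
  · simp
  have h1 := ih _ (by simp) u (b :: v) rfl
  have h2 := ih _ (by simp) (a :: u) v rfl
  rw [paths_cons, wmap_pre, map_add (wmap _), map_add (wmap _), map_smul, h1, h2, List.map_cons, List.map_cons,
    paths_cons, List.length_map, wmap_unitIf]
  rfl

lemma wmap_cpaths {V' W' : Type*} (f : V → V') (g : W → W') (u u' : List V) (v v' : List W) :
    wmap (Prod.map f g) (cpaths K u u' v v') =
      cpaths K (u.map f) (u'.map f) (v.map g) (v'.map g) := by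
  induction hn : u.length + v.length using Nat.strong_induction_on generalizing u v with
  | _ n ih =>
  subst hn
  rcases u with _ | ⟨a, u⟩
  · simp [cpaths_nil, wmap_paths]
  rcases v with _ | ⟨b, v⟩
  · simp [cpaths_nil_right]
  have h1 := ih _ (by simp) u (b :: v) rfl
  have h2 := ih _ (by simp) (a :: u) v rfl
  rw [cpaths_cons, wmap_pre, map_add (wmap _), map_smul, h1, h2, List.map_cons, List.map_cons,
    cpaths_cons, List.length_map, List.length_map]
  rfl

lemma wlift_wmap {M : Type*} [AddCommGroup M] [Module K M] (f : List W → M) (g : V → W)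
    (z : Words K V) : wlift f (wmap g z) = wlift (fun l => f (l.map g)) z := by
  suffices h : wlift f ∘ₗ wmap g = wlift (K := K) (fun l => f (l.map g)) from
    LinearMap.congr_fun h z
  exact words_ext fun l => by simp

lemma lin_wlift {M M' : Type*} [AddCommGroup M] [Module K M] [AddCommGroup M'] [Module K M']
    (g : M →ₗ[K] M') (f : List V → M) (z : Words K V) :
    g (wlift f z) = wlift (fun l => g (f l)) z := by
  suffices h : g ∘ₗ wlift f = wlift (K := K) (fun l => g (f l)) from LinearMap.congr_fun h z
  exact words_ext fun l => by simp

lemma wlift_wbd {M : Type*} [AddCommGroup M] [Module K M] (f : List V → M) (z : Words K V) :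
    wlift f (wbd z) = wlift (altSum f) z := by
  suffices h : wlift f ∘ₗ wbd = wlift (K := K) (altSum f) from LinearMap.congr_fun h z
  exact words_ext fun l => by simp [wlift_altSum]

end PathTools

section Splittings

variable {K : Type*} [CommRing K] {V W M : Type*} [AddCommGroup M] [Module K M]

/-- The sum over all ways to cut a word at one of its letters; the letter belongs to both parts. -/
def cutSum : (List V → List V → M) → List V → M
  | _, [] => 0
  | g, x :: l => g [x] (x :: l) + cutSum (fun w w' => g (x :: w) w') l

@[simp] lemma cutSum_nil (g : List V → List V → M) : cutSum g [] = 0 := rfl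

lemma cutSum_cons (g : List V → List V → M) (x : V) (l : List V) :
    cutSum g (x :: l) = g [x] (x :: l) + cutSum (fun w w' => g (x :: w) w') l := rfl

lemma cutSum_congr {g g' : List V → List V → M} {l : List V}
    (h : ∀ w c w', w ++ c :: w' = l → g (w ++ [c]) (c :: w') = g' (w ++ [c]) (c :: w')) :
    cutSum g l = cutSum g' l := by
  induction l generalizing g g' with
  | nil => rfl
  | cons x l ih =>
    rw [cutSum_cons, cutSum_cons, ih (g' := fun w w' => g' (x :: w) w') fun w c w' e => by
      simpa using h (x :: w) c w' (by simp [e])]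
    congr 1
    exact h [] x l rfl

lemma cutSum_add (g g' : List V → List V → M) (l : List V) :
    cutSum (fun w w' => g w w' + g' w w') l = cutSum g l + cutSum g' l := by
  induction l generalizing g g' with
  | nil => simp
  | cons x l ih => rw [cutSum_cons, cutSum_cons, cutSum_cons, ih]; abel

lemma cutSum_lin {M' : Type*} [AddCommGroup M'] [Module K M'] (φ : M →ₗ[K] M')
    (g : List V → List V → M) (l : List V) :
    cutSum (fun w w' => φ (g w w')) l = φ (cutSum g l) := by
  induction l generalizing g with
  | nil => simp
  | cons x l ih => rw [cutSum_cons, cutSum_cons, map_add, ← ih]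

lemma cutSum_smul (c : K) (g : List V → List V → M) (l : List V) :
    cutSum (fun w w' => c • g w w') l = c • cutSum g l :=
  cutSum_lin (LinearMap.lsmul K M c) g l

lemma cutSum_zero (l : List V) : cutSum (fun _ _ => (0 : M)) l = 0 := by
  have := cutSum_smul (0 : ℤ) (fun _ _ : List V => (0 : M)) l
  simpa using this

lemma cutSum_eq_sum (g : List V → List V → M) (l : List V) :
    cutSum g l = ∑ k ∈ Finset.range l.length, g (l.take (k + 1)) (l.drop k) := by
  induction l generalizing g with
  | nil => simp
  | cons x l ih =>
    rw [cutSum_cons, ih, List.length_cons, Finset.sum_range_succ']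
    simp [add_comm (g _ _)]

/-- The sum over all cuts of a word of pairs, where the first components of the front part and the
second components of the back part are used. -/
def frontBack (f : List V → List W → M) (l : List (V × W)) : M :=
  cutSum (fun w w' => f (w.map Prod.fst) (w'.map Prod.snd)) l

@[simp] lemma frontBack_nil (f : List V → List W → M) : frontBack f [] = 0 := rfl

lemma frontBack_cons (f : List V → List W → M) (x : V × W) (l : List (V × W)) :
    frontBack f (x :: l) = f [x.1] (x.2 :: l.map Prod.snd) +
      frontBack (fun w w' => f (x.1 :: w) w') l := rfl

lemma frontBack_eq_sum (f : List V → List W → M) (l : List (V × W)) :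
    frontBack f l = ∑ k ∈ Finset.range l.length,
      f ((l.map Prod.fst).take (k + 1)) ((l.map Prod.snd).drop k) := by
  rw [frontBack, cutSum_eq_sum]
  simp [List.map_take, List.map_drop]

lemma frontBack_lin {M' : Type*} [AddCommGroup M'] [Module K M'] (φ : M →ₗ[K] M')
    (g : List V → List W → M) (l : List (V × W)) :
    frontBack (fun w w' => φ (g w w')) l = φ (frontBack g l) := cutSum_lin φ _ l

lemma frontBack_congr {f f' : List V → List W → M} {l : List (V × W)}
    (h : ∀ w w', w.length + w'.length = l.length + 1 → w ≠ [] → w' ≠ [] → f w w' = f' w w') :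
    frontBack f l = frontBack f' l := by
  refine cutSum_congr fun w c w' e => h _ _ ?_ (by simp) (by simp)
  rw [← e]
  simp only [List.map_append, List.length_append, List.length_map, List.length_cons,
    List.length_nil]
  omega

/-- The alternating sum of the cuts of the faces of a word, compared with the alternating sums of
the faces of the parts. -/
lemma frontBack_altSum (f : List V → List W → M) (l : List (V × W)) :
    frontBack (fun w w' => altSum (fun y => f y w') w +
      (-1 : ℤ) ^ (w.length + 1) • altSum (f w) w') l =
    altSum (frontBack f) l + f [] (l.map Prod.snd) -
      (-1 : ℤ) ^ l.length • f (l.map Prod.fst) [] := by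
  induction l generalizing f with
  | nil => simp
  | cons x l ih =>
    have h := ih fun w w' => f (x.1 :: w) w'
    have e : frontBack (fun w w' => altSum (fun y => f y w') (x.1 :: w) +
        (-1 : ℤ) ^ ((x.1 :: w).length + 1) • altSum (f (x.1 :: w)) w') l =
        frontBack f l - frontBack (fun w w' => altSum (fun y => f (x.1 :: y) w') w +
          (-1 : ℤ) ^ (w.length + 1) • altSum (f (x.1 :: w)) w') l := by
      rw [sub_eq_add_neg]
      have h1 := frontBack_lin (-LinearMap.id : M →ₗ[ℤ] M)
        (fun w w' => altSum (fun y => f (x.1 :: y) w') w +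
          (-1 : ℤ) ^ (w.length + 1) • altSum (f (x.1 :: w)) w') l
      simp only [LinearMap.neg_apply, LinearMap.id_apply] at h1
      rw [← h1, frontBack, frontBack, frontBack, ← cutSum_add]
      congr 1
      funext w w'
      rw [altSum_cons, List.length_cons, pow_succ _ (_ + 1)]
      simp only [mul_neg, mul_one, neg_smul]
      abel
    rw [frontBack_cons, e, h, altSum_cons, List.map_cons, List.map_cons, altSum_cons,
      List.length_cons, List.length_cons, List.length_nil, pow_succ _ l.length]
    simp only [frontBack_cons, altSum_nil, altSum_add, altSum_cons, mul_neg, mul_one, neg_smul]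
    rw [altSum_map (fun w => f [x.1] (x.2 :: w))]
    simp
    abel

end Splittings

section Homotopy

variable {K : Type*} [CommRing K] {V W : Type*}

variable (K) in
/-- The sum, over all cuts of a word of pairs, of the paths in the grid spanned by the columns of
the front part and the rows of the back part: the composite of the Alexander-Whitney map and the
shuffle map. -/
def shuffleCut (l : List (V × W)) : Words K (V × W) := frontBack (paths K) l

lemma shuffleCut_single (x : V × W) : shuffleCut K [x] = wd K [x] := by
  simp [shuffleCut, frontBack_cons, paths]

/-- The composite of the Alexander-Whitney map and the shuffle map is a chain map. -/
lemma wbd_shuffleCut (l : List (V × W)) (hl : l.length ≠ 1) :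
    wbd (shuffleCut K l) = altSum (shuffleCut K) l := by
  have h := frontBack_altSum (paths K) l
  simp only [paths_nil_left, paths_nil_right, smul_zero, add_zero, sub_zero] at h
  rw [shuffleCut, ← frontBack_lin]
  refine Eq.trans (frontBack_congr fun w w' e h1 h2 => ?_) h
  rw [wbd_paths, if_neg, add_zero]
  · rw [← Int.cast_smul_eq_zsmul K]
    push_cast
    rfl
  · omega

variable (K) in
/-- The Eilenberg-Zilber homotopy on words of length `n + 1`, obtained recursively with the
contraction that adds the first letter of the word in front. -/
def ezHomotopy : ℕ → List (V × W) → Words K (V × W)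
  | 0, _ => 0
  | _ + 1, [] => 0
  | n + 1, x :: l => pre x (shuffleCut K (x :: l) - wd K (x :: l) -
      altSum (fun w => ezHomotopy n w) (x :: l))

/-- The recursion defines a homotopy from the identity to `shuffleCut`, because adding a letter in
front is a contraction and the expression it is applied to is a cycle by induction. -/
lemma wbd_ezHomotopy (n : ℕ) (l : List (V × W)) (hl : l.length = n + 2) :
    wbd (ezHomotopy K (n + 1) l) =
      shuffleCut K l - wd K l - altSum (fun w => ezHomotopy K n w) l := by
  induction n generalizing l with
  | zero =>
    rcases l with _ | ⟨x, l⟩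
    · simp at hl
    rw [ezHomotopy, wbd_pre]
    simp only [ezHomotopy, altSum_zero, sub_zero, map_sub, wbd_wd]
    rw [wbd_shuffleCut _ (by omega), altSum_congr_length (f := shuffleCut K) (f' := wd K)]
    · simp
    · intro w hw
      obtain ⟨y, rfl⟩ := List.length_eq_one_iff.1 (show w.length = 1 by omega)
      exact shuffleCut_single y
  | succ n ih =>
    rcases l with _ | ⟨x, l⟩
    · simp at hl
    rw [ezHomotopy, wbd_pre, map_sub wbd, map_sub wbd, ← altSum_lin, wbd_wd,
      wbd_shuffleCut _ (by omega)]
    rw [altSum_congr_length (f := fun w => wbd (ezHomotopy K (n + 1) w))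
      (fun w hw => ih w (by omega)), altSum_sub, altSum_sub, altSum_altSum]
    simp

/-- The words with two equal consecutive letters. -/
def HasRepeat (l : List V) : Prop := ∃ l₁ x l₂, l = l₁ ++ x :: x :: l₂

lemma HasRepeat.cons {l : List V} (h : HasRepeat l) (x : V) : HasRepeat (x :: l) := by
  obtain ⟨l₁, y, l₂, rfl⟩ := h
  exact ⟨x :: l₁, y, l₂, rfl⟩

lemma hasRepeat_cons_cons (x : V) (l : List V) : HasRepeat (x :: x :: l) := ⟨[], x, l, rfl⟩

lemma HasRepeat.map {l : List V} (h : HasRepeat l) (f : V → W) : HasRepeat (l.map f) := by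
  obtain ⟨l₁, y, l₂, rfl⟩ := h
  exact ⟨l₁.map f, f y, l₂.map f, by simp⟩

lemma IsPath.exists_cons {u : List V} {v : List W} {a : V} {b : W} {l : List (V × W)}
    (h : IsPath (a :: u) (b :: v) l) : ∃ l', l = (a, b) :: l' := by
  cases h <;> exact ⟨_, rfl⟩

/-- A path through at least two columns repeats a row. -/
lemma IsPath.hasRepeat_snd {u : List V} {v : List W} {l : List (V × W)} (h : IsPath u v l)
    (hu : 2 ≤ u.length) : HasRepeat (l.map Prod.snd) := by
  induction h with
  | single a b => simp at hu
  | @left u v l a b h ih =>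
    rcases u with _ | ⟨a', u⟩
    · simp at hu
    obtain ⟨l', rfl⟩ := h.exists_cons
    exact hasRepeat_cons_cons _ _
  | right a b h ih => exact (ih hu).cons _

lemma paths_single (a : V) (v : List W) (hv : v ≠ []) :
    paths K [a] v = wd K (v.map fun b => (a, b)) := by
  induction v with
  | nil => simp at hv
  | cons b v ih =>
    rcases v with _ | ⟨b', v⟩
    · simp [paths]
    · rw [paths_cons, ih (by simp), unitIf_of_ne (by simp)]
      simp

/-- In a column all cuts except the first one have a degenerate front part. -/
lemma frontBack_column {M : Type*} [AddCommGroup M] (f : List V → List W → M)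
    (h1 : ∀ u v, HasRepeat u → f u v = 0) (a : V) (v : List W) (hv : v ≠ []) :
    frontBack f (v.map fun b => (a, b)) = f [a] v := by
  induction v generalizing f with
  | nil => simp at hv
  | cons b v ih =>
    have e : (v.map fun b => (a, b)).map Prod.snd = v := by simp
    rw [List.map_cons, frontBack_cons, e, add_eq_left]
    rcases v with _ | ⟨b', v⟩
    · simp
    · rw [ih (fun w w' => f (a :: w) w') (fun w w' h => h1 _ _ (h.cons a)) (by simp)]
      exact h1 _ _ (hasRepeat_cons_cons _ _)

/-- The Alexander-Whitney map is left inverse to the shuffle map up to degenerate terms. -/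
lemma frontBack_paths {M : Type*} [AddCommGroup M] [Module K M] (f : List V → List W → M)
    (h1 : ∀ u v, HasRepeat u → f u v = 0) (h2 : ∀ u v, HasRepeat v → f u v = 0)
    (u : List V) (v : List W) (hu : u ≠ []) (hv : v ≠ []) :
    wlift (frontBack f) (paths K u v) = f u v := by
  induction hn : u.length + v.length using Nat.strong_induction_on generalizing u v f with
  | _ n ih =>
  subst hn
  rcases u with _ | ⟨a, _ | ⟨a', u⟩⟩
  · simp at hu
  · rw [paths_single a v hv, wlift_wd, frontBack_column f h1 a v hv]
  rcases v with _ | ⟨b, v⟩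
  · simp at hv
  rw [paths_cons, wlift_pre, unitIf_of_ne (by simp), zero_add, map_add, map_smul]
  -- a path that starts with a step to the next column repeats the first row, so the cut at its
  -- first vertex has a degenerate back part
  have e1 : wlift (fun l => frontBack f ((a, b) :: l)) (paths K (a' :: u) (b :: v)) =
      f (a :: a' :: u) (b :: v) := by
    rw [← ih _ (by simp) (fun w w' => f (a :: w) w') (fun w w' h => h1 _ _ (h.cons a))
      (fun w w' h => h2 _ _ h) (a' :: u) (b :: v) (by simp) (by simp) rfl]
    refine wlift_paths_congr _ _ fun l hl => ?_
    obtain ⟨l', rfl⟩ := hl.exists_cons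
    rw [frontBack_cons, List.map_cons, h2 _ _ (hasRepeat_cons_cons _ _), zero_add]
  -- a path that starts with a step to the next row repeats the first column
  have e2 : wlift (fun l => frontBack f ((a, b) :: l)) (paths K (a :: a' :: u) v) = 0 := by
    by_cases hv : v = []
    · subst hv; simp
    · have e3 := ih _ (by simp) (fun w w' => f (a :: w) w') (fun w w' h => h1 _ _ (h.cons a))
        (fun w w' h => h2 _ _ h) (a :: a' :: u) v (by simp) hv rfl
      rw [h1 _ _ (hasRepeat_cons_cons _ _)] at e3
      rw [← e3]
      refine wlift_paths_congr _ _ fun l hl => ?_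
      rw [frontBack_cons, h2 _ _ ((hl.hasRepeat_snd (by simp)).cons b), zero_add]
  rw [e1, e2, smul_zero, add_zero]

/-- Cutting the sum of all paths: a path and a vertex on it are the same as a vertex of the grid
together with a path that leads to it and a path that starts there. -/
lemma cutSum_paths {M : Type*} [AddCommGroup M] [Module K M]
    (G : Words K (V × W) →ₗ[K] Words K (V × W) →ₗ[K] M) (u : List V) (v : List W) :
    wlift (cutSum fun w w' => G (wd K w) (wd K w')) (paths K u v) =
      cutSum (fun u₁ u₂ => cutSum (fun v₁ v₂ =>
        (-1 : K) ^ ((v₁.length + 1) * (u₂.length + 1)) • G (paths K u₁ v₁) (paths K u₂ v₂)) v) u := by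
  induction hn : u.length + v.length using Nat.strong_induction_on generalizing u v G with
  | _ n ih =>
  subst hn
  rcases u with _ | ⟨a, u⟩
  · simp
  rcases v with _ | ⟨b, v⟩
  · simp [cutSum_zero]
  -- the cut at the first vertex, and the cuts of the paths after the first step
  have e0 : wlift (cutSum fun w w' => G (wd K w) (wd K w')) (paths K (a :: u) (b :: v)) =
      G (wd K [(a, b)]) (paths K (a :: u) (b :: v)) +
      (wlift (cutSum fun w w' => (G ∘ₗ pre (a, b)) (wd K w) (wd K w')) (paths K u (b :: v)) +
      (-1 : K) ^ u.length •
        wlift (cutSum fun w w' => (G ∘ₗ pre (a, b)) (wd K w) (wd K w')) (paths K (a :: u) v)) := by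
    have key : ∀ z, wlift (cutSum fun w w' => G (wd K w) (wd K w')) (pre (a, b) z) =
        G (wd K [(a, b)]) (pre (a, b) z) +
          wlift (cutSum fun w w' => (G ∘ₗ pre (a, b)) (wd K w) (wd K w')) z := by
      intro z
      suffices h : (wlift (cutSum fun w w' => G (wd K w) (wd K w')) ∘ₗ pre (a, b)) =
        G (wd K [(a, b)]) ∘ₗ pre (a, b) +
          wlift (cutSum fun w w' => (G ∘ₗ pre (a, b)) (wd K w) (wd K w')) from
        LinearMap.congr_fun h z
      exact words_ext fun l => by simp [cutSum_cons]
    rw [paths_cons, key, map_add (wlift _), map_add (wlift _), map_smul (wlift _), wlift_unitIf]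
    simp
  -- the cuts in the first column
  have c1 : cutSum (fun v₁ v₂ => (-1 : K) ^ (((b :: v₁).length + 1) * ((a :: u).length + 1)) •
        G (paths K [a] (b :: v₁)) (paths K (a :: u) v₂)) v =
      (-1 : K) ^ u.length • cutSum (fun v₁ v₂ =>
        (-1 : K) ^ ((v₁.length + 1) * ((a :: u).length + 1)) •
          (G ∘ₗ pre (a, b)) (paths K [a] v₁) (paths K (a :: u) v₂)) v := by
    rw [← cutSum_smul]
    refine cutSum_congr fun w c w' _ => ?_
    rw [paths_cons, unitIf_of_ne (by simp), smul_smul, ← pow_add]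
    simp only [paths_nil_left, List.length_nil, pow_zero, one_smul, zero_add, LinearMap.comp_apply,
      List.length_append, List.length_cons]
    congr 1
    exact neg_one_pow_congr (by grind)
  -- the cuts in the other columns, by the first step of the front part
  have c3 : cutSum (fun u₁ u₂ => cutSum (fun v₁ v₂ =>
        (-1 : K) ^ ((v₁.length + 1) * (u₂.length + 1)) •
          G (paths K (a :: u₁) v₁) (paths K u₂ v₂)) (b :: v)) u =
      cutSum (fun u₁ u₂ => cutSum (fun v₁ v₂ =>
        (-1 : K) ^ ((v₁.length + 1) * (u₂.length + 1)) •
          (G ∘ₗ pre (a, b)) (paths K u₁ v₁) (paths K u₂ v₂)) (b :: v)) u +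
      (-1 : K) ^ u.length • cutSum (fun u₁ u₂ => cutSum (fun v₁ v₂ =>
        (-1 : K) ^ ((v₁.length + 1) * (u₂.length + 1)) •
          (G ∘ₗ pre (a, b)) (paths K (a :: u₁) v₁) (paths K u₂ v₂)) v) u := by
    rw [← cutSum_smul, ← cutSum_add]
    refine cutSum_congr fun w c w' hw => ?_
    rw [← cutSum_smul, cutSum_cons, cutSum_cons, add_assoc, ← cutSum_add]
    congr 1
    · rw [paths_cons, unitIf_of_ne (by simp)]
      simp
    · refine cutSum_congr fun y d y' hy => ?_
      rw [paths_cons, unitIf_of_ne (by simp), zero_add, map_add, map_add, LinearMap.add_apply,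
        smul_add, map_smul, map_smul, LinearMap.smul_apply, smul_smul, smul_smul, ← pow_add,
        ← pow_add]
      congr 2
      refine neg_one_pow_congr ?_
      rw [← hw]
      simp only [List.length_append, List.length_cons, List.length_nil]
      grind
  rw [e0, ih _ (by simp) _ u (b :: v) rfl, ih _ (by simp) _ (a :: u) v rfl, cutSum_cons _ a,
    cutSum_cons _ a, cutSum_cons _ b, c1, c3, smul_add]
  have c0 : (-1 : K) ^ (([b].length + 1) * ((a :: u).length + 1)) •
      G (paths K [a] [b]) (paths K (a :: u) (b :: v)) =
      G (wd K [(a, b)]) (paths K (a :: u) (b :: v)) := by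
    rw [Even.neg_one_pow (by simp), one_smul]
    simp [paths]
  rw [c0]
  abel

end Homotopy

/-! ### Linear combinations of words with a given property -/

section Support

variable {K : Type*} [CommRing K] {V W : Type*}

variable (K) in
/-- The formal linear combinations of words with a given property. -/
def wordsOn (Q : List V → Prop) : Submodule K (Words K V) :=
  Submodule.span K {z | ∃ l, Q l ∧ z = wd K l}

lemma wd_mem {Q : List V → Prop} {l : List V} (h : Q l) : wd K l ∈ wordsOn K Q :=
  Submodule.subset_span ⟨l, h, rfl⟩

lemma wordsOn_mono {Q Q' : List V → Prop} (h : ∀ l, Q l → Q' l) : wordsOn K Q ≤ wordsOn K Q' :=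
  Submodule.span_mono fun _ ⟨l, hl, e⟩ => ⟨l, h l hl, e⟩

/-- Linear maps that agree on the words with a property agree on their linear combinations. -/
lemma eqOn_wordsOn {M : Type*} [AddCommGroup M] [Module K M] {f f' : Words K V →ₗ[K] M}
    {Q : List V → Prop} (h : ∀ l, Q l → f (wd K l) = f' (wd K l)) {z : Words K V}
    (hz : z ∈ wordsOn K Q) : f z = f' z := by
  refine LinearMap.eqOn_span (s := {z | ∃ l, Q l ∧ z = wd K l}) ?_ hz
  rintro _ ⟨l, hl, rfl⟩
  exact h l hl

lemma map_mem_wordsOn {M : Type*} [AddCommGroup M] [Module K M] {f : Words K V →ₗ[K] M}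
    {Q : List V → Prop} {N : Submodule K M} (h : ∀ l, Q l → f (wd K l) ∈ N) {z : Words K V}
    (hz : z ∈ wordsOn K Q) : f z ∈ N := by
  have : wordsOn K Q ≤ N.comap f := by
    refine Submodule.span_le.2 ?_
    rintro _ ⟨l, hl, rfl⟩
    exact h l hl
  exact this hz

lemma pre_mem {Q Q' : List V → Prop} {x : V} (h : ∀ l, Q l → Q' (x :: l)) {z : Words K V}
    (hz : z ∈ wordsOn K Q) : pre x z ∈ wordsOn K Q' :=
  map_mem_wordsOn (fun l hl => by rw [pre_wd]; exact wd_mem (h l hl)) hz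

lemma altSum_mem {M : Type*} [AddCommGroup M] [Module K M] {N : Submodule K M}
    {f : List V → M} {l : List V} (h : ∀ k, k < l.length → f (l.eraseIdx k) ∈ N) :
    altSum f l ∈ N := by
  rw [altSum_eq_sum]
  exact Submodule.sum_mem _ fun k hk => zsmul_mem (h k (Finset.mem_range.1 hk)) _

lemma cutSum_mem {M : Type*} [AddCommGroup M] [Module K M] {N : Submodule K M}
    {g : List V → List V → M} {l : List V}
    (h : ∀ w c w', w ++ c :: w' = l → g (w ++ [c]) (c :: w') ∈ N) : cutSum g l ∈ N := by
  induction l generalizing g with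
  | nil => exact N.zero_mem
  | cons x l ih =>
    rw [cutSum_cons]
    refine N.add_mem (h [] x l rfl) (ih fun w c w' e => ?_)
    simpa using h (x :: w) c w' (by simp [e])

lemma paths_mem (u : List V) (v : List W) : paths K u v ∈ wordsOn K (IsPath u v) := by
  induction hn : u.length + v.length using Nat.strong_induction_on generalizing u v with
  | _ n ih =>
  subst hn
  rcases u with _ | ⟨a, u⟩
  · simp
  rcases v with _ | ⟨b, v⟩
  · simp
  rw [paths_cons, map_add, map_add, map_smul]
  refine Submodule.add_mem _ (Submodule.add_mem _ ?_ ?_) (Submodule.smul_mem _ _ ?_)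
  · unfold unitIf
    split_ifs with h
    · obtain ⟨rfl, rfl⟩ := h
      rw [pre_wd]
      exact wd_mem (IsPath.single a b)
    · simp
  · exact pre_mem (fun l hl => hl.left a b) (ih _ (by simp) u (b :: v) rfl)
  · exact pre_mem (fun l hl => hl.right a b) (ih _ (by simp) (a :: u) v rfl)

lemma cpaths_mem (u u' : List V) (v v' : List W) :
    cpaths K u u' v v' ∈ wordsOn K (IsPath (u ++ u') (v ++ v')) := by
  induction hn : u.length + v.length using Nat.strong_induction_on generalizing u v with
  | _ n ih =>
  subst hn
  rcases u with _ | ⟨a, u⟩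
  · rw [cpaths_nil]; exact paths_mem _ _
  rcases v with _ | ⟨b, v⟩
  · simp [cpaths_nil_right]
  rw [cpaths_cons, map_add, map_smul]
  exact Submodule.add_mem _ (pre_mem (fun l hl => hl.left a b) (ih _ (by simp) u (b :: v) rfl))
    (Submodule.smul_mem _ _
      (pre_mem (fun l hl => hl.right a b) (ih _ (by simp) (a :: u) v rfl)))

lemma IsPath.mem {u : List V} {v : List W} {l : List (V × W)} (h : IsPath u v l) :
    ∀ x ∈ l, x.1 ∈ u ∧ x.2 ∈ v := by
  induction h with
  | single a b => simp
  | left a b h ih =>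
    intro x hx
    rcases List.mem_cons.1 hx with rfl | hx
    · simp
    · exact ⟨List.mem_cons_of_mem _ (ih x hx).1, (ih x hx).2⟩
  | right a b h ih =>
    intro x hx
    rcases List.mem_cons.1 hx with rfl | hx
    · simp
    · exact ⟨(ih x hx).1, List.mem_cons_of_mem _ (ih x hx).2⟩

lemma IsPath.pairwise [Preorder V] [Preorder W] {u : List V} {v : List W} {l : List (V × W)}
    (h : IsPath u v l) (hu : u.Pairwise (· ≤ ·)) (hv : v.Pairwise (· ≤ ·)) :
    l.Pairwise (· ≤ ·) := by
  induction h with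
  | single a b => simp
  | left a b h ih =>
    refine List.pairwise_cons.2 ⟨fun x hx => ⟨?_, ?_⟩, ih (List.pairwise_cons.1 hu).2 hv⟩
    · exact (List.pairwise_cons.1 hu).1 _ (h.mem x hx).1
    · rcases List.mem_cons.1 (h.mem x hx).2 with e | e
      · exact e.ge
      · exact (List.pairwise_cons.1 hv).1 _ e
  | right a b h ih =>
    refine List.pairwise_cons.2 ⟨fun x hx => ⟨?_, ?_⟩, ih hu (List.pairwise_cons.1 hv).2⟩
    · rcases List.mem_cons.1 (h.mem x hx).1 with e | e
      · exact e.ge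
      · exact (List.pairwise_cons.1 hu).1 _ e
    · exact (List.pairwise_cons.1 hv).1 _ (h.mem x hx).2

lemma hasRepeat_cons_iff {x : V} {l : List V} :
    HasRepeat (x :: l) ↔ (∃ l', l = x :: l') ∨ HasRepeat l := by
  constructor
  · rintro ⟨_ | ⟨y, l₁⟩, z, l₂, e⟩
    · simp only [List.nil_append, List.cons.injEq] at e
      obtain ⟨rfl, rfl⟩ := e
      exact Or.inl ⟨l₂, rfl⟩
    · simp only [List.cons_append, List.cons.injEq] at e
      exact Or.inr ⟨l₁, z, l₂, e.2⟩
  · rintro (⟨l', rfl⟩ | h)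
    · exact hasRepeat_cons_cons _ _
    · exact h.cons _

lemma IsPath.hasRepeat_right {u : List V} {v : List W} {l : List (V × W)} (h : IsPath u v l)
    (hv : HasRepeat v) : HasRepeat l := by
  induction h with
  | single a b =>
    rcases hasRepeat_cons_iff.1 hv with ⟨l', e⟩ | ⟨_ | _, _, _, e⟩ <;> simp at e
  | left a b h ih => exact (ih hv).cons _
  | right a b h ih =>
    rcases hasRepeat_cons_iff.1 hv with ⟨v', rfl⟩ | hv
    · obtain ⟨l', rfl⟩ := h.exists_cons
      exact hasRepeat_cons_cons _ _
    · exact (ih hv).cons _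

lemma IsPath.hasRepeat_left {u : List V} {v : List W} {l : List (V × W)} (h : IsPath u v l)
    (hu : HasRepeat u) : HasRepeat l := by
  induction h with
  | single a b =>
    rcases hasRepeat_cons_iff.1 hu with ⟨l', e⟩ | ⟨_ | _, _, _, e⟩ <;> simp at e
  | right a b h ih => exact (ih hu).cons _
  | left a b h ih =>
    rcases hasRepeat_cons_iff.1 hu with ⟨v', rfl⟩ | hu
    · obtain ⟨l', rfl⟩ := h.exists_cons
      exact hasRepeat_cons_cons _ _
    · exact (ih hu).cons _

/-- If a word with a repetition is cut, one of the parts has a repetition. -/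
lemma HasRepeat.cut {w w' : List V} {c : V} (h : HasRepeat (w ++ c :: w')) :
    HasRepeat (w ++ [c]) ∨ HasRepeat (c :: w') := by
  induction w with
  | nil => exact Or.inr h
  | cons x w ih =>
    rw [List.cons_append] at h
    rcases hasRepeat_cons_iff.1 h with ⟨l', e⟩ | h
    · left
      rcases w with _ | ⟨y, w⟩
      · simp only [List.nil_append, List.cons.injEq] at e
        rw [e.1]
        exact hasRepeat_cons_cons _ _
      · simp only [List.cons_append, List.cons.injEq] at e
        rw [e.1]
        exact hasRepeat_cons_cons _ _
    · exact (ih h).imp_left fun h => h.cons x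

/-- `shuffleCut` preserves degenerate words. -/
lemma shuffleCut_mem_hasRepeat {l : List (V × W)} (h : HasRepeat l) :
    shuffleCut K l ∈ wordsOn K HasRepeat := by
  refine cutSum_mem ?_
  rintro w c w' rfl
  rcases h.cut with h | h
  · exact wordsOn_mono (fun l hl => hl.hasRepeat_left (h.map _)) (paths_mem _ _)
  · exact wordsOn_mono (fun l hl => hl.hasRepeat_right (h.map _)) (paths_mem _ _)

/-- The Eilenberg-Zilber homotopy preserves degenerate words; hence it descends to normalized chains. -/
lemma ezHomotopy_mem_hasRepeat (n : ℕ) {l : List (V × W)} (h : HasRepeat l) :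
    ezHomotopy K n l ∈ wordsOn K HasRepeat := by
  induction n generalizing l with
  | zero => exact Submodule.zero_mem _
  | succ n ih =>
    rcases l with _ | ⟨x, l⟩
    · exact Submodule.zero_mem _
    rw [ezHomotopy]
    refine pre_mem (Q := HasRepeat) (fun l hl => hl.cons x)
      (Submodule.sub_mem _ (Submodule.sub_mem _ ?_ ?_) ?_)
    · exact shuffleCut_mem_hasRepeat h
    · exact wd_mem h
    · obtain ⟨l₁, y, l₂, e⟩ := h
      rw [e, altSum_append, altSum_cons, altSum_cons]
      -- the two faces that delete one of the equal letters cancel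
      rw [sub_sub_cancel]
      refine Submodule.add_mem _ (altSum_mem fun k hk => ih ⟨_, y, l₂, rfl⟩)
        (zsmul_mem (altSum_mem (f := fun w => ezHomotopy K n (l₁ ++ y :: y :: w))
          fun k hk => ih ⟨l₁, y, _, rfl⟩) _)

/-- `Spanned l n w`: the word `w` of length `n` is increasing and consists of vertices of the grid
spanned by the vertices of the word `l`. -/
def Spanned [Preorder V] [Preorder W] (l : List (V × W)) (n : ℕ) (w : List (V × W)) : Prop :=
  w.length = n ∧ w.Pairwise (· ≤ ·) ∧ ∀ x ∈ w, x.1 ∈ l.map Prod.fst ∧ x.2 ∈ l.map Prod.snd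

variable [Preorder V] [Preorder W]

lemma shuffleCut_mem {l : List (V × W)} (h : l.Pairwise (· ≤ ·)) :
    shuffleCut K l ∈ wordsOn K (Spanned l l.length) := by
  refine cutSum_mem ?_
  rintro w c w' rfl
  refine wordsOn_mono (fun l hl => ⟨?_, hl.pairwise ?_ ?_, fun x hx => ⟨?_, ?_⟩⟩) (paths_mem _ _)
  · have := hl.length
    simp only [List.length_map, List.length_append, List.length_cons, List.length_nil] at *
    omega
  · refine (List.Pairwise.sublist ?_ h).map _ fun a b h => h.1
    simp
  · refine (List.Pairwise.sublist ?_ h).map _ fun a b h => h.2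
    simp
  · have := (hl.mem x hx).1
    simp only [List.map_append, List.map_cons, List.mem_append, List.mem_cons] at this ⊢
    tauto
  · have := (hl.mem x hx).2
    simp only [List.map_append, List.map_cons, List.mem_append, List.mem_cons] at this ⊢
    tauto

lemma ezHomotopy_mem (n : ℕ) {l : List (V × W)} (hl : l.length = n + 1)
    (h : l.Pairwise (· ≤ ·)) : ezHomotopy K n l ∈ wordsOn K (Spanned l (n + 2)) := by
  induction n generalizing l with
  | zero => exact Submodule.zero_mem _
  | succ n ih =>
    rcases l with _ | ⟨x, l⟩
    · exact Submodule.zero_mem _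
    rw [ezHomotopy]
    refine pre_mem (Q := Spanned (x :: l) (n + 2)) ?_
      (Submodule.sub_mem _ (Submodule.sub_mem _ ?_ ?_) ?_)
    · rintro w ⟨h1, h2, h3⟩
      refine ⟨by simp [h1], List.pairwise_cons.2 ⟨fun y hy => ?_, h2⟩, ?_⟩
      · have hx := (List.pairwise_cons.1 h).1
        obtain ⟨h4, h5⟩ := h3 y hy
        simp only [List.map_cons, List.mem_cons, List.mem_map] at h4 h5
        refine ⟨?_, ?_⟩
        · rcases h4 with h4 | ⟨z, hz, h4⟩
          · exact h4.ge
          · exact h4 ▸ (hx z hz).1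
        · rcases h5 with h5 | ⟨z, hz, h5⟩
          · exact h5.ge
          · exact h5 ▸ (hx z hz).2
      · intro y hy
        rcases List.mem_cons.1 hy with rfl | hy
        · simp
        · exact h3 y hy
    · have := shuffleCut_mem (K := K) h
      rwa [hl] at this
    · exact wd_mem ⟨hl, h, fun y hy => ⟨List.mem_map_of_mem hy, List.mem_map_of_mem hy⟩⟩
    · refine altSum_mem fun k hk => ?_
      have hs := List.eraseIdx_sublist (x :: l) k
      refine wordsOn_mono (fun w hw => ⟨hw.1, hw.2.1, fun y hy => ⟨?_, ?_⟩⟩)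
        (ih (by rw [List.length_eraseIdx_of_lt hk]; omega) (h.sublist hs))
      · exact (hs.map _).subset (hw.2.2 y hy).1
      · exact (hs.map _).subset (hw.2.2 y hy).2

end Support

/-! ### Cyclic operators -/

section CyclicOperators

variable {K : Type w} [Field K] {C : Type u} [Category.{v} C] [Preadditive C]
    [Linear K C] [SuperCategory K C]

/-- The composite of the `d` morphisms `h (a + 1), …, h (a + d)` (an identity if `d = 0`). -/
def block (h : ℤ → HArr K C) (a : ℤ) : ℕ → HArr K C
  | 0 => HArr.id (h (a + 1)).src
  | d + 1 => (block h a d).comp (h (a + d + 1))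

/-- The morphisms of a two-sided sequence are composable. -/
def Chainable (h : ℤ → HArr K C) : Prop := ∀ j, (h j).tgt = (h (j + 1)).src

lemma block_src (h : ℤ → HArr K C) (a : ℤ) (d : ℕ) : (block h a d).src = (h (a + 1)).src := by
  induction d with
  | zero => rfl
  | succ d ih => rw [block, HArr.comp_src, ih]

lemma block_tgt {h : ℤ → HArr K C} (hh : Chainable h) (a : ℤ) (d : ℕ) :
    (block h a d).tgt = (h (a + d + 1)).src := by
  induction d with
  | zero => simp [block, HArr.id]
  | succ d ih =>
    rw [block, HArr.comp_tgt ih, hh]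
    push_cast
    rw [add_assoc a]

lemma block_one {h : ℤ → HArr K C} (a : ℤ) : block h a 1 = h (a + 1) := by
  rw [block, block]
  simpa using HArr.id_comp (a := h (a + 1)) rfl

lemma block_add {h : ℤ → HArr K C} (hh : Chainable h) (a : ℤ) (d e : ℕ) :
    (block h a d).comp (block h (a + d) e) = block h a (d + e) := by
  induction e with
  | zero => exact HArr.comp_id (by rw [block_tgt hh])
  | succ e ih =>
    rw [← add_assoc d, block, block, ← ih, HArr.comp_assoc (by rw [block_tgt hh, block_src])
      (by rw [block_tgt hh]; push_cast; rw [← add_assoc a])]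
    push_cast
    rw [← add_assoc a]

lemma block_congr {h h' : ℤ → HArr K C} {a : ℤ} {d : ℕ}
    (hs : (h' (a + 1)).src = (h (a + 1)).src) (he : ∀ i, a < i → i ≤ a + d → h' i = h i) :
    block h' a d = block h a d := by
  induction d with
  | zero => rw [block, block, hs]
  | succ d ih =>
    rw [block, block, ih fun i h1 h2 => he i h1 (by push_cast; omega),
      he _ (by omega) (by push_cast; omega)]

lemma block_shift {h h' : ℤ → HArr K C} {a a' : ℤ} (he : ∀ i, h' (a' + i) = h (a + i)) (d : ℕ) :
    block h' a' d = block h a d := by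
  induction d with
  | zero => rw [block, block, he]
  | succ d ih => rw [block, block, ih, add_assoc, he, ← add_assoc]

/-- A composite is linear in each of its factors. -/
lemma block_linRel {c : K} {h h' h'' : ℤ → HArr K C} (hh : Chainable h) {a j : ℤ} {d : ℕ}
    (hs' : (h' (a + 1)).src = (h (a + 1)).src) (hs'' : (h'' (a + 1)).src = (h (a + 1)).src)
    (h1 : a < j) (h2 : j ≤ a + d) (he : ∀ i, a < i → i ≤ a + d → i ≠ j → h'' i = h i ∧ h' i = h i)
    (hr : LinRel c (h j) (h' j) (h'' j)) :
    LinRel c (block h a d) (block h' a d) (block h'' a d) := by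
  induction d with
  | zero => simp only [Nat.cast_zero] at h2; omega
  | succ d ih =>
    push_cast at h2 he
    rw [block, block, block]
    by_cases e : j = a + d + 1
    · subst e
      rw [block_congr (h' := h') hs' fun i i1 i2 => (he i i1 (by omega) (by omega)).2,
        block_congr (h' := h'') hs'' fun i i1 i2 => (he i i1 (by omega) (by omega)).1]
      exact hr.comp_left _ (by rw [block_tgt hh])
    · have := he (a + d + 1) (by omega) (by omega) (Ne.symm e)
      rw [this.1, this.2]
      exact (ih (by omega) fun i i1 i2 => he i i1 (by omega)).comp_right _ (by rw [block_tgt hh])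

/-- The two-sided periodic extension of `g 0, …, g n`. -/
def perSeq (n : ℕ) (g : ℕ → HArr K C) (j : ℤ) : HArr K C := g (j % (n + 1)).toNat

lemma perSeq_add (n : ℕ) (g : ℕ → HArr K C) (j q : ℤ) :
    perSeq n g (j + (n + 1) * q) = perSeq n g j := by
  simp [perSeq]

lemma perSeq_of_lt {n : ℕ} (g : ℕ → HArr K C) {j : ℕ} (hj : j ≤ n) : perSeq n g j = g j := by
  rw [perSeq, Int.emod_eq_of_lt (by omega) (by omega), Int.toNat_natCast]

/-- Division by `n + 1` with remainder. -/
lemma per_cases (n : ℕ) (j : ℤ) : ∃ (r : ℕ) (q : ℤ), r ≤ n ∧ j = r + (n + 1) * q := by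
  have h1 := Int.emod_nonneg j (show (n + 1 : ℤ) ≠ 0 by omega)
  have h2 := Int.emod_lt_of_pos j (show (0 : ℤ) < n + 1 by omega)
  refine ⟨(j % (n + 1)).toNat, j / (n + 1), by omega, ?_⟩
  rw [Int.toNat_of_nonneg h1]
  exact (Int.emod_add_mul_ediv j (n + 1)).symm

lemma IsCycle.chainable {n : ℕ} {g : ℕ → HArr K C} (hg : IsCycle n g) :
    Chainable (perSeq n g) := by
  intro j
  obtain ⟨r, q, hr, rfl⟩ := per_cases n j
  rw [perSeq_add, perSeq_of_lt g hr]
  rcases hr.lt_or_eq with h | rfl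
  · rw [hg.1 r h, add_right_comm, perSeq_add, ← Nat.cast_succ, perSeq_of_lt g h]
  · rw [hg.2, show (r : ℤ) + (r + 1) * q + 1 = (0 : ℕ) + (r + 1) * (q + 1) by push_cast; ring,
      perSeq_add, perSeq_of_lt g (Nat.zero_le _)]

/-- The sum of the parities of `g 0, …, g j`, extended to all integers `j` additively. -/
def pot (n : ℕ) (g : ℕ → HArr K C) (j : ℤ) : ZMod 2 :=
  ((j / (n + 1) : ℤ) : ZMod 2) * parSum (n + 1) g + parSum ((j % (n + 1)).toNat + 1) g

lemma pot_eq {n : ℕ} (g : ℕ → HArr K C) {r : ℕ} (hr : r ≤ n) (q : ℤ) :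
    pot n g (r + (n + 1) * q) = q * parSum (n + 1) g + parSum (r + 1) g := by
  rw [pot, Int.add_mul_ediv_left _ _ (by omega), Int.add_mul_emod_self_left,
    Int.ediv_eq_zero_of_lt (by omega) (by omega), Int.emod_eq_of_lt (by omega) (by omega),
    Int.toNat_natCast, zero_add]

lemma pot_add (n : ℕ) (g : ℕ → HArr K C) (j q : ℤ) :
    pot n g (j + (n + 1) * q) = pot n g j + q * parSum (n + 1) g := by
  obtain ⟨r, q', hr, rfl⟩ := per_cases n j
  rw [show (r : ℤ) + (n + 1) * q' + (n + 1) * q = r + (n + 1) * (q' + q) by ring, pot_eq g hr,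
    pot_eq g hr]
  push_cast
  ring

lemma pot_neg_one (n : ℕ) (g : ℕ → HArr K C) : pot n g (-1) = 0 := by
  rw [show (-1 : ℤ) = n + (n + 1) * (-1) by ring, pot_eq g le_rfl]
  push_cast
  ring

lemma pot_of_le {n : ℕ} (g : ℕ → HArr K C) {r : ℕ} (hr : r ≤ n) :
    pot n g r = parSum (r + 1) g := by
  simpa using pot_eq g hr 0

lemma pot_succ (n : ℕ) (g : ℕ → HArr K C) (j : ℤ) :
    pot n g (j + 1) = pot n g j + (perSeq n g (j + 1)).par := by
  obtain ⟨r, q, hr, rfl⟩ := per_cases n j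
  rcases hr.lt_or_eq with h | rfl
  · rw [add_right_comm, perSeq_add, ← Nat.cast_succ, perSeq_of_lt g h, pot_eq g h, pot_eq g hr,
      show parSum (r.succ + 1) g = parSum (r + 1) g + (g r.succ).par from
        Finset.sum_range_succ _ _, add_assoc]
  · rw [show (r : ℤ) + (r + 1) * q + 1 = (0 : ℕ) + (r + 1) * (q + 1) by push_cast; ring,
      perSeq_add, perSeq_of_lt g (Nat.zero_le _), pot_eq g le_rfl, pot_eq g (Nat.zero_le _)]
    simp only [parSum, zero_add, Finset.sum_range_one]
    push_cast
    ring

lemma block_par {n : ℕ} {g : ℕ → HArr K C} (hg : IsCycle n g) (a : ℤ) (d : ℕ) :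
    (block (perSeq n g) a d).par = pot n g (a + d) + pot n g a := by
  induction d with
  | zero => simp [block, HArr.id, zmod2_add_self]
  | succ d ih =>
    rw [block, HArr.comp_par (by rw [block_tgt hg.chainable]), ih]
    push_cast
    rw [← add_assoc a, pot_succ]
    ring

/-- Increasing maps `φ : ℤ → ℤ` that are compatible with the translations by `m + 1` and `n + 1`.
These are the morphisms of the cyclic category (with cyclic group of infinite order). -/
structure IsCyc (n m : ℕ) (φ : ℤ → ℤ) : Prop where
  mono : ∀ a b, a ≤ b → φ a ≤ φ b
  per : ∀ a q, φ (a + (m + 1) * q) = φ a + (n + 1) * q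

lemma IsCyc.per_one {n m : ℕ} {φ : ℤ → ℤ} (h : IsCyc n m φ) (a : ℤ) :
    φ (a + (m + 1)) = φ a + (n + 1) := by
  simpa using h.per a 1

lemma IsCyc.comp {n m k : ℕ} {φ ψ : ℤ → ℤ} (h : IsCyc n m φ) (h' : IsCyc m k ψ) :
    IsCyc n k (φ ∘ ψ) :=
  ⟨fun a b hab => h.mono _ _ (h'.mono _ _ hab), fun a q => by
    simp only [Function.comp_apply]; rw [h'.per, h.per]⟩

lemma IsCyc.ext {n m : ℕ} {φ ψ : ℤ → ℤ} (h : IsCyc n m φ) (h' : IsCyc n m ψ)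
    (e : ∀ r : ℕ, r ≤ m → φ r = ψ r) : φ = ψ := by
  funext j
  obtain ⟨r, q, hr, rfl⟩ := per_cases m j
  rw [h.per, h'.per, e r hr]

/-- The sequence of blocks of `g` that is cut out by `φ`. -/
def cycSeq (n : ℕ) (φ : ℤ → ℤ) (g : ℕ → HArr K C) (l : ℕ) : HArr K C :=
  block (perSeq n g) (φ (l - 1)) (φ l - φ (l - 1)).toNat

section CycSeq

variable {n m : ℕ} {φ : ℤ → ℤ} {g : ℕ → HArr K C}

lemma perSeq_cycSeq (h : IsCyc n m φ) (j : ℤ) :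
    perSeq m (cycSeq n φ g) j = block (perSeq n g) (φ (j - 1)) (φ j - φ (j - 1)).toNat := by
  obtain ⟨r, q, hr, rfl⟩ := per_cases m j
  rw [perSeq_add, perSeq_of_lt _ hr, add_sub_right_comm, h.per, h.per, cycSeq,
    add_sub_add_right_eq_sub]
  refine block_shift (fun i => ?_) _
  rw [add_right_comm, perSeq_add]

lemma IsCyc.toNat (h : IsCyc n m φ) {a b : ℤ} (hab : a ≤ b) :
    φ a + ((φ b - φ a).toNat : ℤ) = φ b := by
  rw [Int.toNat_of_nonneg (by have := h.mono _ _ hab; omega)]; ring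

lemma IsCycle.cycSeq (hg : IsCycle n g) (h : IsCyc n m φ) : IsCycle m (cycSeq n φ g) := by
  have ht : ∀ l : ℕ, (SuperCyclic.cycSeq n φ g l).tgt = (perSeq n g (φ l + 1)).src := fun l => by
    rw [SuperCyclic.cycSeq, block_tgt hg.chainable, h.toNat (by omega)]
  constructor
  · intro j hj
    rw [ht, SuperCyclic.cycSeq, block_src]
    push_cast
    rw [add_sub_cancel_right]
  · rw [ht, SuperCyclic.cycSeq, block_src, show (m : ℤ) = -1 + (m + 1) by ring, h.per_one]
    have := perSeq_add n g (φ (-1) + 1) 1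
    rw [mul_one] at this
    rw [add_right_comm, this]
    simp

/-- The partial sums of parities of the blocks are the partial sums of parities of the sequence. -/
lemma pot_cycSeq (hg : IsCycle n g) (h : IsCyc n m φ) (j : ℤ) :
    pot m (cycSeq n φ g) j = pot n g (φ j) + pot n g (φ (-1)) := by
  have step : ∀ j : ℤ, pot m (cycSeq n φ g) (j + 1) + pot n g (φ (j + 1)) =
      pot m (cycSeq n φ g) j + pot n g (φ j) := by
    intro j
    rw [pot_succ, perSeq_cycSeq h, block_par hg, h.toNat (by omega), add_sub_cancel_right]
    have := zmod2_add_self (pot n g (φ (j + 1)))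
    linear_combination this
  have key : pot m (cycSeq n φ g) j + pot n g (φ j) =
      pot m (cycSeq n φ g) (-1) + pot n g (φ (-1)) := by
    induction j using Int.induction_on with
    | zero => simpa using step (-1)
    | succ i ih => rw [step, ih]
    | pred i ih => rw [← ih, ← step, sub_add_cancel]
  rw [pot_neg_one, zero_add] at key
  have := zmod2_add_self (pot n g (φ j))
  linear_combination key - this

lemma parSum_cycSeq (hg : IsCycle n g) (h : IsCyc n m φ) :
    parSum (m + 1) (cycSeq n φ g) = parSum (n + 1) g := by
  rw [← pot_of_le (n := m) _ le_rfl, pot_cycSeq hg h, show (m : ℤ) = -1 + (m + 1) by ring,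
    h.per_one]
  have := pot_add n g (φ (-1)) 1
  rw [mul_one] at this
  rw [this]
  have := zmod2_add_self (pot n g (φ (-1)))
  push_cast
  linear_combination this

lemma block_cycSeq (hg : IsCycle n g) (h : IsCyc n m φ) (a : ℤ) (d : ℕ) :
    block (perSeq m (cycSeq n φ g)) a d =
      block (perSeq n g) (φ a) (φ (a + d) - φ a).toNat := by
  induction d with
  | zero =>
    rw [block, perSeq_cycSeq h, block_src]
    simp [block]
  | succ d ih =>
    rw [block, ih, perSeq_cycSeq h]
    have h1 := h.mono a (a + d) (by omega)
    have h2 := h.mono (a + d) (a + d + 1) (by omega)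
    have h3 := h.toNat (show a ≤ a + d by omega)
    have := block_add hg.chainable (φ a) (φ (a + d) - φ a).toNat (φ (a + d + 1) - φ (a + d)).toNat
    rw [h3] at this
    rw [add_sub_cancel_right, this]
    push_cast
    rw [← add_assoc a]
    congr 1
    omega

/-- The sign exponent of the cyclic operator of `φ`. -/
def cycSign (n : ℕ) (φ : ℤ → ℤ) (g : ℕ → HArr K C) : ZMod 2 :=
  pot n g (φ (-1)) * (parSum (n + 1) g + 1)

/-- The signed sequence of blocks is multilinear in the entries: each entry lies in precisely one of
the blocks, because the blocks cover one period. -/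
lemma cycSeq_multi (h : IsCyc n m φ) : IsMulti n (fun g : ℕ → HArr K C =>
    ksgn K (cycSign n φ g) • cls m (cycSeq n φ g)) := by
  refine isMulti_cls _ _ ?_ ?_
  · intro F F' e
    have e1 : parSum (n + 1) F' = parSum (n + 1) F := parSum_congr fun j hj => e j (by omega)
    unfold cycSign pot
    rw [e1, parSum_congr (m := (φ (-1) % (n + 1)).toNat + 1) fun j hj => e j ?_]
    have := Int.emod_lt_of_pos (φ (-1)) (show (0 : ℤ) < n + 1 by omega)
    omega
  · intro c F F' F'' k hk h1 h2 hc
    have hsrc : ∀ j, j ≤ n → (F' j).src = (F j).src ∧ (F'' j).src = (F j).src := by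
      intro j hj
      by_cases e : j = k
      · subst e; exact ⟨h2.props.1.1, h2.props.2.1⟩
      · rw [(h1 j hj e).1, (h1 j hj e).2]; exact ⟨rfl, rfl⟩
    have hs : ∀ i, (perSeq n F' i).src = (perSeq n F i).src ∧
        (perSeq n F'' i).src = (perSeq n F i).src := by
      intro i
      obtain ⟨r, q, hr, rfl⟩ := per_cases n i
      simp only [perSeq_add, perSeq_of_lt _ hr]
      exact hsrc r hr
    -- the position congruent to `k` in the window that is covered by the blocks
    obtain ⟨j, hj1, hj2, q, hjk⟩ : ∃ j, φ (-1) < j ∧ j ≤ φ m ∧ ∃ q, j = k + (n + 1) * q := by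
      have a1 := Int.emod_nonneg (k - φ (-1) - 1) (show (n + 1 : ℤ) ≠ 0 by omega)
      have a2 := Int.emod_lt_of_pos (k - φ (-1) - 1) (show (0 : ℤ) < n + 1 by omega)
      have a3 := Int.emod_add_mul_ediv (k - φ (-1) - 1) (n + 1)
      have a4 := h.per_one (-1)
      rw [show -1 + ((m : ℤ) + 1) = m by ring] at a4
      refine ⟨φ (-1) + 1 + (k - φ (-1) - 1) % (n + 1), by omega, by omega,
        -((k - φ (-1) - 1) / (n + 1)), ?_⟩
      linear_combination a3
    -- the window has the length of one period, so no other position in it is congruent to `k`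
    have hne : ∀ i, φ (-1) < i → i ≤ φ m → i ≠ j →
        perSeq n F'' i = perSeq n F i ∧ perSeq n F' i = perSeq n F i := by
      intro i i1 i2 ij
      obtain ⟨r, q', hr, rfl⟩ := per_cases n i
      simp only [perSeq_add, perSeq_of_lt _ hr]
      refine h1 r hr fun e => ij ?_
      subst e
      have a4 := h.per_one (-1)
      rw [show -1 + ((m : ℤ) + 1) = m by ring] at a4
      have b1 : ((n : ℤ) + 1) * (q' - q) < n + 1 := by
        rw [mul_sub]; omega
      have b2 : ((n : ℤ) + 1) * (q - q') < n + 1 := by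
        rw [mul_sub]; omega
      have b3 : q' - q < 1 := by
        by_contra hcon
        have := mul_le_mul_of_nonneg_left (not_lt.1 hcon) (show (0 : ℤ) ≤ n + 1 by omega)
        omega
      have b4 : q - q' < 1 := by
        by_contra hcon
        have := mul_le_mul_of_nonneg_left (not_lt.1 hcon) (show (0 : ℤ) ≤ n + 1 by omega)
        omega
      rw [hjk, show q' = q by omega]
    have hr : LinRel c (perSeq n F j) (perSeq n F' j) (perSeq n F'' j) := by
      rw [hjk]
      simp only [perSeq_add, perSeq_of_lt _ hk]
      exact h2
    -- the block that contains `j` is the first one that ends at `j` or later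
    have hex : ∃ l : ℕ, j ≤ φ l := ⟨m, hj2⟩
    classical
    have l1 : j ≤ φ (Nat.find hex) := Nat.find_spec hex
    have l2 : Nat.find hex ≤ m := Nat.find_min' hex hj2
    have l3 : φ ((Nat.find hex : ℕ) - 1) < j := by
      rcases Nat.eq_zero_or_pos (Nat.find hex) with e | e
      · rw [e]; simpa using hj1
      · have := Nat.find_min hex (m := Nat.find hex - 1) (by omega)
        rw [Nat.cast_sub e] at this
        push_cast at this
        omega
    refine ⟨Nat.find hex, l2, ?_, ?_⟩
    · intro l hl hlne
      have w1 := h.mono (-1) (l - 1) (by omega)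
      have w2 := h.mono l m (by omega)
      have w3 := h.toNat (show (l : ℤ) - 1 ≤ l by omega)
      have out : ∀ i, φ (l - 1) < i → i ≤ φ l → i ≠ j := by
        rintro i i1 i2 rfl
        rcases lt_or_gt_of_ne hlne with hlt | hgt
        · exact Nat.find_min hex hlt i2
        · have := h.mono (Nat.find hex) (l - 1) (by omega)
          omega
      exact ⟨block_congr (hs _).2 fun i i1 i2 => (hne i (by omega) (by omega) (out i i1 (by omega))).1,
        block_congr (hs _).1 fun i i1 i2 => (hne i (by omega) (by omega) (out i i1 (by omega))).2⟩
    · have w1 := h.mono (-1) ((Nat.find hex : ℕ) - 1) (by omega)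
      have w2 := h.mono (Nat.find hex) m (by omega)
      have w3 := h.toNat (show (Nat.find hex : ℤ) - 1 ≤ Nat.find hex by omega)
      exact block_linRel hc.chainable (hs _).1 (hs _).2 l3 (by omega)
        (fun i i1 i2 ij => hne i (by omega) (by omega) ij) hr

end CycSeq

open Classical in
/-- The operator `C_n ⟶ C_m` of an increasing equivariant map `φ : ℤ → ℤ`: it composes the
morphisms in each block (and it is zero if `φ` is not such a map). -/
def op (n m : ℕ) (φ : ℤ → ℤ) : NChain K C n →ₗ[K] NChain K C m :=
  if h : IsCyc n m φ then
    lift n (fun g => ksgn K (cycSign n φ g) • cls m (cycSeq n φ g)) (cycSeq_multi h)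
  else 0

lemma op_cls {n m : ℕ} {φ : ℤ → ℤ} (h : IsCyc n m φ) {g : ℕ → HArr K C} (hg : IsCycle n g) :
    op n m φ (cls n g) = ksgn K (cycSign n φ g) • cls m (cycSeq n φ g) := by
  rw [op, dif_pos h, lift_cls _ hg]

/-- The operators are functorial in `φ`, signs included. -/
lemma op_op {n m k : ℕ} {φ ψ : ℤ → ℤ} (h : IsCyc n m φ) (h' : IsCyc m k ψ) (x : NChain K C n) :
    op m k ψ (op n m φ x) = op n k (φ ∘ ψ) x := by
  suffices e : op m k ψ ∘ₗ op n m φ = (op n k (φ ∘ ψ) : NChain K C n →ₗ[K] _) from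
    LinearMap.congr_fun e x
  refine chain_ext fun g hg => ?_
  rw [LinearMap.comp_apply, op_cls h hg, map_smul, op_cls h' (hg.cycSeq h), smul_smul, ← ksgn_add,
    op_cls (h.comp h') hg]
  refine congrArg₂ (· • ·) (congrArg (ksgn K) ?_) (cls_congr fun l hl => ?_)
  · unfold cycSign
    rw [pot_cycSeq hg h, parSum_cycSeq hg h, Function.comp_apply]
    have := zmod2_add_self (pot n g (φ (-1)) * (parSum (n + 1) g + 1))
    linear_combination this
  · rw [cycSeq, block_cycSeq hg h, h'.toNat (by omega)]
    rfl

end CyclicOperators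

/-! ### Operators of words of integers -/

section WordOperators

/-- The equivariant map `ℤ → ℤ` with values `l` on `0, …, m`. -/
def ext (n m : ℕ) (l : List ℤ) (k : ℤ) : ℤ :=
  l.getD (k % (m + 1)).toNat 0 + (n + 1) * (k / (m + 1))

lemma ext_add (n m : ℕ) (l : List ℤ) (k q : ℤ) :
    ext n m l (k + (m + 1) * q) = ext n m l k + (n + 1) * q := by
  rw [ext, ext, Int.add_mul_ediv_left _ _ (by omega), Int.add_mul_emod_self_left]
  ring

lemma ext_of_le {n m : ℕ} (l : List ℤ) {r : ℕ} (hr : r ≤ m) : ext n m l r = l.getD r 0 := by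
  rw [ext, Int.ediv_eq_zero_of_lt (by omega) (by omega), Int.emod_eq_of_lt (by omega) (by omega),
    Int.toNat_natCast]
  ring

/-- The word `l` is increasing and spans at most one period. -/
def Good (n : ℕ) (l : List ℤ) : Prop := l.Pairwise (· ≤ ·) ∧ ∀ a ∈ l, ∀ b ∈ l, b ≤ a + (n + 1)

lemma Good.sublist {n : ℕ} {l l' : List ℤ} (h : Good n l) (hs : l'.Sublist l) : Good n l' :=
  ⟨h.1.sublist hs, fun a ha b hb => h.2 a (hs.subset ha) b (hs.subset hb)⟩

lemma isCyc_ext {n m : ℕ} {l : List ℤ} (h : Good n l) (hl : l.length = m + 1) :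
    IsCyc n m (ext n m l) := by
  refine ⟨fun a b hab => ?_, ext_add n m l⟩
  refine monotone_int_of_le_succ (fun k => ?_) hab
  obtain ⟨r, q, hr, rfl⟩ := per_cases m k
  rw [ext_add, ext_of_le l hr]
  rcases hr.lt_or_eq with h' | rfl
  · rw [add_right_comm, ext_add, ← Nat.cast_succ r, ext_of_le l h',
      List.getD_eq_getElem _ _ (by omega), List.getD_eq_getElem _ _ (by omega)]
    have := List.pairwise_iff_getElem.1 h.1 r (r + 1) (by omega) (by omega) (by omega)
    simp only [Nat.succ_eq_add_one]
    omega
  · rw [show (r : ℤ) + (r + 1) * q + 1 = (0 : ℕ) + (r + 1) * (q + 1) by push_cast; ring, ext_add,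
      ext_of_le l (Nat.zero_le _), List.getD_eq_getElem _ _ (by omega),
      List.getD_eq_getElem _ _ (by omega)]
    have := h.2 _ (List.getElem_mem (show 0 < l.length by omega)) _
      (List.getElem_mem (show r < l.length by omega))
    rw [mul_add]
    omega

lemma Good.map {n m : ℕ} {φ : ℤ → ℤ} (hφ : IsCyc n m φ) {l : List ℤ} (h : Good m l) :
    Good n (l.map φ) := by
  refine ⟨h.1.map _ hφ.mono, fun a ha b hb => ?_⟩
  obtain ⟨a, ha', rfl⟩ := List.mem_map.1 ha
  obtain ⟨b, hb', rfl⟩ := List.mem_map.1 hb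
  rw [← hφ.per_one]
  exact hφ.mono _ _ (h.2 a ha' b hb')

/-- The word `a, a + 1, …, a + N - 1`. -/
def iv (a : ℤ) (N : ℕ) : List ℤ := (List.range N).map fun k => a + (k : ℕ)

@[simp] lemma length_iv (a : ℤ) (N : ℕ) : (iv a N).length = N := by simp [iv]

@[simp] lemma iv_zero (a : ℤ) : iv a 0 = [] := rfl

lemma mem_iv {a x : ℤ} {N : ℕ} : x ∈ iv a N ↔ a ≤ x ∧ x < a + N := by
  simp only [iv, List.mem_map, List.mem_range]
  constructor
  · rintro ⟨k, hk, rfl⟩; omega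
  · rintro ⟨h1, h2⟩; exact ⟨(x - a).toNat, by omega, by omega⟩

@[simp] lemma getElem_iv (a : ℤ) (N k : ℕ) (h : k < (iv a N).length) : (iv a N)[k] = a + k := by
  simp [iv]

lemma iv_getD {a : ℤ} {N k : ℕ} (h : k < N) : (iv a N).getD k 0 = a + k := by
  rw [List.getD_eq_getElem _ _ (by simpa using h), getElem_iv]

lemma iv_succ (a : ℤ) (N : ℕ) : iv a (N + 1) = a :: iv (a + 1) N := by
  rw [iv, List.range_succ_eq_map, List.map_cons, List.map_map]
  simp only [iv, Nat.cast_zero, add_zero]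
  congr 1
  refine List.map_congr_left fun k _ => ?_
  simp only [Function.comp_apply]
  push_cast
  ring

lemma iv_succ' (a : ℤ) (N : ℕ) : iv a (N + 1) = iv a N ++ [a + N] := by
  simp [iv, List.range_succ]

lemma iv_append (a : ℤ) (M N : ℕ) : iv a (M + N) = iv a M ++ iv (a + M) N := by
  induction N with
  | zero => simp
  | succ N ih =>
    rw [← add_assoc, iv_succ', ih, iv_succ', List.append_assoc]
    push_cast
    rw [add_assoc a]

lemma iv_map_add (a b : ℤ) (N : ℕ) : (iv a N).map (· + b) = iv (a + b) N := by
  rw [iv, iv, List.map_map]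
  refine List.map_congr_left fun k _ => ?_
  simp only [Function.comp_apply]
  ring

lemma iv_pairwise (a : ℤ) (N : ℕ) : (iv a N).Pairwise (· < ·) := by
  rw [iv, List.pairwise_map]
  exact List.pairwise_lt_range.imp fun h => by omega

lemma good_iv {n : ℕ} (a : ℤ) {N : ℕ} (h : N ≤ n + 2) : Good n (iv a N) := by
  refine ⟨(iv_pairwise a N).imp fun h => h.le, fun x hx y hy => ?_⟩
  rw [mem_iv] at hx hy
  omega

lemma isCyc_add (n : ℕ) (j : ℤ) : IsCyc n n (· + j) :=
  ⟨fun a b h => by simpa using h, fun a q => by ring⟩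

lemma isCyc_id (n : ℕ) : IsCyc n n id := ⟨fun _ _ h => h, fun _ _ => rfl⟩

variable {K : Type w} [Field K] {C : Type u} [Category.{v} C] [Preadditive C]
    [Linear K C] [SuperCategory K C]

/-- The operator `C_n ⟶ C_m` of a word of `m + 1` integers. -/
def opL (n m : ℕ) (l : List ℤ) : NChain K C n →ₗ[K] NChain K C m := op n m (ext n m l)

lemma op_eq_opL {n m : ℕ} {φ : ℤ → ℤ} (h : IsCyc n m φ) {l : List ℤ} (hl : l.length = m + 1)
    (hG : Good n l) (e : ∀ r : ℕ, r ≤ m → φ r = l.getD r 0) :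
    (op n m φ : NChain K C n →ₗ[K] _) = opL n m l := by
  rw [opL, h.ext (isCyc_ext hG hl) fun r hr => by rw [e r hr, ext_of_le l hr]]

lemma getD_map_of_lt {α β : Type*} (f : α → β) (l : List α) {r : ℕ} (hr : r < l.length) (x : α)
    (y : β) : (l.map f).getD r y = f (l.getD r x) := by
  rw [List.getD_eq_getElem _ _ (by simpa using hr), List.getD_eq_getElem _ _ hr, List.getElem_map]

/-- Composing operators means substituting in words. -/
lemma opL_op {n n' m : ℕ} {φ : ℤ → ℤ} (h : IsCyc n n' φ) {l : List ℤ} (hl : l.length = m + 1)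
    (hG : Good n' l) (x : NChain K C n) : opL n' m l (op n n' φ x) = opL n m (l.map φ) x := by
  rw [opL, op_op h (isCyc_ext hG hl), op_eq_opL (h.comp (isCyc_ext hG hl)) (by simpa using hl)
    (hG.map h)]
  intro r hr
  rw [Function.comp_apply, ext_of_le l hr, getD_map_of_lt _ _ (by omega) 0]

lemma cycSign_eq_zero {n : ℕ} {φ : ℤ → ℤ} (h : φ (-1) = -1) (g : ℕ → HArr K C) :
    cycSign n φ g = 0 := by
  rw [cycSign, h, pot_neg_one, zero_mul]

lemma op_id (n : ℕ) : (op n n id : NChain K C n →ₗ[K] _) = LinearMap.id := by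
  refine chain_ext fun g hg => ?_
  rw [op_cls (isCyc_id n) hg, cycSign_eq_zero rfl, ksgn_zero, one_smul, LinearMap.id_apply]
  refine cls_congr fun j hj => ?_
  rw [cycSeq, id, id, show ((j : ℤ) - (j - 1)).toNat = 1 by omega, block_one, sub_add_cancel,
    perSeq_of_lt g hj]

lemma opL_iv (n : ℕ) : (opL n n (iv 0 (n + 1)) : NChain K C n →ₗ[K] _) = LinearMap.id := by
  rw [← op_id, op_eq_opL (isCyc_id n) (length_iv 0 (n + 1)) (good_iv 0 (by omega))]
  intro r hr
  rw [iv_getD (by omega)]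
  simp

/-- Translating an operator by a full period does not change it. -/
lemma op_add_period {n m : ℕ} {φ : ℤ → ℤ} (h : IsCyc n m φ) :
    (op n m (fun k => φ k + (n + 1)) : NChain K C n →ₗ[K] _) = op n m φ := by
  have h' : IsCyc n m (fun k => φ k + (n + 1)) := (isCyc_add n (n + 1)).comp h
  refine chain_ext fun g hg => ?_
  rw [op_cls h' hg, op_cls h hg]
  refine congrArg₂ (· • ·) (congrArg (ksgn K) ?_) (cls_congr fun l hl => ?_)
  · have := pot_add n g (φ (-1)) 1
    rw [mul_one] at this
    rw [cycSign, cycSign, this]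
    have h1 := zmod2_sq (parSum (n + 1) g)
    have h2 := zmod2_add_self (parSum (n + 1) g)
    push_cast
    linear_combination h1 + h2
  · rw [cycSeq, cycSeq, add_sub_add_right_eq_sub]
    refine block_shift (fun i => ?_) _
    have := perSeq_add n g (φ (l - 1) + i) 1
    rw [mul_one] at this
    rw [add_right_comm, this]

lemma opL_add_period {n m : ℕ} {l : List ℤ} (hl : l.length = m + 1) (hG : Good n l) :
    (opL n m (l.map (· + ((n : ℤ) + 1))) : NChain K C n →ₗ[K] _) = opL n m l := by
  have h := isCyc_ext hG hl
  rw [opL, opL, ← op_add_period h]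
  congr 1
  refine (isCyc_ext (hG.map (isCyc_add n (n + 1))) (by simpa using hl)).ext
    ((isCyc_add n (n + 1)).comp h) fun r hr => ?_
  rw [ext_of_le _ hr, getD_map_of_lt _ _ (by omega) 0, ext_of_le _ hr]

/-- A repetition in the word gives an empty block, hence an identity among the entries. -/
lemma opL_mem_degen {n m : ℕ} {l : List ℤ} (hl : l.length = m + 1) (hG : Good n l)
    (hr : HasRepeat l) (x : NChain K C n) : opL n m l x ∈ degen K C m := by
  obtain ⟨l₁, a, l₂, rfl⟩ := hr
  suffices e : (degen K C m).mkQ ∘ₗ opL n m (l₁ ++ a :: a :: l₂) = 0 by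
    simpa using LinearMap.congr_fun e x
  refine chain_ext fun g hg => ?_
  have h := isCyc_ext hG hl
  simp only [LinearMap.comp_apply, LinearMap.zero_apply, Submodule.mkQ_apply,
    Submodule.Quotient.mk_eq_zero, opL]
  rw [op_cls h hg]
  simp only [List.length_append, List.length_cons] at hl
  refine Submodule.smul_mem _ _ (cls_mem_degen (hg.cycSeq h) (l₁.length + 1) (by omega) (by omega)
    (X := (perSeq n g (a + 1)).src) ?_)
  have e1 : ext n m (l₁ ++ a :: a :: l₂) (l₁.length : ℕ) = a := by
    rw [ext_of_le _ (by omega)]; simp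
  have e2 : ext n m (l₁ ++ a :: a :: l₂) (l₁.length + 1 : ℕ) = a := by
    rw [ext_of_le _ (by omega), List.getD_append_right _ _ _ _ (by omega)]; simp
  rw [cycSeq, show ((l₁.length + 1 : ℕ) : ℤ) - 1 = (l₁.length : ℕ) by push_cast; ring, e1, e2,
    sub_self]
  rfl

/-! #### The simplicial and cyclic operators -/

/-- The face operators are the operators of the injections of the simplicial category. -/
lemma face_eq_op {n i : ℕ} (hi : i ≤ n + 1) {φ : ℤ → ℤ} (h : IsCyc (n + 1) n φ)
    (e : ∀ r : ℕ, r ≤ n → φ r = if r < i then (r : ℤ) else r + 1) :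
    (face n i : NChain K C (n + 1) →ₗ[K] _) = op (n + 1) n φ := by
  refine chain_ext fun g hg => ?_
  have h1 : φ (-1) = if n < i then -2 else -1 := by
    have h1 := h.per_one (-1)
    rw [show (-1 : ℤ) + (n + 1) = n by ring, e n le_rfl] at h1
    push_cast at h1
    split_ifs at h1 ⊢ <;> omega
  rw [face_cls i hg, op_cls h hg]
  refine congrArg₂ (· • ·) (congrArg (ksgn K) ?_) (cls_congr fun l hl => ?_)
  · rw [faceSign_eq]
    by_cases hin : n < i
    · rw [if_pos hin] at h1
      rw [if_neg (by omega), cycSign, h1,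
        show (-2 : ℤ) = n + ((n + 1 : ℕ) + 1) * (-1) by push_cast; ring, pot_eq g (by omega)]
      have h3 : parSum (n + 1 + 1) g = parSum (n + 1) g + (g (n + 1)).par :=
        Finset.sum_range_succ _ _
      have h4 := zmod2_add_self (g (n + 1)).par
      rw [h3]
      push_cast
      linear_combination (parSum (n + 1) g + (g (n + 1)).par + 1) * h4
    · rw [if_neg hin] at h1
      rw [if_pos (by omega), cycSign_eq_zero h1]
  · have e0 : φ ((l : ℤ) - 1) = if l = 0 then (if n < i then -2 else -1) else
        if l - 1 < i then (l : ℤ) - 1 else l := by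
      split_ifs with h0 hn hl'
      · subst h0; simpa [hn] using h1
      · subst h0; simpa [hn] using h1
      · rw [show (l : ℤ) - 1 = (l - 1 : ℕ) by omega, e _ (by omega), if_pos hl']
      · rw [show (l : ℤ) - 1 = (l - 1 : ℕ) by omega, e _ (by omega), if_neg hl']; omega
    have two : ∀ a : ℤ, block (perSeq (n + 1) g) a 2 =
        (perSeq (n + 1) g (a + 1)).comp (perSeq (n + 1) g (a + 2)) := fun a => by
      have := block_one (h := perSeq (n + 1) g) a
      rw [block, this]
      push_cast
      rw [add_assoc]
      rfl
    rw [cycSeq, e0, e l hl]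
    unfold faceSeq
    by_cases hin : i ≤ n
    · rw [if_pos hin]
      rcases lt_trichotomy l i with hlt | rfl | hgt
      · have : (if l = 0 then (if n < i then -2 else -1 : ℤ) else
            if l - 1 < i then (l : ℤ) - 1 else l) = l - 1 := by
          split_ifs <;> omega
        rw [this, if_pos hlt, if_pos hlt, show ((l : ℤ) - (l - 1)).toNat = 1 by omega, block_one,
          sub_add_cancel, perSeq_of_lt g (by omega)]
      · have : (if l = 0 then (if n < l then -2 else -1 : ℤ) else
            if l - 1 < l then (l : ℤ) - 1 else l) = l - 1 := by
          split_ifs <;> omega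
        rw [this, if_neg (lt_irrefl _), if_neg (lt_irrefl _), if_pos rfl,
          show ((l : ℤ) + 1 - (l - 1)).toNat = 2 by omega, two, sub_add_cancel,
          show (l : ℤ) - 1 + 2 = (l + 1 : ℕ) by push_cast; ring, perSeq_of_lt g (by omega),
          perSeq_of_lt g (by omega)]
      · have : (if l = 0 then (if n < i then -2 else -1 : ℤ) else
            if l - 1 < i then (l : ℤ) - 1 else l) = l := by
          split_ifs <;> omega
        rw [this, if_neg (by omega), if_neg (by omega), if_neg (by omega),
          show ((l : ℤ) + 1 - l).toNat = 1 by omega, block_one, ← Nat.cast_succ,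
          perSeq_of_lt g (by omega)]
    · rw [if_neg hin, if_pos (show n < i by omega), if_pos (show l < i by omega)]
      by_cases h0 : l = 0
      · subst h0
        rw [if_pos rfl, if_pos rfl, show (((0 : ℕ) : ℤ) - -2).toNat = 2 by omega, two,
          show (-2 : ℤ) + 1 = (n + 1 : ℕ) + ((n + 1 : ℕ) + 1) * (-1) by push_cast; ring,
          show (-2 : ℤ) + 2 = (0 : ℕ) by rfl, perSeq_add, perSeq_of_lt g (by omega),
          perSeq_of_lt g (by omega)]
      · rw [if_neg h0, if_neg h0, if_pos (by omega), show ((l : ℤ) - (l - 1)).toNat = 1 by omega,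
          block_one, sub_add_cancel, perSeq_of_lt g (by omega)]

lemma iv_eraseIdx_getD {N i r : ℕ} (hr : r + 1 < N) :
    ((iv 0 N).eraseIdx i).getD r 0 = if r < i then (r : ℤ) else r + 1 := by
  have hlen : N - 1 ≤ ((iv 0 N).eraseIdx i).length := by
    have := List.length_eraseIdx_add_one (l := iv 0 N) (i := i)
    rw [List.length_eraseIdx]
    split_ifs <;> simp
  rw [List.getD_eq_getElem _ _ (by omega), List.getElem_eraseIdx]
  split_ifs <;> simp

lemma face_eq_opL {n i : ℕ} (hi : i ≤ n + 1) :
    (face n i : NChain K C (n + 1) →ₗ[K] _) = opL (n + 1) n ((iv 0 (n + 2)).eraseIdx i) := by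
  have hG : Good (n + 1) ((iv 0 (n + 2)).eraseIdx i) :=
    (good_iv (n := n + 1) 0 (by omega)).sublist (List.eraseIdx_sublist _ _)
  have hl : ((iv 0 (n + 2)).eraseIdx i).length = n + 1 := by
    rw [List.length_eraseIdx_of_lt (by simp; omega)]; simp
  refine face_eq_op hi (isCyc_ext hG hl) fun r hr => ?_
  rw [ext_of_le _ hr, iv_eraseIdx_getD (by omega)]

/-- A face of the operator of a word is the operator of the word without a letter. -/
lemma face_opL {n m i : ℕ} (hi : i ≤ m + 1) {l : List ℤ} (hl : l.length = m + 2)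
    (hG : Good n l) (x : NChain K C n) :
    face m i (opL n (m + 1) l x) = opL n m (l.eraseIdx i) x := by
  have hGi : Good (m + 1) ((iv 0 (m + 2)).eraseIdx i) :=
    (good_iv (n := m + 1) 0 (by omega)).sublist (List.eraseIdx_sublist _ _)
  have hli : ((iv 0 (m + 2)).eraseIdx i).length = m + 1 := by
    rw [List.length_eraseIdx_of_lt (by simp; omega)]; simp
  have hle : (l.eraseIdx i).length = m + 1 := by
    rw [List.length_eraseIdx_of_lt (by omega)]; omega
  rw [face_eq_opL hi]
  nth_rw 2 [opL]
  rw [opL_op (isCyc_ext hG hl) hli hGi]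
  congr 2
  refine List.ext_getElem (by simp [hli, hle]) fun r h1 h2 => ?_
  rw [hle] at h2
  have e := iv_eraseIdx_getD (N := m + 2) (i := i) (r := r) (by omega)
  rw [List.getD_eq_getElem _ _ (by omega)] at e
  rw [List.getElem_map, e, List.getElem_eraseIdx]
  split_ifs
  · rw [ext_of_le _ (by omega), List.getD_eq_getElem _ _ (by omega)]
  · rw [← Nat.cast_succ, ext_of_le _ (by omega), List.getD_eq_getElem _ _ (by omega)]

/-- The cyclic operator `t` is, up to its sign `(-1)^n`, the operator of the translation by `-1`. -/
lemma op_sub_one (n : ℕ) : (op n n (· + (-1)) : NChain K C n →ₗ[K] _) = ksgn K n • rot n := by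
  refine chain_ext fun g hg => ?_
  rw [op_cls (isCyc_add n (-1)) hg, LinearMap.smul_apply, rot_cls hg, smul_smul, ← ksgn_add]
  refine congrArg₂ (· • ·) (congrArg (ksgn K) ?_) (cls_congr fun l hl => ?_)
  · rw [last_sign, cycSign]
    have e : pot n g (-1 + -1) = (g n).par := by
      have := pot_succ n g (-1 + -1)
      rw [neg_add_cancel_right, pot_neg_one,
        show (-1 : ℤ) = n + (n + 1) * (-1) by ring, perSeq_add, perSeq_of_lt g le_rfl] at this
      have h2 := zmod2_add_self (g n).par
      rw [show (n : ℤ) + (n + 1) * (-1) = -1 by ring] at this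
      linear_combination -h2 - this
    rw [e, ← add_assoc, zmod2_add_self, zero_add]
  · rw [cycSeq, show ((l : ℤ) + -1 - (l - 1 + -1)).toNat = 1 by omega, block_one,
      neg_add_cancel_right]
    unfold rotSeq
    split_ifs with h0
    · subst h0
      rw [show ((0 : ℕ) : ℤ) - 1 = n + (n + 1) * (-1) by push_cast; ring, perSeq_add,
        perSeq_of_lt g le_rfl]
    · rw [show (l : ℤ) - 1 = (l - 1 : ℕ) by omega, perSeq_of_lt g (by omega)]

lemma op_sub (n i : ℕ) :
    (op n n (· + (-(i : ℤ))) : NChain K C n →ₗ[K] _) = ksgn K (n * i) • rot n ^ i := by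
  induction i with
  | zero =>
    rw [show (fun k : ℤ => k + -((0 : ℕ) : ℤ)) = id by funext k; simp, op_id]
    simp only [Nat.cast_zero, mul_zero, ksgn_zero, one_smul, pow_zero]
    rfl
  | succ i ih =>
    have : (op n n (· + (-((i + 1 : ℕ) : ℤ))) : NChain K C n →ₗ[K] _) =
        op n n (· + (-1)) ∘ₗ op n n (· + (-(i : ℤ))) := by
      ext x
      rw [LinearMap.comp_apply, op_op (isCyc_add n _) (isCyc_add n _)]
      congr 2
      funext k
      simp only [Function.comp_apply]
      push_cast
      ring
    rw [this, ih, op_sub_one, LinearMap.smul_comp, LinearMap.comp_smul, smul_smul, ← ksgn_add,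
      pow_succ', Module.End.mul_eq_comp]
    push_cast
    rw [mul_add, mul_one, add_comm]

lemma rot_pow_eq (n i : ℕ) :
    (rot n ^ i : NChain K C n →ₗ[K] _) = ksgn K (n * i) • op n n (· + (-(i : ℤ))) := by
  rw [op_sub, smul_smul, ksgn_sq, one_smul]

/-- The operator `s` is the operator of the word `-1, 0, …, n`. -/
lemma extra_eq_opL (n : ℕ) :
    (extra n : NChain K C n →ₗ[K] _) = opL n (n + 1) (iv (-1) (n + 2)) := by
  have hG : Good n (iv (-1) (n + 2)) := good_iv _ (by omega)
  have h := isCyc_ext hG (m := n + 1) (by simp)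
  have hm1 : ext n (n + 1) (iv (-1) (n + 2)) (-1) = -1 := by
    have h1 := h.per_one (-1)
    rw [show (-1 : ℤ) + ((n + 1 : ℕ) + 1) = (n + 1 : ℕ) by push_cast; ring, ext_of_le _ le_rfl,
      iv_getD (by omega)] at h1
    push_cast at h1
    omega
  refine chain_ext fun g hg => ?_
  rw [extra_cls hg, opL, op_cls h hg, cycSign_eq_zero hm1, ksgn_zero, one_smul]
  refine cls_congr fun l hl => ?_
  rw [cycSeq]
  rcases Nat.eq_zero_or_pos l with rfl | h0
  · rw [Nat.cast_zero, zero_sub, hm1]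
    have := ext_of_le (n := n) (m := n + 1) (iv (-1) (n + 2)) (Nat.zero_le _)
    rw [Nat.cast_zero] at this
    rw [this, iv_getD (by omega)]
    simp only [Nat.cast_zero, add_zero, sub_self, Int.toNat_zero, block, idSeq, if_true,
      neg_add_cancel]
    have := perSeq_of_lt (n := n) g (Nat.zero_le _)
    rw [Nat.cast_zero] at this
    rw [this]
  · rw [show (l : ℤ) - 1 = (l - 1 : ℕ) by omega, ext_of_le _ (by omega), ext_of_le _ (by omega),
      iv_getD (by omega), iv_getD (by omega), show ((-1 : ℤ) + l - (-1 + (l - 1 : ℕ))).toNat = 1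
      by omega, block_one, neg_add_cancel_comm, perSeq_of_lt g (by omega), idSeq,
      if_neg (by omega)]

end WordOperators

/-! ### Chains of a tensor product of categories -/

section PiTensor

variable {K : Type*} [Field K] {ι : Type*} [Fintype ι] {M N P : ι → Type*}
  [∀ i, AddCommGroup (M i)] [∀ i, Module K (M i)] [∀ i, AddCommGroup (N i)] [∀ i, Module K (N i)]
  [∀ i, AddCommGroup (P i)] [∀ i, Module K (P i)]

/-- Over a field, finite tensor products commute with binary tensor products. -/
def piTmul (e : ∀ i, (M i ⊗[K] N i) ≃ₗ[K] P i) :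
    ((⨂[K] i, M i) ⊗[K] (⨂[K] i, N i)) ≃ₗ[K] ⨂[K] i, P i :=
  ((Basis.piTensorProduct fun i => Module.Basis.ofVectorSpace K (M i)).tensorProduct
    (Basis.piTensorProduct fun i => Module.Basis.ofVectorSpace K (N i))).equiv
    (Basis.piTensorProduct fun i => ((Module.Basis.ofVectorSpace K (M i)).tensorProduct
      (Module.Basis.ofVectorSpace K (N i))).map (e i))
    { toFun := fun p i => (p.1 i, p.2 i)
      invFun := fun p => (fun i => (p i).1, fun i => (p i).2)
      left_inv := fun _ => rfl
      right_inv := fun _ => rfl }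

lemma piTmul_tmul (e : ∀ i, (M i ⊗[K] N i) ≃ₗ[K] P i) (x : ∀ i, M i) (y : ∀ i, N i) :
    piTmul e ((PiTensorProduct.tprod K x) ⊗ₜ[K] (PiTensorProduct.tprod K y)) =
      PiTensorProduct.tprod K fun i => e i (x i ⊗ₜ[K] y i) := by
  suffices h : (piTmul e).toLinearMap = TensorProduct.lift (PiTensorProduct.map₂ fun i =>
      (TensorProduct.mk K (M i) (N i)).compr₂ (e i).toLinearMap) by
    have := LinearMap.congr_fun h ((PiTensorProduct.tprod K x) ⊗ₜ[K] (PiTensorProduct.tprod K y))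
    rw [TensorProduct.lift.tmul, PiTensorProduct.map₂_tprod_tprod] at this
    exact this
  refine ((Basis.piTensorProduct fun i => Module.Basis.ofVectorSpace K (M i)).tensorProduct
    (Basis.piTensorProduct fun i => Module.Basis.ofVectorSpace K (N i))).ext fun p => ?_
  rw [LinearEquiv.coe_coe, piTmul, Module.Basis.equiv_apply, Module.Basis.tensorProduct_apply,
    Basis.piTensorProduct_apply, Basis.piTensorProduct_apply, Basis.piTensorProduct_apply,
    TensorProduct.lift.tmul, PiTensorProduct.map₂_tprod_tprod]
  congr 1
  funext i
  simp [Module.Basis.tensorProduct_apply]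

end PiTensor

section Twist

variable {K : Type w} [Field K]
  {A : Type u} [Category.{v} A] [Preadditive A] [Linear K A] [SuperCategory K A]
  {B : Type u'} [Category.{v'} B] [Preadditive B] [Linear K B] [SuperCategory K B]
  {M : Type*} [AddCommGroup M] [Module K M]

lemma chain_ext₂ {n m : ℕ} {f f' : NChain K A n →ₗ[K] NChain K B m →ₗ[K] M}
    (h : ∀ (a : ℕ → HArr K A) (b : ℕ → HArr K B), IsCycle n a → IsCycle m b →
      f (cls n a) (cls m b) = f' (cls n a) (cls m b)) : f = f' :=
  chain_ext fun a ha => chain_ext fun b hb => h a b ha hb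

lemma par_congr {n k : ℕ} {c : K} {F F' F'' : ℕ → HArr K A}
    (h1 : ∀ j, j ≤ n → j ≠ k → F'' j = F j ∧ F' j = F j) (h2 : LinRel c (F k) (F' k) (F'' k))
    (j : ℕ) (hj : j ≤ n) : (F' j).par = (F j).par ∧ (F'' j).par = (F j).par := by
  by_cases e : j = k
  · subst e; exact ⟨h2.props.1.2.2, h2.props.2.2.2⟩
  · rw [(h1 j hj e).1, (h1 j hj e).2]; exact ⟨rfl, rfl⟩

/-- A bilinear map of chains, twisted by a sign that depends on the parities of the entries. -/
lemma exists_twist (n m : ℕ) (s : (ℕ → HArr K A) → (ℕ → HArr K B) → ZMod 2)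
    (hs : ∀ a a' b b', (∀ j, j ≤ n → (a' j).par = (a j).par) →
      (∀ j, j ≤ m → (b' j).par = (b j).par) → s a' b' = s a b)
    (f : NChain K A n →ₗ[K] NChain K B m →ₗ[K] M) :
    ∃ f' : NChain K A n →ₗ[K] NChain K B m →ₗ[K] M, ∀ a b, IsCycle n a → IsCycle m b →
      f' (cls n a) (cls m b) = ksgn K (s a b) • f (cls n a) (cls m b) := by
  have hb : ∀ a, IsMulti m fun b => ksgn K (s a b) • f (cls n a) (cls m b) := by
    intro a c F F' F'' k hk h1 h2 hc
    have hp := par_congr h1 h2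
    dsimp only
    rw [hs a a F F' (fun _ _ => rfl) fun j hj => (hp j hj).1,
      hs a a F F'' (fun _ _ => rfl) fun j hj => (hp j hj).2, cls_lin hk h1 h2, map_add, map_smul,
      smul_add, smul_comm]
  have ha : IsMulti n fun a => (lift m (fun b => ksgn K (s a b) • f (cls n a) (cls m b)) (hb a) :
      NChain K B m →ₗ[K] M) := by
    intro c F F' F'' k hk h1 h2 hc
    have hp := par_congr h1 h2
    refine chain_ext fun b hcb => ?_
    rw [LinearMap.add_apply, LinearMap.smul_apply, lift_cls _ hcb, lift_cls _ hcb, lift_cls _ hcb,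
      hs F F' b b (fun j hj => (hp j hj).1) (fun _ _ => rfl),
      hs F F'' b b (fun j hj => (hp j hj).2) (fun _ _ => rfl), cls_lin hk h1 h2, map_add, map_smul,
      LinearMap.add_apply, LinearMap.smul_apply, smul_add, smul_comm]
  exact ⟨lift n _ ha, fun a b hca hcb => by rw [lift_cls _ hca, lift_cls _ hcb]⟩

end Twist

section Zip

variable {K : Type w} [Field K]
  {A : Type u} [Category.{v} A] [Preadditive A] [Linear K A] [SuperCategory K A]
  {B : Type u'} [Category.{v'} B] [Preadditive B] [Linear K B] [SuperCategory K B]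

/-- The morphisms of the tensor product category. -/
def tensorHom (X Y : SuperTensor K A B) :
    ((X.fst ⟶ Y.fst) ⊗[K] (X.snd ⟶ Y.snd)) ≃ₗ[K] (X ⟶ Y) where
  toFun x := x
  invFun x := x
  map_add' _ _ := rfl
  map_smul' _ _ := rfl
  left_inv _ := rfl
  right_inv _ := rfl

/-- The comparison of tensor products of morphism spaces, without signs. -/
def cellEquiv {n : ℕ} (X : Fin (n + 1) → SuperTensor K A B) :
    ((⨂[K] i : Fin (n + 1), ((X i).fst ⟶ (X (i + 1)).fst)) ⊗[K]
      (⨂[K] i : Fin (n + 1), ((X i).snd ⟶ (X (i + 1)).snd))) ≃ₗ[K]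
      ⨂[K] i : Fin (n + 1), (X i ⟶ X (i + 1)) :=
  piTmul fun i => tensorHom (X i) (X (i + 1))

/-- The comparison `(a₀, …, aₙ) ⊗ (b₀, …, bₙ) ↦ (a₀ ⊗ b₀, …, aₙ ⊗ bₙ)` without signs. -/
def zipUnsigned (n : ℕ) :
    NChain K A n →ₗ[K] NChain K B n →ₗ[K] NChain K (SuperTensor K A B) n :=
  NChain.desc fun X => LinearMap.flip <| NChain.desc fun Y =>
    ((TensorProduct.mk K (⨂[K] i : Fin (n + 1), (X i ⟶ X (i + 1)))
      (⨂[K] i : Fin (n + 1), (Y i ⟶ Y (i + 1)))).compr₂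
      (NChain.of (K := K) (fun i => (⟨X i, Y i⟩ : SuperTensor K A B)) ∘ₗ
        (cellEquiv fun i => (⟨X i, Y i⟩ : SuperTensor K A B)).toLinearMap)).flip

lemma zipUnsigned_of {n : ℕ} (X : Fin (n + 1) → A) (Y : Fin (n + 1) → B)
    (x : ⨂[K] i : Fin (n + 1), (X i ⟶ X (i + 1))) (y : ⨂[K] i : Fin (n + 1), (Y i ⟶ Y (i + 1))) :
    zipUnsigned n (NChain.of X x) (NChain.of Y y) =
      NChain.of (K := K) (fun i => (⟨X i, Y i⟩ : SuperTensor K A B))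
        (cellEquiv (fun i => (⟨X i, Y i⟩ : SuperTensor K A B)) (x ⊗ₜ[K] y)) := by
  rw [zipUnsigned, NChain.desc_of, LinearMap.flip_apply, NChain.desc_of]
  rfl

/-- The inverse of the comparison map. -/
def unzipUnsigned (n : ℕ) :
    NChain K (SuperTensor K A B) n →ₗ[K] NChain K A n ⊗[K] NChain K B n :=
  NChain.desc fun X => TensorProduct.map (NChain.of fun i => (X i).fst)
    (NChain.of fun i => (X i).snd) ∘ₗ (cellEquiv X).symm.toLinearMap

lemma unzipUnsigned_of {n : ℕ} (X : Fin (n + 1) → SuperTensor K A B)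
    (z : (⨂[K] i : Fin (n + 1), ((X i).fst ⟶ (X (i + 1)).fst)) ⊗[K]
      (⨂[K] i : Fin (n + 1), ((X i).snd ⟶ (X (i + 1)).snd))) :
    unzipUnsigned n (NChain.of (K := K) X (cellEquiv X z)) =
      TensorProduct.map (NChain.of fun i => (X i).fst) (NChain.of fun i => (X i).snd) z := by
  rw [unzipUnsigned, NChain.desc_of, LinearMap.comp_apply, LinearEquiv.coe_coe,
    LinearEquiv.symm_apply_apply]

lemma unzip_zip_unsigned (n : ℕ) (x : NChain K A n) (y : NChain K B n) :
    unzipUnsigned n (zipUnsigned n x y) = x ⊗ₜ[K] y := by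
  suffices h : (zipUnsigned n).compr₂ (unzipUnsigned n) =
      TensorProduct.mk K (NChain K A n) (NChain K B n) from
    LinearMap.congr_fun (LinearMap.congr_fun h x) y
  refine NChain.hom_ext fun X => LinearMap.ext fun x => NChain.hom_ext fun Y =>
    LinearMap.ext fun y => ?_
  simp only [LinearMap.comp_apply, LinearMap.compr₂_apply, TensorProduct.mk_apply]
  rw [zipUnsigned_of, unzipUnsigned, NChain.desc_of, LinearMap.comp_apply, LinearEquiv.coe_coe,
    LinearEquiv.symm_apply_apply, TensorProduct.map_tmul]

lemma zip_unzip_unsigned (n : ℕ) (z : NChain K (SuperTensor K A B) n) :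
    TensorProduct.lift (zipUnsigned n) (unzipUnsigned n z) = z := by
  suffices h : TensorProduct.lift (zipUnsigned n) ∘ₗ unzipUnsigned n =
      (LinearMap.id : NChain K (SuperTensor K A B) n →ₗ[K] _) from LinearMap.congr_fun h z
  refine NChain.hom_ext fun X => LinearMap.ext fun z => ?_
  obtain ⟨z, rfl⟩ := (cellEquiv X).surjective z
  simp only [LinearMap.comp_apply, LinearMap.id_apply]
  rw [unzipUnsigned_of]
  induction z using TensorProduct.induction_on with
  | zero => simp only [map_zero]
  | add z z' h h' => simp only [map_add, h, h']
  | tmul x y =>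
    rw [TensorProduct.map_tmul, TensorProduct.lift.tmul, zipUnsigned_of]

lemma IsCycle.tensor {n : ℕ} {a : ℕ → HArr K A} {b : ℕ → HArr K B} (ha : IsCycle n a)
    (hb : IsCycle n b) : IsCycle n fun i => (a i).tensor (b i) := by
  constructor
  · intro j hj
    simp only [HArr.tensor, ha.1 j hj, hb.1 j hj]
  · simp only [HArr.tensor, ha.2, hb.2]

lemma zipUnsigned_cls {n : ℕ} {a : ℕ → HArr K A} {b : ℕ → HArr K B} (ha : IsCycle n a)
    (hb : IsCycle n b) :
    zipUnsigned n (cls n a) (cls n b) = cls n fun i => (a i).tensor (b i) := by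
  rw [cls, dif_pos ha, cls, dif_pos hb, zipUnsigned_of, cellEquiv, piTmul_tmul]
  rw [cls_eq (fun i : Fin (n + 1) => (⟨(a i).src, (b i).src⟩ : SuperTensor K A B)) (fun i => rfl)
    (fun i => by simp only [HArr.tensor, ha.fin i, hb.fin i])]
  congr 2
  funext i
  have gen : ∀ (x : HArr K A) (y : HArr K B) (Z : A) (W : B) (h : x.tgt = Z) (h' : y.tgt = W)
      (h'' : (x.tensor y).tgt = ⟨Z, W⟩), ((x.hom ≫ eqToHom h) ⊗ₜ[K] (y.hom ≫ eqToHom h') :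
        (x.src ⟶ Z) ⊗[K] (y.src ⟶ W)) =
      (eqToHom (rfl : (⟨x.src, y.src⟩ : SuperTensor K A B) = (x.tensor y).src) ≫
        (x.tensor y).hom ≫ eqToHom h'' : (⟨x.src, y.src⟩ : SuperTensor K A B) ⟶ ⟨Z, W⟩) := by
    rintro x y Z W rfl rfl h''
    rw [eqToHom_refl, eqToHom_refl, Category.comp_id, Category.comp_id]
    change _ = 𝟙 (x.tensor y).src ≫ (x.tensor y).hom ≫ 𝟙 (x.tensor y).tgt
    rw [Category.comp_id, Category.id_comp]
    rfl
  exact gen _ _ _ _ _ _ _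

/-- The Koszul sign exponent of the reordering
`(a₀, …, aₙ, b₀, …, bₙ) ↦ (a₀, b₀, …, aₙ, bₙ)`. -/
def zipSign (n : ℕ) (a : ℕ → HArr K A) (b : ℕ → HArr K B) : ZMod 2 :=
  ∑ j ∈ Finset.range (n + 1), (a j).par * parSum j b

lemma zipSign_congr {n : ℕ} {a a' : ℕ → HArr K A} {b b' : ℕ → HArr K B}
    (ha : ∀ j, j ≤ n → (a' j).par = (a j).par) (hb : ∀ j, j ≤ n → (b' j).par = (b j).par) :
    zipSign n a' b' = zipSign n a b := by
  refine Finset.sum_congr rfl fun j hj => ?_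
  have := Finset.mem_range.1 hj
  rw [ha j (by omega), parSum_congr fun i hi => hb i (by omega)]

lemma zip_exists (n : ℕ) : ∃ f : NChain K A n →ₗ[K] NChain K B n →ₗ[K]
    NChain K (SuperTensor K A B) n, ∀ a b, IsCycle n a → IsCycle n b →
      f (cls n a) (cls n b) = ksgn K (zipSign n a b) • zipUnsigned n (cls n a) (cls n b) :=
  exists_twist n n (zipSign n) (fun _ _ _ _ h h' => zipSign_congr h h') _

/-- The comparison `(a₀, …, aₙ) ⊗ (b₀, …, bₙ) ↦ ± (a₀ ⊗ b₀, …, aₙ ⊗ bₙ)` with the Koszul sign. -/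
def zip (n : ℕ) : NChain K A n →ₗ[K] NChain K B n →ₗ[K] NChain K (SuperTensor K A B) n :=
  (zip_exists n).choose

lemma zip_cls {n : ℕ} {a : ℕ → HArr K A} {b : ℕ → HArr K B} (ha : IsCycle n a)
    (hb : IsCycle n b) : zip n (cls n a) (cls n b) =
      ksgn K (zipSign n a b) • cls n fun i => (a i).tensor (b i) := by
  rw [← zipUnsigned_cls ha hb]
  exact (zip_exists n).choose_spec a b ha hb

lemma unzip_exists (n : ℕ) : ∃ f : NChain K A n →ₗ[K] NChain K B n →ₗ[K]
    NChain K A n ⊗[K] NChain K B n, ∀ a b, IsCycle n a → IsCycle n b →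
      f (cls n a) (cls n b) = ksgn K (zipSign n a b) • TensorProduct.mk K (NChain K A n)
        (NChain K B n) (cls n a) (cls n b) :=
  exists_twist n n (zipSign n) (fun _ _ _ _ h h' => zipSign_congr h h') _

/-- The inverse of `zip`. -/
def unzip (n : ℕ) : NChain K (SuperTensor K A B) n →ₗ[K] NChain K A n ⊗[K] NChain K B n :=
  TensorProduct.lift (unzip_exists n).choose ∘ₗ unzipUnsigned n

lemma unzip_zip (n : ℕ) (x : NChain K A n) (y : NChain K B n) :
    unzip n (zip n x y) = x ⊗ₜ[K] y := by
  suffices h : (zip n).compr₂ (unzip n) = TensorProduct.mk K (NChain K A n) (NChain K B n) from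
    LinearMap.congr_fun (LinearMap.congr_fun h x) y
  refine chain_ext₂ fun a b ha hb => ?_
  rw [LinearMap.compr₂_apply, zip_cls ha hb, map_smul, ← zipUnsigned_cls ha hb, unzip,
    LinearMap.comp_apply, unzip_zip_unsigned, TensorProduct.lift.tmul,
    (unzip_exists n).choose_spec a b ha hb, smul_smul, ksgn_sq, one_smul]

lemma zip_unzip (n : ℕ) (z : NChain K (SuperTensor K A B) n) :
    TensorProduct.lift (zip n) (unzip n z) = z := by
  suffices h : TensorProduct.lift (zip (K := K) (A := A) (B := B) n) ∘ₗ
      TensorProduct.lift (unzip_exists n).choose = TensorProduct.lift (zipUnsigned n) by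
    have h' := LinearMap.congr_fun h (unzipUnsigned n z)
    rwa [zip_unzip_unsigned] at h'
  refine TensorProduct.ext (chain_ext₂ fun a b ha hb => ?_)
  change TensorProduct.lift _ (TensorProduct.lift _ (cls n a ⊗ₜ[K] cls n b)) =
    TensorProduct.lift _ (cls n a ⊗ₜ[K] cls n b)
  rw [TensorProduct.lift.tmul, TensorProduct.lift.tmul, (unzip_exists n).choose_spec a b ha hb,
    map_smul, TensorProduct.mk_apply, TensorProduct.lift.tmul, zip_cls ha hb, smul_smul, ksgn_sq,
    one_smul, zipUnsigned_cls ha hb]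

/-- Chains of the tensor product are sums of zipped chains. -/
lemma zip_induction {n : ℕ} {p : NChain K (SuperTensor K A B) n → Prop} (h0 : p 0)
    (hadd : ∀ z z', p z → p z' → p (z + z')) (hz : ∀ x y, p (zip n x y))
    (z : NChain K (SuperTensor K A B) n) : p z := by
  rw [← zip_unzip n z]
  induction unzip n z using TensorProduct.induction_on with
  | zero => rw [map_zero]; exact h0
  | add z z' h h' => rw [map_add]; exact hadd _ _ h h'
  | tmul x y => rw [TensorProduct.lift.tmul]; exact hz x y

/-! #### Naturality -/

lemma tensor_par (a : HArr K A) (b : HArr K B) : (a.tensor b).par = a.par + b.par := rfl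

lemma parSum_tensor (n : ℕ) (a : ℕ → HArr K A) (b : ℕ → HArr K B) :
    parSum n (fun i => (a i).tensor (b i)) = parSum n a + parSum n b := by
  simp only [parSum, tensor_par, Finset.sum_add_distrib]

/-- The comparison `zip` commutes with cyclic permutations. -/
lemma zip_rot (n : ℕ) (x : NChain K A n) (y : NChain K B n) :
    zip n (op n n (· + (-1)) x) (op n n (· + (-1)) y) = op n n (· + (-1)) (zip n x y) := by
  suffices h : (zip n).compl₁₂ (op n n (· + (-1))) (op n n (· + (-1))) =
      (zip (K := K) (A := A) (B := B) n).compr₂ (op n n (· + (-1))) from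
    LinearMap.congr_fun (LinearMap.congr_fun h x) y
  refine chain_ext₂ fun a b ha hb => ?_
  rw [LinearMap.compr₂_apply, LinearMap.compl₁₂_apply, zip_cls ha hb]
  simp only [op_sub_one, LinearMap.smul_apply, map_smul, rot_cls ha, rot_cls hb]
  rw [zip_cls ha.rot hb.rot, rot_cls (ha.tensor hb)]
  simp only [smul_smul, ← ksgn_add]
  refine congrArg₂ (· • ·) (congrArg (ksgn K) ?_) (cls_congr fun j hj => ?_)
  · rw [parSum_tensor, tensor_par, zipSign, zipSign, Finset.sum_range_succ', Finset.sum_range_succ]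
    have h1 : ∀ j, parSum (j + 1) (rotSeq n b) = (b n).par + parSum j b := by
      intro j
      rw [parSum, Finset.sum_range_succ', add_comm]
      simp [rotSeq, parSum]
    simp only [h1]
    have h2 : ∀ j : ℕ, (rotSeq n a (j + 1)).par = (a j).par := fun j => by simp [rotSeq]
    simp only [h2, mul_add, Finset.sum_add_distrib, ← Finset.sum_mul]
    have h3 : ∑ j ∈ Finset.range n, (a j).par = parSum n a := rfl
    have h4 : parSum 0 (rotSeq n b) = 0 := rfl
    rw [h3, h4]
    have h5 := zmod2_add_self (n : ZMod 2)
    have h6 := zmod2_add_self ((a n).par * parSum n b)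
    linear_combination h5 - h6
  · unfold rotSeq
    split_ifs <;> rfl

lemma zip_extra (n : ℕ) (x : NChain K A n) (y : NChain K B n) :
    zip (n + 1) (extra n x) (extra n y) = extra n (zip n x y) := by
  suffices h : (zip (n + 1)).compl₁₂ (extra n) (extra n) =
      (zip (K := K) (A := A) (B := B) n).compr₂ (extra n) from
    LinearMap.congr_fun (LinearMap.congr_fun h x) y
  refine chain_ext₂ fun a b ha hb => ?_
  rw [LinearMap.compr₂_apply, LinearMap.compl₁₂_apply, zip_cls ha hb, map_smul, extra_cls ha,
    extra_cls hb, zip_cls ha.extra hb.extra, extra_cls (ha.tensor hb)]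
  refine congrArg₂ (· • ·) (congrArg (ksgn K) ?_) (cls_congr fun j hj => ?_)
  · rw [zipSign, zipSign, Finset.sum_range_succ']
    have h1 : ∀ j, parSum (j + 1) (idSeq b) = parSum j b := by
      intro j
      rw [parSum, Finset.sum_range_succ']
      simp [idSeq, parSum, HArr.id]
    simp only [h1]
    simp [idSeq, parSum]
  · unfold idSeq
    split_ifs
    · exact HArr.tensor_id _ _
    · rfl

/-- The composition in the tensor product, with its Koszul sign, as a linear relation. -/
lemma tensor_comp_hom (a a' : HArr K A) (b b' : HArr K B) (h : a.tgt = a'.src)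
    (h' : b.tgt = b'.src) : LinRel (ksgn K (b.par * a'.par) - 1)
      ((a.comp a').tensor (b.comp b')) ((a.comp a').tensor (b.comp b'))
      ((a.tensor b).comp (a'.tensor b')) := by
  obtain ⟨s, t, p, f, hf⟩ := a
  obtain ⟨s', t', p', f', hf'⟩ := a'
  obtain ⟨S, T, P, g, hg⟩ := b
  obtain ⟨S', T', P', g', hg'⟩ := b'
  dsimp only at h h'
  subst h h'
  rw [HArr.comp_mk, HArr.comp_mk]
  have hm : (f ≫ f') ⊗ₜ[K] (g ≫ g') ∈ tensorGr (⟨s, S⟩ : SuperTensor K A B) ⟨t', T'⟩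
      ((p + p') + (P + P')) :=
    Submodule.subset_span ⟨_, _, _, _, SuperCategory.comp_mem hf hf', SuperCategory.comp_mem hg hg',
      rfl, rfl⟩
  have key := LinRel.mk (K := K) (C := SuperTensor K A B) (c := ksgn K (P * p') - 1) ⟨s, S⟩
    ⟨t', T'⟩ ((p + p') + (P + P')) ((f ≫ f') ⊗ₜ[K] (g ≫ g')) ((f ≫ f') ⊗ₜ[K] (g ≫ g')) hm hm
  have e1 := HArr.comp_mk (K := K) (C := SuperTensor K A B)
    (HArr.tensor (K := K) ⟨s, t, p, f, hf⟩ ⟨S, T, P, g, hg⟩).mem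
    (HArr.tensor (K := K) ⟨t, t', p', f', hf'⟩ ⟨T, T', P', g', hg'⟩).mem
  have e2 : tensorComp (K := K) (⟨s, S⟩ : SuperTensor K A B) ⟨t, T⟩ ⟨t', T'⟩ (f ⊗ₜ[K] g)
      (f' ⊗ₜ[K] g') = (ksgn K (P * p') - 1) • ((f ≫ f') ⊗ₜ[K] (g ≫ g')) +
        (f ≫ f') ⊗ₜ[K] (g ≫ g') := by
    rw [tensorComp_tmul (X := (⟨s, S⟩ : SuperTensor K A B)) (Y := ⟨t, T⟩) (Z := ⟨t', T'⟩) f g' hg hf',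
      sub_smul, one_smul, sub_add_cancel]
  have e3 := e1.trans (HArr.mk_congr (K := K) (C := SuperTensor K A B) (X := ⟨s, S⟩) (Y := ⟨t', T'⟩)
    (show p + P + (p' + P') = p + p' + (P + P') by ring) e2 (h' :=
      Submodule.add_mem _ (Submodule.smul_mem _ _ hm) hm))
  exact e3 ▸ key

/-- The Koszul sign of the composition in the tensor product is the one by which the signs of `zip`
in consecutive degrees differ. -/
lemma zip_face_zero (n : ℕ) (x : NChain K A (n + 1)) (y : NChain K B (n + 1)) :
    zip n (face n 0 x) (face n 0 y) = face n 0 (zip (n + 1) x y) := by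
  suffices h : (zip n).compl₁₂ (face n 0) (face n 0) =
      (zip (K := K) (A := A) (B := B) (n + 1)).compr₂ (face n 0) from
    LinearMap.congr_fun (LinearMap.congr_fun h x) y
  refine chain_ext₂ fun a b ha hb => ?_
  have ht := tensor_comp_hom (a 0) (a 1) (b 0) (b 1) (ha.1 0 (by omega)) (hb.1 0 (by omega))
  rw [LinearMap.compr₂_apply, LinearMap.compl₁₂_apply, zip_cls ha hb, map_smul, face_cls 0 ha,
    face_cls 0 hb, face_cls 0 (ha.tensor hb)]
  simp only [faceSign, if_pos (Nat.zero_le n), ksgn_zero, one_smul]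
  rw [zip_cls (ha.face 0) (hb.face 0)]
  have e := cls_lin (K := K) (n := n) (c := ksgn K ((b 0).par * (a 1).par) - 1)
    (F := fun i => (faceSeq n 0 a i).tensor (faceSeq n 0 b i))
    (F' := fun i => (faceSeq n 0 a i).tensor (faceSeq n 0 b i))
    (F'' := faceSeq n 0 fun i => (a i).tensor (b i)) (k := 0) (Nat.zero_le _)
    (fun j hj hne => ⟨by simp [faceSeq, hne], rfl⟩)
    (by simpa [faceSeq] using ht)
  rw [e, sub_smul, one_smul, sub_add_cancel, smul_smul, ← ksgn_add]
  congr 2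
  rw [zipSign, zipSign, Finset.sum_range_succ', Finset.sum_range_succ' _ (n + 1),
    Finset.sum_range_succ' _ n]
  have h1 : ∀ j, parSum (j + 1) (faceSeq n 0 b) = parSum (j + 1 + 1) b := by
    intro j
    rw [parSum, Finset.sum_range_succ', parSum, Finset.sum_range_succ', Finset.sum_range_succ']
    have : (faceSeq n 0 b 0).par = (b 0).par + (b 1).par := by
      simp only [faceSeq, if_pos (Nat.zero_le n), lt_irrefl, if_false, if_true]
      exact HArr.comp_par (hb.1 0 (by omega))
    rw [this, add_assoc, add_comm (b 0).par]
    simp [faceSeq]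
  have h2 : ∀ j : ℕ, (faceSeq n 0 a (j + 1)).par = (a (j + 1 + 1)).par := fun j => by
    simp [faceSeq]
  simp only [h1, h2]
  have h3 := zmod2_add_self ((b 0).par * (a 1).par)
  simp only [parSum, Finset.range_zero, Finset.sum_empty, mul_zero, add_zero, zero_add,
    Finset.sum_range_one]
  linear_combination -h3

lemma zip_sub (n i : ℕ) (x : NChain K A n) (y : NChain K B n) :
    zip n (op n n (· + (-(i : ℤ))) x) (op n n (· + (-(i : ℤ))) y) =
      op n n (· + (-(i : ℤ))) (zip n x y) := by
  induction i with
  | zero =>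
    rw [show (fun k : ℤ => k + -((0 : ℕ) : ℤ)) = id by funext k; simp, op_id, op_id, op_id]
    rfl
  | succ i ih =>
    have e : (fun k : ℤ => k + -((i + 1 : ℕ) : ℤ)) = (· + -(i : ℤ)) ∘ (· + (-1)) := by
      funext k
      simp only [Function.comp_apply]
      push_cast
      ring
    rw [e, ← op_op (isCyc_add n _) (isCyc_add n _), ← op_op (isCyc_add n _) (isCyc_add n _),
      ← op_op (isCyc_add n _) (isCyc_add n _), zip_rot, ih]

lemma zip_add (n : ℕ) {i : ℕ} (hi : i ≤ n + 1) (x : NChain K A n) (y : NChain K B n) :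
    zip n (op n n (· + (i : ℤ)) x) (op n n (· + (i : ℤ)) y) =
      op n n (· + (i : ℤ)) (zip n x y) := by
  have e : (fun k : ℤ => k + (i : ℤ)) = fun k => (k + -((n + 1 - i : ℕ) : ℤ)) + (n + 1) := by
    funext k
    push_cast [Nat.cast_sub hi]
    ring
  rw [e, op_add_period (isCyc_add n _), op_add_period (isCyc_add n _),
    op_add_period (isCyc_add n _), zip_sub]

/-- Every face is conjugate to the first one by cyclic permutations. -/
lemma face_eq_comp {C : Type u} [Category.{v} C] [Preadditive C] [Linear K C] [SuperCategory K C]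
    {n i : ℕ} (hi : i ≤ n + 1) (x : NChain K C (n + 1)) :
    face n i x = op n n (· + (-(i : ℤ))) (face n 0 (op (n + 1) (n + 1) (· + (i : ℤ)) x)) := by
  have hG : Good (n + 1) ((iv 0 (n + 2)).eraseIdx 0) :=
    (good_iv (n := n + 1) 0 (by omega)).sublist (List.eraseIdx_sublist _ _)
  have hl : ((iv 0 (n + 2)).eraseIdx 0).length = n + 1 := by
    rw [List.length_eraseIdx_of_lt (by simp)]; simp
  have h0 := isCyc_ext hG hl
  rw [face_eq_opL (Nat.zero_le _), opL, op_op (isCyc_add _ _) h0,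
    op_op ((isCyc_add _ _).comp h0) (isCyc_add _ _),
    face_eq_op hi (((isCyc_add _ _).comp h0).comp (isCyc_add _ _))]
  intro r hr
  simp only [Function.comp_apply]
  by_cases hri : r < i
  · have h1 := h0.per_one ((r : ℤ) + -i)
    rw [show (r : ℤ) + -i + (n + 1) = (n + 1 + r - i : ℕ) by omega, ext_of_le _ (by omega),
      iv_eraseIdx_getD (by omega), if_neg (by omega)] at h1
    rw [if_pos hri]
    push_cast at h1 ⊢
    omega
  · rw [if_neg hri, show (r : ℤ) + -i = (r - i : ℕ) by omega, ext_of_le _ (by omega),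
      iv_eraseIdx_getD (by omega), if_neg (by omega)]
    omega

/-- Since the face operators are generated by the first one and the cyclic permutations, `zip`
commutes with all of them. -/
lemma zip_face {n i : ℕ} (hi : i ≤ n + 1) (x : NChain K A (n + 1)) (y : NChain K B (n + 1)) :
    zip n (face n i x) (face n i y) = face n i (zip (n + 1) x y) := by
  rw [face_eq_comp hi, face_eq_comp hi, face_eq_comp hi, zip_sub, zip_face_zero, zip_add _ (by omega)]

/-- The word `0, …, j - 1, j - 1, …, n` of the degeneracy that inserts an identity at the
position `j`. -/
def degWord (n j : ℕ) : List ℤ := iv 0 j ++ iv (j - 1) (n + 2 - j)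

lemma length_degWord {n j : ℕ} (hj : j ≤ n + 1) : (degWord n j).length = n + 2 := by
  simp [degWord]; omega

lemma degWord_getD {n j r : ℕ} (hj : j ≤ n + 1) (hr : r ≤ n + 1) :
    (degWord n j).getD r 0 = if r < j then (r : ℤ) else r - 1 := by
  split_ifs with h
  · rw [degWord, List.getD_append _ _ _ _ (by simpa using h), iv_getD h, zero_add]
  · rw [degWord, List.getD_append_right _ _ _ _ (by simp; omega), length_iv, iv_getD (by omega)]
    omega

lemma good_degWord {n j : ℕ} (h1 : 1 ≤ j) (hj : j ≤ n + 1) : Good n (degWord n j) := by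
  refine ⟨List.pairwise_append.2 ⟨(iv_pairwise _ _).imp fun h => h.le,
    (iv_pairwise _ _).imp fun h => h.le, fun a ha b hb => ?_⟩, fun a ha b hb => ?_⟩
  · rw [mem_iv] at ha hb; omega
  · simp only [degWord, List.mem_append, mem_iv] at ha hb
    omega

lemma hasRepeat_degWord {n j : ℕ} (h1 : 1 ≤ j) (hj : j ≤ n + 1) : HasRepeat (degWord n j) := by
  obtain ⟨j, rfl⟩ : ∃ i, j = i + 1 := ⟨j - 1, by omega⟩
  refine ⟨iv 0 j, j, iv (j + 1) (n - j), ?_⟩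
  rw [degWord, iv_succ', show n + 2 - (j + 1) = n - j + 1 by omega, iv_succ]
  simp

/-- The degeneracies are conjugate to `s` by cyclic permutations. -/
lemma degWord_eq_comp {C : Type u} [Category.{v} C] [Preadditive C] [Linear K C]
    [SuperCategory K C] {n j : ℕ} (h1 : 1 ≤ j) (hj : j ≤ n + 1) (x : NChain K C n) :
    opL n (n + 1) (degWord n j) x =
      op (n + 1) (n + 1) (· + (-(j : ℤ))) (extra n (op n n (· + (j : ℤ)) x)) := by
  have h0 := isCyc_ext (m := n + 1) (good_iv (n := n) (-1) (le_refl (n + 2))) (by simp)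
  rw [extra_eq_opL, opL, opL, op_op (isCyc_add _ _) h0,
    op_op ((isCyc_add _ _).comp h0) (isCyc_add _ _)]
  congr 2
  refine (isCyc_ext (good_degWord h1 hj) (length_degWord hj)).ext
    (((isCyc_add _ _).comp h0).comp (isCyc_add _ _)) fun r hr => ?_
  rw [ext_of_le _ hr, degWord_getD hj hr]
  simp only [Function.comp_apply]
  by_cases hri : r < j
  · have h1 := h0.per_one ((r : ℤ) + -j)
    rw [show (r : ℤ) + -j + ((n + 1 : ℕ) + 1) = (n + 2 + r - j : ℕ) by omega,
      ext_of_le _ (by omega), iv_getD (by omega)] at h1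
    rw [if_pos hri]
    omega
  · rw [if_neg hri, show (r : ℤ) + -j = (r - j : ℕ) by omega, ext_of_le _ (by omega),
      iv_getD (by omega)]
    omega

lemma zip_degWord {n j : ℕ} (h1 : 1 ≤ j) (hj : j ≤ n + 1) (x : NChain K A n) (y : NChain K B n) :
    zip (n + 1) (opL n (n + 1) (degWord n j) x) (opL n (n + 1) (degWord n j) y) =
      opL n (n + 1) (degWord n j) (zip n x y) := by
  rw [degWord_eq_comp h1 hj, degWord_eq_comp h1 hj, degWord_eq_comp h1 hj, zip_sub, zip_extra,
    zip_add _ hj]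

/-- Degenerate chains are sums of values of degeneracies. -/
lemma degen_succ_le {C : Type u} [Category.{v} C] [Preadditive C] [Linear K C]
    [SuperCategory K C] {n : ℕ} {N : Submodule K (NChain K C (n + 1))}
    (h : ∀ j, 1 ≤ j → j ≤ n + 1 → ∀ x, opL n (n + 1) (degWord n j) x ∈ N) :
    degen K C (n + 1) ≤ N := by
  refine Submodule.span_le.2 ?_
  rintro _ ⟨g, hg, ⟨j, h1, h2, X, hX⟩, rfl⟩
  -- the chain without its `j`-th entry
  let g' : ℕ → HArr K C := fun k => if k < j then g k else g (k + 1)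
  have e1 : (g (j - 1)).tgt = X := by
    have := hg.1 (j - 1) (by omega)
    rwa [show j - 1 + 1 = j by omega, hX] at this
  have hg' : IsCycle n g' := by
    constructor
    · intro k hk
      simp only [g']
      split_ifs with a b
      · exact hg.1 k (by omega)
      · have := hg.1 j (by omega)
        rw [show k = j - 1 by omega, e1, show j - 1 + 1 + 1 = j + 1 by omega, ← this, hX]
        rfl
      · omega
      · exact hg.1 (k + 1) (by omega)
    · simp only [g', if_pos (show 0 < j by omega)]
      split_ifs with a
      · have := hg.2
        rw [show n + 1 = j by omega, hX] at this
        rw [show n = j - 1 by omega, e1, ← this]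
        rfl
      · exact hg.2
  have hc := isCyc_ext (good_degWord h1 h2) (length_degWord h2)
  have e : cls (n + 1) g = opL n (n + 1) (degWord n j) (cls n g') := by
    have hm1 : ext n (n + 1) (degWord n j) (-1) = -1 := by
      have h1 := hc.per_one (-1)
      rw [show (-1 : ℤ) + ((n + 1 : ℕ) + 1) = (n + 1 : ℕ) by push_cast; ring,
        ext_of_le _ le_rfl, degWord_getD h2 le_rfl, if_neg (by omega)] at h1
      push_cast at h1
      omega
    rw [opL, op_cls hc hg', cycSign_eq_zero hm1, ksgn_zero, one_smul]
    refine cls_congr fun l hl => ?_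
    have e0 : ext n (n + 1) (degWord n j) ((l : ℤ) - 1) = if l ≤ j then (l : ℤ) - 1 else l - 2 := by
      rcases Nat.eq_zero_or_pos l with rfl | hl0
      · simpa using hm1
      · rw [show (l : ℤ) - 1 = (l - 1 : ℕ) by omega, ext_of_le _ (by omega),
          degWord_getD h2 (by omega)]
        split_ifs <;> omega
    rw [cycSeq, e0, ext_of_le _ hl, degWord_getD h2 hl]
    rcases lt_trichotomy l j with hlt | rfl | hgt
    · rw [if_pos hlt, if_pos hlt.le, show ((l : ℤ) - (l - 1)).toNat = 1 by omega, block_one,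
        sub_add_cancel, perSeq_of_lt g' (by omega)]
      simp [g', hlt]
    · rw [if_neg (lt_irrefl _), if_pos le_rfl, sub_self, Int.toNat_zero, block, hX,
        sub_add_cancel]
      have := hg'.chainable ((l - 1 : ℕ) : ℤ)
      rw [perSeq_of_lt g' (by omega), show ((l - 1 : ℕ) : ℤ) + 1 = l by omega] at this
      rw [← this]
      simp [g', show l - 1 < l by omega, e1]
    · rw [if_neg (by omega), if_neg (by omega),
        show ((l : ℤ) - 1 - (l - 2)).toNat = 1 by omega, block_one,
        show (l : ℤ) - 2 + 1 = (l - 1 : ℕ) by omega, perSeq_of_lt g' (by omega)]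
      simp only [g', if_neg (show ¬ l - 1 < j by omega), show l - 1 + 1 = l by omega]
  rw [e]
  exact h j h1 h2 _

lemma degen_zero {C : Type u} [Category.{v} C] [Preadditive C] [Linear K C] [SuperCategory K C] :
    degen K C 0 = ⊥ := by
  rw [degen, Submodule.span_eq_bot]
  rintro _ ⟨g, hg, ⟨j, h1, h2, -⟩, -⟩
  omega

end Zip

/-! ### Shuffles and lattice paths -/

section Steps

variable {N : ℕ}

/-- The number of steps of the kind `c` among the first `t` steps. -/
def stepCount (c : Bool) (χ : Fin N → Bool) (t : ℕ) : ℕ :=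
  ∑ s : Fin N, if (s : ℕ) < t ∧ χ s = c then 1 else 0

/-- The lattice path that starts in `(x, y)` and has the given steps (`true` for a step to the
right, `false` for a step upwards). -/
def stepWord (χ : Fin N → Bool) (x y : ℤ) : List (ℤ × ℤ) :=
  (List.range (N + 1)).map fun t => (x + stepCount true χ t, y + stepCount false χ t)

/-- The sign of the shuffle that corresponds to a lattice path: it counts the pairs of a step
upwards and a later step to the right. -/
def stepSign (χ : Fin N → Bool) : ℤ :=
  ∏ s : Fin N, ∏ t : Fin N, if t < s ∧ χ t = false ∧ χ s = true then -1 else 1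

lemma stepCount_zero (c : Bool) (χ : Fin N → Bool) : stepCount c χ 0 = 0 := by
  simp [stepCount]

lemma stepCount_cons (c d : Bool) (χ : Fin N → Bool) (t : ℕ) :
    stepCount c (Fin.cons d χ : Fin (N + 1) → Bool) (t + 1) =
      (if d = c then 1 else 0) + stepCount c χ t := by
  rw [stepCount, Fin.sum_univ_succ]
  simp only [Fin.cons_zero, Fin.cons_succ, Fin.val_zero, Fin.val_succ, Nat.zero_lt_succ,
    true_and, Nat.add_lt_add_iff_right]
  rfl

lemma stepCount_le (c : Bool) (χ : Fin N → Bool) (t : ℕ) : stepCount c χ t ≤ N := by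
  refine (Finset.sum_le_card_nsmul _ _ 1 fun s _ => ?_).trans (by simp)
  split_ifs <;> simp

lemma stepWord_cons (d : Bool) (χ : Fin N → Bool) (x y : ℤ) :
    stepWord (Fin.cons d χ : Fin (N + 1) → Bool) x y =
      (x, y) :: stepWord χ (x + if d = true then 1 else 0) (y + if d = false then 1 else 0) := by
  rw [stepWord, List.range_succ_eq_map, List.map_cons, List.map_map, stepCount_zero,
    stepCount_zero, stepWord]
  congr 1
  · simp
  · refine List.map_congr_left fun t _ => ?_
    simp only [Function.comp_apply, Nat.succ_eq_add_one, stepCount_cons]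
    push_cast
    rw [add_assoc, add_assoc]

lemma stepSign_cons (d : Bool) (χ : Fin N → Bool) :
    stepSign (Fin.cons d χ : Fin (N + 1) → Bool) =
      (if d = false then (-1) ^ stepCount true χ N else 1) * stepSign χ := by
  rw [stepSign, Fin.prod_univ_succ]
  simp only [Fin.prod_univ_succ (n := N), Fin.not_lt_zero, false_and, if_false, Fin.cons_zero,
    Fin.cons_succ, Fin.succ_lt_succ_iff, Finset.prod_const_one, one_mul, mul_one,
    Finset.prod_mul_distrib, Fin.succ_pos, true_and]
  congr 1
  cases d
  · simp only [true_and, if_true, stepCount]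
    rw [← Finset.prod_pow_eq_pow_sum]
    refine Finset.prod_congr rfl fun s _ => ?_
    simp only [s.2, true_and]
    split_ifs <;> simp
  · simp

/-- The paths are sorted by their first step. -/
lemma sum_steps {M : Type*} [AddCommMonoid M] (f : (Fin (N + 1) → Bool) → M) :
    ∑ χ, f χ = ∑ χ : Fin N → Bool, f (Fin.cons true χ) + ∑ χ : Fin N → Bool, f (Fin.cons false χ) := by
  rw [← Equiv.sum_comp (Fin.consEquiv fun _ : Fin (N + 1) => Bool), Fintype.sum_prod_type,
    Fintype.sum_bool]
  rfl

/-- The sum over all lattice paths, as a sum over their steps. -/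
lemma sum_stepWord {K : Type*} [CommRing K] {M : Type*} [AddCommGroup M] [Module K M] (p q : ℕ)
    (h : p + q = N) (F : List (ℤ × ℤ) → M) (x y : ℤ) :
    ∑ χ : Fin N → Bool, (if stepCount true χ N = p then
      ((stepSign χ : ℤ) : K) • F (stepWord χ x y) else 0) =
      wlift F (paths K (iv x (p + 1)) (iv y (q + 1))) := by
  induction N generalizing p q F x y with
  | zero =>
    obtain ⟨rfl, rfl⟩ : p = 0 ∧ q = 0 := by omega
    rw [Fintype.sum_unique, iv_succ, iv_succ, iv_zero, iv_zero, paths, wlift_wd]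
    simp [stepCount, stepSign, stepWord]
  | succ N ih =>
    rw [sum_steps, iv_succ x, iv_succ y, paths_cons, wlift_pre, map_add, map_add, map_smul,
      unitIf_of_ne, map_zero, zero_add, length_iv]
    swap
    · rcases Nat.eq_zero_or_pos p with rfl | hp
      · right; intro h0
        have := congrArg List.length h0
        simp at this; omega
      · left; intro h0
        have := congrArg List.length h0
        simp at this; omega
    simp only [stepCount_cons, stepWord_cons, stepSign_cons]
    congr 1
    · rcases p with _ | p
      · rw [iv_zero, paths_nil_left, map_zero]
        refine Finset.sum_eq_zero fun χ _ => ?_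
        rw [if_neg (by simp)]
      · rw [← iv_succ, ← ih p q (by omega)]
        refine Finset.sum_congr rfl fun χ _ => ?_
        simp only [if_true, add_comm 1, Nat.add_right_cancel_iff, Bool.true_eq_false, if_false,
          one_mul, add_zero]
    · rcases q with _ | q
      · rw [iv_zero, paths_nil_right, map_zero, smul_zero]
        refine Finset.sum_eq_zero fun χ _ => ?_
        have := stepCount_le true χ N
        rw [if_neg]
        simp only [Bool.false_eq_true, if_false]
        omega
      · rw [← iv_succ, ← ih p q (by omega), Finset.smul_sum]
        refine Finset.sum_congr rfl fun χ _ => ?_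
        simp only [if_true, Bool.false_eq_true, if_false, zero_add, add_zero]
        split_ifs with h0
        · rw [h0, smul_smul]
          push_cast
          rfl
        · rw [smul_zero]

lemma card_lt_le {p : ℕ} {f : Fin p → ℕ} (hf : ∀ i i', i < i' → f i < f i') (t : ℕ) (i : Fin p) :
    (∑ i' : Fin p, if f i' < t then 1 else 0) ≤ (i : ℕ) ↔ t ≤ f i := by
  rw [Finset.sum_boole, Nat.cast_id]
  constructor
  · intro h
    by_contra hlt
    have : Finset.Iic i ⊆ Finset.univ.filter fun i' => f i' < t := by
      intro i' hi'
      rcases (Finset.mem_Iic.1 hi').lt_or_eq with h1 | rfl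
      · have := hf _ _ h1; simp; omega
      · simp; omega
    have := Finset.card_le_card this
    rw [Fin.card_Iic] at this
    omega
  · intro h
    have : (Finset.univ.filter fun i' => f i' < t) ⊆ Finset.Iio i := by
      intro i' hi'
      rw [Finset.mem_Iio]
      by_contra hge
      rcases (not_lt.1 hge).lt_or_eq with h1 | rfl
      · have := hf _ _ h1; simp at hi'; omega
      · simp at hi'; omega
    have := Finset.card_le_card this
    rwa [Fin.card_Iio] at this

end Steps

section Shuffles

variable {p q : ℕ}

/-- The steps of a shuffle: to the right for a letter of the first kind, upwards for a letter of
the second kind. -/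
def shSteps (σ : Equiv.Perm (Fin (p + q))) (s : Fin (p + q)) : Bool :=
  decide ((σ.symm s : ℕ) < p)

@[simp] lemma shSteps_castAdd (σ : Equiv.Perm (Fin (p + q))) (i : Fin p) :
    shSteps σ (σ (Fin.castAdd q i)) = true := by
  simp [shSteps]

@[simp] lemma shSteps_natAdd (σ : Equiv.Perm (Fin (p + q))) (j : Fin q) :
    shSteps σ (σ (Fin.natAdd p j)) = false := by
  simp [shSteps]

lemma sum_positions {M : Type*} [AddCommMonoid M] (σ : Equiv.Perm (Fin (p + q)))
    (f : Fin (p + q) → M) :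
    ∑ s, f s = ∑ i : Fin p, f (σ (Fin.castAdd q i)) + ∑ j : Fin q, f (σ (Fin.natAdd p j)) := by
  rw [← Equiv.sum_comp σ, Fin.sum_univ_add]

lemma prod_positions {M : Type*} [CommMonoid M] (σ : Equiv.Perm (Fin (p + q)))
    (f : Fin (p + q) → M) :
    ∏ s, f s = (∏ i : Fin p, f (σ (Fin.castAdd q i))) * ∏ j : Fin q, f (σ (Fin.natAdd p j)) := by
  rw [← Equiv.prod_comp σ, Fin.prod_univ_add]

lemma stepCount_true (σ : Equiv.Perm (Fin (p + q))) (t : ℕ) : stepCount true (shSteps σ) t =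
    ∑ i : Fin p, if (σ (Fin.castAdd q i) : ℕ) < t then 1 else 0 := by
  rw [stepCount, sum_positions σ]
  simp

lemma stepCount_false (σ : Equiv.Perm (Fin (p + q))) (t : ℕ) : stepCount false (shSteps σ) t =
    ∑ j : Fin q, if (σ (Fin.natAdd p j) : ℕ) < t then 1 else 0 := by
  rw [stepCount, sum_positions σ]
  simp

lemma stepCount_add (χ : Fin (p + q) → Bool) {t : ℕ} (ht : t ≤ p + q) :
    stepCount true χ t + stepCount false χ t = t := by
  rw [stepCount, stepCount, ← Finset.sum_add_distrib]
  have : ∀ s : Fin (p + q), ((if (s : ℕ) < t ∧ χ s = true then 1 else 0) +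
      (if (s : ℕ) < t ∧ χ s = false then 1 else 0)) = if (s : ℕ) < t then 1 else 0 := by
    intro s
    cases χ s <;> simp
  simp only [this]
  rw [Fin.sum_univ_eq_sum_range (fun s => if s < t then 1 else 0), Finset.sum_boole, Nat.cast_id,
    show (Finset.range (p + q)).filter (· < t) = Finset.range t by ext s; simp; omega,
    Finset.card_range]

lemma stepCount_all (σ : Equiv.Perm (Fin (p + q))) :
    stepCount true (shSteps σ) (p + q) = p := by
  rw [stepCount_true]
  simp

lemma IsShuffle.stepCount_le_left {σ : Equiv.Perm (Fin (p + q))} (h : IsShuffle p q σ) (t : ℕ)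
    (i : Fin p) : stepCount true (shSteps σ) t ≤ i ↔ t ≤ σ (Fin.castAdd q i) := by
  rw [stepCount_true]
  exact card_lt_le (f := fun i => (σ (Fin.castAdd q i) : ℕ)) (fun i i' e => h.1 i i' e) t i

lemma IsShuffle.stepCount_le_right {σ : Equiv.Perm (Fin (p + q))} (h : IsShuffle p q σ) (t : ℕ)
    (j : Fin q) : stepCount false (shSteps σ) t ≤ j ↔ t ≤ σ (Fin.natAdd p j) := by
  rw [stepCount_false]
  exact card_lt_le (f := fun j => (σ (Fin.natAdd p j) : ℕ)) (fun i i' e => h.2 i i' e) t j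

lemma stepCount_step (χ : Fin (p + q) → Bool) (c : Bool) (s : Fin (p + q)) :
    stepCount c χ (s + 1) = stepCount c χ s + if χ s = c then 1 else 0 := by
  rw [stepCount, stepCount, ← Finset.sum_add_sum_compl {s}, ← Finset.sum_add_sum_compl {s}]
  simp only [Finset.sum_singleton, lt_irrefl, false_and, if_false, zero_add,
    Nat.lt_succ_self, true_and]
  rw [add_comm]
  congr 1
  refine Finset.sum_congr rfl fun s' hs' => ?_
  have : (s' : ℕ) ≠ s := fun e => by simp [Fin.ext e] at hs'
  congr 1
  rw [eq_iff_iff]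
  constructor
  · rintro ⟨h1, h2⟩; exact ⟨by omega, h2⟩
  · rintro ⟨h1, h2⟩; exact ⟨by omega, h2⟩

lemma IsShuffle.stepCount_castAdd {σ : Equiv.Perm (Fin (p + q))} (h : IsShuffle p q σ)
    (i : Fin p) : stepCount true (shSteps σ) (σ (Fin.castAdd q i)) = i ∧
      stepCount false (shSteps σ) (σ (Fin.castAdd q i)) = σ (Fin.castAdd q i) - i := by
  have h1 := (h.stepCount_le_left (σ (Fin.castAdd q i)) i).2 le_rfl
  have h2 : ¬ stepCount true (shSteps σ) (σ (Fin.castAdd q i) + 1) ≤ i := by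
    rw [h.stepCount_le_left]; omega
  rw [stepCount_step, shSteps_castAdd, if_pos rfl] at h2
  have h3 := stepCount_add (shSteps σ) (σ (Fin.castAdd q i)).2.le
  omega

lemma IsShuffle.stepCount_natAdd {σ : Equiv.Perm (Fin (p + q))} (h : IsShuffle p q σ)
    (j : Fin q) : stepCount false (shSteps σ) (σ (Fin.natAdd p j)) = j ∧
      stepCount true (shSteps σ) (σ (Fin.natAdd p j)) = σ (Fin.natAdd p j) - j := by
  have h1 := (h.stepCount_le_right (σ (Fin.natAdd p j)) j).2 le_rfl
  have h2 : ¬ stepCount false (shSteps σ) (σ (Fin.natAdd p j) + 1) ≤ j := by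
    rw [h.stepCount_le_right]; omega
  rw [stepCount_step, shSteps_natAdd, if_pos rfl] at h2
  have h3 := stepCount_add (shSteps σ) (σ (Fin.natAdd p j)).2.le
  omega

/-- The inversions of a shuffle are the pairs of a left and a right position in the wrong order. -/
lemma IsShuffle.sign_eq {σ : Equiv.Perm (Fin (p + q))} (h : IsShuffle p q σ) :
    (Equiv.Perm.sign σ : ℤ) = stepSign (shSteps σ) := by
  -- the sign as a product over all pairs, of which only the mixed ones contribute
  have e1 : (Equiv.Perm.sign σ : ℤ) =
      ∏ j : Fin (p + q), ∏ i : Fin (p + q), if i < j ∧ ¬ σ i < σ j then -1 else 1 := by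
    rw [Equiv.Perm.sign_eq_prod_prod_Iio, Units.coe_prod]
    refine Finset.prod_congr rfl fun j _ => ?_
    rw [Units.coe_prod, ← Finset.prod_subset (Finset.subset_univ (Finset.Iio j))]
    · refine Finset.prod_congr rfl fun i hi => ?_
      rw [Finset.mem_Iio] at hi
      simp only [hi, true_and]
      split_ifs <;> simp
    · intro i _ hi
      rw [Finset.mem_Iio] at hi
      simp [hi]
  have l1 : ∀ i i' : Fin p, Fin.castAdd q i < Fin.castAdd q i' →
      σ (Fin.castAdd q i) < σ (Fin.castAdd q i') := fun i i' e => h.1 i i' e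
  have l2 : ∀ i i' : Fin q, Fin.natAdd p i < Fin.natAdd p i' →
      σ (Fin.natAdd p i) < σ (Fin.natAdd p i') := fun i i' e => h.2 i i' (by
        rw [Fin.lt_def] at e ⊢; simpa using e)
  have l3 : ∀ (i : Fin p) (j : Fin q), ¬ Fin.natAdd p j < Fin.castAdd q i := fun i j => by
    rw [Fin.lt_def]; simp; omega
  have l4 : ∀ (i : Fin p) (j : Fin q), Fin.castAdd q i < Fin.natAdd p j := fun i j => by
    rw [Fin.lt_def]; simp; omega
  have l5 : ∀ (i : Fin p) (j : Fin q), ¬ σ (Fin.castAdd q i) < σ (Fin.natAdd p j) ↔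
      σ (Fin.natAdd p j) < σ (Fin.castAdd q i) := fun i j => by
    rw [not_lt, le_iff_lt_or_eq, or_iff_left]
    intro e
    have := σ.injective e
    rw [Fin.ext_iff] at this
    simp at this
    omega
  have m1 : ∀ i i' : Fin p, ¬ (Fin.castAdd q i < Fin.castAdd q i' ∧
      ¬ σ (Fin.castAdd q i) < σ (Fin.castAdd q i')) := fun i i' e => e.2 (l1 i i' e.1)
  have m2 : ∀ i i' : Fin q, ¬ (Fin.natAdd p i < Fin.natAdd p i' ∧
      ¬ σ (Fin.natAdd p i) < σ (Fin.natAdd p i')) := fun i i' e => e.2 (l2 i i' e.1)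
  have e2 : (∏ j : Fin (p + q), ∏ i : Fin (p + q), if i < j ∧ ¬ σ i < σ j then (-1 : ℤ) else 1) =
      ∏ j : Fin q, ∏ i : Fin p,
        if σ (Fin.natAdd p j) < σ (Fin.castAdd q i) then (-1 : ℤ) else 1 := by
    rw [Fin.prod_univ_add]
    simp only [Fin.prod_univ_add (a := p) (b := q), if_neg (m1 _ _), if_neg (m2 _ _), l3, l4,
      false_and, if_false, true_and, l5, Finset.prod_const_one, one_mul, mul_one]
  have e3 : stepSign (shSteps σ) = ∏ i : Fin p, ∏ j : Fin q,
      if σ (Fin.natAdd p j) < σ (Fin.castAdd q i) then (-1 : ℤ) else 1 := by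
    rw [stepSign, prod_positions σ]
    simp only [shSteps_castAdd, shSteps_natAdd, Bool.false_eq_true, and_false, if_false,
      Finset.prod_const_one, mul_one, and_true]
    refine Finset.prod_congr rfl fun i _ => ?_
    rw [prod_positions σ]
    simp only [shSteps_castAdd, shSteps_natAdd, Bool.true_eq_false, and_false, if_false,
      Finset.prod_const_one, one_mul, and_true]
  rw [e1, e2, e3, Finset.prod_comm]

/-- A shuffle is determined by the sequence of its steps. -/
lemma shSteps_injective {σ τ : Equiv.Perm (Fin (p + q))} (hσ : IsShuffle p q σ)
    (hτ : IsShuffle p q τ) (h : shSteps σ = shSteps τ) : σ = τ := by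
  have e1 : ∀ i : Fin p, σ (Fin.castAdd q i) = τ (Fin.castAdd q i) := by
    intro i
    have a := hσ.stepCount_le_left (τ (Fin.castAdd q i)) i
    have b := hτ.stepCount_le_left (σ (Fin.castAdd q i)) i
    rw [← h, (hσ.stepCount_castAdd i).1] at b
    rw [h, (hτ.stepCount_castAdd i).1] at a
    exact Fin.ext (le_antisymm (b.1 le_rfl) (a.1 le_rfl))
  have e2 : ∀ j : Fin q, σ (Fin.natAdd p j) = τ (Fin.natAdd p j) := by
    intro i
    have a := hσ.stepCount_le_right (τ (Fin.natAdd p i)) i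
    have b := hτ.stepCount_le_right (σ (Fin.natAdd p i)) i
    rw [← h, (hσ.stepCount_natAdd i).1] at b
    rw [h, (hτ.stepCount_natAdd i).1] at a
    exact Fin.ext (le_antisymm (b.1 le_rfl) (a.1 le_rfl))
  ext m
  induction m using Fin.addCases with
  | left i => rw [e1]
  | right j => rw [e2]

/-- Every sequence of steps with the right number of steps of each kind comes from a shuffle. -/
lemma exists_shuffle (χ : Fin (p + q) → Bool) (h : stepCount true χ (p + q) = p) :
    ∃ σ : Equiv.Perm (Fin (p + q)), IsShuffle p q σ ∧ shSteps σ = χ := by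
  classical
  let s : Finset (Fin (p + q)) := Finset.univ.filter fun m => χ m = true
  have hs : s.card = p := by
    rw [stepCount] at h
    simp only [Fin.is_lt, true_and] at h
    rw [Finset.sum_boole, Nat.cast_id] at h
    exact h
  have hs' : sᶜ.card = q := by
    rw [Finset.card_compl, hs, Fintype.card_fin]; omega
  let σ : Equiv.Perm (Fin (p + q)) := finSumFinEquiv.symm.trans (finSumEquivOfFinset hs hs')
  have e1 : ∀ i : Fin p, σ (Fin.castAdd q i) = s.orderEmbOfFin hs i := fun i => by
    simp [σ]
  have e2 : ∀ j : Fin q, σ (Fin.natAdd p j) = sᶜ.orderEmbOfFin hs' j := fun i => by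
    simp [σ]
  refine ⟨σ, ⟨fun i i' hi => ?_, fun j j' hj => ?_⟩, ?_⟩
  · rw [e1, e1]; exact (s.orderEmbOfFin hs).strictMono hi
  · rw [e2, e2]; exact (sᶜ.orderEmbOfFin hs').strictMono hj
  · funext m
    obtain ⟨m, rfl⟩ := σ.surjective m
    induction m using Fin.addCases with
    | left i =>
      rw [shSteps_castAdd, e1]
      exact (Finset.mem_filter.1 (s.orderEmbOfFin_mem hs i)).2.symm
    | right j =>
      rw [shSteps_natAdd, e2]
      have := sᶜ.orderEmbOfFin_mem hs' j
      rw [Finset.mem_compl, Finset.mem_filter] at this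
      simpa using this

/-- A sum over shuffles is a sum over lattice paths. -/
lemma sum_shuffles {K : Type*} [CommRing K] {M : Type*} [AddCommGroup M] [Module K M]
    [Fintype {σ : Equiv.Perm (Fin (p + q)) // IsShuffle p q σ}] (F : List (ℤ × ℤ) → M) (x y : ℤ) :
    ∑ σ : {σ : Equiv.Perm (Fin (p + q)) // IsShuffle p q σ},
      ((Equiv.Perm.sign σ.1 : ℤ) : K) • F (stepWord (shSteps σ.1) x y) =
      wlift F (paths K (iv x (p + 1)) (iv y (q + 1))) := by
  rw [← sum_stepWord p q rfl, ← Finset.sum_filter]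
  refine Finset.sum_bij (fun σ _ => shSteps σ.1) ?_ ?_ ?_ ?_
  · intro σ _
    simp [stepCount_all]
  · intro σ _ τ _ h
    exact Subtype.ext (shSteps_injective σ.2 τ.2 h)
  · intro χ hχ
    obtain ⟨σ, h1, h2⟩ := exists_shuffle χ (Finset.mem_filter.1 hχ).2
    exact ⟨⟨σ, h1⟩, Finset.mem_univ _, h2⟩
  · intro σ _
    rw [σ.2.sign_eq]

/-- A path does not visit the quadrant to the left of `0` and above `0` if and only if it crosses
the column `0` before the row `0`. -/
lemma IsShuffle.crossing {σ : Equiv.Perm (Fin (p + q))} (h : IsShuffle p q σ) (i : Fin p)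
    (j : Fin q) : σ (Fin.castAdd q i) < σ (Fin.natAdd p j) ↔
      ∀ c ∈ stepWord (shSteps σ) (-1 - i) (-1 - j), ¬ (c.1 < 0 ∧ 0 ≤ c.2) := by
  constructor
  · intro hlt c hc
    obtain ⟨t, ht, rfl⟩ := List.mem_map.1 hc
    rintro ⟨h1, h2⟩
    have a := (h.stepCount_le_left t i).1 (by dsimp only at h1; omega)
    have b := (h.stepCount_le_right t j).not.1 (by dsimp only at h2; omega)
    rw [Fin.lt_def] at hlt
    omega
  · intro hc
    by_contra hlt
    have hne : σ (Fin.castAdd q i) ≠ σ (Fin.natAdd p j) := fun e => by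
      have := σ.injective e
      rw [Fin.ext_iff] at this
      simp at this
      omega
    have hlt' : (σ (Fin.natAdd p j) : ℕ) < σ (Fin.castAdd q i) := by
      have : (σ (Fin.natAdd p j) : ℕ) ≠ σ (Fin.castAdd q i) := fun e => hne (Fin.ext e.symm)
      rw [Fin.lt_def] at hlt
      omega
    have hb := (σ (Fin.castAdd q i)).2
    refine hc _ (List.mem_map.2 ⟨σ (Fin.castAdd q i), List.mem_range.2 (by omega), rfl⟩) ⟨?_, ?_⟩
    · have := (h.stepCount_le_left (σ (Fin.castAdd q i)) i).2 le_rfl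
      dsimp only; omega
    · have := (h.stepCount_le_right (σ (Fin.castAdd q i)) j).not.2 (by omega)
      dsimp only; omega

open Classical in
/-- The paths that cross the column `0` before the row `0`. -/
lemma cpaths_eq_filter {K : Type*} [CommRing K] {M : Type*} [AddCommGroup M] [Module K M] (a b : ℕ)
    (u' v' : ℕ) (F : List (ℤ × ℤ) → M) :
    wlift F (cpaths K (iv (-a) a) (iv 0 (u' + 1)) (iv (-b) b) (iv 0 (v' + 1))) =
      wlift (fun l => if ∀ c ∈ l, ¬ (c.1 < 0 ∧ 0 ≤ c.2) then F l else 0)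
        (paths K (iv (-a) (a + (u' + 1))) (iv (-b) (b + (v' + 1)))) := by
  induction hn : a + b using Nat.strong_induction_on generalizing a b F with
  | _ n ih =>
  subst hn
  rcases a with _ | a
  · rw [iv_zero, cpaths_nil, Nat.cast_zero, neg_zero, zero_add, iv_append (-(b : ℤ)) b (v' + 1), neg_add_cancel]
    refine wlift_paths_congr _ _ fun l hl => (if_pos fun c hc hc' => ?_).symm
    have := (hl.mem c hc).1
    rw [mem_iv] at this
    omega
  rcases b with _ | b
  -- all paths start in the forbidden quadrant
  · rw [iv_zero, cpaths_nil_right, if_neg (by rw [iv_succ]; simp), map_zero, Nat.cast_zero,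
      neg_zero, zero_add, iv_succ 0, show a + 1 + (u' + 1) = a + (u' + 1) + 1 by omega, iv_succ,
      paths_cons, wlift_pre]
    have h0 : ∀ l : List (ℤ × ℤ), (if ∀ c ∈ (-((a + 1 : ℕ) : ℤ), (0 : ℤ)) :: l,
        ¬ (c.1 < 0 ∧ 0 ≤ c.2) then F ((-((a + 1 : ℕ) : ℤ), (0 : ℤ)) :: l) else 0) =
        (0 : M →ₗ[K] M) 0 := fun l => by
      rw [if_neg, LinearMap.zero_apply]
      intro h
      have := h _ List.mem_cons_self
      dsimp only at this
      omega
    simp only [h0]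
    rw [← lin_wlift (0 : M →ₗ[K] M) fun _ => 0, LinearMap.zero_apply]
  · have h1 : -((a + 1 : ℕ) : ℤ) + 1 = -(a : ℤ) := by push_cast; ring
    have h2 : -((b + 1 : ℕ) : ℤ) + 1 = -(b : ℤ) := by push_cast; ring
    have h3 : iv (-((a + 1 : ℕ) : ℤ)) (a + 1) = -((a + 1 : ℕ) : ℤ) :: iv (-a) a := by
      rw [iv_succ, h1]
    have h4 : iv (-((b + 1 : ℕ) : ℤ)) (b + 1) = -((b + 1 : ℕ) : ℤ) :: iv (-b) b := by
      rw [iv_succ, h2]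
    have h5 : iv (-((a + 1 : ℕ) : ℤ)) (a + 1 + (u' + 1)) =
        -((a + 1 : ℕ) : ℤ) :: iv (-a) (a + (u' + 1)) := by
      rw [show a + 1 + (u' + 1) = a + (u' + 1) + 1 by omega, iv_succ, h1]
    have h6 : iv (-((b + 1 : ℕ) : ℤ)) (b + 1 + (v' + 1)) =
        -((b + 1 : ℕ) : ℤ) :: iv (-b) (b + (v' + 1)) := by
      rw [show b + 1 + (v' + 1) = b + (v' + 1) + 1 by omega, iv_succ, h2]
    rw [h3, h4, h5, h6, cpaths_cons, paths_cons, unitIf_of_ne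
      (Or.inl fun e => by simpa using congrArg List.length e), zero_add, ← h3, ← h4, ← h5, ← h6,
      wlift_pre, wlift_pre, map_add, map_add, map_smul, map_smul, ih _ (by omega) a (b + 1) _ rfl,
      ih _ (by omega) (a + 1) b _ rfl]
    simp only [length_iv]
    have hcond : ∀ l : List (ℤ × ℤ), (∀ c ∈ (-((a + 1 : ℕ) : ℤ), -((b + 1 : ℕ) : ℤ)) :: l,
        ¬ (c.1 < 0 ∧ 0 ≤ c.2)) ↔ ∀ c ∈ l, ¬ (c.1 < 0 ∧ 0 ≤ c.2) := by
      intro l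
      rw [List.forall_mem_cons]
      refine and_iff_right ?_
      dsimp only
      omega
    simp only [hcond]

end Shuffles

/-! ### The shuffle maps as sums over lattice paths -/

section Grid

variable {K : Type w} [Field K]
  {A : Type u} [Category.{v} A] [Preadditive A] [Linear K A] [SuperCategory K A]
  {B : Type u'} [Category.{v'} B] [Preadditive B] [Linear K B] [SuperCategory K B]

/-- The pairing `C_p(A) × C_q(B) ⟶ C_m(A ⊗ B)` of a word of `m + 1` vertices: its columns act on
the first chain and its rows on the second one, and the results are multiplied entry by entry. -/
def grid (p q m : ℕ) (l : List (ℤ × ℤ)) :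
    NChain K A p →ₗ[K] NChain K B q →ₗ[K] NChain K (SuperTensor K A B) m :=
  (zip m).compl₁₂ (opL p m (l.map Prod.fst)) (opL q m (l.map Prod.snd))

lemma grid_apply (p q m : ℕ) (l : List (ℤ × ℤ)) (x : NChain K A p) (y : NChain K B q) :
    grid p q m l x y = zip m (opL p m (l.map Prod.fst) x) (opL q m (l.map Prod.snd) y) := rfl

/-- The words of `m + 1` vertices for which `grid` is meaningful. -/
def GoodWord (p q m : ℕ) (l : List (ℤ × ℤ)) : Prop :=
  l.length = m + 1 ∧ Good p (l.map Prod.fst) ∧ Good q (l.map Prod.snd)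

lemma length_stepWord {N : ℕ} (χ : Fin N → Bool) (x y : ℤ) : (stepWord χ x y).length = N + 1 := by
  simp [stepWord]

lemma stepCount_mono {N : ℕ} (c : Bool) (χ : Fin N → Bool) {s t : ℕ} (h : s ≤ t) :
    stepCount c χ s ≤ stepCount c χ t := by
  refine Finset.sum_le_sum fun i _ => ?_
  split_ifs with h1 h2 <;> first | omega | exact absurd ⟨by omega, h1.2⟩ h2

lemma IsShuffle.stepCount_le {p q : ℕ} (σ : Equiv.Perm (Fin (p + q))) (t : ℕ) :
    stepCount true (shSteps σ) t ≤ p ∧ stepCount false (shSteps σ) t ≤ q := by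
  rw [stepCount_true, stepCount_false]
  constructor
  · refine (Finset.sum_le_card_nsmul _ _ 1 fun s _ => ?_).trans (by simp)
    split_ifs <;> simp
  · refine (Finset.sum_le_card_nsmul _ _ 1 fun s _ => ?_).trans (by simp)
    split_ifs <;> simp

lemma goodWord_stepWord {p q : ℕ} (σ : Equiv.Perm (Fin (p + q))) :
    GoodWord p q (p + q) (stepWord (shSteps σ) 0 0) := by
  have hb := IsShuffle.stepCount_le σ
  refine ⟨length_stepWord _ _ _, ⟨?_, ?_⟩, ?_, ?_⟩
  · rw [stepWord, List.map_map, List.pairwise_map]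
    refine List.pairwise_lt_range.imp fun {s t} h => ?_
    have := stepCount_mono true (shSteps σ) h.le
    simpa using this
  · intro a ha b hb'
    simp only [stepWord, List.map_map, List.mem_map, Function.comp_apply] at ha hb'
    obtain ⟨t, -, rfl⟩ := ha
    obtain ⟨s, -, rfl⟩ := hb'
    have := (hb s).1
    omega
  · rw [stepWord, List.map_map, List.pairwise_map]
    refine List.pairwise_lt_range.imp fun {s t} h => ?_
    have := stepCount_mono false (shSteps σ) h.le
    simpa using this
  · intro a ha b hb'
    simp only [stepWord, List.map_map, List.mem_map, Function.comp_apply] at ha hb'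
    obtain ⟨t, -, rfl⟩ := ha
    obtain ⟨s, -, rfl⟩ := hb'
    have := (hb s).2
    omega

lemma ext_neg_one (n m : ℕ) (l : List ℤ) : ext n m l (-1) = l.getD m 0 - (n + 1) := by
  have h := ext_add n m l m (-1)
  rw [show (m : ℤ) + (m + 1) * (-1) = -1 by ring, ext_of_le l le_rfl] at h
  rw [h]; ring

lemma stepWord_fst_getD {N : ℕ} (χ : Fin N → Bool) {t : ℕ} (ht : t ≤ N) :
    ((stepWord χ 0 0).map Prod.fst).getD t 0 = stepCount true χ t := by
  rw [stepWord, List.map_map, getD_map_of_lt _ _ (by simp; omega) 0]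
  simp [Nat.lt_succ_of_le ht]

lemma stepWord_snd_getD {N : ℕ} (χ : Fin N → Bool) {t : ℕ} (ht : t ≤ N) :
    ((stepWord χ 0 0).map Prod.snd).getD t 0 = stepCount false χ t := by
  rw [stepWord, List.map_map, getD_map_of_lt _ _ (by simp; omega) 0]
  simp [Nat.lt_succ_of_le ht]

lemma parSum_positions {p q : ℕ} (σ : Equiv.Perm (Fin (p + q))) (g : ℕ → HArr K A) (s : ℕ)
    (hs : s ≤ p + q) : parSum (s + 1) g = (g 0).par +
      ((∑ i : Fin p, if (σ (Fin.castAdd q i) : ℕ) < s then (g (σ (Fin.castAdd q i) + 1)).par else 0) +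
      ∑ j : Fin q, if (σ (Fin.natAdd p j) : ℕ) < s then (g (σ (Fin.natAdd p j) + 1)).par else 0) := by
  rw [← sum_positions σ (fun u : Fin (p + q) => if (u : ℕ) < s then (g (u + 1)).par else 0),
    parSum, Finset.sum_range_succ', add_comm]
  congr 1
  rw [Fin.sum_univ_eq_sum_range (fun u => if u < s then (g (u + 1)).par else 0),
    ← Finset.sum_filter, show (Finset.range (p + q)).filter (· < s) = Finset.range s by
      ext u; simp; omega]

/-- The entry of a word operator between two consecutive letters. -/
lemma cycSeq_of {n m : ℕ} {l : List ℤ} (g : ℕ → HArr K A) {t : ℕ} (ht : t + 1 ≤ m) {a : ℕ}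
    {d : ℕ} (h1 : l.getD t 0 = a) (h2 : l.getD (t + 1) 0 = a + d) :
    cycSeq n (ext n m l) g (t + 1) = block (perSeq n g) a d := by
  rw [cycSeq, Nat.cast_succ, add_sub_cancel_right, ← Nat.cast_succ, ext_of_le l ht,
    ext_of_le l (by omega : t ≤ m), h1, h2]
  congr 1
  omega

/-- A term of the shuffle product is the pairing of a lattice path. -/
lemma shTerm_eq_grid {p q : ℕ} {σ : Equiv.Perm (Fin (p + q))} (hσ : IsShuffle p q σ)
    (x : NChain K A p) (y : NChain K B q) :
    shTerm (p + q) p q rfl σ hσ x y = grid p q (p + q) (stepWord (shSteps σ) 0 0) x y := by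
  revert x y
  suffices h : shTerm (K := K) (A := A) (B := B) (p + q) p q rfl σ hσ =
      grid p q (p + q) (stepWord (shSteps σ) 0 0) from
    fun x y => by rw [h]
  refine chain_ext₂ fun a b ha hb => ?_
  obtain ⟨hlen, hA, hB⟩ := goodWord_stepWord σ
  have cA := isCyc_ext hA (by simpa using hlen)
  have cB := isCyc_ext hB (by simpa using hlen)
  have tp : stepCount true (shSteps σ) (p + q) = p := stepCount_all σ
  have tq : stepCount false (shSteps σ) (p + q) = q := by
    have := stepCount_add (shSteps σ) le_rfl
    omega
  have eA : ext p (p + q) ((stepWord (shSteps σ) 0 0).map Prod.fst) (-1) = -1 := by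
    rw [ext_neg_one, stepWord_fst_getD _ le_rfl, tp]; ring
  have eB : ext q (p + q) ((stepWord (shSteps σ) 0 0).map Prod.snd) (-1) = -1 := by
    rw [ext_neg_one, stepWord_snd_getD _ le_rfl, tq]; ring
  set α := cycSeq p (ext p (p + q) ((stepWord (shSteps σ) 0 0).map Prod.fst)) a with hα
  set β := cycSeq q (ext q (p + q) ((stepWord (shSteps σ) 0 0).map Prod.snd)) b with hβ
  have e0a : ext p (p + q) ((stepWord (shSteps σ) 0 0).map Prod.fst) 0 = 0 := by
    have := ext_of_le (n := p) (m := p + q) ((stepWord (shSteps σ) 0 0).map Prod.fst)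
      (Nat.zero_le _)
    rwa [stepWord_fst_getD _ (Nat.zero_le _), stepCount_zero, Nat.cast_zero] at this
  have e0b : ext q (p + q) ((stepWord (shSteps σ) 0 0).map Prod.snd) 0 = 0 := by
    have := ext_of_le (n := q) (m := p + q) ((stepWord (shSteps σ) 0 0).map Prod.snd)
      (Nat.zero_le _)
    rwa [stepWord_snd_getD _ (Nat.zero_le _), stepCount_zero, Nat.cast_zero] at this
  have α0 : α 0 = a 0 := by
    rw [hα, cycSeq, Nat.cast_zero, zero_sub, eA, e0a]
    refine (block_one _).trans ?_
    exact perSeq_of_lt a (Nat.zero_le _)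
  have β0 : β 0 = b 0 := by
    rw [hβ, cycSeq, Nat.cast_zero, zero_sub, eB, e0b]
    refine (block_one _).trans ?_
    exact perSeq_of_lt b (Nat.zero_le _)
  -- in each step one of the two factors advances by a single morphism, and the other one by an
  -- identity
  have stepA : ∀ s : Fin (p + q), ∀ d : ℕ, (if shSteps σ s = true then 1 else 0) = d →
      α (s + 1) = block (perSeq p a) (stepCount true (shSteps σ) s : ℕ) d := by
    rintro s d rfl
    refine cycSeq_of a s.2 (stepWord_fst_getD _ s.2.le) ?_
    rw [stepWord_fst_getD _ s.2, stepCount_step, Nat.cast_add]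
  have stepB : ∀ s : Fin (p + q), ∀ d : ℕ, (if shSteps σ s = false then 1 else 0) = d →
      β (s + 1) = block (perSeq q b) (stepCount false (shSteps σ) s : ℕ) d := by
    rintro s d rfl
    refine cycSeq_of b s.2 (stepWord_snd_getD _ s.2.le) ?_
    rw [stepWord_snd_getD _ s.2, stepCount_step, Nat.cast_add]
  have α1 : ∀ i : Fin p, α (σ (Fin.castAdd q i) + 1) = a (i + 1) := fun i => by
    rw [stepA _ 1 (by simp), (hσ.stepCount_castAdd i).1]
    exact (block_one _).trans (perSeq_of_lt a (Nat.succ_le_of_lt i.2))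
  have β2 : ∀ j : Fin q, β (σ (Fin.natAdd p j) + 1) = b (j + 1) := fun j => by
    rw [stepB _ 1 (by simp), (hσ.stepCount_natAdd j).1]
    exact (block_one _).trans (perSeq_of_lt b (Nat.succ_le_of_lt j.2))
  have β1 : ∀ i : Fin p, β (σ (Fin.castAdd q i) + 1) =
      HArr.id (b (σ (Fin.castAdd q i) - i)).tgt := fun i => by
    rw [stepB _ 0 (by simp), (hσ.stepCount_castAdd i).2, block, ← hb.chainable,
      perSeq_of_lt b (hσ.bound_left i)]
  have α2 : ∀ j : Fin q, α (σ (Fin.natAdd p j) + 1) =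
      HArr.id (a (σ (Fin.natAdd p j) - j)).tgt := fun i => by
    rw [stepA _ 0 (by simp), (hσ.stepCount_natAdd i).2, block, ← ha.chainable,
      perSeq_of_lt a (hσ.bound_right i)]
  -- identities are even, so only the pairs `(a i, b j)` with `b j` in front of `a i` count
  have hsign : zipSign (p + q) α β = shSign p q σ a b := by
    rw [zipSign, Finset.sum_range_succ', parSum, Finset.sum_range_zero, mul_zero, add_zero,
      ← Fin.sum_univ_eq_sum_range (fun s => (α (s + 1)).par * parSum (s + 1) β),
      sum_positions σ]
    have z : ∑ j : Fin q, (α (σ (Fin.natAdd p j) + 1)).par * parSum (σ (Fin.natAdd p j) + 1) β = 0 :=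
      Finset.sum_eq_zero fun j _ => by
        rw [α2]
        exact zero_mul _
    rw [z, add_zero, shSign]
    refine Finset.sum_congr rfl fun i _ => ?_
    rw [α1, parSum_positions σ β _ (σ (Fin.castAdd q i)).2.le, β0, mul_add, mul_add]
    congr 1
    rw [Finset.mul_sum, Finset.mul_sum, Finset.sum_eq_zero, zero_add]
    · refine Finset.sum_congr rfl fun j _ => ?_
      rw [β2]
      simp only [Fin.lt_def]
      split_ifs <;> simp
    · intro i' _
      rw [β1]
      split_ifs
      · exact mul_zero _
      · exact mul_zero _
  rw [shTerm_cls rfl σ hσ ha hb, grid_apply, opL, opL, op_cls cA ha, op_cls cB hb,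
    cycSign_eq_zero eA, cycSign_eq_zero eB, ksgn_zero, one_smul, one_smul,
    zip_cls (ha.cycSeq cA) (hb.cycSeq cB), ← hα, ← hβ, hsign]
  congr 1
  refine cls_congr fun l hl => ?_
  rcases position_cases σ l hl with rfl | ⟨i, rfl⟩ | ⟨j, rfl⟩
  · rw [shSeq_zero, α0, β0]
  · rw [shSeq_castAdd, α1, β1]
  · rw [shSeq_natAdd, α2, β2]

end Grid

section GridWords

variable {K : Type w} [Field K]
  {A : Type u} [Category.{v} A] [Preadditive A] [Linear K A] [SuperCategory K A]
  {B : Type u'} [Category.{v'} B] [Preadditive B] [Linear K B] [SuperCategory K B]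

lemma ksgn_natCast (n : ℕ) : ksgn K (n : ZMod 2) = (-1) ^ n := by
  induction n with
  | zero => rw [Nat.cast_zero, ksgn_zero, pow_zero]
  | succ n ih => rw [ksgn_succ, ih, pow_succ, mul_neg_one]

/-- The pairing of a formal linear combination of words of `m + 1` vertices. -/
def gridW (p q m : ℕ) : Words K (ℤ × ℤ) →ₗ[K]
    NChain K A p →ₗ[K] NChain K B q →ₗ[K] NChain K (SuperTensor K A B) m :=
  wlift (grid p q m)

lemma gridW_wd (p q m : ℕ) (l : List (ℤ × ℤ)) :
    (gridW p q m (wd K l) : NChain K A p →ₗ[K] NChain K B q →ₗ[K] _) = grid p q m l :=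
  wlift_wd _ _

lemma gridW_apply (p q m : ℕ) (z : Words K (ℤ × ℤ)) (x : NChain K A p) (y : NChain K B q) :
    gridW p q m z x y = wlift (fun l => grid p q m l x y) z := by
  rw [gridW]
  simpa using lin_wlift ((LinearMap.applyₗ y) ∘ₗ (LinearMap.applyₗ (R := K) x)) (grid p q m) z

lemma GoodWord.eraseIdx {p q m k : ℕ} {l : List (ℤ × ℤ)} (h : GoodWord p q (m + 1) l)
    (hk : k < l.length) : GoodWord p q m (l.eraseIdx k) := by
  refine ⟨?_, h.2.1.sublist ((List.eraseIdx_sublist _ _).map _),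
    h.2.2.sublist ((List.eraseIdx_sublist _ _).map _)⟩
  rw [List.length_eraseIdx_of_lt hk, h.1]; omega

lemma IsPath.goodWord {p q m : ℕ} {u v : List ℤ} {l : List (ℤ × ℤ)} (h : IsPath u v l)
    (hu : Good p u) (hv : Good q v) (hm : u.length + v.length = m + 2) : GoodWord p q m l := by
  have hp := h.pairwise hu.1 hv.1
  have hl := h.length
  refine ⟨by omega, ⟨?_, ?_⟩, ?_, ?_⟩
  · rw [List.pairwise_map]
    exact hp.imp fun h => h.1
  · intro a ha b hb
    obtain ⟨c, hc, rfl⟩ := List.mem_map.1 ha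
    obtain ⟨d, hd, rfl⟩ := List.mem_map.1 hb
    exact hu.2 _ (h.mem c hc).1 _ (h.mem d hd).1
  · rw [List.pairwise_map]
    exact hp.imp fun h => h.2
  · intro a ha b hb
    obtain ⟨c, hc, rfl⟩ := List.mem_map.1 ha
    obtain ⟨d, hd, rfl⟩ := List.mem_map.1 hb
    exact hv.2 _ (h.mem c hc).2 _ (h.mem d hd).2

lemma paths_good {p q m : ℕ} {u v : List ℤ} (hu : Good p u) (hv : Good q v)
    (hm : u.length + v.length = m + 2) : paths K u v ∈ wordsOn K (GoodWord p q m) :=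
  wordsOn_mono (fun _ h => h.goodWord hu hv hm) (paths_mem u v)

lemma cpaths_good {p q m : ℕ} {u u' v v' : List ℤ} (hu : Good p (u ++ u')) (hv : Good q (v ++ v'))
    (hm : u.length + u'.length + (v.length + v'.length) = m + 2) :
    cpaths K u u' v v' ∈ wordsOn K (GoodWord p q m) :=
  wordsOn_mono (fun _ h => h.goodWord hu hv (by simpa using hm)) (cpaths_mem u u' v v')

/-- A face of the pairing of a word is the pairing of the word without a letter. This rests on
`zip_face` and `face_opL`. -/
lemma face_grid {p q m k : ℕ} {l : List (ℤ × ℤ)} (h : GoodWord p q (m + 1) l) (hk : k ≤ m + 1)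
    (x : NChain K A p) (y : NChain K B q) :
    face m k (grid p q (m + 1) l x y) = grid p q m (l.eraseIdx k) x y := by
  rw [grid_apply, ← zip_face hk, face_opL hk (by simpa using h.1) h.2.1,
    face_opL hk (by simpa using h.1) h.2.2, grid_apply, List.eraseIdx_map, List.eraseIdx_map]

lemma bdry_apply {C : Type u} [Category.{v} C] [Preadditive C] [Linear K C] [SuperCategory K C]
    (n : ℕ) (x : NChain K C (n + 1)) :
    bdry n x = ∑ k ∈ Finset.range (n + 2), (-1 : K) ^ k • face n k x := by
  simp [bdry, ksgn_natCast]

lemma altSum_eq_sum_smul {V M : Type*} [AddCommGroup M] [Module K M] (f : List V → M)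
    (l : List V) : altSum f l = ∑ k ∈ Finset.range l.length, (-1 : K) ^ k • f (l.eraseIdx k) := by
  rw [altSum_eq_sum]
  refine Finset.sum_congr rfl fun k _ => ?_
  rw [← Int.cast_smul_eq_zsmul K]
  simp

/-- A linear map sends a boundary to an alternating sum over the words without a letter. -/
lemma map_bdry {C : Type u} [Category.{v} C] [Preadditive C] [Linear K C] [SuperCategory K C]
    {M : Type*} [AddCommGroup M] [Module K M] (n : ℕ) (x : NChain K C (n + 1))
    (Φ : NChain K C n →ₗ[K] M) (F : List ℤ → M)
    (h : ∀ k, k ≤ n + 1 → Φ (opL (n + 1) n ((iv 0 (n + 2)).eraseIdx k) x) =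
      F ((iv 0 (n + 2)).eraseIdx k)) :
    Φ (bdry n x) = altSum F (iv 0 (n + 2)) := by
  rw [bdry_apply, map_sum, altSum_eq_sum_smul (K := K), length_iv]
  refine Finset.sum_congr rfl fun k hk => ?_
  rw [Finset.mem_range] at hk
  rw [map_smul, face_eq_opL (by omega), h k (by omega)]

/-- The pairing is compatible with the boundaries. -/
lemma bdry_gridW {p q m : ℕ} {z : Words K (ℤ × ℤ)} (hz : z ∈ wordsOn K (GoodWord p q (m + 1)))
    (x : NChain K A p) (y : NChain K B q) :
    bdry m (gridW p q (m + 1) z x y) = gridW p q m (wbd z) x y := by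
  rw [gridW_apply, gridW_apply, wlift_wbd, lin_wlift]
  refine eqOn_wordsOn (fun l hl => ?_) hz
  rw [wlift_wd, wlift_wd, bdry_apply, altSum_eq_sum_smul (K := K), hl.1]
  refine Finset.sum_congr rfl fun k hk => ?_
  rw [Finset.mem_range] at hk
  rw [face_grid hl (by omega)]

lemma gridW_op_left {p p' q m : ℕ} {φ : ℤ → ℤ} (hφ : IsCyc p p' φ) {z : Words K (ℤ × ℤ)}
    (hz : z ∈ wordsOn K (GoodWord p' q m)) (x : NChain K A p) (y : NChain K B q) :
    gridW p' q m z (op p p' φ x) y = gridW p q m (wmap (Prod.map φ id) z) x y := by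
  rw [gridW_apply, gridW_apply, wlift_wmap]
  refine eqOn_wordsOn (fun l hl => ?_) hz
  rw [wlift_wd, wlift_wd, grid_apply, grid_apply, opL_op hφ (by simpa using hl.1) hl.2.1,
    List.map_map, List.map_map, List.map_map]
  rfl

lemma gridW_op_right {p q q' m : ℕ} {φ : ℤ → ℤ} (hφ : IsCyc q q' φ) {z : Words K (ℤ × ℤ)}
    (hz : z ∈ wordsOn K (GoodWord p q' m)) (x : NChain K A p) (y : NChain K B q) :
    gridW p q' m z x (op q q' φ y) = gridW p q m (wmap (Prod.map id φ) z) x y := by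
  rw [gridW_apply, gridW_apply, wlift_wmap]
  refine eqOn_wordsOn (fun l hl => ?_) hz
  rw [wlift_wd, wlift_wd, grid_apply, grid_apply, opL_op hφ (by simpa using hl.1) hl.2.2,
    List.map_map, List.map_map, List.map_map]
  rfl

/-- The pairing does not change if the letters of one factor are moved by a period. -/
lemma gridW_add_period {p q m : ℕ} {z : Words K (ℤ × ℤ)}
    (hz : z ∈ wordsOn K (GoodWord p q m)) (x : NChain K A p) (y : NChain K B q) :
    gridW p q m (wmap (Prod.map id (· + ((q : ℤ) + 1))) z) x y = gridW p q m z x y := by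
  rw [gridW_apply, gridW_apply, wlift_wmap]
  refine eqOn_wordsOn (fun l hl => ?_) hz
  rw [wlift_wd, wlift_wd, grid_apply, grid_apply, ← opL_add_period (by simpa using hl.1) hl.2.2,
    List.map_map, List.map_map, List.map_map]
  rfl

/-- The shuffle product as a sum over lattice paths. -/
lemma sh_eq {n p q : ℕ} (hn : p + q = n) (x : NChain K A p) (y : NChain K B q) :
    sh n p q hn x y = gridW p q n (paths K (iv 0 (p + 1)) (iv 0 (q + 1))) x y := by
  subst hn
  classical
  rw [gridW_apply, ← sum_shuffles, sh, LinearMap.sum_apply, LinearMap.sum_apply]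
  refine Finset.sum_congr ?_ fun σ _ => ?_
  · ext; simp
  · rw [LinearMap.smul_apply, LinearMap.smul_apply, shTerm_eq_grid]

lemma iv_map_ext_take {n m N : ℕ} {l : List ℤ} (hl : l.length = m + 1) (hN : N ≤ m + 1) :
    (iv 0 N).map (ext n m l) = l.take N := by
  refine List.ext_getElem (by simp; omega) fun k h1 h2 => ?_
  rw [List.length_map, length_iv] at h1
  rw [List.getElem_map, getElem_iv, zero_add, ext_of_le l (by omega), List.getElem_take,
    List.getD_eq_getElem]

lemma iv_map_ext_drop {n m i : ℕ} {l : List ℤ} (hl : l.length = m + 1) (hi : i ≤ m) :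
    (iv (-1 - i) (i + 1)).map (ext n m l) = (l.drop (m - i)).map (· - ((n : ℤ) + 1)) := by
  refine List.ext_getElem (by simp; omega) fun k h1 h2 => ?_
  rw [List.length_map, length_iv] at h1
  have e : -1 - (i : ℤ) + k = ((m - i + k : ℕ) : ℤ) + (m + 1) * (-1) := by omega
  rw [List.getElem_map, getElem_iv, e, ext_add, ext_of_le l (by omega), List.getElem_map,
    List.getElem_drop, List.getD_eq_getElem]
  · ring
  · omega

lemma iv_map_ext {n m i : ℕ} {l : List ℤ} (hl : l.length = m + 1) (hi : i ≤ m) :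
    (iv (-1 - i) (m + 2)).map (ext n m l) =
      (l.drop (m - i)).map (· - ((n : ℤ) + 1)) ++ l.take (m - i + 1) := by
  rw [show m + 2 = (i + 1) + (m - i + 1) by omega, iv_append, List.map_append,
    iv_map_ext_drop hl hi, show -1 - (i : ℤ) + (i + 1 : ℕ) = 0 by push_cast; ring,
    iv_map_ext_take hl (by omega)]

/-- The chain `s t^i x` is given by the window of `ℤ` that starts at `-1 - i`. -/
lemma extra_rot_pow {C : Type u} [Category.{v} C] [Preadditive C] [Linear K C] [SuperCategory K C]
    (n i : ℕ) (x : NChain K C n) :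
    extra n ((rot n ^ i : NChain K C n →ₗ[K] NChain K C n) x) =
      (-1 : K) ^ (n * i) • opL n (n + 1) (iv (-1 - i) (n + 2)) x := by
  rw [rot_pow_eq, ← Nat.cast_mul, ksgn_natCast, LinearMap.smul_apply, map_smul, extra_eq_opL,
    opL_op (isCyc_add n _) (length_iv _ _) (good_iv _ le_rfl), iv_map_add]
  rfl

/-- The words of a shuffle of two cyclically permuted chains with a unit in front. -/
lemma grid_extra_rot {p q : ℕ} {i j : ℕ} (σ : Equiv.Perm (Fin ((p + 1) + (q + 1))))
    (x : NChain K A p) (y : NChain K B q) :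
    grid (p + 1) (q + 1) ((p + 1) + (q + 1)) (stepWord (shSteps σ) 0 0)
      (extra p ((rot p ^ i : NChain K A p →ₗ[K] _) x))
      (extra q ((rot q ^ j : NChain K B q →ₗ[K] _) y)) =
    (-1 : K) ^ (p * i + q * j) •
      grid p q ((p + 1) + (q + 1)) (stepWord (shSteps σ) (-1 - i) (-1 - j)) x y := by
  have hG := goodWord_stepWord σ
  have hb := IsShuffle.stepCount_le σ
  rw [extra_rot_pow, extra_rot_pow, map_smul, map_smul, LinearMap.smul_apply, smul_smul,
    mul_comm, ← pow_add]
  congr 1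
  refine congrArg₂ (fun a b => zip _ a b) ?_ ?_
  · change opL _ _ _ (op p (p + 1) (ext p (p + 1) (iv (-1 - (i : ℤ)) (p + 2))) x) = _
    rw [opL_op (isCyc_ext (good_iv _ le_rfl) (length_iv _ _)) (by simpa using hG.1) hG.2.1]
    congr 2
    rw [stepWord, stepWord, List.map_map, List.map_map, List.map_map]
    refine List.map_congr_left fun t _ => ?_
    simp only [Function.comp_apply, zero_add]
    have := (hb t).1
    rw [ext_of_le _ this, iv_getD (by omega)]
  · change opL _ _ _ (op q (q + 1) (ext q (q + 1) (iv (-1 - (j : ℤ)) (q + 2))) y) = _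
    rw [opL_op (isCyc_ext (good_iv _ le_rfl) (length_iv _ _)) (by simpa using hG.1) hG.2.2]
    congr 2
    rw [stepWord, stepWord, List.map_map, List.map_map, List.map_map]
    refine List.map_congr_left fun t _ => ?_
    simp only [Function.comp_apply, zero_add]
    have := (hb t).2
    rw [ext_of_le _ this, iv_getD (by omega)]

/-- The words of the cyclic shuffle product that belong to the rotations `i` and `j`. -/
def cycWords (K : Type w) [Field K] (p q i j : ℕ) : Words K (ℤ × ℤ) :=
  cpaths K (iv (-1 - i) (i + 1)) (iv 0 (p - i + 1)) (iv (-1 - j) (j + 1)) (iv 0 (q - j + 1))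

/-- The cyclic shuffle product as a sum over lattice paths that avoid a corner. -/
lemma csh_eq {n p q : ℕ} (hn : p + q + 2 = n) (x : NChain K A p) (y : NChain K B q) :
    csh n p q hn x y = (-1 : K) ^ p • ∑ i ∈ Finset.range (p + 1), ∑ j ∈ Finset.range (q + 1),
      (-1 : K) ^ (p * i + q * j) • gridW p q n (cycWords K p q i j) x y := by
  obtain rfl : n = (p + 1) + (q + 1) := by omega
  classical
  simp only [csh, LinearMap.smul_apply, LinearMap.sum_apply]
  rw [← Fin.sum_univ_eq_sum_range (fun i => ∑ j ∈ Finset.range (q + 1),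
      (-1 : K) ^ (p * i + q * j) • gridW p q (p + 1 + (q + 1)) (cycWords K p q i j) x y)]
  congr 1
  refine Finset.sum_congr rfl fun i _ => ?_
  rw [← Fin.sum_univ_eq_sum_range (fun j =>
      (-1 : K) ^ (p * i + q * j) • gridW p q (p + 1 + (q + 1)) (cycWords K p q i j) x y)]
  refine Finset.sum_congr rfl fun j _ => ?_
  have hi := i.2
  have hj := j.2
  -- the condition on the shuffles says that the path avoids a corner
  have key := cpaths_eq_filter (K := K) (i + 1) (j + 1) (p - i) (q - j)
    (fun l => grid p q (p + 1 + (q + 1)) l x y)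
  rw [show -(((i : ℕ) + 1 : ℕ) : ℤ) = -1 - (i : ℕ) by push_cast; ring,
    show -(((j : ℕ) + 1 : ℕ) : ℤ) = -1 - (j : ℕ) by push_cast; ring,
    show (i : ℕ) + 1 + (p - i + 1) = p + 1 + 1 by omega,
    show (j : ℕ) + 1 + (q - j + 1) = q + 1 + 1 by omega, ← sum_shuffles] at key
  rw [gridW_apply, cycWords, key, Finset.smul_sum]
  have e1 : ∀ σ : {σ : Equiv.Perm (Fin ((p + 1) + (q + 1))) // IsShuffle (p + 1) (q + 1) σ ∧
        σ (Fin.castAdd (q + 1) i) < σ (Fin.natAdd (p + 1) j)},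
      ((Equiv.Perm.sign σ.1 : ℤ) : K) •
        (shTerm (p + 1 + (q + 1)) (p + 1) (q + 1) rfl σ.1 σ.2.1).compl₁₂
          (extra p ∘ₗ rot p ^ (i : ℕ)) (extra q ∘ₗ rot q ^ (j : ℕ)) x y =
      (-1 : K) ^ (p * i + q * j) • ((Equiv.Perm.sign σ.1 : ℤ) : K) •
        grid p q ((p + 1) + (q + 1)) (stepWord (shSteps σ.1) (-1 - (i : ℕ)) (-1 - (j : ℕ))) x y := by
    intro σ
    rw [LinearMap.compl₁₂_apply, LinearMap.comp_apply, LinearMap.comp_apply, shTerm_eq_grid,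
      grid_extra_rot, smul_comm]
  refine (Finset.sum_congr rfl fun σ _ => e1 σ).trans ?_
  rw [← Finset.sum_subtype (Finset.univ.filter fun σ : Equiv.Perm (Fin ((p + 1) + (q + 1))) =>
      IsShuffle (p + 1) (q + 1) σ ∧ σ (Fin.castAdd (q + 1) i) < σ (Fin.natAdd (p + 1) j))
      (by simp) (fun σ => (-1 : K) ^ (p * i + q * j : ℕ) • ((Equiv.Perm.sign σ : ℤ) : K) •
        grid p q ((p + 1) + (q + 1)) (stepWord (shSteps σ) (-1 - (i : ℕ)) (-1 - (j : ℕ))) x y),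
    ← Finset.filter_filter, Finset.sum_filter,
    Finset.sum_subtype (p := IsShuffle (p + 1) (q + 1)) _ (by simp)]
  refine Finset.sum_congr rfl fun σ _ => ?_
  by_cases h : σ.1 (Fin.castAdd (q + 1) i) < σ.1 (Fin.natAdd (p + 1) j)
  · rw [if_pos h, if_pos ((σ.2.crossing i j).1 h)]
  · rw [if_neg h, if_neg fun h' => h ((σ.2.crossing i j).2 h'), smul_zero, smul_zero]

end GridWords

/-! ### The shuffle maps and the operators of the mixed complexes -/

/-- The alternating sum over the windows `(-1 - i, …, -1 | 0, …, p - i)`. Dropping the first letter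
of a window and dropping the last letter of the previous window cancel, which leaves the first
and the last term; the other terms are the windows of the words `(0, …, p)` without a letter. -/
lemma altSum_rotations {K : Type*} [CommRing K] {M : Type*} [AddCommGroup M] [Module K M]
    (F : List ℤ → List ℤ → M) (p : ℕ) :
    ∑ i ∈ Finset.range (p + 1), (-1 : K) ^ (p * i) •
      (altSum (fun w => F w (iv 0 (p - i + 1))) (iv (-1 - i) (i + 1)) +
        (-1 : K) ^ (i + 1) • altSum (F (iv (-1 - i) (i + 1))) (iv 0 (p - i + 1))) =
    F [] (iv 0 (p + 1)) - F (iv (-1 - p) (p + 1)) [] -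
      ∑ i ∈ Finset.range p, (-1 : K) ^ ((p + 1) * i) •
        altSum (fun l => F ((l.drop (p - 1 - i)).map (· - ((p : ℤ) + 1))) (l.take (p - i)))
          (iv 0 (p + 1)) := by
  -- `e i` collects the terms that telescope; `f` and `g` are the sums over the left part of a window
  -- without its first letter and over the right part without its last letter
  let e : ℕ → M := fun i => (-1 : K) ^ (p * i) • F (iv (-i) i) (iv 0 (p + 1 - i))
  let f : ℕ → M := fun i => (-1 : K) ^ (p * i) •
    altSum (fun w => F ((-1 - i : ℤ) :: w) (iv 0 (p - i + 1))) (iv (-i) i)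
  let g : ℕ → M := fun i => (-1 : K) ^ (p * i + i + 1) •
    altSum (fun w => F (iv (-1 - i) (i + 1)) (w ++ [((p - i : ℕ) : ℤ)])) (iv 0 (p - i))
  have h1 : ∀ i ∈ Finset.range (p + 1), (-1 : K) ^ (p * i) •
      (altSum (fun w => F w (iv 0 (p - i + 1))) (iv (-1 - i) (i + 1)) +
        (-1 : K) ^ (i + 1) • altSum (F (iv (-1 - i) (i + 1))) (iv 0 (p - i + 1))) =
      (e i - e (i + 1)) + (g i - f i) := by
    intro i hi
    rw [Finset.mem_range] at hi
    have a1 : iv (-1 - (i : ℤ)) (i + 1) = (-1 - i : ℤ) :: iv (-i) i := by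
      rw [iv_succ]; congr 2; ring
    have a2 : iv 0 (p - i + 1) = iv 0 (p - i) ++ [((p - i : ℕ) : ℤ)] := by
      rw [iv_succ', zero_add]
    have a3 : altSum (F (iv (-1 - (i : ℤ)) (i + 1))) (iv 0 (p - i + 1)) =
        altSum (fun w => F (iv (-1 - i) (i + 1)) (w ++ [((p - i : ℕ) : ℤ)])) (iv 0 (p - i)) +
        (-1 : K) ^ (p - i) • F (iv (-1 - i) (i + 1)) (iv 0 (p - i)) := by
      rw [a2, altSum_append, length_iv, altSum_cons, altSum_nil, sub_zero, List.append_nil,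
        ← Int.cast_smul_eq_zsmul K]
      push_cast
      rfl
    have a4 : altSum (fun w => F w (iv 0 (p - i + 1))) (iv (-1 - i) (i + 1)) =
        F (iv (-i) i) (iv 0 (p + 1 - i)) -
          altSum (fun w => F ((-1 - i : ℤ) :: w) (iv 0 (p - i + 1))) (iv (-i) i) := by
      rw [a1, altSum_cons, show p + 1 - i = p - i + 1 by omega]
    have a5 : e (i + 1) = -((-1 : K) ^ (p * i) • (-1 : K) ^ (i + 1) • (-1 : K) ^ (p - i) •
        F (iv (-1 - i) (i + 1)) (iv 0 (p - i))) := by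
      simp only [e]
      rw [smul_smul, smul_smul, ← pow_add, ← pow_add, show p * i + (i + 1) + (p - i) = p * i + (p + 1) by omega,
        ← neg_smul, show p * i + (p + 1) = p * (i + 1) + 1 by ring, pow_succ _ (p * (i + 1)),
        mul_neg_one, neg_neg, show p + 1 - (i + 1) = p - i by omega]
      congr 3
      push_cast; ring
    rw [a3, a4, a5]
    simp only [e, f, g]
    rw [add_assoc, pow_add _ (p * i) (i + 1), mul_smul]
    simp only [smul_add, smul_sub]
    abel
  -- the windows of the shortened words: the missing letter belongs to the left part of the window
  -- `i + 1` or to the right part of the window `i`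
  have h2 : ∀ i ∈ Finset.range p, (-1 : K) ^ ((p + 1) * i) •
        altSum (fun l => F ((l.drop (p - 1 - i)).map (· - ((p : ℤ) + 1))) (l.take (p - i)))
          (iv 0 (p + 1)) = f (i + 1) - g i := by
    intro i hi
    rw [Finset.mem_range] at hi
    have b1 : iv 0 (p + 1) = iv 0 (p - i) ++ iv ((p - i : ℕ) : ℤ) (i + 1) := by
      rw [show p + 1 = p - i + (i + 1) by omega, iv_append, zero_add]
    have b2 : altSum (fun w => F (((w ++ iv ((p - i : ℕ) : ℤ) (i + 1)).drop (p - 1 - i)).map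
          (· - ((p : ℤ) + 1))) ((w ++ iv ((p - i : ℕ) : ℤ) (i + 1)).take (p - i))) (iv 0 (p - i)) =
        altSum (fun w => F (iv (-1 - i) (i + 1)) (w ++ [((p - i : ℕ) : ℤ)])) (iv 0 (p - i)) := by
      refine altSum_congr_length fun w hw => ?_
      rw [length_iv] at hw
      have hw' : w.length = p - 1 - i := by omega
      rw [List.drop_left' hw', List.take_append, List.take_of_length_le (by omega),
        show p - i - w.length = 1 by omega, iv_succ, List.take_succ_cons, List.take_zero, ← iv_succ]
      congr 1
      simp only [sub_eq_add_neg]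
      rw [iv_map_add]
      congr 1
      omega
    have b3 : altSum (fun w => F (((iv 0 (p - i) ++ w).drop (p - 1 - i)).map
          (· - ((p : ℤ) + 1))) ((iv 0 (p - i) ++ w).take (p - i))) (iv ((p - i : ℕ) : ℤ) (i + 1)) =
        altSum (fun w => F ((-1 - (i + 1 : ℕ) : ℤ) :: w) (iv 0 (p - (i + 1) + 1)))
          (iv (-(i + 1 : ℕ)) (i + 1)) := by
      rw [show iv (-((i + 1 : ℕ) : ℤ)) (i + 1) =
        (iv ((p - i : ℕ) : ℤ) (i + 1)).map (· - ((p : ℤ) + 1)) from ?_, altSum_map]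
      · refine congrArg₂ altSum (funext fun w => ?_) rfl
        rw [List.take_left' (length_iv _ _), show p - (i + 1) + 1 = p - i by omega]
        congr 1
        rw [show p - i = (p - 1 - i) + 1 by omega, iv_succ', List.append_assoc,
          List.drop_left' (length_iv _ _), List.singleton_append, List.map_cons]
        congr 1
        omega
      · simp only [sub_eq_add_neg]
        rw [iv_map_add]
        congr 1
        omega
    rw [b1, altSum_append, b2, b3, length_iv, ← Int.cast_smul_eq_zsmul K]
    have s1 : (-1 : K) ^ ((p + 1) * i) = -(-1 : K) ^ (p * i + i + 1) := by
      rw [pow_succ, mul_neg_one, neg_neg, add_mul, one_mul]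
    have s2 : (p + 1) * i + (p - i) = p * (i + 1) := by
      rw [add_mul, one_mul, add_assoc, mul_add, mul_one]
      congr 1
      omega
    simp only [f, g, Int.cast_pow, Int.cast_neg, Int.cast_one]
    rw [smul_add, smul_smul, ← pow_add, s2, s1, neg_smul]
    abel
  rw [Finset.sum_congr rfl h1, Finset.sum_congr rfl h2, Finset.sum_add_distrib,
    Finset.sum_range_sub', Finset.sum_sub_distrib, Finset.sum_sub_distrib,
    Finset.sum_range_succ g, Finset.sum_range_succ' f]
  have c1 : e 0 = F [] (iv 0 (p + 1)) := by simp [e]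
  have c2 : e (p + 1) = F (iv (-1 - p) (p + 1)) [] := by
    simp only [e]
    rw [Even.neg_one_pow (Nat.even_mul_succ_self p), one_smul, Nat.sub_self, iv_zero]
    congr 2
    push_cast; ring
  have c3 : g p = 0 := by simp [g]
  have c4 : f 0 = 0 := by simp [f]
  rw [c1, c2, c3, c4]
  abel

section Identities

variable {K : Type w} [Field K]
  {A : Type u} [Category.{v} A] [Preadditive A] [Linear K A] [SuperCategory K A]
  {B : Type u'} [Category.{v'} B] [Preadditive B] [Linear K B] [SuperCategory K B]

lemma gridW_altSum {V : Type*} (p q m : ℕ) (F : List V → Words K (ℤ × ℤ)) (l : List V)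
    (x : NChain K A p) (y : NChain K B q) :
    gridW p q m (altSum F l) x y = altSum (fun w => gridW p q m (F w) x y) l := by
  simp only [gridW_apply]
  rw [altSum_lin]

lemma gridW_bdry_left {p q m : ℕ} (F : List ℤ → Words K (ℤ × ℤ)) {z : Words K (ℤ × ℤ)}
    (hz : z ∈ wordsOn K (GoodWord p q m))
    (h : ∀ k, k ≤ p + 1 →
      wmap (Prod.map (ext (p + 1) p ((iv 0 (p + 2)).eraseIdx k)) id) z =
        F ((iv 0 (p + 2)).eraseIdx k)) (x : NChain K A (p + 1)) (y : NChain K B q) :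
    gridW p q m z (bdry p x) y = gridW (p + 1) q m (altSum F (iv 0 (p + 2))) x y := by
  rw [gridW_altSum]
  refine map_bdry p x ((gridW p q m z).flip y) _ fun k hk => ?_
  rw [LinearMap.flip_apply, opL, gridW_op_left (isCyc_ext ((good_iv _ (by omega)).sublist
    (List.eraseIdx_sublist _ _)) (by rw [List.length_eraseIdx_of_lt] <;> simp; omega)) hz, h k hk]

lemma gridW_bdry_right {p q m : ℕ} (F : List ℤ → Words K (ℤ × ℤ)) {z : Words K (ℤ × ℤ)}
    (hz : z ∈ wordsOn K (GoodWord p q m))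
    (h : ∀ k, k ≤ q + 1 →
      wmap (Prod.map id (ext (q + 1) q ((iv 0 (q + 2)).eraseIdx k))) z =
        F ((iv 0 (q + 2)).eraseIdx k)) (x : NChain K A p) (y : NChain K B (q + 1)) :
    gridW p q m z x (bdry q y) = gridW p (q + 1) m (altSum F (iv 0 (q + 2))) x y := by
  rw [gridW_altSum]
  refine map_bdry q y (gridW p q m z x) _ fun k hk => ?_
  rw [opL, gridW_op_right (isCyc_ext ((good_iv _ (by omega)).sublist
    (List.eraseIdx_sublist _ _)) (by rw [List.length_eraseIdx_of_lt] <;> simp; omega)) hz, h k hk]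

lemma length_iv_eraseIdx {n k : ℕ} (hk : k ≤ n + 1) :
    ((iv 0 (n + 2)).eraseIdx k).length = n + 1 := by
  rw [List.length_eraseIdx_of_lt] <;> simp; omega

lemma sh_bdry_left {m p q : ℕ} (hn : p + q = m) (x : NChain K A (p + 1)) (y : NChain K B q) :
    sh m p q hn (bdry p x) y =
      gridW (p + 1) q m (altSum (fun w => paths K w (iv 0 (q + 1))) (iv 0 (p + 2))) x y := by
  rw [sh_eq, gridW_bdry_left _ (paths_good (good_iv _ (by omega)) (good_iv _ (by omega))
    (by simp; omega))]
  intro k hk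
  have hl := length_iv_eraseIdx hk
  rw [wmap_paths, iv_map_ext_take hl le_rfl, List.take_of_length_le hl.le, List.map_id]

lemma sh_bdry_right {m p q : ℕ} (hn : p + q = m) (x : NChain K A p) (y : NChain K B (q + 1)) :
    sh m p q hn x (bdry q y) =
      gridW p (q + 1) m (altSum (fun w => paths K (iv 0 (p + 1)) w) (iv 0 (q + 2))) x y := by
  rw [sh_eq, gridW_bdry_right _ (paths_good (good_iv _ (by omega)) (good_iv _ (by omega))
    (by simp; omega))]
  intro k hk
  have hl := length_iv_eraseIdx hk
  rw [wmap_paths, iv_map_ext_take hl le_rfl, List.take_of_length_le hl.le, List.map_id]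

/-- The shuffle map is compatible with the boundary, before the degrees `p = 0` and `q = 0` are
separated from the others. -/
lemma bdry_sh {m p q : ℕ} (hn : p + q = m + 1) (x : NChain K A p) (y : NChain K B q) :
    bdry m (sh (m + 1) p q hn x y) =
      gridW p q m (altSum (fun w => paths K w (iv 0 (q + 1))) (iv 0 (p + 1))) x y +
      (-1 : K) ^ p • gridW p q m (altSum (fun w => paths K (iv 0 (p + 1)) w) (iv 0 (q + 1))) x y := by
  rw [sh_eq, bdry_gridW (paths_good (good_iv _ (by omega)) (good_iv _ (by omega))
    (by simp; omega)), wbd_paths, if_neg (by simp; omega), add_zero, map_add, map_smul, length_iv,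
    show p + 1 + 1 = p + 2 by rfl, pow_add]
  simp

/-- The shuffle product is compatible with the boundaries. -/
lemma bdry_sh_succ_succ {m p q : ℕ} (hn : p + 1 + (q + 1) = m + 1) (x : NChain K A (p + 1))
    (y : NChain K B (q + 1)) : bdry m (sh (m + 1) (p + 1) (q + 1) hn x y) =
      sh m p (q + 1) (by omega) (bdry p x) y +
      (-1 : K) ^ (p + 1) • sh m (p + 1) q (by omega) x (bdry q y) := by
  rw [bdry_sh, sh_bdry_left, sh_bdry_right]

lemma bdry_sh_succ_zero {m p : ℕ} (hn : p + 1 + 0 = m + 1) (x : NChain K A (p + 1))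
    (y : NChain K B 0) : bdry m (sh (m + 1) (p + 1) 0 hn x y) =
      sh m p 0 (by omega) (bdry p x) y := by
  rw [bdry_sh, sh_bdry_left, zero_add, iv_succ, iv_zero, altSum_cons (l := []), altSum_nil,
    paths_nil_right]
  simp

lemma bdry_sh_zero_succ {m q : ℕ} (hn : 0 + (q + 1) = m + 1) (x : NChain K A 0)
    (y : NChain K B (q + 1)) : bdry m (sh (m + 1) 0 (q + 1) hn x y) =
      sh m 0 q (by omega) x (bdry q y) := by
  have : altSum (fun w => paths K w (iv 0 (q + 1 + 1))) (iv 0 (0 + 1)) = 0 := by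
    rw [zero_add, iv_succ 0 0, iv_zero, altSum_cons, altSum_nil, paths_nil_left, sub_zero]
  rw [bdry_sh, sh_bdry_right, this]
  simp

/-- The words that arise from the cyclic shuffles of a face of the first chain. -/
lemma csh_bdry_left {n p q : ℕ} (hn : p + q + 2 = n) (x : NChain K A (p + 1)) (y : NChain K B q) :
    csh n p q hn (bdry p x) y = (-1 : K) ^ p • ∑ i ∈ Finset.range (p + 1),
      ∑ j ∈ Finset.range (q + 1), (-1 : K) ^ (p * i + q * j) • gridW (p + 1) q n
        (altSum (fun l => cpaths K ((l.drop (p - i)).map (· - (((p + 1 : ℕ) : ℤ) + 1)))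
          (l.take (p - i + 1)) (iv (-1 - j) (j + 1)) (iv 0 (q - j + 1))) (iv 0 (p + 2))) x y := by
  rw [csh_eq]
  congr 1
  refine Finset.sum_congr rfl fun i hi => Finset.sum_congr rfl fun j hj => ?_
  rw [Finset.mem_range] at hi hj
  congr 1
  refine gridW_bdry_left _ (cpaths_good ?_ ?_ ?_) ?_ x y
  · rw [show (0 : ℤ) = -1 - i + ((i + 1 : ℕ) : ℤ) by push_cast; ring, ← iv_append]
    exact good_iv _ (by omega)
  · rw [show (0 : ℤ) = -1 - j + ((j + 1 : ℕ) : ℤ) by push_cast; ring, ← iv_append]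
    exact good_iv _ (by omega)
  · simp; omega
  · intro k hk
    have hl := length_iv_eraseIdx hk
    rw [wmap_cpaths, iv_map_ext_drop hl (by omega), iv_map_ext_take hl (by omega),
      List.map_id, List.map_id]

lemma csh_bdry_right {n p q : ℕ} (hn : p + q + 2 = n) (x : NChain K A p) (y : NChain K B (q + 1)) :
    csh n p q hn x (bdry q y) = (-1 : K) ^ p • ∑ i ∈ Finset.range (p + 1),
      ∑ j ∈ Finset.range (q + 1), (-1 : K) ^ (p * i + q * j) • gridW p (q + 1) n
        (altSum (fun l => cpaths K (iv (-1 - i) (i + 1)) (iv 0 (p - i + 1))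
          ((l.drop (q - j)).map (· - (((q + 1 : ℕ) : ℤ) + 1)))
          (l.take (q - j + 1))) (iv 0 (q + 2))) x y := by
  rw [csh_eq]
  congr 1
  refine Finset.sum_congr rfl fun i hi => Finset.sum_congr rfl fun j hj => ?_
  rw [Finset.mem_range] at hi hj
  congr 1
  refine gridW_bdry_right _ (cpaths_good ?_ ?_ ?_) ?_ x y
  · rw [show (0 : ℤ) = -1 - i + ((i + 1 : ℕ) : ℤ) by push_cast; ring, ← iv_append]
    exact good_iv _ (by omega)
  · rw [show (0 : ℤ) = -1 - j + ((j + 1 : ℕ) : ℤ) by push_cast; ring, ← iv_append]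
    exact good_iv _ (by omega)
  · simp; omega
  · intro k hk
    have hl := length_iv_eraseIdx hk
    rw [wmap_cpaths, iv_map_ext_drop hl (by omega), iv_map_ext_take hl (by omega),
      List.map_id, List.map_id]

/-- Connes' operator as a sum over the windows of `ℤ`. -/
lemma extra_normOp {C : Type u} [Category.{v} C] [Preadditive C] [Linear K C] [SuperCategory K C]
    (n : ℕ) (x : NChain K C n) : extra n (normOp n x) = ∑ i ∈ Finset.range (n + 1),
      (-1 : K) ^ (n * i) • opL n (n + 1) (iv (-1 - i) (n + 2)) x := by
  rw [normOp, LinearMap.sum_apply, map_sum]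
  exact Finset.sum_congr rfl fun i _ => extra_rot_pow n i x

lemma sh_extraNorm_left {n p q : ℕ} (hn : p + 1 + q = n) (x : NChain K A p) (y : NChain K B q) :
    sh n (p + 1) q hn (extra p (normOp p x)) y = ∑ i ∈ Finset.range (p + 1),
      (-1 : K) ^ (p * i) • gridW p q n (paths K (iv (-1 - i) (p + 2)) (iv 0 (q + 1))) x y := by
  rw [extra_normOp, map_sum, LinearMap.sum_apply]
  refine Finset.sum_congr rfl fun i _ => ?_
  rw [map_smul, LinearMap.smul_apply, sh_eq, opL, gridW_op_left (isCyc_ext (good_iv _ le_rfl)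
    (length_iv _ _)) (paths_good (good_iv _ (by omega)) (good_iv _ (by omega)) (by simp; omega)),
    wmap_paths, iv_map_ext_take (length_iv _ _) le_rfl, List.take_of_length_le (length_iv _ _).le,
    List.map_id]

lemma sh_extraNorm_right {n p q : ℕ} (hn : p + (q + 1) = n) (x : NChain K A p)
    (y : NChain K B q) :
    sh n p (q + 1) hn x (extra q (normOp q y)) = ∑ j ∈ Finset.range (q + 1),
      (-1 : K) ^ (q * j) • gridW p q n (paths K (iv 0 (p + 1)) (iv (-1 - j) (q + 2))) x y := by
  rw [extra_normOp, map_sum]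
  refine Finset.sum_congr rfl fun i _ => ?_
  rw [map_smul, sh_eq, opL, gridW_op_right (isCyc_ext (good_iv _ le_rfl)
    (length_iv _ _)) (paths_good (good_iv _ (by omega)) (good_iv _ (by omega)) (by simp; omega)),
    wmap_paths, iv_map_ext_take (length_iv _ _) le_rfl, List.take_of_length_le (length_iv _ _).le,
    List.map_id]

end Identities

/-! ### The boundary of the cyclic shuffle product -/

section CyclicIdentity

variable {K : Type w} [Field K]
  {A : Type u} [Category.{v} A] [Preadditive A] [Linear K A] [SuperCategory K A]
  {B : Type u'} [Category.{v'} B] [Preadditive B] [Linear K B] [SuperCategory K B]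

lemma neg_one_pow_eq {R : Type*} [CommRing R] {m n a b : ℕ} (h : m + 2 * a = n + 2 * b) :
    (-1 : R) ^ m = (-1) ^ n := by
  have := congrArg (fun k => (-1 : R) ^ k) h
  simpa [pow_add, pow_mul] using this

lemma opL_rot {C : Type u} [Category.{v} C] [Preadditive C] [Linear K C] [SuperCategory K C]
    {p n c : ℕ} {l : List ℤ} (hl : l.length = n + 1) (hG : Good p l) (hc : c ≤ n)
    (x : NChain K C p) :
    opL n (n + 1) (iv (-1) (n + 2)) (op n n (· + (-(c : ℤ))) (opL p n l x)) =
      opL p (n + 1) ((l.drop (n - c)).map (· - ((p : ℤ) + 1)) ++ l.take (n - c + 1)) x := by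
  have h1 := isCyc_ext hG hl
  rw [opL_op (isCyc_add n _) (length_iv _ _) (good_iv _ le_rfl), iv_map_add, opL,
    ← iv_map_ext hl hc]
  exact opL_op h1 (length_iv _ _) (good_iv _ le_rfl) x

/-- A cyclic permutation of a word, with a unit in front: the word is cut at one of its letters,
which then belongs to both parts, and the back part is moved to the front. -/
lemma extra_rot_grid {p q n c : ℕ} {l : List (ℤ × ℤ)} (h : GoodWord p q n l) (hc : c ≤ n)
    (x : NChain K A p) (y : NChain K B q) :
    extra n ((rot n ^ c : NChain K (SuperTensor K A B) n →ₗ[K] _) (grid p q n l x y)) =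
      (-1 : K) ^ (n * c) • grid p q (n + 1)
        ((l.drop (n - c)).map (Prod.map (· - ((p : ℤ) + 1)) (· - ((q : ℤ) + 1))) ++
          l.take (n - c + 1)) x y := by
  rw [rot_pow_eq, ← Nat.cast_mul, ksgn_natCast, LinearMap.smul_apply, map_smul]
  congr 1
  rw [grid_apply, ← zip_sub, ← zip_extra, extra_eq_opL, extra_eq_opL,
    opL_rot (by simpa using h.1) h.2.1 hc, opL_rot (by simpa using h.1) h.2.2 hc, grid_apply,
    List.map_append, List.map_append, List.map_map, List.map_map, List.map_drop, List.map_drop,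
    List.map_take, List.map_take, List.map_drop, List.map_drop, List.map_map, List.map_map]
  rfl

/-- Connes' operator, applied to the pairing of a word, as a sum over the cuts of the word. -/
lemma extra_normOp_grid {p q n : ℕ} {l : List (ℤ × ℤ)} (h : GoodWord p q n l)
    (x : NChain K A p) (y : NChain K B q) :
    extra n (normOp n (grid p q n l x y)) = cutSum (fun w w' => (-1 : K) ^ (n * (w'.length + 1)) •
      grid p q (n + 1)
        (w'.map (Prod.map (· - ((p : ℤ) + 1)) (· - ((q : ℤ) + 1))) ++ w) x y) l := by
  rw [cutSum_eq_sum, normOp, LinearMap.sum_apply, map_sum, h.1,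
    ← Finset.sum_range_reflect (n := n + 1)]
  refine Finset.sum_congr rfl fun k hk => ?_
  rw [Finset.mem_range] at hk
  rw [extra_rot_grid h (by omega), List.length_drop, h.1]
  congr 1
  · rw [show n + 1 - 1 - k = n - k by omega, show n + 1 - k + 1 = n - k + 2 by omega, mul_add,
      pow_add, mul_comm n 2, pow_mul (-1 : K) 2 n]
    simp
  · rw [show n - (n + 1 - 1 - k) = k by omega]

/-- Connes' operator of a shuffle product, up to degenerate chains: the sum over the pairs of
paths which together form a path that passes through the corner between the rotated and the
other columns and rows. -/
lemma extraNorm_sh {n p q : ℕ} (hn : p + q = n) (x : NChain K A p) (y : NChain K B q) :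
    extra n (normOp n (sh n p q hn x y)) = ∑ i ∈ Finset.range (p + 1),
      ∑ j ∈ Finset.range (q + 1), (-1 : K) ^ (i * (q - j) + n * (i + j)) •
        gridW p q (n + 1) (cat (paths K (iv (-1 - i) (i + 1)) (iv (-1 - j) (j + 1)))
          (paths K (iv 0 (p - i + 1)) (iv 0 (q - j + 1)))) x y := by
  let τ : ℤ × ℤ → ℤ × ℤ := Prod.map (· - ((p : ℤ) + 1)) (· - ((q : ℤ) + 1))
  let G : Words K (ℤ × ℤ) →ₗ[K] Words K (ℤ × ℤ) →ₗ[K] NChain K (SuperTensor K A B) (n + 1) :=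
    wlift fun w => wlift fun w' => (-1 : K) ^ (n * (w'.length + 1)) •
      grid p q (n + 1) (w'.map τ ++ w) x y
  -- the paths in the two parts of a cut, with the back part moved to the front by a period
  have hG : ∀ (u₁ v₁ u₂ v₂ : List ℤ), G (paths K u₁ v₁) (paths K u₂ v₂) =
      (-1 : K) ^ (n * (u₂.length + v₂.length)) • gridW p q (n + 1)
        (cat (paths K (u₂.map (· - ((p : ℤ) + 1))) (v₂.map (· - ((q : ℤ) + 1))))
          (paths K u₁ v₁)) x y := by
    intro u₁ v₁ u₂ v₂
    have e1 : ∀ w, G (wd K w) (paths K u₂ v₂) =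
        (-1 : K) ^ (n * (u₂.length + v₂.length)) • gridW p q (n + 1)
        (cat (paths K (u₂.map (· - ((p : ℤ) + 1))) (v₂.map (· - ((q : ℤ) + 1))))
          (wd K w)) x y := by
      intro w
      simp only [G, wlift_wd]
      rw [← wmap_paths, gridW_apply]
      have : ∀ w', IsPath u₂ v₂ w' → (-1 : K) ^ (n * (w'.length + 1)) •
          grid p q (n + 1) (w'.map τ ++ w) x y = (-1 : K) ^ (n * (u₂.length + v₂.length)) •
          grid p q (n + 1) (w'.map τ ++ w) x y := fun w' hw' => by rw [hw'.length]
      rw [wlift_paths_congr _ _ this]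
      let g : NChain K (SuperTensor K A B) (n + 1) →ₗ[K] NChain K (SuperTensor K A B) (n + 1) :=
        (-1 : K) ^ (n * (u₂.length + v₂.length)) • LinearMap.id
      have e2 := lin_wlift g (fun w' => grid p q (n + 1) (w'.map τ ++ w) x y) (paths K u₂ v₂)
      refine e2.symm.trans ?_
      simp only [g, LinearMap.smul_apply, LinearMap.id_apply]
      congr 1
      refine eqOn_wordsOn (f := wlift _) (f' := (wlift fun l => grid p q (n + 1) l x y) ∘ₗ
        (cat.flip (wd K w)) ∘ₗ wmap τ) (Q := fun _ => True) (fun l _ => ?_)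
        (wordsOn_mono (fun _ _ => trivial) (paths_mem u₂ v₂))
      simp
    refine eqOn_wordsOn (f := G.flip (paths K u₂ v₂)) (f' :=
      (-1 : K) ^ (n * (u₂.length + v₂.length)) • ((wlift fun l => grid p q (n + 1) l x y) ∘ₗ
        (cat (paths K (u₂.map (· - ((p : ℤ) + 1))) (v₂.map (· - ((q : ℤ) + 1)))))))
      (Q := fun _ => True) (fun l _ => ?_)
        (wordsOn_mono (fun _ _ => trivial) (paths_mem u₁ v₁)) |>.trans ?_
    · rw [LinearMap.flip_apply, e1, gridW_apply]
      rfl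
    · rw [gridW_apply]
      rfl
  have h1 : extra n (normOp n (sh n p q hn x y)) =
      wlift (cutSum fun w w' => G (wd K w) (wd K w')) (paths K (iv 0 (p + 1)) (iv 0 (q + 1))) := by
    rw [sh_eq, gridW_apply, ← LinearMap.comp_apply, lin_wlift]
    refine eqOn_wordsOn (fun l hl => ?_) (paths_good (p := p) (q := q) (m := n)
      (good_iv _ (by omega)) (good_iv _ (by omega)) (by simp; omega))
    simp only [wlift_wd, LinearMap.comp_apply]
    rw [extra_normOp_grid hl]
    simp only [G, wlift_wd]
    rfl
  rw [h1, cutSum_paths, cutSum_eq_sum, length_iv, ← Finset.sum_range_reflect]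
  refine Finset.sum_congr rfl fun i hi => ?_
  rw [cutSum_eq_sum, length_iv, ← Finset.sum_range_reflect]
  refine Finset.sum_congr rfl fun j hj => ?_
  rw [Finset.mem_range] at hi hj
  -- the cuts of `0, …, r`, with the back part translated by `-(r + 1)`
  have t : ∀ (r s : ℕ), s ≤ r → (iv 0 (r + 1)).take (r + 1 - 1 - s + 1) = iv 0 (r - s + 1) ∧
      ((iv 0 (r + 1)).drop (r + 1 - 1 - s)).map (· - ((r : ℤ) + 1)) = iv (-1 - s) (s + 1) ∧
      ((iv 0 (r + 1)).drop (r + 1 - 1 - s)).length = s + 1 := by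
    intro r s hs
    have e1 : iv 0 (r + 1) = iv 0 (r - s + 1) ++ iv ((r - s + 1 : ℕ) : ℤ) s := by
      rw [show r + 1 = r - s + 1 + s by omega, iv_append, zero_add]
    have e2 : iv 0 (r + 1) = iv 0 (r - s) ++ iv ((r - s : ℕ) : ℤ) (s + 1) := by
      rw [show r + 1 = r - s + (s + 1) by omega, iv_append, zero_add]
    refine ⟨?_, ?_, ?_⟩
    · rw [e1, List.take_left' (by rw [length_iv]; omega)]
    · rw [e2, List.drop_left' (by rw [length_iv]; omega)]
      simp only [sub_eq_add_neg]
      rw [iv_map_add]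
      congr 1
      omega
    · rw [List.length_drop, length_iv]; omega
  obtain ⟨p1, p2, p3⟩ := t p i (by omega)
  obtain ⟨q1, q2, q3⟩ := t q j (by omega)
  rw [hG, p1, p2, p3, q1, q2, q3, smul_smul, length_iv, ← pow_add]
  congr 1
  rw [show (q - j + 1 + 1) * (i + 1 + 1) + n * (i + 1 + (j + 1)) =
    (i * (q - j) + n * (i + j)) + 2 * (i + (q - j) + 2 + n) by ring, pow_add, pow_mul _ 2]
  simp

/-- The sum over all faces of the first factor of the words of the cyclic shuffle product. -/
def cshFacesLeft (p q n : ℕ) (x : NChain K A p) (y : NChain K B q) :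
    NChain K (SuperTensor K A B) n :=
  -(-1 : K) ^ p • ∑ i ∈ Finset.range p, ∑ j ∈ Finset.range (q + 1),
    (-1 : K) ^ ((p + 1) * i + q * j) • gridW p q n
      (altSum (fun l => cpaths K ((l.drop (p - 1 - i)).map (· - ((p : ℤ) + 1)))
        (l.take (p - i)) (iv (-1 - j) (j + 1)) (iv 0 (q - j + 1))) (iv 0 (p + 1))) x y

/-- The sum over all faces of the second factor of the words of the cyclic shuffle product. -/
def cshFacesRight (p q n : ℕ) (x : NChain K A p) (y : NChain K B q) :
    NChain K (SuperTensor K A B) n :=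
  ∑ i ∈ Finset.range (p + 1), ∑ j ∈ Finset.range q,
    (-1 : K) ^ (p * i + (q + 1) * j) • gridW p q n
      (altSum (fun l => cpaths K (iv (-1 - i) (i + 1)) (iv 0 (p - i + 1))
        ((l.drop (q - 1 - j)).map (· - ((q : ℤ) + 1))) (l.take (q - j))) (iv 0 (q + 1))) x y

lemma cshFacesLeft_zero (q n : ℕ) (x : NChain K A 0) (y : NChain K B q) :
    cshFacesLeft 0 q n x y = 0 := by simp [cshFacesLeft]

lemma cshFacesRight_zero (p n : ℕ) (x : NChain K A p) (y : NChain K B 0) :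
    cshFacesRight p 0 n x y = 0 := by simp [cshFacesRight]

lemma cshFacesLeft_succ {n p q : ℕ} (hn : p + q + 2 = n) (x : NChain K A (p + 1))
    (y : NChain K B q) : cshFacesLeft (p + 1) q n x y = csh n p q hn (bdry p x) y := by
  rw [csh_bdry_left, cshFacesLeft, pow_succ, mul_neg_one, neg_neg]
  congr 1
  refine Finset.sum_congr rfl fun i hi => Finset.sum_congr rfl fun j _ => ?_
  rw [Finset.mem_range] at hi
  rw [show p + 1 - 1 - i = p - i by omega, show p + 1 - i = p - i + 1 by omega]
  congr 1
  rw [show (p + 1 + 1) * i + q * j = 2 * i + (p * i + q * j) by ring, pow_add, pow_mul]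
  simp

lemma cshFacesRight_succ {n p q : ℕ} (hn : p + q + 2 = n) (x : NChain K A p)
    (y : NChain K B (q + 1)) :
    cshFacesRight p (q + 1) n x y = (-1 : K) ^ p • csh n p q hn x (bdry q y) := by
  rw [csh_bdry_right, cshFacesRight, smul_smul, neg_pow_sq, one_smul]
  refine Finset.sum_congr rfl fun i hi => Finset.sum_congr rfl fun j hj => ?_
  rw [Finset.mem_range] at hj
  rw [show q + 1 - 1 - j = q - j by omega, show q + 1 - j = q - j + 1 by omega]
  congr 1
  rw [show p * i + (q + 1 + 1) * j = 2 * j + (p * i + q * j) by ring, pow_add, pow_mul]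
  simp

/-- The bookkeeping of signs and summation orders in `bdry_csh`. -/
lemma collect_sums {M : Type*} [AddCommGroup M] [Module K M] (p q : ℕ) (P Q : ℕ → M)
    (L R : ℕ → ℕ → M) (c : M) :
    (-1 : K) ^ p • (∑ j ∈ Finset.range (q + 1), (-1 : K) ^ (q * j) •
        (Q j - ∑ i ∈ Finset.range p, (-1 : K) ^ ((p + 1) * i) • L i j) -
      (-1 : K) ^ p • ∑ i ∈ Finset.range (p + 1), (-1 : K) ^ (p * i) •
        (-P i - ∑ j ∈ Finset.range q, (-1 : K) ^ ((q + 1) * j) • R i j) + c) + -(-1 : K) ^ p • c =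
    ∑ i ∈ Finset.range (p + 1), (-1 : K) ^ (p * i) • P i +
      (-1 : K) ^ p • ∑ j ∈ Finset.range (q + 1), (-1 : K) ^ (q * j) • Q j +
      -(-1 : K) ^ p • ∑ i ∈ Finset.range p, ∑ j ∈ Finset.range (q + 1),
        (-1 : K) ^ ((p + 1) * i + q * j) • L i j +
      ∑ i ∈ Finset.range (p + 1), ∑ j ∈ Finset.range q,
        (-1 : K) ^ (p * i + (q + 1) * j) • R i j := by
  have hL : ∑ j ∈ Finset.range (q + 1), ∑ i ∈ Finset.range p,
      (-1 : K) ^ (q * j) • (-1 : K) ^ ((p + 1) * i) • L i j = ∑ i ∈ Finset.range p,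
      ∑ j ∈ Finset.range (q + 1), (-1 : K) ^ ((p + 1) * i + q * j) • L i j := by
    rw [Finset.sum_comm]
    refine Finset.sum_congr rfl fun i _ => Finset.sum_congr rfl fun j _ => ?_
    rw [smul_smul, ← pow_add, add_comm]
  have hR : ∑ i ∈ Finset.range (p + 1), ∑ j ∈ Finset.range q,
      (-1 : K) ^ (p * i) • (-1 : K) ^ ((q + 1) * j) • R i j = ∑ i ∈ Finset.range (p + 1),
      ∑ j ∈ Finset.range q, (-1 : K) ^ (p * i + (q + 1) * j) • R i j := by
    refine Finset.sum_congr rfl fun i _ => Finset.sum_congr rfl fun j _ => ?_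
    rw [smul_smul, ← pow_add]
  rw [← hL, ← hR, smul_add, smul_sub, smul_smul, neg_pow_sq, one_smul, neg_smul, neg_smul]
  simp only [smul_sub, Finset.sum_sub_distrib, smul_neg, Finset.sum_neg_distrib, ← Finset.smul_sum]
  abel

/-- The boundary of the words of the cyclic shuffle product. Words without an end vertex of one
factor cancel for consecutive rotations; what remains are the words of `sh (x ⊗ B y)`,
`sh (B x ⊗ y)` and `B (sh (x ⊗ y))`, and the faces of the two factors. -/
lemma bdry_csh {n p q : ℕ} (hn : p + q = n) (x : NChain K A p) (y : NChain K B q) :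
    bdry (n + 1) (csh (n + 2) p q (by omega) x y) + extra n (normOp n (sh n p q hn x y)) =
      sh (n + 1) (p + 1) q (by omega) (extra p (normOp p x)) y +
      (-1 : K) ^ p • sh (n + 1) p (q + 1) (by omega) x (extra q (normOp q y)) +
      cshFacesLeft p q (n + 1) x y + cshFacesRight p q (n + 1) x y := by
  let Γ : Words K (ℤ × ℤ) →ₗ[K] NChain K (SuperTensor K A B) (n + 1) :=
    wlift fun l => grid p q (n + 1) l x y
  have hΓ : ∀ z, gridW p q (n + 1) z x y = Γ z := fun z => gridW_apply _ _ _ _ _ _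
  let c : ℕ → ℕ → Words K (ℤ × ℤ) := fun i j =>
    cat (paths K (iv (-1 - i) (i + 1)) (iv (-1 - j) (j + 1)))
      (paths K (iv 0 (p - i + 1)) (iv 0 (q - j + 1)))
  have iv_join : ∀ r s : ℕ, s ≤ r → iv (-1 - (s : ℤ)) (s + 1) ++ iv 0 (r - s + 1) =
      iv (-1 - (s : ℤ)) (r + 2) := by
    intro r s hs
    rw [show r + 2 = s + 1 + (r - s + 1) by omega, iv_append _ (s + 1) (r - s + 1),
      show -1 - (s : ℤ) + ((s + 1 : ℕ) : ℤ) = 0 by push_cast; ring]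
  -- the rotations of the first factor
  have hcol : ∀ j ≤ q, ∑ i ∈ Finset.range (p + 1), (-1 : K) ^ (p * i) •
      (altSum (fun w => cpaths K w (iv 0 (p - i + 1)) (iv (-1 - j) (j + 1)) (iv 0 (q - j + 1)))
          (iv (-1 - i) (i + 1)) +
        (-1 : K) ^ (i + 1) • altSum (fun w => cpaths K (iv (-1 - i) (i + 1)) w
          (iv (-1 - j) (j + 1)) (iv 0 (q - j + 1))) (iv 0 (p - i + 1))) =
      paths K (iv 0 (p + 1)) (iv (-1 - j) (q + 2)) -
      ∑ i ∈ Finset.range p, (-1 : K) ^ ((p + 1) * i) •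
        (altSum (fun l => cpaths K ((l.drop (p - 1 - i)).map (· - ((p : ℤ) + 1)))
          (l.take (p - i)) (iv (-1 - j) (j + 1)) (iv 0 (q - j + 1))) (iv 0 (p + 1))) := by
    intro j hj
    rw [altSum_rotations (fun u u' => cpaths K u u' (iv (-1 - j) (j + 1)) (iv 0 (q - j + 1))),
      cpaths_nil, cpaths_nil_left', sub_zero, iv_join q j hj]
  -- the rotations of the second factor
  have hrow : ∀ i ≤ p, ∑ j ∈ Finset.range (q + 1), (-1 : K) ^ (q * j) •
      (altSum (fun w => cpaths K (iv (-1 - i) (i + 1)) (iv 0 (p - i + 1)) w (iv 0 (q - j + 1)))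
          (iv (-1 - j) (j + 1)) +
        (-1 : K) ^ (j + 1) • altSum (fun w => cpaths K (iv (-1 - i) (i + 1)) (iv 0 (p - i + 1))
          (iv (-1 - j) (j + 1)) w) (iv 0 (q - j + 1))) =
      -paths K (iv (-1 - i) (p + 2)) (iv (-1 - q) (q + 1)) -
      ∑ j ∈ Finset.range q, (-1 : K) ^ ((q + 1) * j) •
        (altSum (fun l => cpaths K (iv (-1 - i) (i + 1)) (iv 0 (p - i + 1))
          ((l.drop (q - 1 - j)).map (· - ((q : ℤ) + 1))) (l.take (q - j))) (iv 0 (q + 1))) := by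
    intro i hi
    rw [altSum_rotations (fun v v' => cpaths K (iv (-1 - i) (i + 1)) (iv 0 (p - i + 1)) v v'),
      cpaths_nil_right, if_neg (by rw [iv_succ]; simp),
      cpaths_nil_right' _ _ _ (by rw [iv_succ]; simp) (by rw [iv_succ]; simp), zero_sub,
      iv_join p i hi]
  -- the boundary of a single summand: faces of columns, faces of rows, and the corner `c i j`
  have hW : ∀ i ≤ p, ∀ j ≤ q, wbd (cycWords K p q i j) =
      (altSum (fun w => cpaths K w (iv 0 (p - i + 1)) (iv (-1 - j) (j + 1)) (iv 0 (q - j + 1)))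
          (iv (-1 - i) (i + 1)) +
        (-1 : K) ^ (i + 1) • altSum (fun w => cpaths K (iv (-1 - i) (i + 1)) w
          (iv (-1 - j) (j + 1)) (iv 0 (q - j + 1))) (iv 0 (p - i + 1))) -
      (-1 : K) ^ p • (altSum (fun w => cpaths K (iv (-1 - i) (i + 1)) (iv 0 (p - i + 1)) w
            (iv 0 (q - j + 1))) (iv (-1 - j) (j + 1)) +
        (-1 : K) ^ (j + 1) • altSum (fun w => cpaths K (iv (-1 - i) (i + 1)) (iv 0 (p - i + 1))
          (iv (-1 - j) (j + 1)) w) (iv 0 (q - j + 1))) +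
      (-1 : K) ^ (i + 1 + (j + 1) + (p - i + 1) * (j + 1)) • c i j := by
    intro i hi j hj
    rw [cycWords, wbd_cpaths _ _ _ _ (by rw [iv_succ]; simp) (by rw [iv_succ]; simp)]
    simp only [length_iv]
    rw [show i + 1 + (p - i + 1) + 1 = p + 3 by omega, pow_add _ p 3,
      show (-1 : K) ^ 3 = -1 by norm_num, mul_neg_one, neg_smul, ← sub_eq_add_neg]
  have hb : bdry (n + 1) (csh (n + 2) p q (by omega) x y) =
      (-1 : K) ^ p • ∑ i ∈ Finset.range (p + 1), ∑ j ∈ Finset.range (q + 1),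
        (-1 : K) ^ (p * i + q * j) • Γ (wbd (cycWords K p q i j)) := by
    rw [csh_eq, map_smul, map_sum]
    congr 1
    refine Finset.sum_congr rfl fun i hi => ?_
    rw [map_sum]
    refine Finset.sum_congr rfl fun j hj => ?_
    rw [Finset.mem_range] at hi hj
    rw [map_smul, bdry_gridW, hΓ]
    refine cpaths_good ?_ ?_ (by simp; omega)
    · rw [iv_join p i (by omega)]
      exact good_iv _ le_rfl
    · rw [iv_join q j (by omega)]
      exact good_iv _ le_rfl
  -- the three parts of the boundary
  have hsum : ∑ i ∈ Finset.range (p + 1), ∑ j ∈ Finset.range (q + 1),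
        (-1 : K) ^ (p * i + q * j) • Γ (wbd (cycWords K p q i j)) =
      Γ (∑ j ∈ Finset.range (q + 1), (-1 : K) ^ (q * j) •
        (paths K (iv 0 (p + 1)) (iv (-1 - j) (q + 2)) -
          ∑ i ∈ Finset.range p, (-1 : K) ^ ((p + 1) * i) •
          (altSum (fun l => cpaths K ((l.drop (p - 1 - i)).map (· - ((p : ℤ) + 1)))
            (l.take (p - i)) (iv (-1 - j) (j + 1)) (iv 0 (q - j + 1))) (iv 0 (p + 1))))) -
      (-1 : K) ^ p • Γ (∑ i ∈ Finset.range (p + 1), (-1 : K) ^ (p * i) •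
        (-paths K (iv (-1 - i) (p + 2)) (iv (-1 - q) (q + 1)) -
          ∑ j ∈ Finset.range q, (-1 : K) ^ ((q + 1) * j) •
          (altSum (fun l => cpaths K (iv (-1 - i) (i + 1)) (iv 0 (p - i + 1))
            ((l.drop (q - 1 - j)).map (· - ((q : ℤ) + 1))) (l.take (q - j))) (iv 0 (q + 1))))) +
      ∑ i ∈ Finset.range (p + 1), ∑ j ∈ Finset.range (q + 1), (-1 : K) ^ (p * i + q * j) •
        (-1 : K) ^ (i + 1 + (j + 1) + (p - i + 1) * (j + 1)) • Γ (c i j) := by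
    have e1 : ∀ j ∈ Finset.range (q + 1), (-1 : K) ^ (q * j) •
        (paths K (iv 0 (p + 1)) (iv (-1 - j) (q + 2)) -
          ∑ i ∈ Finset.range p, (-1 : K) ^ ((p + 1) * i) •
          (altSum (fun l => cpaths K ((l.drop (p - 1 - i)).map (· - ((p : ℤ) + 1)))
            (l.take (p - i)) (iv (-1 - j) (j + 1)) (iv 0 (q - j + 1))) (iv 0 (p + 1)))) = _ :=
      fun j hj => congrArg _ (hcol j (Nat.lt_succ_iff.1 (Finset.mem_range.1 hj))).symm
    have e2 : ∀ i ∈ Finset.range (p + 1), (-1 : K) ^ (p * i) •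
        (-paths K (iv (-1 - i) (p + 2)) (iv (-1 - q) (q + 1)) -
          ∑ j ∈ Finset.range q, (-1 : K) ^ ((q + 1) * j) •
          (altSum (fun l => cpaths K (iv (-1 - i) (i + 1)) (iv 0 (p - i + 1))
            ((l.drop (q - 1 - j)).map (· - ((q : ℤ) + 1))) (l.take (q - j))) (iv 0 (q + 1)))) = _ :=
      fun i hi => congrArg _ (hrow i (Nat.lt_succ_iff.1 (Finset.mem_range.1 hi))).symm
    rw [Finset.sum_congr rfl e1, Finset.sum_congr rfl e2]
    simp only [Finset.smul_sum, map_sum]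
    rw [Finset.sum_comm (s := Finset.range (q + 1)), ← Finset.sum_sub_distrib,
      ← Finset.sum_add_distrib]
    refine Finset.sum_congr rfl fun i hi => ?_
    rw [← Finset.sum_sub_distrib, ← Finset.sum_add_distrib]
    refine Finset.sum_congr rfl fun j hj => ?_
    rw [Finset.mem_range] at hi hj
    rw [hW i (by omega) j (by omega), map_add, map_sub, smul_add, smul_sub, map_smul Γ _ (c i j)]
    congr 2
    · rw [← map_smul, smul_smul, ← pow_add, add_comm (p * i)]
    · rw [← map_smul, ← map_smul, smul_smul, smul_smul, smul_smul, ← pow_add, ← pow_add, ← pow_add]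
      congr 3
      ring
  -- the corners are the terms of `B (sh (x ⊗ y))`
  have hdiag : extra n (normOp n (sh n p q hn x y)) = -(-1 : K) ^ p •
      ∑ i ∈ Finset.range (p + 1), ∑ j ∈ Finset.range (q + 1), (-1 : K) ^ (p * i + q * j) •
        (-1 : K) ^ (i + 1 + (j + 1) + (p - i + 1) * (j + 1)) • Γ (c i j) := by
    rw [extraNorm_sh]
    simp only [Finset.smul_sum]
    refine Finset.sum_congr rfl fun i hi => Finset.sum_congr rfl fun j hj => ?_
    rw [Finset.mem_range] at hi hj
    obtain ⟨i', rfl⟩ : ∃ i', p = i + i' := ⟨p - i, by omega⟩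
    obtain ⟨j', rfl⟩ : ∃ j', q = j + j' := ⟨q - j, by omega⟩
    subst hn
    rw [hΓ, smul_smul, smul_smul]
    congr 1
    rw [neg_mul, neg_mul, ← pow_add, ← pow_add, ← neg_one_mul ((-1 : K) ^ _), ← pow_succ',
      Nat.add_sub_cancel_left, Nat.add_sub_cancel_left]
    refine neg_one_pow_eq (a := i + i' + j + 2) (b := i * j + i * j') ?_
    ring
  -- the windows of `b` end at `-1` instead of `q`: a full period is added
  have hleft : sh (n + 1) (p + 1) q (by omega) (extra p (normOp p x)) y =
      Γ (∑ i ∈ Finset.range (p + 1), (-1 : K) ^ (p * i) •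
        paths K (iv (-1 - i) (p + 2)) (iv (-1 - q) (q + 1))) := by
    rw [sh_extraNorm_left, map_sum]
    refine Finset.sum_congr rfl fun i hi => ?_
    rw [Finset.mem_range] at hi
    rw [map_smul, ← hΓ, ← gridW_add_period (z := paths K _ (iv (-1 - q) (q + 1)))
      (paths_good (good_iv _ le_rfl) (good_iv _ (by omega)) (by simp; omega)), wmap_paths,
      iv_map_add, List.map_id, show -1 - (q : ℤ) + (q + 1) = 0 by ring]
  have hright : sh (n + 1) p (q + 1) (by omega) x (extra q (normOp q y)) =
      Γ (∑ j ∈ Finset.range (q + 1), (-1 : K) ^ (q * j) •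
        paths K (iv 0 (p + 1)) (iv (-1 - j) (q + 2))) := by
    rw [sh_extraNorm_right, map_sum]
    exact Finset.sum_congr rfl fun i hi => by rw [map_smul, ← hΓ]
  rw [hb, hsum, hdiag, hleft, hright, cshFacesLeft, cshFacesRight]
  simp only [hΓ, map_sub, map_sum, map_smul, map_neg]
  exact collect_sums p q _ _ _ _ _

end CyclicIdentity

/-! ### The shuffle maps on normalized complexes -/

section TensorInclusion

universe z z'

variable {K : Type w} [Field K] (M : MixedComplex.{w, z} K) (M' : MixedComplex.{w, z'} K)

/-- The inclusion of `M_p ⊗ M'_q` into the tensor product. -/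
def tensorIncl {n : ℕ} (p q : ℕ) (h : p + q = n) : M.X p ⊗[K] M'.X q →ₗ[K] tensorX M M' n :=
  LinearMap.single K (fun x : {x : ℕ × ℕ // x.1 + x.2 = n} => M.X x.1.1 ⊗[K] M'.X x.1.2) ⟨(p, q), h⟩

lemma coord_incl_self {n p q : ℕ} (h : p + q = n) (t : M.X p ⊗[K] M'.X q) :
    tensorCoord M M' p q h (tensorIncl M M' p q h t) = t :=
  Pi.single_eq_same (M := fun x : {x : ℕ × ℕ // x.1 + x.2 = n} => M.X x.1.1 ⊗[K] M'.X x.1.2)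
    ⟨(p, q), h⟩ t

lemma coord_incl_of_ne {n p q p' q' : ℕ} (h : p + q = n) (h' : p' + q' = n) (hne : p' ≠ p)
    (t : M.X p ⊗[K] M'.X q) : tensorCoord M M' p' q' h' (tensorIncl M M' p q h t) = 0 :=
  Pi.single_eq_of_ne
    (M := fun x : {x : ℕ × ℕ // x.1 + x.2 = n} => M.X x.1.1 ⊗[K] M'.X x.1.2)
    (i := ⟨(p, q), h⟩) (i' := ⟨(p', q'), h'⟩)
    (fun e => hne (congrArg (fun x : {x : ℕ × ℕ // x.1 + x.2 = n} => x.1.1) e)) t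

variable {M M'}

lemma tensorX_hom_ext {n : ℕ} {P : Type*} [AddCommGroup P] [Module K P]
    {f g : tensorX M M' n →ₗ[K] P}
    (h : ∀ p q (e : p + q = n) s t, f (tensorIncl M M' p q e (s ⊗ₜ t)) =
      g (tensorIncl M M' p q e (s ⊗ₜ t))) : f = g := by
  have : Finite {x : ℕ × ℕ // x.1 + x.2 = n} :=
    Finite.of_injective (fun x => (⟨x.1.1, by have := x.2; omega⟩ : Fin (n + 1))) fun x y e => by
      have e1 : x.1.1 = y.1.1 := congrArg Fin.val e
      have := x.2
      have := y.2
      exact Subtype.ext (Prod.ext e1 (by omega))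
  refine LinearMap.pi_ext' fun x => TensorProduct.ext' fun s t => ?_
  exact h x.1.1 x.1.2 x.2 s t

lemma tensorb_incl_succ_succ {n p q : ℕ} (h : p + 1 + (q + 1) = n + 1) (s : M.X (p + 1))
    (t : M'.X (q + 1)) : tensorb M M' n (tensorIncl M M' (p + 1) (q + 1) h (s ⊗ₜ t)) =
      tensorIncl M M' p (q + 1) (by omega) (M.b p s ⊗ₜ t) +
      (-1 : K) ^ (p + 1) • tensorIncl M M' (p + 1) q (by omega) (s ⊗ₜ M'.b q t) := by
  refine tensorX_ext M M' fun p' q' e => ?_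
  rw [coord_b, map_add, map_smul]
  by_cases h1 : p' = p
  · obtain rfl : q' = q + 1 := by omega
    subst h1
    rw [coord_incl_self, coord_incl_self, coord_incl_of_ne _ _ _ _ (by omega),
      coord_incl_of_ne _ _ _ _ (by omega), LinearMap.rTensor_tmul]
    simp
  · rw [coord_incl_of_ne M M' (p' := p' + 1) h _ (by omega),
      coord_incl_of_ne M M' (p := p) _ e h1]
    by_cases h2 : p' = p + 1
    · obtain rfl : q' = q := by omega
      subst h2
      rw [coord_incl_self, coord_incl_self, LinearMap.lTensor_tmul]
      simp
    · rw [coord_incl_of_ne _ _ _ _ h2, coord_incl_of_ne _ _ _ _ h2]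
      simp

lemma tensorb_incl_succ_zero {n p : ℕ} (h : p + 1 + 0 = n + 1) (s : M.X (p + 1))
    (t : M'.X 0) : tensorb M M' n (tensorIncl M M' (p + 1) 0 h (s ⊗ₜ t)) =
      tensorIncl M M' p 0 (by omega) (M.b p s ⊗ₜ t) := by
  refine tensorX_ext M M' fun p' q' e => ?_
  rw [coord_b]
  by_cases h1 : p' = p
  · obtain rfl : q' = 0 := by omega
    subst h1
    rw [coord_incl_self, coord_incl_self, coord_incl_of_ne _ _ _ _ (by omega),
      LinearMap.rTensor_tmul]
    simp
  · rw [coord_incl_of_ne M M' (p' := p' + 1) h _ (by omega),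
      coord_incl_of_ne M M' (p := p) _ e h1]
    by_cases h2 : p' = p + 1
    · omega
    · rw [coord_incl_of_ne _ _ _ _ h2]
      simp

lemma tensorb_incl_zero_succ {n q : ℕ} (h : 0 + (q + 1) = n + 1) (s : M.X 0)
    (t : M'.X (q + 1)) : tensorb M M' n (tensorIncl M M' 0 (q + 1) h (s ⊗ₜ t)) =
      tensorIncl M M' 0 q (by omega) (s ⊗ₜ M'.b q t) := by
  refine tensorX_ext M M' fun p' q' e => ?_
  rw [coord_b, coord_incl_of_ne _ _ _ _ (by omega)]
  by_cases h1 : p' = 0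
  · obtain rfl : q' = q := by omega
    subst h1
    rw [coord_incl_self, coord_incl_self, LinearMap.lTensor_tmul]
    simp
  · rw [coord_incl_of_ne _ _ _ _ h1, coord_incl_of_ne _ _ _ _ h1]
    simp

lemma tensorB_incl {n p q : ℕ} (h : p + q = n) (s : M.X p) (t : M'.X q) :
    tensorB M M' n (tensorIncl M M' p q h (s ⊗ₜ t)) =
      tensorIncl M M' (p + 1) q (by omega) (M.B p s ⊗ₜ t) +
      (-1 : K) ^ p • tensorIncl M M' p (q + 1) (by omega) (s ⊗ₜ M'.B q t) := by
  refine tensorX_ext M M' fun p' q' e => ?_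
  have e1 : ∀ (p' q' : ℕ) (e : p' + q' = n + 1), tensorBleft M M' n p' q' e
      (tensorIncl M M' p q h (s ⊗ₜ t)) =
      tensorCoord M M' p' q' e (tensorIncl M M' (p + 1) q (by omega) (M.B p s ⊗ₜ t)) := by
    intro p' q' e
    by_cases h1 : p' = p + 1
    · obtain rfl : q' = q := by omega
      subst h1
      rw [coord_incl_self, tensorBleft, LinearMap.comp_apply, coord_incl_self,
        LinearMap.rTensor_tmul]
    · rw [coord_incl_of_ne _ _ _ _ h1]
      rcases p' with _ | p'
      · rfl
      · rw [tensorBleft, LinearMap.comp_apply, coord_incl_of_ne _ _ _ _ (by omega), map_zero]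
  have e2 : ∀ (p' q' : ℕ) (e : p' + q' = n + 1), tensorBright M M' n p' q' e
      (tensorIncl M M' p q h (s ⊗ₜ t)) = (-1 : K) ^ p •
      tensorCoord M M' p' q' e (tensorIncl M M' p (q + 1) (by omega) (s ⊗ₜ M'.B q t)) := by
    intro p' q' e
    by_cases h1 : p' = p
    · obtain rfl : q' = q + 1 := by omega
      subst h1
      rw [coord_incl_self, tensorBright, LinearMap.smul_apply, LinearMap.comp_apply,
        coord_incl_self, LinearMap.lTensor_tmul]
    · rw [coord_incl_of_ne _ _ _ _ h1, smul_zero]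
      rcases q' with _ | q'
      · cases p' <;> rfl
      · rw [tensorBright, LinearMap.smul_apply, LinearMap.comp_apply,
          coord_incl_of_ne _ _ _ _ h1, map_zero, smul_zero]
  rw [map_add, map_smul, ← e1, ← e2]
  rfl

end TensorInclusion

section Normalized

variable {K : Type w} [Field K]
  {A : Type u} [Category.{v} A] [Preadditive A] [Linear K A] [SuperCategory K A]
  {B : Type u'} [Category.{v'} B] [Preadditive B] [Linear K B] [SuperCategory K B]

/-- The class of a chain in the normalized complex. -/
def nmk {C : Type u} [Category.{v} C] [Preadditive C] [Linear K C] [SuperCategory K C] (n : ℕ) :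
    NChain K C n →ₗ[K] (normMixed K C).X n := (degen K C n).mkQ

lemma nmk_surjective {C : Type u} [Category.{v} C] [Preadditive C] [Linear K C]
    [SuperCategory K C] (n : ℕ) : Function.Surjective (nmk (K := K) (C := C) n) :=
  (degen K C n).mkQ_surjective

lemma nmk_eq_zero {C : Type u} [Category.{v} C] [Preadditive C] [Linear K C]
    [SuperCategory K C] {n : ℕ} {x : NChain K C n} : nmk n x = 0 ↔ x ∈ degen K C n :=
  Submodule.Quotient.mk_eq_zero _

lemma b_nmk {C : Type u} [Category.{v} C] [Preadditive C] [Linear K C] [SuperCategory K C]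
    (n : ℕ) (x : NChain K C (n + 1)) : (normMixed K C).b n (nmk (n + 1) x) = nmk n (bdry n x) :=
  rfl

lemma B_nmk {C : Type u} [Category.{v} C] [Preadditive C] [Linear K C] [SuperCategory K C]
    (n : ℕ) (x : NChain K C n) :
    (normMixed K C).B n (nmk n x) = nmk (n + 1) (extra n (normOp n x)) := by
  have h : (normMixed K C).B n (nmk n x) = nmk (n + 1) (connes n x) := rfl
  rw [h, ← sub_eq_zero, ← map_sub, nmk_eq_zero, connes, LinearMap.comp_apply, LinearMap.comp_apply,
    LinearMap.sub_apply, LinearMap.id_apply, sub_sub_cancel_left]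
  exact neg_mem (rot_extra_mem n _)

variable (K A B) in
/-- The tensor product of the normalized complexes. -/
abbrev tensorMixed : MixedComplex K := (normMixed K A).tensor (normMixed K B)

/-- The element `x ⊗ y` of the tensor product of the normalized complexes. -/
def tcell {n : ℕ} (p q : ℕ) (h : p + q = n) :
    NChain K A p →ₗ[K] NChain K B q →ₗ[K] (tensorMixed K A B).X n :=
  ((TensorProduct.mk K _ _).compl₁₂ (nmk p) (nmk q)).compr₂
    (tensorIncl (normMixed K A) (normMixed K B) p q h)

lemma tcell_apply {n p q : ℕ} (h : p + q = n) (x : NChain K A p) (y : NChain K B q) :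
    tcell p q h x y =
      tensorIncl (normMixed K A) (normMixed K B) p q h (nmk p x ⊗ₜ nmk q y) := rfl

/-- A linear map on `N(A) ⊗ N(B)` is determined by its values on the products of chains. -/
lemma tcell_hom_ext {n : ℕ} {P : Type*} [AddCommGroup P] [Module K P]
    {f g : (tensorMixed K A B).X n →ₗ[K] P}
    (h : ∀ p q (e : p + q = n) x y, f (tcell p q e x y) = g (tcell p q e x y)) : f = g := by
  refine tensorX_hom_ext fun p q e s t => ?_
  obtain ⟨x, rfl⟩ := nmk_surjective p s
  obtain ⟨y, rfl⟩ := nmk_surjective q t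
  exact h p q e x y

lemma b_tcell_succ_succ {n p q : ℕ} (h : p + 1 + (q + 1) = n + 1) (x : NChain K A (p + 1))
    (y : NChain K B (q + 1)) : (tensorMixed K A B).b n (tcell (p + 1) (q + 1) h x y) =
      tcell p (q + 1) (by omega) (bdry p x) y +
      (-1 : K) ^ (p + 1) • tcell (p + 1) q (by omega) x (bdry q y) :=
  tensorb_incl_succ_succ h _ _

lemma b_tcell_succ_zero {n p : ℕ} (h : p + 1 + 0 = n + 1) (x : NChain K A (p + 1))
    (y : NChain K B 0) : (tensorMixed K A B).b n (tcell (p + 1) 0 h x y) =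
      tcell p 0 (by omega) (bdry p x) y :=
  tensorb_incl_succ_zero h _ _

lemma b_tcell_zero_succ {n q : ℕ} (h : 0 + (q + 1) = n + 1) (x : NChain K A 0)
    (y : NChain K B (q + 1)) : (tensorMixed K A B).b n (tcell 0 (q + 1) h x y) =
      tcell 0 q (by omega) x (bdry q y) :=
  tensorb_incl_zero_succ h _ _

lemma B_tcell {n p q : ℕ} (h : p + q = n) (x : NChain K A p) (y : NChain K B q) :
    (tensorMixed K A B).B n (tcell p q h x y) =
      tcell (p + 1) q (by omega) (extra p (normOp p x)) y +
      (-1 : K) ^ p • tcell p (q + 1) (by omega) x (extra q (normOp q y)) := by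
  refine (tensorB_incl h _ _).trans ?_
  rw [B_nmk, B_nmk]
  rfl

lemma shuffleMap_tcell {n p q : ℕ} (h : p + q = n) (x : NChain K A p) (y : NChain K B q) :
    shuffleMap K A B n (tcell p q h x y) = nmk n (sh n p q h x y) := by
  obtain rfl : q = n - p := by omega
  refine (LinearMap.sum_apply Finset.univ (fun p : Fin (n + 1) =>
    (descend (sh n p (n - p) (by omega)) (degen K A p) (degen K B (n - p))
      (degen K (SuperTensor K A B) n) (sh_degen _) ∘ₗ
      tensorCoord (normMixed K A) (normMixed K B) p (n - p) (by omega) :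
      (tensorMixed K A B).X n →ₗ[K] (normMixed K (SuperTensor K A B)).X n)) _).trans ?_
  rw [tcell_apply, Finset.sum_eq_single (⟨p, by omega⟩ : Fin (n + 1))]
  · exact (congrArg (descend (sh n p (n - p) _) (degen K A p) (degen K B (n - p))
      (degen K (SuperTensor K A B) n) (sh_degen _)) (coord_incl_self _ _ _ _)).trans rfl
  · intro p' _ hne
    exact (congrArg (descend (sh n p' (n - p') (by omega)) (degen K A p') (degen K B (n - p'))
      (degen K (SuperTensor K A B) n) (sh_degen _))
      (coord_incl_of_ne _ _ _ _ (fun e => hne (Fin.ext e)) _)).trans (map_zero _)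
  · exact fun h => absurd (Finset.mem_univ _) h

lemma cyclicShuffleMap_tcell {n p q : ℕ} (h : p + q = n) (x : NChain K A p) (y : NChain K B q) :
    cyclicShuffleMap K A B n (tcell p q h x y) =
      nmk (n + 2) (csh (n + 2) p q (by omega) x y) := by
  obtain rfl : q = n - p := by omega
  refine (LinearMap.sum_apply Finset.univ (fun p : Fin (n + 1) =>
    (descend (csh (n + 2) p (n - p) (by omega)) (degen K A p) (degen K B (n - p))
      (degen K (SuperTensor K A B) (n + 2)) (csh_degen _) ∘ₗ
      tensorCoord (normMixed K A) (normMixed K B) p (n - p) (by omega) :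
      (tensorMixed K A B).X n →ₗ[K] (normMixed K (SuperTensor K A B)).X (n + 2))) _).trans ?_
  rw [tcell_apply, Finset.sum_eq_single (⟨p, by omega⟩ : Fin (n + 1))]
  · exact (congrArg (descend (csh (n + 2) p (n - p) _) (degen K A p) (degen K B (n - p))
      (degen K (SuperTensor K A B) (n + 2)) (csh_degen _)) (coord_incl_self _ _ _ _)).trans rfl
  · intro p' _ hne
    exact (congrArg (descend (csh (n + 2) p' (n - p') (by omega)) (degen K A p') (degen K B (n - p'))
      (degen K (SuperTensor K A B) (n + 2)) (csh_degen _))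
      (coord_incl_of_ne _ _ _ _ (fun e => hne (Fin.ext e)) _)).trans (map_zero _)
  · exact fun h => absurd (Finset.mem_univ _) h

/-- The shuffle map is compatible with `∂`. -/
lemma b_shuffleMap (n : ℕ) (x : (tensorMixed K A B).X (n + 1)) :
    (normMixed K (SuperTensor K A B)).b n (shuffleMap K A B (n + 1) x) =
      shuffleMap K A B n ((tensorMixed K A B).b n x) := by
  refine LinearMap.congr_fun (f := (normMixed K (SuperTensor K A B)).b n ∘ₗ
    shuffleMap K A B (n + 1)) (g := shuffleMap K A B n ∘ₗ (tensorMixed K A B).b n)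
    (tcell_hom_ext fun p q e x y => ?_) x
  rw [LinearMap.comp_apply, LinearMap.comp_apply, shuffleMap_tcell, b_nmk]
  rcases p with _ | p <;> rcases q with _ | q
  · omega
  · rw [b_tcell_zero_succ, shuffleMap_tcell, bdry_sh_zero_succ]
  · rw [b_tcell_succ_zero, shuffleMap_tcell, bdry_sh_succ_zero]
  · rw [b_tcell_succ_succ, map_add, map_smul, shuffleMap_tcell, shuffleMap_tcell,
      bdry_sh_succ_succ, map_add, map_smul]

/-- The compatibility of the shuffle maps with `∂ + B` in degree `0`, where there is no `∂` on the
source. -/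
lemma b_cyclicShuffleMap_zero (x : (tensorMixed K A B).X 0) :
    (normMixed K (SuperTensor K A B)).b 1 (cyclicShuffleMap K A B 0 x) +
      (normMixed K (SuperTensor K A B)).B 0 (shuffleMap K A B 0 x) =
      shuffleMap K A B 1 ((tensorMixed K A B).B 0 x) := by
  refine LinearMap.congr_fun (f := (normMixed K (SuperTensor K A B)).b 1 ∘ₗ
      cyclicShuffleMap K A B 0 + (normMixed K (SuperTensor K A B)).B 0 ∘ₗ shuffleMap K A B 0)
    (g := shuffleMap K A B 1 ∘ₗ (tensorMixed K A B).B 0)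
    (tcell_hom_ext fun p q e x y => ?_) x
  rw [LinearMap.add_apply, LinearMap.comp_apply, LinearMap.comp_apply, LinearMap.comp_apply,
    cyclicShuffleMap_tcell, shuffleMap_tcell, b_nmk, B_nmk, ← map_add, bdry_csh e, B_tcell,
    map_add (shuffleMap K A B 1), map_smul, shuffleMap_tcell, shuffleMap_tcell, map_add, map_add, map_add, map_smul]
  obtain rfl : p = 0 := by omega
  obtain rfl : q = 0 := by omega
  rw [cshFacesLeft_zero, cshFacesRight_zero, map_zero, add_zero, add_zero]

/-- The shuffle maps are compatible with `∂ + B`. -/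
lemma b_cyclicShuffleMap (n : ℕ) (x : (tensorMixed K A B).X (n + 1)) :
    (normMixed K (SuperTensor K A B)).b (n + 2) (cyclicShuffleMap K A B (n + 1) x) +
      (normMixed K (SuperTensor K A B)).B (n + 1) (shuffleMap K A B (n + 1) x) =
      shuffleMap K A B (n + 2) ((tensorMixed K A B).B (n + 1) x) +
      cyclicShuffleMap K A B n ((tensorMixed K A B).b n x) := by
  refine LinearMap.congr_fun (f := (normMixed K (SuperTensor K A B)).b (n + 2) ∘ₗ
      cyclicShuffleMap K A B (n + 1) +
      (normMixed K (SuperTensor K A B)).B (n + 1) ∘ₗ shuffleMap K A B (n + 1))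
    (g := shuffleMap K A B (n + 2) ∘ₗ (tensorMixed K A B).B (n + 1) +
      cyclicShuffleMap K A B n ∘ₗ (tensorMixed K A B).b n)
    (tcell_hom_ext fun p q e x y => ?_) x
  rw [LinearMap.add_apply, LinearMap.add_apply, LinearMap.comp_apply, LinearMap.comp_apply,
    LinearMap.comp_apply, LinearMap.comp_apply,
    cyclicShuffleMap_tcell, shuffleMap_tcell, b_nmk, B_nmk, ← map_add, bdry_csh e, B_tcell,
    map_add (shuffleMap K A B (n + 2)), map_smul, shuffleMap_tcell, shuffleMap_tcell, map_add,
    map_add, map_add, map_smul, add_assoc]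
  congr 1
  rcases p with _ | p <;> rcases q with _ | q
  · omega
  · rw [b_tcell_zero_succ, cyclicShuffleMap_tcell, cshFacesLeft_zero, cshFacesRight_succ (by omega),
      pow_zero, one_smul, map_zero, zero_add]
  · rw [b_tcell_succ_zero, cyclicShuffleMap_tcell, cshFacesLeft_succ (by omega),
      cshFacesRight_zero, map_zero, add_zero]
  · rw [b_tcell_succ_succ, map_add, map_smul, cyclicShuffleMap_tcell, cyclicShuffleMap_tcell,
      cshFacesLeft_succ (by omega), cshFacesRight_succ (by omega), map_smul]

end Normalized

/-! ### The morphisms of complexes -/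

section Total

variable {K : Type w} [Field K]
  {C : Type u} [Category.{v} C] [Preadditive C] [Linear K C] [SuperCategory K C]

lemma extra_mem_weakDegen (n : ℕ) (x : NChain K C n) : extra n x ∈ weakDegen K C (n + 1) := by
  suffices h : (weakDegen K C (n + 1)).mkQ ∘ₗ extra n = 0 by
    have := LinearMap.congr_fun h x
    simpa using this
  refine chain_ext fun g hg => ?_
  rw [LinearMap.comp_apply, LinearMap.zero_apply, Submodule.mkQ_apply,
    Submodule.Quotient.mk_eq_zero, extra_cls hg]
  exact cls_mem_weakDegen hg.extra 0 (by omega) (X := (g 0).src) (by simp [idSeq])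

lemma normOp_weakDegen {n : ℕ} {x : NChain K C n} (hx : x ∈ weakDegen K C n) :
    normOp n x ∈ weakDegen K C n := by
  rw [normOp, LinearMap.sum_apply]
  exact Submodule.sum_mem _ fun i _ => rot_pow_weakDegen n i hx

variable {A : Type u} [Category.{v} A] [Preadditive A] [Linear K A] [SuperCategory K A]
  {B : Type u'} [Category.{v'} B] [Preadditive B] [Linear K B] [SuperCategory K B]

/-- A shuffle of two chains that start with an identity starts with an identity. -/
lemma shTerm_extra_mem {n p q : ℕ} (hn : p + 1 + (q + 1) = n)
    (σ : Equiv.Perm (Fin (p + 1 + (q + 1)))) (hσ : IsShuffle (p + 1) (q + 1) σ)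
    (x : NChain K A p) (y : NChain K B q) :
    shTerm n (p + 1) (q + 1) hn σ hσ (extra p x) (extra q y) ∈
      weakDegen K (SuperTensor K A B) n := by
  suffices h : ((shTerm n (p + 1) (q + 1) hn σ hσ).compl₁₂ (extra p) (extra q)).compr₂
      (weakDegen K (SuperTensor K A B) n).mkQ = 0 by
    have := LinearMap.congr_fun (LinearMap.congr_fun h x) y
    simpa using this
  refine chain_ext₂ fun a b ha hb => ?_
  change (weakDegen K (SuperTensor K A B) n).mkQ
    (shTerm n (p + 1) (q + 1) hn σ hσ (extra p (cls p a)) (extra q (cls q b))) = 0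
  rw [Submodule.mkQ_apply, Submodule.Quotient.mk_eq_zero, extra_cls ha, extra_cls hb,
    shTerm_cls hn σ hσ ha.extra hb.extra]
  refine Submodule.smul_mem _ _ ?_
  by_cases hc : IsCycle n (shSeq (p + 1) (q + 1) σ (idSeq a) (idSeq b))
  · refine cls_mem_weakDegen hc 0 (by omega) (X := ⟨(a 0).src, (b 0).src⟩) ?_
    rw [shSeq_zero, ← HArr.tensor_id]
    rfl
  · rw [cls_not hc]
    exact zero_mem _

/-- A submodule that contains the shuffles of the chains `s t^i x` and `s t^j y` contains the cyclic
shuffle product. -/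
lemma csh_mem {n p q : ℕ} (hn : p + q + 2 = n) (P : Submodule K (NChain K (SuperTensor K A B) n))
    (x : NChain K A p) (y : NChain K B q)
    (h : ∀ (i j : ℕ) σ hσ, shTerm n (p + 1) (q + 1) (by omega) σ hσ (extra p ((rot p ^ i) x))
      (extra q ((rot q ^ j) y)) ∈ P) :
    csh n p q hn x y ∈ P := by
  rw [csh, LinearMap.smul_apply, LinearMap.smul_apply]
  refine Submodule.smul_mem _ _ ?_
  rw [LinearMap.sum_apply, LinearMap.sum_apply]
  refine Submodule.sum_mem _ fun i _ => ?_
  rw [LinearMap.sum_apply, LinearMap.sum_apply]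
  refine Submodule.sum_mem _ fun j _ => ?_
  rw [LinearMap.sum_apply, LinearMap.sum_apply]
  refine Submodule.sum_mem _ fun σ _ => ?_
  rw [LinearMap.smul_apply, LinearMap.smul_apply]
  exact Submodule.smul_mem _ _ (h i j σ.1 σ.2.1)

lemma extraNorm_csh_mem {n p q : ℕ} (hn : p + q + 2 = n) (x : NChain K A p) (y : NChain K B q) :
    extra n (normOp n (csh n p q hn x y)) ∈ degen K (SuperTensor K A B) (n + 1) :=
  extra_weakDegen n (normOp_weakDegen (csh_mem hn _ x y fun _ _ _ _ => shTerm_extra_mem _ _ _ _ _))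

lemma csh_extra_mem_left {n p q : ℕ} (hn : p + 1 + q + 2 = n) (x : NChain K A p)
    (y : NChain K B q) :
    csh n (p + 1) q hn (extra p x) y ∈ degen K (SuperTensor K A B) n :=
  csh_mem hn _ _ _ fun i _ _ _ => shTerm_degen _ _ _ _ _
    (Or.inl (extra_weakDegen _ (rot_pow_weakDegen _ i (extra_mem_weakDegen p x))))

lemma csh_extra_mem_right {n p q : ℕ} (hn : p + (q + 1) + 2 = n) (x : NChain K A p)
    (y : NChain K B q) :
    csh n p (q + 1) hn x (extra q y) ∈ degen K (SuperTensor K A B) n :=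
  csh_mem hn _ _ _ fun _ j _ _ => shTerm_degen _ _ _ _ _
    (Or.inr (extra_weakDegen _ (rot_pow_weakDegen _ j (extra_mem_weakDegen q y))))

/-- A cyclic shuffle starts with an identity morphism, hence is killed by `B`. -/
lemma B_cyclicShuffleMap (n : ℕ) (x : (tensorMixed K A B).X n) :
    (normMixed K (SuperTensor K A B)).B (n + 2) (cyclicShuffleMap K A B n x) = 0 := by
  refine LinearMap.congr_fun (f := (normMixed K (SuperTensor K A B)).B (n + 2) ∘ₗ
    cyclicShuffleMap K A B n) (g := 0) (tcell_hom_ext fun p q e x y => ?_) x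
  rw [LinearMap.comp_apply, LinearMap.zero_apply, cyclicShuffleMap_tcell, B_nmk, nmk_eq_zero]
  exact extraNorm_csh_mem _ x y

/-- The chain `B x` is a sum of chains with an identity in front; another identity is put in front of
its cyclic permutations, which makes them degenerate. -/
lemma cyclicShuffleMap_B (n : ℕ) (x : (tensorMixed K A B).X n) :
    cyclicShuffleMap K A B (n + 1) ((tensorMixed K A B).B n x) = 0 := by
  refine LinearMap.congr_fun (f := cyclicShuffleMap K A B (n + 1) ∘ₗ (tensorMixed K A B).B n)
    (g := 0) (tcell_hom_ext fun p q e x y => ?_) x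
  rw [LinearMap.comp_apply, LinearMap.zero_apply, B_tcell, map_add, map_smul,
    cyclicShuffleMap_tcell, cyclicShuffleMap_tcell, nmk_eq_zero.2 (csh_extra_mem_left _ _ _),
    nmk_eq_zero.2 (csh_extra_mem_right _ _ _), smul_zero, add_zero]

variable {M : MixedComplex.{w, u} K} {M' : MixedComplex.{w, v} K}
  (f : ∀ n, M.X n →ₗ[K] M'.X n) (g : ∀ n, M.X n →ₗ[K] M'.X (n + 2))

lemma coord_totMatrix_zero {n k : ℕ} (h : 0 + 2 * k = n) (x : totX M n) :
    totCoord M' 0 k h (totMatrix f g n x) = f 0 (totCoord M 0 k h x) := add_zero _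

lemma coord_totMatrix_one {n k : ℕ} (h : 1 + 2 * k = n) (x : totX M n) :
    totCoord M' 1 k h (totMatrix f g n x) = f 1 (totCoord M 1 k h x) := add_zero _

lemma coord_totMatrix_succ {n m k : ℕ} (h : m + 2 + 2 * k = n) (x : totX M n) :
    totCoord M' (m + 2) k h (totMatrix f g n x) = f (m + 2) (totCoord M (m + 2) k h x) +
      g m (totCoord M m (k + 1) (by omega) x) := rfl

/-- A matrix of maps is a morphism of total complexes if it commutes with `b + B`, degree by
degree. -/
lemma totD_totMatrix (hb : ∀ n x, M'.b n (f (n + 1) x) = f n (M.b n x))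
    (h0 : ∀ x, M'.b 1 (g 0 x) + M'.B 0 (f 0 x) = f 1 (M.B 0 x))
    (hs : ∀ n x, M'.b (n + 2) (g (n + 1) x) + M'.B (n + 1) (f (n + 1) x) =
      f (n + 2) (M.B (n + 1) x) + g n (M.b n x))
    (hB : ∀ n x, M'.B (n + 2) (g n x) = 0) (hg : ∀ n x, g (n + 1) (M.B n x) = 0)
    (n : ℕ) (x : totX M (n + 1)) :
    totD M' n (totMatrix f g (n + 1) x) = totMatrix f g n (totD M n x) := by
  refine totX_ext M' fun m k e => ?_
  rcases m with _ | _ | _ | m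
  · rw [coord_totD_zero, coord_totMatrix_one, coord_totMatrix_zero, coord_totD_zero, hb]
  · rw [coord_totD_succ, coord_totMatrix_succ, coord_totMatrix_one, coord_totMatrix_zero,
      coord_totD_succ, map_add, map_add, hb, add_assoc, h0]
  · rw [coord_totD_succ, coord_totMatrix_succ, coord_totMatrix_succ, coord_totMatrix_one,
      coord_totD_succ, coord_totD_zero, map_add, map_add, hb]
    exact (add_assoc _ _ _).trans ((congrArg _ (hs 0 _)).trans (add_assoc _ _ _).symm)
  · rw [coord_totD_succ, coord_totMatrix_succ, coord_totMatrix_succ, coord_totMatrix_succ,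
      coord_totD_succ, coord_totD_succ, map_add, map_add, map_add, map_add, hb, hB, hg, add_zero,
      add_zero]
    exact (add_assoc _ _ _).trans ((congrArg _ (hs (m + 1) _)).trans (add_assoc _ _ _).symm)

variable (K A B) in
/-- The shuffle map as a morphism of complexes. -/
def shuffleHom : (tensorMixed K A B).chain ⟶ (normMixed K (SuperTensor K A B)).chain :=
  ChainComplex.ofHom (X := (tensorMixed K A B).chain)
    (Y := (normMixed K (SuperTensor K A B)).chain)
    (fun n => ModuleCat.ofHom (shuffleMap K A B n)) fun n => by
      rw [chain_d, chain_d]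
      ext1
      exact LinearMap.ext (b_shuffleMap n)

variable (K A B) in
/-- The map `Sh` as a morphism of complexes. -/
def totalShuffleHom : (tensorMixed K A B).tot ⟶ (normMixed K (SuperTensor K A B)).tot :=
  ChainComplex.ofHom (X := (tensorMixed K A B).tot) (Y := (normMixed K (SuperTensor K A B)).tot)
    (fun n => ModuleCat.ofHom (totalShuffleMap K A B n)) fun n => by
      rw [tot_d, tot_d]
      ext1
      exact LinearMap.ext (totD_totMatrix _ _ b_shuffleMap b_cyclicShuffleMap_zero
        b_cyclicShuffleMap B_cyclicShuffleMap cyclicShuffleMap_B n)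

end Total

/-! ### Connes' exact sequences and the five lemma -/

section Connes

universe z

open HomologicalComplex ComposableArrows

variable {K : Type w} [Field K] {M M' : MixedComplex.{w, z} K} {f : M.chain ⟶ M'.chain}
  {F : M.tot ⟶ M'.tot}

/-- A morphism of the short exact sequences that define Connes' exact sequences. -/
def connesSeqMap (hI : M.I ≫ F = f ≫ M'.I) (hS : M.S ≫ shiftMap F = F ≫ M'.S) :
    M.connesSeq ⟶ M'.connesSeq where
  τ₁ := f
  τ₂ := F
  τ₃ := shiftMap F
  comm₁₂ := hI.symm
  comm₂₃ := hS.symm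

lemma connesI_naturality (hI : M.I ≫ F = f ≫ M'.I) (n : ℕ) :
    M.connesI n ≫ homologyMap F n = homologyMap f n ≫ M'.connesI n := by
  rw [MixedComplex.connesI, MixedComplex.connesI, ← homologyMap_comp, ← homologyMap_comp, hI]

lemma shiftHomologyIso_naturality (n : ℕ) :
    homologyMap (shiftMap F) (n + 2) ≫ (shiftHomologyIso M'.tot n).hom =
      (shiftHomologyIso M.tot n).hom ≫ homologyMap F n :=
  extendHomologyIso_hom_naturality F shiftTwo (shiftTwo_f n)

lemma connesS_naturality (hS : M.S ≫ shiftMap F = F ≫ M'.S) (n : ℕ) :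
    M.connesS n ≫ homologyMap F n = homologyMap F (n + 2) ≫ M'.connesS n := by
  rw [MixedComplex.connesS, MixedComplex.connesS, Category.assoc, ← shiftHomologyIso_naturality,
    ← Category.assoc, ← Category.assoc, ← homologyMap_comp, ← homologyMap_comp, hS]

/-- The connecting homomorphism is natural for morphisms of short exact sequences. -/
lemma connesB_naturality (hI : M.I ≫ F = f ≫ M'.I) (hS : M.S ≫ shiftMap F = F ≫ M'.S) (n : ℕ) :
    M.connesB n ≫ homologyMap f (n + 1) = homologyMap F n ≫ M'.connesB n := by
  have h := HomologySequence.δ_naturality (connesSeqMap hI hS) (connesSeq_exact M)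
    (connesSeq_exact M') (n + 2) (n + 1) rfl
  have e : (shiftHomologyIso M.tot n).inv ≫ homologyMap (shiftMap F) (n + 2) =
      homologyMap F n ≫ (shiftHomologyIso M'.tot n).inv := by
    rw [Iso.inv_comp_eq, ← Category.assoc, Iso.eq_comp_inv, shiftHomologyIso_naturality]
  exact (Category.assoc _ _ _).trans ((congrArg ((shiftHomologyIso M.tot n).inv ≫ ·) h).trans
    ((Category.assoc _ _ _).symm.trans ((congrArg (· ≫ (connesSeq_exact M').δ (n + 2) (n + 1) rfl)
      e).trans (Category.assoc _ _ _))))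

/-- The complex shifted by two vanishes in the degrees `0` and `1`, and has the homology of the
original complex in the others. -/
lemma isIso_homologyMap_shiftMap (n : ℕ) (h : ∀ m, m + 2 = n → IsIso (homologyMap F m)) :
    IsIso (homologyMap (shiftMap F) n) := by
  by_cases hn : n < 2
  · have hz : ∀ C : ChainComplex (ModuleCat.{z} K) ℕ, Limits.IsZero ((shift C).homology n) :=
      fun C => (C.extend_exactAt shiftTwo n (shiftTwo_ne hn)).isZero_homology
    exact ⟨0, (hz _).eq_of_src _ _, (hz _).eq_of_src _ _⟩
  · obtain ⟨m, rfl⟩ : ∃ m, n = m + 2 := ⟨n - 2, by omega⟩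
    have := h m rfl
    have e : homologyMap (shiftMap F) (m + 2) = (shiftHomologyIso M.tot m).hom ≫
        homologyMap F m ≫ (shiftHomologyIso M'.tot m).inv := by
      rw [← Category.assoc, Iso.eq_comp_inv, shiftHomologyIso_naturality]
    rw [e]
    infer_instance

/-- By the five lemma, an isomorphism on Hochschild homology is one on cyclic homology. -/
lemma isIso_homologyMap_tot (hI : M.I ≫ F = f ≫ M'.I) (hS : M.S ≫ shiftMap F = F ≫ M'.S)
    (h : ∀ n, IsIso (homologyMap f n)) (n : ℕ) : IsIso (homologyMap F n) := by
  induction n using Nat.strong_induction_on with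
  | _ n ih =>
  let φ := connesSeqMap hI hS
  have hM := connesSeq_exact M
  have hM' := connesSeq_exact M'
  have h1 : ∀ m, IsIso (homologyMap φ.τ₁ m) := h
  -- the homology of the shifted complex in degree `m` is the cyclic homology in degree `m - 2 < n`
  have h3 : ∀ m, m ≤ n + 1 → IsIso (homologyMap φ.τ₃ m) := fun m hm =>
    isIso_homologyMap_shiftMap m fun k hk => ih k (by omega)
  have hmono : Mono (homologyMap φ.τ₂ n) := by
    have := h1 n
    have := h3 (n + 1) le_rfl
    have := h3 n (by omega)
    apply Abelian.mono_of_epi_of_mono_of_mono ((δ₀Functor ⋙ δ₀Functor).map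
      (HomologySequence.mapComposableArrows₅ φ hM hM' (n + 1) n rfl))
    · exact (HomologySequence.composableArrows₅_exact hM (n + 1) n rfl).δ₀.δ₀
    · exact (HomologySequence.composableArrows₅_exact hM' (n + 1) n rfl).δ₀.δ₀
    · exact inferInstanceAs (Epi (homologyMap φ.τ₃ (n + 1)))
    · exact inferInstanceAs (Mono (homologyMap φ.τ₁ n))
    · exact inferInstanceAs (Mono (homologyMap φ.τ₃ n))
  have hepi : Epi (homologyMap φ.τ₂ n) := by
    have := h1 n
    rcases n with _ | n
    -- in degree `0` the exact sequence ends with the surjection `I`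
    · have hz : Limits.IsZero ((shift M'.tot).homology 0) :=
        (M'.tot.extend_exactAt shiftTwo 0 (shiftTwo_ne (by omega))).isZero_homology
      have hepi := (hM'.homology_exact₂ 0).epi_f (hz.eq_of_tgt _ _)
      have e : homologyMap M.I 0 ≫ homologyMap φ.τ₂ 0 = homologyMap φ.τ₁ 0 ≫ homologyMap M'.I 0 :=
        connesI_naturality hI 0
      have hcomp := @epi_comp _ _ _ _ _ (homologyMap φ.τ₁ 0) inferInstance (homologyMap M'.I 0) hepi
      exact @epi_of_epi_fac _ _ _ _ _ _ _ _ hcomp e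
    · have := h1 n
      have := h3 (n + 1) (by omega)
      apply Abelian.epi_of_epi_of_epi_of_mono ((δlastFunctor ⋙ δlastFunctor).map
        (HomologySequence.mapComposableArrows₅ φ hM hM' (n + 1) n rfl))
      · exact (HomologySequence.composableArrows₅_exact hM (n + 1) n rfl).δlast.δlast
      · exact (HomologySequence.composableArrows₅_exact hM' (n + 1) n rfl).δlast.δlast
      · exact inferInstanceAs (Epi (homologyMap φ.τ₁ (n + 1)))
      · exact inferInstanceAs (Epi (homologyMap φ.τ₃ (n + 1)))
      · exact inferInstanceAs (Mono (homologyMap φ.τ₁ n))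
  exact isIso_of_mono_of_epi (homologyMap φ.τ₂ n)

end Connes

section TotalShuffle

variable {K : Type w} [Field K]
  {A : Type u} [Category.{v} A] [Preadditive A] [Linear K A] [SuperCategory K A]
  {B : Type u'} [Category.{v'} B] [Preadditive B] [Linear K B] [SuperCategory K B]

open HomologicalComplex

section Matrices

variable {M : MixedComplex.{w, u} K} {M' : MixedComplex.{w, v} K}
  (f : ∀ n, M.X n →ₗ[K] M'.X n) (g : ∀ n, M.X n →ₗ[K] M'.X (n + 2))

/-- On the summand `k = 0` a matrix restricts to its diagonal entry. -/
lemma totMatrix_totIncl (n : ℕ) (x : M.X n) :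
    totMatrix f g n (totIncl M n x) = totIncl M' n (f n x) := by
  refine totX_ext M' fun m k e => ?_
  rcases k with _ | k
  · obtain rfl : m = n := by omega
    rcases m with _ | _ | m
    · rw [coord_totMatrix_zero, coord_incl_zero, coord_incl_zero]
    · rw [coord_totMatrix_one, coord_incl_zero, coord_incl_zero]
    · rw [coord_totMatrix_succ, coord_incl_zero, coord_incl_zero, coord_incl_succ, map_zero,
        add_zero]
  · rw [coord_incl_succ]
    rcases m with _ | _ | m
    · rw [coord_totMatrix_zero, coord_incl_succ, map_zero]
    · rw [coord_totMatrix_one, coord_incl_succ, map_zero]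
    · rw [coord_totMatrix_succ, coord_incl_succ, coord_incl_succ, map_zero, map_zero, add_zero]

lemma totMatrix_totShift (n : ℕ) (x : totX M (n + 2)) :
    totMatrix f g n (totShift M n x) = totShift M' n (totMatrix f g (n + 2) x) := by
  refine totX_ext M' fun m k e => ?_
  rcases m with _ | _ | m <;> rfl

end Matrices

lemma comp_conj_iso {D : Type*} [Category* D] {X X' Y Y' Z Z' : D} {s : X ⟶ Y} {s' : X' ⟶ Y'}
    {F : Y ⟶ Y'} {G : X ⟶ X'} (e : s ≫ F = G ≫ s') (i : Z ≅ Y) (j : Z' ≅ Y') :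
    (s ≫ i.inv) ≫ i.hom ≫ F ≫ j.inv = G ≫ s' ≫ j.inv := by
  rw [Category.assoc, Iso.inv_hom_id_assoc, ← Category.assoc, ← Category.assoc, e]

lemma I_totalShuffleHom : (tensorMixed K A B).I ≫ totalShuffleHom K A B =
    shuffleHom K A B ≫ (normMixed K (SuperTensor K A B)).I := by
  ext1 n
  refine ModuleCat.hom_ext (LinearMap.ext fun x => ?_)
  exact totMatrix_totIncl (M := tensorMixed K A B) (M' := normMixed K (SuperTensor K A B))
    (shuffleMap K A B) (cyclicShuffleMap K A B) n x

lemma S_totalShuffleHom : (tensorMixed K A B).S ≫ shiftMap (totalShuffleHom K A B) =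
    totalShuffleHom K A B ≫ (normMixed K (SuperTensor K A B)).S := by
  ext1 n
  by_cases hn : n < 2
  · exact (isZero_extend_X _ shiftTwo n (shiftTwo_ne hn)).eq_of_tgt _ _
  · obtain ⟨n, rfl⟩ : ∃ m, n = m + 2 := ⟨n - 2, by omega⟩
    have e : ModuleCat.ofHom (totShift (tensorMixed K A B) n) ≫ (totalShuffleHom K A B).f n =
        (totalShuffleHom K A B).f (n + 2) ≫
          ModuleCat.ofHom (totShift (normMixed K (SuperTensor K A B)) n) :=
      ModuleCat.hom_ext (LinearMap.ext (totMatrix_totShift (M := tensorMixed K A B)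
        (M' := normMixed K (SuperTensor K A B)) (shuffleMap K A B) (cyclicShuffleMap K A B) n))
    rw [comp_f, comp_f, S_f, S_f, extendMap_f _ shiftTwo (shiftTwo_f n)]
    exact comp_conj_iso e _ _

end TotalShuffle

/-! ### The Alexander-Whitney map and the homotopy -/

section WordMaps

variable {K : Type*} [CommRing K] {V W V' W' : Type*}

lemma mem_wordsOn_iff {Q : List V → Prop} {z : Words K V} :
    z ∈ wordsOn K Q ↔ ∀ l ∈ z.support, Q l := by
  have e : wordsOn K Q = Finsupp.supported K K {l | Q l} := by
    rw [Finsupp.supported_eq_span_single, wordsOn]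
    congr 1
    ext z
    exact ⟨fun ⟨l, hl, h⟩ => ⟨l, hl, h.symm⟩, fun ⟨l, hl, h⟩ => ⟨l, hl, h.symm⟩⟩
  rw [e, Finsupp.mem_supported]
  rfl

lemma frontBack_map {M : Type*} [AddCommGroup M] (F : List V' → List W' → M) (f : V → V')
    (g : W → W') (l : List (V × W)) :
    frontBack F (l.map (Prod.map f g)) = frontBack (fun w w' => F (w.map f) (w'.map g)) l := by
  induction l generalizing F with
  | nil => rfl
  | cons x l ih =>
    rw [List.map_cons, frontBack_cons, frontBack_cons, ih]
    simp [Function.comp_def]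

/-- `shuffleCut` is natural for maps of letters that act on the two components separately. -/
lemma wmap_shuffleCut (f : V → V') (g : W → W') (l : List (V × W)) :
    wmap (Prod.map f g) (shuffleCut K l) = shuffleCut K (l.map (Prod.map f g)) := by
  rw [shuffleCut, shuffleCut, frontBack_map, ← frontBack_lin]
  simp only [wmap_paths]

lemma wmap_ezHomotopy (f : V → V') (g : W → W') (n : ℕ) (l : List (V × W)) :
    wmap (Prod.map f g) (ezHomotopy K n l) = ezHomotopy K n (l.map (Prod.map f g)) := by
  induction n generalizing l with
  | zero => exact map_zero _
  | succ n ih =>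
    rcases l with _ | ⟨x, l⟩
    · exact map_zero _
    · rw [List.map_cons, ezHomotopy, ezHomotopy, wmap_pre, map_sub (wmap _), map_sub (wmap _),
        wmap_shuffleCut,
        wmap_wd, ← altSum_lin, ← List.map_cons, altSum_map]
      simp only [ih]

end WordMaps

section Diagonal

variable {K : Type w} [Field K]
  {A : Type u} [Category.{v} A] [Preadditive A] [Linear K A] [SuperCategory K A]
  {B : Type u'} [Category.{v'} B] [Preadditive B] [Linear K B] [SuperCategory K B]

lemma iv_map_ext_drop_of_nonneg {n m k : ℕ} {l : List ℤ} (hl : l.length = m + 1) (hk : k ≤ m + 1) :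
    (iv k (m + 1 - k)).map (ext n m l) = l.drop k := by
  have h : (iv 0 (m + 1)).map (ext n m l) = l := by
    rw [iv_map_ext_take hl le_rfl, ← hl, List.take_length]
  obtain ⟨d, hd⟩ : ∃ d, m + 1 = k + d := ⟨m + 1 - k, by omega⟩
  rw [show m + 1 - k = d by omega]
  rw [hd, iv_append, List.map_append, zero_add] at h
  have h' := congrArg (List.drop k) h
  rwa [List.drop_left' (by simp)] at h'

lemma opL_opL {C : Type u} [Category.{v} C] [Preadditive C] [Linear K C] [SuperCategory K C]
    {n n' m : ℕ} {l l' : List ℤ} (hl : l.length = n' + 1) (hG : Good n l)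
    (hl' : l'.length = m + 1) (hG' : Good n' l') (x : NChain K C n) :
    opL n' m l' (opL n n' l x) = opL n m (l'.map (ext n n' l)) x :=
  opL_op (isCyc_ext hG hl) hl' hG' x

/-- The diagonal word `(0, 0), …, (m, m)`. -/
def diag (m : ℕ) : List (ℤ × ℤ) := (iv 0 (m + 1)).map fun k => (k, k)

lemma diag_fst (m : ℕ) : (diag m).map Prod.fst = iv 0 (m + 1) := by
  simp [diag, Function.comp_def]

lemma diag_snd (m : ℕ) : (diag m).map Prod.snd = iv 0 (m + 1) := by
  simp [diag, Function.comp_def]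

lemma goodWord_diag (m : ℕ) : GoodWord m m m (diag m) := by
  refine ⟨by simp [diag], ?_, ?_⟩
  · rw [diag_fst]; exact good_iv 0 (by omega)
  · rw [diag_snd]; exact good_iv 0 (by omega)

/-- Every word is the image of the diagonal word. -/
lemma diag_map {p q m : ℕ} {l : List (ℤ × ℤ)} (h : GoodWord p q m l) :
    (diag m).map (Prod.map (ext p m (l.map Prod.fst)) (ext q m (l.map Prod.snd))) = l := by
  have h1 : (l.map Prod.fst).length = m + 1 := by rw [List.length_map, h.1]
  have h2 : (l.map Prod.snd).length = m + 1 := by rw [List.length_map, h.1]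
  have e1 := iv_map_ext_take (n := p) h1 le_rfl
  have e2 := iv_map_ext_take (n := q) h2 le_rfl
  rw [List.take_of_length_le h1.le] at e1
  rw [List.take_of_length_le h2.le] at e2
  refine List.ext_getElem (by simp [diag, h.1]) fun k hk hk' => ?_
  have h3 := congrArg (fun l => l.getD k 0) e1
  have h4 := congrArg (fun l => l.getD k 0) e2
  simp only [diag, List.length_map, length_iv] at hk
  simp [hk, hk'] at h3 h4
  simp [diag, h3, h4]

lemma grid_diag (m : ℕ) (x : NChain K A m) (y : NChain K B m) :
    grid m m m (diag m) x y = zip m x y := by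
  rw [grid_apply, diag_fst, diag_snd, opL_iv, opL_iv]
  rfl

lemma isCyc_fst {p q m : ℕ} {l : List (ℤ × ℤ)} (h : GoodWord p q m l) :
    IsCyc p m (ext p m (l.map Prod.fst)) := isCyc_ext h.2.1 (by rw [List.length_map, h.1])

lemma isCyc_snd {p q m : ℕ} {l : List (ℤ × ℤ)} (h : GoodWord p q m l) :
    IsCyc q m (ext q m (l.map Prod.snd)) := isCyc_ext h.2.2 (by rw [List.length_map, h.1])

lemma GoodWord.pairwise {p q m : ℕ} {l : List (ℤ × ℤ)} (h : GoodWord p q m l) :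
    l.Pairwise (· ≤ ·) := by
  have h1 := List.pairwise_map.1 h.2.1.1
  have h2 := List.pairwise_map.1 h.2.2.1
  exact (h1.and h2).imp fun h => h

lemma Spanned.goodWord {p q m n : ℕ} {l w : List (ℤ × ℤ)} (h : GoodWord p q m l)
    (hw : Spanned l (n + 1) w) : GoodWord p q n w := by
  refine ⟨hw.1, ⟨List.pairwise_map.2 (hw.2.1.imp fun h => h.1), fun a ha b hb => ?_⟩,
    ⟨List.pairwise_map.2 (hw.2.1.imp fun h => h.2), fun a ha b hb => ?_⟩⟩
  · obtain ⟨x, hx, rfl⟩ := List.mem_map.1 ha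
    obtain ⟨y, hy, rfl⟩ := List.mem_map.1 hb
    exact h.2.1.2 _ (hw.2.2 x hx).1 _ (hw.2.2 y hy).1
  · obtain ⟨x, hx, rfl⟩ := List.mem_map.1 ha
    obtain ⟨y, hy, rfl⟩ := List.mem_map.1 hb
    exact h.2.2.2 _ (hw.2.2 x hx).2 _ (hw.2.2 y hy).2

lemma ezHomotopy_good {p q m : ℕ} {l : List (ℤ × ℤ)} (h : GoodWord p q m l) :
    ezHomotopy K m l ∈ wordsOn K (GoodWord p q (m + 1)) :=
  wordsOn_mono (fun _ hw => Spanned.goodWord h hw) (ezHomotopy_mem m h.1 h.pairwise)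

/-- A word of vertices with a repetition pairs chains to a degenerate chain. -/
lemma grid_mem_degen {p q m : ℕ} {l : List (ℤ × ℤ)} (h : GoodWord p q m l) (hr : HasRepeat l)
    (x : NChain K A p) (y : NChain K B q) :
    grid p q m l x y ∈ degen K (SuperTensor K A B) m := by
  obtain ⟨l₁, a, l₂, rfl⟩ := hr
  obtain ⟨m, rfl⟩ : ∃ k, m = k + 1 := ⟨l₁.length + l₂.length, by
    have := h.1; simp at this; omega⟩
  have hlen : l₁.length + l₂.length = m := by have := h.1; simp at this; omega
  have h1 : 1 ≤ l₁.length + 1 := by omega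
  have h2 : l₁.length + 1 ≤ m + 1 := by omega
  have hs : (l₁ ++ a :: l₂).Sublist (l₁ ++ a :: a :: l₂) :=
    (List.sublist_cons_self a (a :: l₂)).append_left l₁
  have hG : GoodWord p q m (l₁ ++ a :: l₂) := by
    refine ⟨by simp; omega, h.2.1.sublist (hs.map _), h.2.2.sublist (hs.map _)⟩
  -- The word is obtained from the word without the repetition by a degeneracy.
  have key : ∀ {n : ℕ} (f : ℤ × ℤ → ℤ), ((degWord m (l₁.length + 1)).map
      (ext n m ((l₁ ++ a :: l₂).map f))) = (l₁ ++ a :: a :: l₂).map f := by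
    intro n f
    have hl : ((l₁ ++ a :: l₂).map f).length = m + 1 := by rw [List.length_map, hG.1]
    rw [degWord, List.map_append, iv_map_ext_take hl (by omega)]
    have e : ((l₁.length + 1 : ℕ) : ℤ) - 1 = (l₁.length : ℕ) := by push_cast; ring
    rw [e, show m + 2 - (l₁.length + 1) = m + 1 - l₁.length by omega,
      iv_map_ext_drop_of_nonneg hl (by omega)]
    simp [List.take_append, List.take_of_length_le]
  have e : grid p q (m + 1) (l₁ ++ a :: a :: l₂) x y =
      opL m (m + 1) (degWord m (l₁.length + 1)) (grid p q m (l₁ ++ a :: l₂) x y) := by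
    rw [grid_apply p q m, ← zip_degWord h1 h2,
      opL_opL (by rw [List.length_map, hG.1]) hG.2.1 (length_degWord h2) (good_degWord h1 h2),
      opL_opL (by rw [List.length_map, hG.1]) hG.2.2 (length_degWord h2) (good_degWord h1 h2),
      key, key, grid_apply]
  rw [e]
  exact opL_mem_degen (length_degWord h2) (good_degWord h1 h2) (hasRepeat_degWord h1 h2) _

end Diagonal

section AlexanderWhitney

variable {K : Type w} [Field K]
  {A : Type u} [Category.{v} A] [Preadditive A] [Linear K A] [SuperCategory K A]
  {B : Type u'} [Category.{v'} B] [Preadditive B] [Linear K B] [SuperCategory K B]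

/-- Two words that give operators from `C_p(A)` and `C_q(B)` to chains of total degree `m`. -/
def GoodCell (p q m : ℕ) (u v : List ℤ) : Prop :=
  Good p u ∧ Good q v ∧ u ≠ [] ∧ v ≠ [] ∧ u.length + v.length = m + 2

lemma GoodCell.length_eq {p q m : ℕ} {u v : List ℤ} (h : GoodCell p q m u v) :
    u.length - 1 + (v.length - 1) = m := by
  have h1 := List.length_pos_of_ne_nil h.2.2.1
  have h2 := List.length_pos_of_ne_nil h.2.2.2.1
  have h3 := h.2.2.2.2
  omega

open Classical in
/-- The pairing `(x, y) ↦ u x ⊗ v y` of two words, with values in the tensor product of the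
normalized complexes, and zero unless the words give operators of total degree `m`. -/
def cell (p q m : ℕ) (u v : List ℤ) :
    NChain K A p →ₗ[K] NChain K B q →ₗ[K] (tensorMixed K A B).X m :=
  if h : GoodCell p q m u v then
    (tcell (u.length - 1) (v.length - 1) h.length_eq).compl₁₂ (opL p (u.length - 1) u)
      (opL q (v.length - 1) v)
  else 0

lemma cell_apply {p q m a b : ℕ} {u v : List ℤ} (hu : Good p u) (hv : Good q v)
    (ha : u.length = a + 1) (hb : v.length = b + 1) (h : a + b = m) (x : NChain K A p)
    (y : NChain K B q) : cell p q m u v x y = tcell a b h (opL p a u x) (opL q b v y) := by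
  have hc : GoodCell p q m u v := by
    refine ⟨hu, hv, ?_, ?_, by omega⟩
    · rintro rfl; simp at ha
    · rintro rfl; simp at hb
  obtain rfl : a = u.length - 1 := by omega
  obtain rfl : b = v.length - 1 := by omega
  rw [cell, dif_pos hc]
  rfl

lemma cell_of_not {p q m : ℕ} {u v : List ℤ} (h : ¬GoodCell p q m u v) :
    (cell p q m u v : NChain K A p →ₗ[K] NChain K B q →ₗ[K] _) = 0 := dif_neg h

lemma cell_hasRepeat_left {p q m : ℕ} {u v : List ℤ} (hr : HasRepeat u) :
    (cell p q m u v : NChain K A p →ₗ[K] NChain K B q →ₗ[K] _) = 0 := by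
  by_cases h : GoodCell p q m u v
  · obtain ⟨a, ha⟩ := Nat.exists_eq_add_one.2 (List.length_pos_of_ne_nil h.2.2.1)
    obtain ⟨b, hb⟩ := Nat.exists_eq_add_one.2 (List.length_pos_of_ne_nil h.2.2.2.1)
    have h3 := h.2.2.2.2
    refine LinearMap.ext₂ fun x y => ?_
    rw [cell_apply h.1 h.2.1 ha hb (by omega), tcell_apply,
      nmk_eq_zero.2 (opL_mem_degen ha h.1 hr x), TensorProduct.zero_tmul, map_zero]
    rfl
  · exact cell_of_not h

lemma cell_hasRepeat_right {p q m : ℕ} {u v : List ℤ} (hr : HasRepeat v) :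
    (cell p q m u v : NChain K A p →ₗ[K] NChain K B q →ₗ[K] _) = 0 := by
  by_cases h : GoodCell p q m u v
  · obtain ⟨a, ha⟩ := Nat.exists_eq_add_one.2 (List.length_pos_of_ne_nil h.2.2.1)
    obtain ⟨b, hb⟩ := Nat.exists_eq_add_one.2 (List.length_pos_of_ne_nil h.2.2.2.1)
    have h3 := h.2.2.2.2
    refine LinearMap.ext₂ fun x y => ?_
    rw [cell_apply h.1 h.2.1 ha hb (by omega), tcell_apply,
      nmk_eq_zero.2 (opL_mem_degen hb h.2.1 hr y), TensorProduct.tmul_zero, map_zero]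
    rfl
  · exact cell_of_not h

lemma cell_opL {p p' q q' m a b : ℕ} {u v l l' : List ℤ} (hu : Good p' u) (hv : Good q' v)
    (ha : u.length = a + 1) (hb : v.length = b + 1) (h : a + b = m)
    (hl : l.length = p' + 1) (hG : Good p l) (hl' : l'.length = q' + 1) (hG' : Good q l')
    (x : NChain K A p) (y : NChain K B q) :
    cell p' q' m u v (opL p p' l x) (opL q q' l' y) =
      cell p q m (u.map (ext p p' l)) (v.map (ext q q' l')) x y := by
  rw [cell_apply hu hv ha hb h, opL_opL hl hG ha hu, opL_opL hl' hG' hb hv,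
    cell_apply (hu.map (isCyc_ext hG hl)) (hv.map (isCyc_ext hG' hl'))
      (by rw [List.length_map, ha]) (by rw [List.length_map, hb]) h]

/-- The shuffle map turns the cell of two words into the sum of the paths in their grid. -/
lemma shuffleMap_cell {p q m : ℕ} {u v : List ℤ} (h : GoodCell p q m u v) (x : NChain K A p)
    (y : NChain K B q) :
    shuffleMap K A B m (cell p q m u v x y) = nmk m (gridW p q m (paths K u v) x y) := by
  obtain ⟨a, ha⟩ := Nat.exists_eq_add_one.2 (List.length_pos_of_ne_nil h.2.2.1)
  obtain ⟨b, hb⟩ := Nat.exists_eq_add_one.2 (List.length_pos_of_ne_nil h.2.2.2.1)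
  have h3 := h.2.2.2.2
  have ia : Good a (iv 0 (a + 1)) := good_iv 0 (by omega)
  have ib : Good b (iv 0 (b + 1)) := good_iv 0 (by omega)
  rw [cell_apply h.1 h.2.1 ha hb (by omega), shuffleMap_tcell, sh_eq]
  have cu := isCyc_ext h.1 ha
  have cv := isCyc_ext h.2.1 hb
  have e1 : (iv 0 (a + 1)).map (ext p a u) = u := by
    rw [iv_map_ext_take ha le_rfl, ← ha, List.take_length]
  have e2 : (iv 0 (b + 1)).map (ext q b v) = v := by
    rw [iv_map_ext_take hb le_rfl, ← hb, List.take_length]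
  rw [show opL p a u x = op p a (ext p a u) x from rfl,
    show opL q b v y = op q b (ext q b v) y from rfl,
    gridW_op_left cu (paths_good ia ib (by rw [length_iv, length_iv]; omega)), wmap_paths, e1,
    List.map_id, gridW_op_right cv (paths_good h.1 ib (by rw [length_iv]; omega)), wmap_paths, e2,
    List.map_id]

variable (K A B) in
/-- The Alexander-Whitney map `C_m(A ⊗ B) ⟶ (N(A) ⊗ N(B))_m`: the sum of all front faces of the
first factor tensored with the complementary back faces of the second one. -/
def awMap (m : ℕ) : NChain K (SuperTensor K A B) m →ₗ[K] (tensorMixed K A B).X m :=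
  TensorProduct.lift (frontBack (cell m m m) (diag m)) ∘ₗ unzip m

/-- On the pairing of a word the Alexander-Whitney map is given by the cuts of that word; this is the
definition for the diagonal word, and the general case follows by naturality. -/
lemma awMap_grid {p q m : ℕ} {l : List (ℤ × ℤ)} (h : GoodWord p q m l) (x : NChain K A p)
    (y : NChain K B q) :
    awMap K A B m (grid p q m l x y) = frontBack (cell p q m) l x y := by
  have h1 : (l.map Prod.fst).length = m + 1 := by rw [List.length_map, h.1]
  have h2 : (l.map Prod.snd).length = m + 1 := by rw [List.length_map, h.1]
  rw [awMap, LinearMap.comp_apply, grid_apply, unzip_zip, TensorProduct.lift.tmul,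
    frontBack_eq_sum, frontBack_eq_sum, LinearMap.sum_apply, LinearMap.sum_apply,
    LinearMap.sum_apply, LinearMap.sum_apply, h.1, diag_fst, diag_snd, (goodWord_diag m).1]
  refine Finset.sum_congr rfl fun k hk => ?_
  rw [Finset.mem_range] at hk
  have e1 : (iv 0 (m + 1)).take (k + 1) = iv 0 (k + 1) := by
    obtain ⟨d, rfl⟩ : ∃ d, m = k + d := ⟨m - k, by omega⟩
    rw [show k + d + 1 = k + 1 + d by omega, iv_append, List.take_left' (by simp)]
  have e2 : (iv 0 (m + 1)).drop k = iv k (m + 1 - k) := by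
    obtain ⟨d, hd⟩ : ∃ d, m + 1 = k + d := ⟨m + 1 - k, by omega⟩
    rw [hd, iv_append, List.drop_left' (by simp), show k + d - k = d by omega, zero_add]
  rw [e1, e2, cell_opL (a := k) (b := m - k) (good_iv 0 (by omega)) (good_iv _ (by omega))
    (by simp) (by rw [length_iv]; omega) (by omega) h1 h.2.1 h2 h.2.2,
    iv_map_ext_take h1 (by omega), iv_map_ext_drop_of_nonneg h2 (by omega)]

lemma awMap_gridW {p q m : ℕ} {z : Words K (ℤ × ℤ)} (hz : z ∈ wordsOn K (GoodWord p q m))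
    (x : NChain K A p) (y : NChain K B q) :
    awMap K A B m (gridW p q m z x y) = wlift (fun l => frontBack (cell p q m) l x y) z := by
  rw [gridW_apply, lin_wlift]
  refine eqOn_wordsOn (fun l hl => ?_) hz
  rw [wlift_wd, wlift_wd, awMap_grid hl]

/-- A degeneracy applied to a product of two chains is given by a word with a repetition. -/
lemma degWord_zip {m j : ℕ} (h1 : 1 ≤ j) (hj : j ≤ m + 1) (x : NChain K A m) (y : NChain K B m) :
    ∃ l, GoodWord m m (m + 1) l ∧ HasRepeat l ∧
      opL m (m + 1) (degWord m j) (zip m x y) = grid m m (m + 1) l x y := by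
  have e1 : ((degWord m j).map fun k => (k, k)).map Prod.fst = degWord m j := by
    simp [Function.comp_def]
  have e2 : ((degWord m j).map fun k => (k, k)).map Prod.snd = degWord m j := by
    simp [Function.comp_def]
  refine ⟨(degWord m j).map fun k => (k, k), ⟨?_, ?_, ?_⟩, (hasRepeat_degWord h1 hj).map _, ?_⟩
  · rw [List.length_map, length_degWord hj]
  · rw [e1]; exact good_degWord h1 hj
  · rw [e2]; exact good_degWord h1 hj
  · rw [grid_apply, e1, e2, zip_degWord h1 hj]

/-- If a degenerate word is cut, one of the two parts is degenerate. -/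
lemma awMap_degen (m : ℕ) : degen K (SuperTensor K A B) m ≤ LinearMap.ker (awMap K A B m) := by
  rcases m with _ | m
  · rw [degen_zero]; exact bot_le
  · refine degen_succ_le fun j h1 hj z => ?_
    rw [LinearMap.mem_ker]
    refine zip_induction (p := fun z => awMap K A B (m + 1) (opL m (m + 1) (degWord m j) z) = 0)
      (by rw [map_zero, map_zero]) (fun z z' h h' => by rw [map_add, map_add, h, h', add_zero])
      (fun x y => ?_) z
    obtain ⟨l, hl, hr, e⟩ := degWord_zip h1 hj x y
    rw [e, awMap_grid hl, frontBack, cutSum_congr (g' := fun _ _ => 0), cutSum_zero]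
    · rfl
    · rintro w c w' rfl
      rcases hr.cut with h | h
      · exact cell_hasRepeat_left (h.map _)
      · exact cell_hasRepeat_right (h.map _)

variable (K A B) in
/-- The Alexander-Whitney map on normalized chains. -/
def awNorm (m : ℕ) : (normMixed K (SuperTensor K A B)).X m →ₗ[K] (tensorMixed K A B).X m :=
  (degen K (SuperTensor K A B) m).liftQ (awMap K A B m) (awMap_degen m)

lemma awNorm_nmk (m : ℕ) (z : NChain K (SuperTensor K A B) m) :
    awNorm K A B m (nmk m z) = awMap K A B m z := rfl

/-- The Alexander-Whitney map is a left inverse of the shuffle map on normalized chains. -/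
lemma awNorm_shuffleMap (m : ℕ) (t : (tensorMixed K A B).X m) :
    awNorm K A B m (shuffleMap K A B m t) = t := by
  refine LinearMap.congr_fun (f := awNorm K A B m ∘ₗ shuffleMap K A B m) (g := LinearMap.id)
    (tcell_hom_ext fun p q e x y => ?_) t
  have ip : Good p (iv 0 (p + 1)) := good_iv 0 (by omega)
  have iq : Good q (iv 0 (q + 1)) := good_iv 0 (by omega)
  rw [LinearMap.comp_apply, LinearMap.id_apply, shuffleMap_tcell, awNorm_nmk, sh_eq,
    awMap_gridW (paths_good ip iq (by rw [length_iv, length_iv]; omega))]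
  have h : wlift (frontBack fun u v => cell p q m u v x y)
      (paths K (iv 0 (p + 1)) (iv 0 (q + 1))) = cell p q m (iv 0 (p + 1)) (iv 0 (q + 1)) x y :=
    frontBack_paths _ (fun u v hu => by rw [cell_hasRepeat_left hu]; rfl)
      (fun u v hv => by rw [cell_hasRepeat_right hv]; rfl) _ _ (by rw [iv_succ]; simp)
      (by rw [iv_succ]; simp)
  have h' : ∀ l, frontBack (fun u v => cell p q m u v x y) l = frontBack (cell p q m) l x y := by
    intro l
    rw [frontBack_eq_sum, frontBack_eq_sum, LinearMap.sum_apply, LinearMap.sum_apply]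
  simp only [← h']
  rw [h, cell_apply ip iq (length_iv _ _) (length_iv _ _) e, opL_iv, opL_iv]
  rfl

/-- The composite of the Alexander-Whitney map and the shuffle map is given by `shuffleCut`. -/
lemma shuffleMap_awMap_grid {p q m : ℕ} {l : List (ℤ × ℤ)} (h : GoodWord p q m l)
    (x : NChain K A p) (y : NChain K B q) :
    shuffleMap K A B m (awMap K A B m (grid p q m l x y)) =
      nmk m (gridW p q m (shuffleCut K l) x y) := by
  rw [awMap_grid h, frontBack_eq_sum, shuffleCut, frontBack_eq_sum, map_sum (gridW p q m),
    LinearMap.sum_apply, LinearMap.sum_apply, LinearMap.sum_apply, LinearMap.sum_apply, map_sum,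
    map_sum]
  refine Finset.sum_congr rfl fun k hk => shuffleMap_cell ?_ x y
  rw [Finset.mem_range] at hk
  have hl := h.1
  refine ⟨h.2.1.sublist (List.take_sublist _ _), h.2.2.sublist (List.drop_sublist _ _), ?_, ?_, ?_⟩
  · rw [← List.length_pos_iff]; simp; omega
  · rw [← List.length_pos_iff]; simp; omega
  · simp; omega

variable (K A B) in
/-- The Eilenberg-Zilber homotopy on chains. -/
def homotopyMap (m : ℕ) :
    NChain K (SuperTensor K A B) m →ₗ[K] NChain K (SuperTensor K A B) (m + 1) :=
  TensorProduct.lift (gridW m m (m + 1) (ezHomotopy K m (diag m))) ∘ₗ unzip m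

/-- On the pairing of a word the homotopy is given by the homotopy of that word, by naturality. -/
lemma homotopyMap_grid {p q m : ℕ} {l : List (ℤ × ℤ)} (h : GoodWord p q m l) (x : NChain K A p)
    (y : NChain K B q) :
    homotopyMap K A B m (grid p q m l x y) = gridW p q (m + 1) (ezHomotopy K m l) x y := by
  have hd := ezHomotopy_good (K := K) (goodWord_diag m)
  have hd' : wmap (Prod.map (ext p m (l.map Prod.fst)) id) (ezHomotopy K m (diag m)) ∈
      wordsOn K (GoodWord p m (m + 1)) :=
    map_mem_wordsOn (fun w hw => by
      rw [wmap_wd]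
      refine wd_mem ⟨by rw [List.length_map, hw.1], ?_, ?_⟩
      · have := hw.2.1.map (isCyc_fst h)
        rwa [List.map_map] at this ⊢
      · have := hw.2.2
        rwa [List.map_map]) hd
  rw [homotopyMap, LinearMap.comp_apply, grid_apply, unzip_zip, TensorProduct.lift.tmul,
    show opL p m (l.map Prod.fst) x = op p m (ext p m (l.map Prod.fst)) x from rfl,
    show opL q m (l.map Prod.snd) y = op q m (ext q m (l.map Prod.snd)) y from rfl,
    gridW_op_left (isCyc_fst h) hd, gridW_op_right (isCyc_snd h) hd', wmap_ezHomotopy,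
    wmap_ezHomotopy, List.map_map]
  congr 4
  exact diag_map h

lemma homotopyMap_degen (m : ℕ) : degen K (SuperTensor K A B) m ≤
    (degen K (SuperTensor K A B) (m + 1)).comap (homotopyMap K A B m) := by
  rcases m with _ | m
  · rw [degen_zero]; exact bot_le
  · refine degen_succ_le fun j h1 hj z => ?_
    rw [Submodule.mem_comap]
    refine zip_induction (p := fun z => homotopyMap K A B (m + 1)
      (opL m (m + 1) (degWord m j) z) ∈ degen K (SuperTensor K A B) (m + 1 + 1))
      (by rw [map_zero, map_zero]; exact zero_mem _)
      (fun z z' h h' => by rw [map_add, map_add]; exact add_mem h h') (fun x y => ?_) z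
    obtain ⟨l, hl, hr, e⟩ := degWord_zip h1 hj x y
    rw [e, homotopyMap_grid hl, gridW_apply]
    have hm : ezHomotopy K (m + 1) l ∈
        wordsOn K fun w => GoodWord m m (m + 1 + 1) w ∧ HasRepeat w :=
      mem_wordsOn_iff.2 fun w hw => ⟨mem_wordsOn_iff.1 (ezHomotopy_good hl) w hw,
        mem_wordsOn_iff.1 (ezHomotopy_mem_hasRepeat _ hr) w hw⟩
    refine map_mem_wordsOn (fun w hw => ?_) hm
    rw [wlift_wd]
    exact grid_mem_degen hw.1 hw.2 x y

variable (K A B) in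
/-- The Eilenberg-Zilber homotopy on normalized chains. -/
def homotopyNorm (m : ℕ) : (normMixed K (SuperTensor K A B)).X m →ₗ[K]
    (normMixed K (SuperTensor K A B)).X (m + 1) :=
  (degen K (SuperTensor K A B) m).mapQ _ (homotopyMap K A B m) (homotopyMap_degen m)

lemma homotopyNorm_nmk (m : ℕ) (z : NChain K (SuperTensor K A B) m) :
    homotopyNorm K A B m (nmk m z) = nmk (m + 1) (homotopyMap K A B m z) := rfl

/-- Identities on `N(A ⊗ B)` may be checked on the values of `zip`. -/
lemma norm_zip_induction {m : ℕ} {P : (normMixed K (SuperTensor K A B)).X m → Prop} (h0 : P 0)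
    (hadd : ∀ z z', P z → P z' → P (z + z'))
    (hz : ∀ (x : NChain K A m) (y : NChain K B m), P (nmk m (zip m x y)))
    (z : (normMixed K (SuperTensor K A B)).X m) : P z := by
  obtain ⟨z, rfl⟩ := nmk_surjective m z
  refine zip_induction (p := fun z => P (nmk m z)) (by rw [map_zero]; exact h0)
    (fun z z' h h' => by rw [map_add]; exact hadd _ _ h h') hz z

lemma shuffleMap_awNorm_zero (z : (normMixed K (SuperTensor K A B)).X 0) :
    shuffleMap K A B 0 (awNorm K A B 0 z) = z := by
  refine norm_zip_induction (P := fun z => shuffleMap K A B 0 (awNorm K A B 0 z) = z)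
    (by rw [map_zero, map_zero]) (fun z z' h h' => by rw [map_add, map_add, h, h'])
    (fun x y => ?_) z
  rw [awNorm_nmk, ← grid_diag, shuffleMap_awMap_grid (goodWord_diag 0)]
  rw [show diag 0 = [(0, 0)] from rfl, shuffleCut_single, gridW_wd]

lemma homotopyNorm_zero : homotopyNorm K A B 0 = 0 := by
  refine LinearMap.ext fun z => ?_
  refine norm_zip_induction (P := fun z => homotopyNorm K A B 0 z = 0) (map_zero _)
    (fun z z' h h' => by rw [map_add, h, h', add_zero]) (fun x y => ?_) z
  rw [homotopyNorm_nmk, ← grid_diag, homotopyMap_grid (goodWord_diag 0), ezHomotopy, map_zero]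
  exact map_zero _

/-- The shuffle map composed with the Alexander-Whitney map is homotopic to the identity. -/
lemma shuffleMap_awNorm (m : ℕ) (z : (normMixed K (SuperTensor K A B)).X (m + 1)) :
    shuffleMap K A B (m + 1) (awNorm K A B (m + 1) z) = z +
      (homotopyNorm K A B m ((normMixed K (SuperTensor K A B)).b m z) +
        (normMixed K (SuperTensor K A B)).b (m + 1) (homotopyNorm K A B (m + 1) z)) := by
  refine norm_zip_induction (P := fun z => shuffleMap K A B (m + 1) (awNorm K A B (m + 1) z) = z +
      (homotopyNorm K A B m ((normMixed K (SuperTensor K A B)).b m z) +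
        (normMixed K (SuperTensor K A B)).b (m + 1) (homotopyNorm K A B (m + 1) z)))
    (by simp only [map_zero, add_zero]) (fun z z' h h' => ?_) (fun x y => ?_) z
  · simp only [map_add, h, h']
    abel
  have hd := goodWord_diag (m + 1)
  -- the homotopy of the faces of the diagonal word
  have e : homotopyMap K A B m (bdry m (grid (m + 1) (m + 1) (m + 1) (diag (m + 1)) x y)) =
      gridW (m + 1) (m + 1) (m + 1)
        (altSum (fun w => ezHomotopy K m w) (diag (m + 1))) x y := by
    rw [← gridW_wd, bdry_gridW (wd_mem hd), wbd_wd, altSum_eq_sum_smul (K := K),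
      altSum_eq_sum_smul (K := K), map_sum, map_sum, LinearMap.sum_apply, LinearMap.sum_apply,
      LinearMap.sum_apply, LinearMap.sum_apply, map_sum]
    refine Finset.sum_congr rfl fun k hk => ?_
    rw [Finset.mem_range] at hk
    rw [map_smul, map_smul, LinearMap.smul_apply, LinearMap.smul_apply, LinearMap.smul_apply,
      LinearMap.smul_apply, map_smul, gridW_wd, homotopyMap_grid (hd.eraseIdx hk)]
  rw [homotopyNorm_nmk, b_nmk, b_nmk, homotopyNorm_nmk, awNorm_nmk, ← grid_diag,
    shuffleMap_awMap_grid hd, homotopyMap_grid hd, bdry_gridW (ezHomotopy_good hd),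
    wbd_ezHomotopy m _ hd.1, e, ← map_add, ← map_add]
  congr 1
  simp only [map_sub, LinearMap.sub_apply, gridW_wd]
  abel

end AlexanderWhitney

/-! ### The shuffle map on homology -/

section ShuffleIso

open HomologicalComplex

variable {K : Type w} [Field K]
  {A : Type u} [Category.{v} A] [Preadditive A] [Linear K A] [SuperCategory K A]
  {B : Type u'} [Category.{v'} B] [Preadditive B] [Linear K B] [SuperCategory K B]

/-- The Alexander-Whitney map commutes with the differentials because the shuffle map is
injective and the two sides become equal after applying it. -/
lemma b_awNorm (n : ℕ) (z : (normMixed K (SuperTensor K A B)).X (n + 1)) :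
    (tensorMixed K A B).b n (awNorm K A B (n + 1) z) =
      awNorm K A B n ((normMixed K (SuperTensor K A B)).b n z) := by
  rw [← awNorm_shuffleMap n ((tensorMixed K A B).b n (awNorm K A B (n + 1) z)),
    ← b_shuffleMap, shuffleMap_awNorm, map_add ((normMixed K (SuperTensor K A B)).b n),
    map_add ((normMixed K (SuperTensor K A B)).b n), MixedComplex.bb, add_zero]
  have h : shuffleMap K A B n (awNorm K A B n ((normMixed K (SuperTensor K A B)).b n z)) =
      (normMixed K (SuperTensor K A B)).b n z + (normMixed K (SuperTensor K A B)).b n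
        (homotopyNorm K A B n ((normMixed K (SuperTensor K A B)).b n z)) := by
    rcases n with _ | n
    · rw [shuffleMap_awNorm_zero, homotopyNorm_zero, LinearMap.zero_apply, map_zero, add_zero]
    · rw [shuffleMap_awNorm, MixedComplex.bb, map_zero, zero_add]
  rw [← h, awNorm_shuffleMap]

variable (K A B) in
/-- The Alexander-Whitney map as a morphism of complexes. -/
def awHom : (normMixed K (SuperTensor K A B)).chain ⟶ (tensorMixed K A B).chain :=
  ChainComplex.ofHom (X := (normMixed K (SuperTensor K A B)).chain)
    (Y := (tensorMixed K A B).chain) (fun n => ModuleCat.ofHom (awNorm K A B n)) fun n => by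
      rw [chain_d, chain_d]
      have e : (tensorMixed K A B).b n ∘ₗ awNorm K A B (n + 1) =
          awNorm K A B n ∘ₗ (normMixed K (SuperTensor K A B)).b n := LinearMap.ext (b_awNorm n)
      have e' := congrArg ModuleCat.ofHom e
      rw [ModuleCat.ofHom_comp, ModuleCat.ofHom_comp] at e'
      exact e'

lemma shuffleHom_awHom : shuffleHom K A B ≫ awHom K A B = 𝟙 _ := by
  ext1 n
  exact ModuleCat.hom_ext (LinearMap.ext fun x => awNorm_shuffleMap (K := K) (A := A) (B := B) n x)

variable (K A B) in
/-- The components of the Eilenberg-Zilber homotopy. -/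
def homotopyHom (i j : ℕ) (h : (ComplexShape.down ℕ).Rel j i) :
    (normMixed K (SuperTensor K A B)).chain.X i ⟶ (normMixed K (SuperTensor K A B)).chain.X j :=
  match j, h with
  | _, rfl => ModuleCat.ofHom (homotopyNorm K A B i)

/-- The homotopy between the composite of the Alexander-Whitney map and the shuffle map and the
identity, as an identity of morphisms of complexes. -/
lemma awHom_shuffleHom : awHom K A B ≫ shuffleHom K A B =
    𝟙 _ + Homotopy.nullHomotopicMap' (homotopyHom K A B) := by
  ext1 n
  rcases n with _ | n
  · have h0 : homotopyHom K A B 0 1 rfl ≫ (normMixed K (SuperTensor K A B)).chain.d 1 0 = 0 := by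
      have h : homotopyHom K A B 0 1 rfl = 0 := congrArg ModuleCat.ofHom homotopyNorm_zero
      rw [h, Limits.zero_comp]
    rw [add_f_apply, Homotopy.nullHomotopicMap'_f_of_not_rel_left (k₁ := 1) (k₀ := 0) rfl
      (fun l h => by simp at h), h0, add_zero]
    exact ModuleCat.hom_ext (LinearMap.ext shuffleMap_awNorm_zero)
  · rw [add_f_apply, Homotopy.nullHomotopicMap'_f (k₂ := n + 2) (k₁ := n + 1) (k₀ := n) rfl rfl,
      chain_d, chain_d]
    refine ModuleCat.hom_ext (LinearMap.ext fun z => ?_)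
    exact shuffleMap_awNorm n z

/-- The Eilenberg-Zilber theorem for Hochschild homology. -/
lemma isIso_homologyMap_shuffleHom (n : ℕ) : IsIso (homologyMap (shuffleHom K A B) n) := by
  refine ⟨homologyMap (awHom K A B) n, ?_, ?_⟩
  · rw [← homologyMap_comp, shuffleHom_awHom, homologyMap_id]
  · rw [← homologyMap_comp, awHom_shuffleHom, homologyMap_add, homologyMap_id,
      (Homotopy.nullHomotopy' (homotopyHom K A B)).homologyMap_eq, homologyMap_zero, add_zero]

end ShuffleIso

end SuperCyclic

end

theorem mainTheorem4 {K : Type w} [Field K]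
    {A : Type u} [Category.{v} A] [Preadditive A] [Linear K A] [SuperCyclic.SuperCategory K A]
    {B : Type u'} [Category.{v'} B] [Preadditive B] [Linear K B] [SuperCyclic.SuperCategory K B] :
    ∃ (sh : ((SuperCyclic.normMixed K A).tensor (SuperCyclic.normMixed K B)).chain ⟶
          (SuperCyclic.normMixed K (SuperCyclic.SuperTensor K A B)).chain)
      (Sh : ((SuperCyclic.normMixed K A).tensor (SuperCyclic.normMixed K B)).tot ⟶
          (SuperCyclic.normMixed K (SuperCyclic.SuperTensor K A B)).tot),
      (∀ n, sh.f n = ModuleCat.ofHom (SuperCyclic.shuffleMap K A B n)) ∧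
      (∀ n, Sh.f n = ModuleCat.ofHom (SuperCyclic.totalShuffleMap K A B n)) ∧
      (∀ n, IsIso (HomologicalComplex.homologyMap Sh n)) ∧
      (∀ n, ((SuperCyclic.normMixed K A).tensor (SuperCyclic.normMixed K B)).connesI n ≫
          HomologicalComplex.homologyMap Sh n =
        HomologicalComplex.homologyMap sh n ≫
          (SuperCyclic.normMixed K (SuperCyclic.SuperTensor K A B)).connesI n) ∧
      (∀ n, ((SuperCyclic.normMixed K A).tensor (SuperCyclic.normMixed K B)).connesS n ≫
          HomologicalComplex.homologyMap Sh n =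
        HomologicalComplex.homologyMap Sh (n + 2) ≫
          (SuperCyclic.normMixed K (SuperCyclic.SuperTensor K A B)).connesS n) ∧
      (∀ n, ((SuperCyclic.normMixed K A).tensor (SuperCyclic.normMixed K B)).connesB n ≫
          HomologicalComplex.homologyMap sh (n + 1) =
        HomologicalComplex.homologyMap Sh n ≫
          (SuperCyclic.normMixed K (SuperCyclic.SuperTensor K A B)).connesB n) := by
  refine ⟨SuperCyclic.shuffleHom K A B, SuperCyclic.totalShuffleHom K A B, fun _ => rfl,
    fun _ => rfl, ?_, ?_, ?_, ?_⟩
  · exact SuperCyclic.isIso_homologyMap_tot SuperCyclic.I_totalShuffleHom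
      SuperCyclic.S_totalShuffleHom SuperCyclic.isIso_homologyMap_shuffleHom
  · exact SuperCyclic.connesI_naturality SuperCyclic.I_totalShuffleHom
  · exact SuperCyclic.connesS_naturality SuperCyclic.S_totalShuffleHom
  · exact SuperCyclic.connesB_naturality SuperCyclic.I_totalShuffleHom
      SuperCyclic.S_totalShuffleHom
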